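/- Let $k$ be a field. All algebras are associative and unital $k$-algebras, and bimodules are $k$-central. A quiver has finitely many vertices and edges; $kQ$ is its path algebra (paths composed from left to right), and $R\subseteq kQ$ is the ideal spanned by the paths of positive length. The word 2-category is used in the weak sense (bicategory). **The 2-category $\mathsf{BdQuivCon}$.** Objects are bound quivers $(Q,I)$: a quiver $Q$ with a two-sided ideal $I$ of $kQ$ which is admissible, i.e. $R^n\subseteq I\subseteq R^2$ for some $n$. For quivers $G,H$ write $E^G_{g,g'}$ for the vector space with basis the edges $g\to g'$ of $G$. A connection $(\Gamma,U)$ from $G$ to $H$ consists of finite-dimensional vector spaces $\Gamma_{g,h}$ ($g\in V(G)$, $h\in V(H)$) and linear isomorphisms $$U_{g,h}:\bigoplus_{g'}E^G_{g,g'}\otimes\Gamma_{g',h}\to\bigoplus_{h'}\Gamma_{g,h'}\otimes E^H_{h',h}.$$ Iterating $U$ gives isomorphisms $U^n$ from $\bigoplus_{g'} k[\text{paths } g\to g' \text{ of length } n]\otimes\Gamma_{g',h}$ to $\bigoplus_{h'}\Gamma_{g,h'}\otimes k[\text{paths } h'\to h\text{ of length } n]$. A connection between bound quivers $(G,I)$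 and $(H,J)$ is ideally connected if $\bigoplus_n U^n$ maps $x\otimes\gamma$ into $\bigoplus_{h'}\Gamma_{g,h'}\otimes (J\cap k[\text{paths } h'\to h])$ for every linear combination $x\in I$ of paths $g\to g'$ and every $\gamma\in\Gamma_{g',h}$, and its inverse maps $\gamma\otimes y$ into $\bigoplus_{g'} (I\cap k[\text{paths } g\to g'])\otimes\Gamma_{g',h}$ for every linear combination $y\in J$ of paths $h'\to h$ and every $\gamma\in\Gamma_{g,h'}$. The 1-morphisms are the ideally connected connections. The composite of $(\Gamma,U):G\to H$ and $(\Delta,V):H\to K$ is $(\Gamma\otimes\Delta)_{g,l}=\bigoplus_h\Gamma_{g,h}\otimes\Delta_{h,l}$ with the isomorphisms $(\mathrm{id}\otimes V)\circ(U\otimes\mathrm{id})$. The 2-morphisms $(\Gamma,U)\to(\Delta,V)$ are the families of linear maps $f_{g,h}:\Gamma_{g,h}\to\Delta_{g,h}$ with $V\circ(\mathrm{id}\otimes f)=(f\otimes\mathrm{id})\circ U$. **The 2-category $\mathbf{BSA}$.** Objects are finite-dimensional basic algebras $A$ (there is a complete set of primitive orthogonal idempotents $e_i$ with $e_iA\not\cong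 e_jA$ for $i\ne j$, and $A/\operatorname{rad}A\cong k^n$ as algebras) with quiver data: linear sections $\delta^1_A$ of $A\to A/\operatorname{rad}A$ and $\delta^2_A$ of $\operatorname{rad}A\to\operatorname{rad}A/\operatorname{rad}^2A$ such that $\delta^1_A(xy)=\delta^1_A(x)\delta^1_A(y)$ and $\delta^2_A(\delta^1_A(x)z\delta^1_A(y))=\delta^1_A(x)\delta^2_A(z)\delta^1_A(y)$. The 1-morphisms $A\to B$ are the $A$-$B$-bimodules $M$ which are radically symmetric ($\operatorname{rad}(A)M=M\operatorname{rad}(B)=:\operatorname{rad}M$) and dualizable (have a left and a right dual in the 2-category of algebras, bimodules and intertwiners), with quiver data: linear sections $\delta^1_M$ of $M\to M/\operatorname{rad}M$ and $\delta^2_M$ of $\operatorname{rad}M\to\operatorname{rad}M/\operatorname{rad}^2M$, both equivariant for the left action of $\delta^1_A(A/\operatorname{rad}A)$ and the right action of $\delta^1_B(B/\operatorname{rad}B)$, such that $\delta^2_A(x)\delta^1_M(m)=\delta^2_M(xm)$ and $\delta^1_M(m)\delta^2_B(y)=\delta^2_M(my)$ for $x\in\operatorname{rad}A/\operatorname{rad}^2A$,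 $m\in M/\operatorname{rad}M$, $y\in\operatorname{rad}B/\operatorname{rad}^2B$. The composite of $M:A\to B$ and $N:B\to C$ is $M\otimes_BN$ with the quiver data determined by $\delta^1([m\otimes n])=\delta^1_M([m])\otimes\delta^1_N([n])$ for $n\in N$ and $\delta^2([m\otimes n])=\delta^1_M([m])\otimes\delta^2_N([n])$ for $n\in\operatorname{rad}N$. The 2-morphisms $M\to N$ are the bimodule maps $f$ with $f\circ\delta^1_M=\delta^1_N\circ\tilde f$, where $\tilde f:M/\operatorname{rad}M\to N/\operatorname{rad}N$ is induced by $f$. **Theorem.** There is a pseudofunctor $\mathcal P:\mathsf{BdQuivCon}\to\mathbf{BSA}$ that is given, up to isomorphism, as follows. 1. $\mathcal P(Q,I)=kQ/I$, with $\delta^1(v+\operatorname{rad})=v$ for vertices $v$ and $\delta^2(e+\operatorname{rad}^2)=e$ for edges $e$. 2. For an ideally connected connection $(\Gamma,U)$ from $(G,I)$ to $(H,J)$, $\mathcal P(\Gamma,U)=M/MJ$. Here $M=k(\Gamma H)=\bigoplus_{g,h,l}\Gamma_{g,h}\otimes k[\text{paths }h\to l]$, with the right action of $kH$ by concatenation and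 the left action of $kG$ by moving paths of $G$ across $\Gamma$ by means of $U^n$ and then concatenating; $\delta^1(\gamma+\operatorname{rad})=\gamma$ and $\delta^2(\gamma e+\operatorname{rad}^2)=\gamma e$ for $\gamma\in\Gamma_{g,h}$ and edges $e$ of $H$ starting at $h$. 3. $\mathcal P(f)$ is induced by $\sum\gamma b\mapsto\sum f(\gamma)b$. 4. The unit and composition isomorphisms of $\mathcal P$ are induced by $1_v\mapsto v$ (where $1_v$ is the generator of the identity connection at the vertex $v$) and $\gamma\otimes\delta\mapsto\gamma\otimes\delta$. This $\mathcal P$ is an equivalence of 2-categories: every object of $\mathbf{BSA}$ is equivalent in $\mathbf{BSA}$ to some $\mathcal P(Q,I)$, and for all objects $X,Y$ of $\mathsf{BdQuivCon}$ the functor $\mathsf{BdQuivCon}(X,Y)\to\mathbf{BSA}(\mathcal PX,\mathcal PY)$ is an equivalence of categories. -/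

import Mathlib

open CategoryTheory TensorProduct MulOpposite
open scoped Bicategory

universe u

noncomputable section

namespace QuiverConnections

/-! ### The bicategory of algebras, bimodules and intertwiners -/

/-- An (associative, unital) algebra over the field `k`, as an object of the bicategory of
bimodules. -/
structure Bim (k : Type u) [Field k] where
  carrier : Type u
  [ring : Ring carrier]
  [algebra : Algebra k carrier]

namespace Bim
variable {k : Type u} [Field k]
instance : CoeSort (Bim k) (Type u) := ⟨Bim.carrier⟩
instance (A : Bim k) : Ring A := A.ring
instance (A : Bim k) : Algebra k A := A.algebra
end Bim

/-- An `A`-`B` bimodule, on which the two actions of `k` agree. -/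
structure Bimodule {k : Type u} [Field k] (A B : Bim k) where
  carrier : Type u
  [addCommGroup : AddCommGroup carrier]
  [module : Module k carrier]
  [leftModule : Module A carrier]
  [rightModule : Module Bᵐᵒᵖ carrier]
  [smulComm : SMulCommClass A Bᵐᵒᵖ carrier]
  [leftTower : IsScalarTower k A carrier]
  [rightTower : IsScalarTower k Bᵐᵒᵖ carrier]

namespace Bimodule
variable {k : Type u} [Field k] {A B C D : Bim k}

instance : CoeSort (Bimodule A B) (Type u) := ⟨Bimodule.carrier⟩
instance (M : Bimodule A B) : AddCommGroup M := M.addCommGroup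
instance (M : Bimodule A B) : Module k M := M.module
instance (M : Bimodule A B) : Module A M := M.leftModule
instance (M : Bimodule A B) : Module Bᵐᵒᵖ M := M.rightModule
instance (M : Bimodule A B) : SMulCommClass A Bᵐᵒᵖ M := M.smulComm
instance (M : Bimodule A B) : IsScalarTower k A M := M.leftTower
instance (M : Bimodule A B) : IsScalarTower k Bᵐᵒᵖ M := M.rightTower

/-- Intertwiners of bimodules. -/
@[ext]
structure Hom (M N : Bimodule A B) where
  toLin : M →ₗ[k] N
  map_left : ∀ (a : A) (m : M), toLin (a • m) = a • toLin m
  map_right : ∀ (b : B) (m : M), toLin (op b • m) = op b • toLin m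

instance : Category (Bimodule A B) where
  Hom M N := Hom M N
  id M := ⟨LinearMap.id, fun _ _ => rfl, fun _ _ => rfl⟩
  comp f g := ⟨g.toLin ∘ₗ f.toLin, fun a m => by simp [f.map_left, g.map_left],
    fun b m => by simp [f.map_right, g.map_right]⟩

/-- The linear map underlying an intertwiner. -/
def lin {M N : Bimodule A B} (f : M ⟶ N) : M →ₗ[k] N := Hom.toLin f

lemma lin_left {M N : Bimodule A B} (f : M ⟶ N) (a : A) (m : M) :
    lin f (a • m) = a • lin f m := Hom.map_left f a m

lemma lin_right {M N : Bimodule A B} (f : M ⟶ N) (b : B) (m : M) :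
    lin f (op b • m) = op b • lin f m := Hom.map_right f b m

lemma hom_ext {M N : Bimodule A B} {f g : M ⟶ N} (h : ∀ m, lin f m = lin g m) : f = g :=
  Hom.ext (LinearMap.ext h)

@[simp] lemma lin_id (M : Bimodule A B) (m : M) : lin (𝟙 M) m = m := rfl

@[simp] lemma lin_comp {M N P : Bimodule A B} (f : M ⟶ N) (g : N ⟶ P) (m : M) :
    lin (f ≫ g) m = lin g (lin f m) := rfl

/-- Construct an isomorphism of bimodules from a pair of mutually inverse linear maps. -/
def mkIso {M N : Bimodule A B} (f : M →ₗ[k] N) (g : N →ₗ[k] M)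
    (hl : ∀ (a : A) (m : M), f (a • m) = a • f m)
    (hr : ∀ (b : B) (m : M), f (op b • m) = op b • f m)
    (hfg : ∀ m, g (f m) = m) (hgf : ∀ n, f (g n) = n) : M ≅ N where
  hom := (⟨f, hl, hr⟩ : Hom M N)
  inv := (⟨g, fun a n => by rw [← hgf n, ← hl, hfg, hfg],
    fun b n => by rw [← hgf n, ← hr, hfg, hfg]⟩ : Hom N M)
  hom_inv_id := hom_ext hfg
  inv_hom_id := hom_ext hgf

/-- The subspace of `M ⊗ₖ N` spanned by the elements `m b ⊗ n - m ⊗ b n`. -/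
def balanced (M : Bimodule A B) (N : Bimodule B C) : Submodule k (M ⊗[k] N) :=
  Submodule.span k {t | ∃ (m : M) (b : B) (n : N),
    t = (op b • m) ⊗ₜ[k] n - m ⊗ₜ[k] (b • n)}

/-- The vector space underlying the tensor product `M ⊗_B N`. -/
def TensorSpace (M : Bimodule A B) (N : Bimodule B C) : Type u := (M ⊗[k] N) ⧸ balanced M N

section tensor
variable (M : Bimodule A B) (N : Bimodule B C)

instance : AddCommGroup (TensorSpace M N) :=
  inferInstanceAs (AddCommGroup ((M ⊗[k] N) ⧸ balanced M N))
instance : Module k (TensorSpace M N) :=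
  inferInstanceAs (Module k ((M ⊗[k] N) ⧸ balanced M N))

/-- The bilinear map `(m, n) ↦ m ⊗ n` to `M ⊗_B N`. -/
def tmulₗ : M →ₗ[k] N →ₗ[k] TensorSpace M N :=
  (TensorProduct.mk k M N).compr₂ (balanced M N).mkQ

variable {M N}

/-- The element `m ⊗ n` of `M ⊗_B N`. -/
def tmul (m : M) (n : N) : TensorSpace M N := tmulₗ M N m n

lemma tmulₗ_apply (m : M) (n : N) : tmulₗ M N m n = tmul m n := rfl

lemma tmul_add (m : M) (n n' : N) : tmul m (n + n') = tmul m n + tmul m n' := map_add _ _ _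
lemma add_tmul (m m' : M) (n : N) : tmul (m + m') n = tmul m n + tmul m' n := by
  simp [← tmulₗ_apply]
lemma smul_tmul (c : k) (m : M) (n : N) : tmul (c • m) n = c • tmul m n := by
  simp [← tmulₗ_apply]
lemma tmul_smul (c : k) (m : M) (n : N) : tmul m (c • n) = c • tmul m n := map_smul _ _ _
@[simp] lemma tmul_zero (m : M) : tmul m (0 : N) = 0 := map_zero _
@[simp] lemma zero_tmul (n : N) : tmul (0 : M) n = 0 := by simp [← tmulₗ_apply]

lemma tmul_balanced (m : M) (b : B) (n : N) : tmul (op b • m) n = tmul m (b • n) :=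
  (Submodule.Quotient.eq _).2 (Submodule.subset_span ⟨m, b, n, rfl⟩)

lemma tensor_induction {p : TensorSpace M N → Prop} (t : TensorSpace M N) (h0 : p 0)
    (ht : ∀ m n, p (tmul m n)) (ha : ∀ s t, p s → p t → p (s + t)) : p t := by
  obtain ⟨t, rfl⟩ := Submodule.mkQ_surjective _ t
  induction t with
  | zero => rw [map_zero]; exact h0
  | tmul m n => exact ht m n
  | add s t hs ht => rw [map_add]; exact ha _ _ hs ht

lemma lin_ext_tensor {X : Type*} [AddCommGroup X] [Module k X] {f g : TensorSpace M N →ₗ[k] X}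
    (h : ∀ m n, f (tmul m n) = g (tmul m n)) (t : TensorSpace M N) : f t = g t := by
  induction t using tensor_induction with
  | h0 => simp
  | ht m n => exact h m n
  | ha s t hs ht => rw [map_add, map_add, hs, ht]

/-- A bilinear map `f` on `M × N` is `B`-balanced if `f (m b, n) = f (m, b n)`. -/
structure IsBalanced {X : Type*} [AddCommGroup X] [Module k X] (f : M →ₗ[k] N →ₗ[k] X) :
    Prop where
  eq : ∀ (m : M) (b : B) (n : N), f (op b • m) n = f m (b • n)

/-- The linear map out of `M ⊗_B N` induced by a balanced bilinear map. -/
def lift {X : Type*} [AddCommGroup X] [Module k X] (f : M →ₗ[k] N →ₗ[k] X)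
    (hf : IsBalanced f) : TensorSpace M N →ₗ[k] X :=
  (balanced M N).liftQ (TensorProduct.lift f) (by
    rw [balanced, Submodule.span_le]
    rintro _ ⟨m, b, n, rfl⟩
    simp [hf.eq])

@[simp] lemma lift_tmul {X : Type*} [AddCommGroup X] [Module k X] (f : M →ₗ[k] N →ₗ[k] X)
    (hf : IsBalanced f) (m : M) (n : N) :
    lift f hf (tmul m n) = f m n :=
  TensorProduct.lift.tmul (f' := f) m n

/-- Left action of `a` on `M ⊗_B N`. -/
def leftMulₗ (a : A) : TensorSpace M N →ₗ[k] TensorSpace M N :=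
  lift ((tmulₗ M N).comp (Algebra.lsmul k k M a)) ⟨by
    intro m b n
    simp [tmulₗ_apply, smul_comm a (op b) m, tmul_balanced]⟩

/-- Right action of `c` on `M ⊗_B N`. -/
def rightMulₗ (c : Cᵐᵒᵖ) : TensorSpace M N →ₗ[k] TensorSpace M N :=
  lift ((tmulₗ M N).compl₂ (Algebra.lsmul k k N c)) ⟨by
    intro m b n
    simp [tmulₗ_apply, ← smul_comm b c n, tmul_balanced]⟩

@[simp] lemma leftMulₗ_tmul (a : A) (m : M) (n : N) :
    leftMulₗ a (tmul m n) = tmul (a • m) n := by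
  rw [leftMulₗ, lift_tmul]; rfl
@[simp] lemma rightMulₗ_tmul (c : Cᵐᵒᵖ) (m : M) (n : N) :
    rightMulₗ c (tmul m n) = tmul m (c • n) := by
  rw [rightMulₗ, lift_tmul]; rfl

instance : Module A (TensorSpace M N) where
  smul a t := leftMulₗ a t
  one_smul t := lin_ext_tensor (g := LinearMap.id)
    (fun m n => by rw [leftMulₗ_tmul, one_smul]; rfl) t
  mul_smul a b t := lin_ext_tensor (f := leftMulₗ (a * b)) (g := leftMulₗ a ∘ₗ leftMulₗ b)
    (fun m n => by simp [mul_smul]) t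
  smul_zero a := map_zero (leftMulₗ a)
  smul_add a := map_add (leftMulₗ a)
  add_smul a b t := lin_ext_tensor (f := leftMulₗ (a + b)) (g := leftMulₗ a + leftMulₗ b)
    (fun m n => by simp [add_smul, add_tmul]) t
  zero_smul t := lin_ext_tensor (f := leftMulₗ 0) (g := 0) (fun m n => by simp) t

instance : Module Cᵐᵒᵖ (TensorSpace M N) where
  smul a t := rightMulₗ a t
  one_smul t := lin_ext_tensor (g := LinearMap.id)
    (fun m n => by rw [rightMulₗ_tmul, one_smul]; rfl) t
  mul_smul a b t := lin_ext_tensor (f := rightMulₗ (a * b)) (g := rightMulₗ a ∘ₗ rightMulₗ b)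
    (fun m n => by simp [mul_smul]) t
  smul_zero a := map_zero (rightMulₗ a)
  smul_add a := map_add (rightMulₗ a)
  add_smul a b t := lin_ext_tensor (f := rightMulₗ (a + b)) (g := rightMulₗ a + rightMulₗ b)
    (fun m n => by simp [add_smul, tmul_add]) t
  zero_smul t := lin_ext_tensor (f := rightMulₗ 0) (g := 0) (fun m n => by simp) t

lemma smul_tmul_left (a : A) (m : M) (n : N) : a • tmul m n = tmul (a • m) n :=
  leftMulₗ_tmul a m n
lemma smul_tmul_right (c : Cᵐᵒᵖ) (m : M) (n : N) : c • tmul m n = tmul m (c • n) :=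
  rightMulₗ_tmul c m n

instance : SMulCommClass A Cᵐᵒᵖ (TensorSpace M N) where
  smul_comm a c t := lin_ext_tensor (f := leftMulₗ a ∘ₗ rightMulₗ c)
    (g := rightMulₗ c ∘ₗ leftMulₗ a) (fun m n => by simp) t

instance : IsScalarTower k A (TensorSpace M N) where
  smul_assoc c a t := lin_ext_tensor (f := leftMulₗ (c • a)) (g := c • leftMulₗ a)
    (fun m n => by simp [smul_assoc, smul_tmul]) t

instance : IsScalarTower k Cᵐᵒᵖ (TensorSpace M N) where
  smul_assoc c a t := lin_ext_tensor (f := rightMulₗ (c • a)) (g := c • rightMulₗ a)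
    (fun m n => by simp [smul_assoc, tmul_smul]) t

end tensor

/-- The bimodule `M ⊗_B N`. -/
def tensor (M : Bimodule A B) (N : Bimodule B C) : Bimodule A C where
  carrier := TensorSpace M N

/-- The regular bimodule. -/
def unit (A : Bim k) : Bimodule A A where
  carrier := A

/-- The identification of `A` with the underlying space of the regular bimodule. -/
def toUnit (A : Bim k) : A ≃ₗ[k] unit A := LinearEquiv.refl k A

/-- The element `m ⊗ n` of the bimodule `M ⊗_B N`. -/
def tm {M : Bimodule A B} {N : Bimodule B C} (m : M) (n : N) : tensor M N := tmul m n

section bicategory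
variable {M M' M'' : Bimodule A B} {N N' N'' : Bimodule B C} {P : Bimodule C D}

lemma tm_balanced (m : M) (b : B) (n : N) : tm (op b • m) n = tm m (b • n) := tmul_balanced m b n
lemma smul_tm_left (a : A) (m : M) (n : N) : a • tm m n = tm (a • m) n := smul_tmul_left a m n
lemma smul_tm_right (c : Cᵐᵒᵖ) (m : M) (n : N) : c • tm m n = tm m (c • n) :=
  smul_tmul_right c m n

/-- The bilinear map `(m, n) ↦ m ⊗ n`. -/
def tmₗ (M : Bimodule A B) (N : Bimodule B C) : M →ₗ[k] N →ₗ[k] tensor M N := tmulₗ M N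
@[simp] lemma tmₗ_apply (m : M) (n : N) : tmₗ M N m n = tm m n := rfl

lemma tm_add (m : M) (n n' : N) : tm m (n + n') = tm m n + tm m n' := tmul_add m n n'
lemma add_tm (m m' : M) (n : N) : tm (m + m') n = tm m n + tm m' n := add_tmul m m' n
lemma smul_tm (c : k) (m : M) (n : N) : tm (c • m) n = c • tm m n := smul_tmul c m n
lemma tm_smul (c : k) (m : M) (n : N) : tm m (c • n) = c • tm m n := tmul_smul c m n
@[simp] lemma tm_zero (m : M) : tm m (0 : N) = 0 := tmul_zero m
@[simp] lemma zero_tm (n : N) : tm (0 : M) n = 0 := zero_tmul n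

lemma tm_induction {p : tensor M N → Prop} (t : tensor M N) (h0 : p 0)
    (ht : ∀ m n, p (tm m n)) (ha : ∀ s t, p s → p t → p (s + t)) : p t :=
  tensor_induction (M := M) (N := N) t h0 ht ha

/-- The linear map out of `M ⊗_B N` induced by a balanced bilinear map. -/
def tlift {X : Type*} [AddCommGroup X] [Module k X] (f : M →ₗ[k] N →ₗ[k] X)
    (hf : IsBalanced f) : tensor M N →ₗ[k] X := lift f hf

@[simp] lemma tlift_tm {X : Type*} [AddCommGroup X] [Module k X] (f : M →ₗ[k] N →ₗ[k] X)
    (hf : IsBalanced f) (m : M) (n : N) :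
    tlift f hf (tm m n) = f m n := lift_tmul f hf m n

lemma linearMap_ext {X : Type*} [AddCommGroup X] [Module k X] {f g : tensor M N →ₗ[k] X}
    (h : ∀ m n, f (tm m n) = g (tm m n)) (t : tensor M N) : f t = g t :=
  lin_ext_tensor (M := M) (N := N) h t

lemma linearMap_ext₁ {X : Type*} [AddCommGroup X] [Module k X]
    {f g : tensor (tensor M N) P →ₗ[k] X}
    (h : ∀ m n p, f (tm (tm m n) p) = g (tm (tm m n) p)) (t) : f t = g t := by
  refine linearMap_ext (fun s p => ?_) t
  induction s using tm_induction with
  | h0 => simp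
  | ht m n => exact h m n p
  | ha s t hs ht => rw [add_tm, map_add, map_add, hs, ht]

lemma linearMap_ext₂ {X : Type*} [AddCommGroup X] [Module k X]
    {f g : tensor M (tensor N P) →ₗ[k] X}
    (h : ∀ m n p, f (tm m (tm n p)) = g (tm m (tm n p))) (t) : f t = g t := by
  refine linearMap_ext (fun m s => ?_) t
  induction s using tm_induction with
  | h0 => simp
  | ht n p => exact h m n p
  | ha s t hs ht => rw [tm_add, map_add, map_add, hs, ht]

lemma linearMap_ext₃ {E : Bim k} {Q : Bimodule D E} {X : Type*} [AddCommGroup X] [Module k X]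
    {f g : tensor (tensor (tensor M N) P) Q →ₗ[k] X}
    (h : ∀ m n p q, f (tm (tm (tm m n) p) q) = g (tm (tm (tm m n) p) q)) (t) : f t = g t := by
  refine linearMap_ext₁ (fun s p q => ?_) t
  induction s using tm_induction with
  | h0 => simp
  | ht n p => exact h _ _ _ _
  | ha s t hs ht => rw [add_tm, add_tm, map_add, map_add, hs, ht]

/-- The linear map underlying the tensor product of two intertwiners. -/
def tensorMapₗ (f : M ⟶ M') (g : N ⟶ N') : tensor M N →ₗ[k] tensor M' N' :=
  tlift ((tmₗ M' N').compl₁₂ (lin f) (lin g)) ⟨by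
    intro m b n
    simp [lin_right, lin_left, tm_balanced]⟩

@[simp] lemma tensorMapₗ_tm (f : M ⟶ M') (g : N ⟶ N') (m : M) (n : N) :
    tensorMapₗ f g (tm m n) = tm (lin f m) (lin g n) := by
  rw [tensorMapₗ, tlift_tm]; rfl

/-- The tensor product (horizontal composite) of two intertwiners. -/
def tensorMap (f : M ⟶ M') (g : N ⟶ N') : tensor M N ⟶ tensor M' N' where
  toLin := tensorMapₗ f g
  map_left a t := by
    induction t using tm_induction with
    | h0 => simp
    | ht m n => simp [smul_tm_left, lin_left]
    | ha s t hs ht => rw [smul_add, map_add, map_add, hs, ht, smul_add]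
  map_right a t := by
    induction t using tm_induction with
    | h0 => simp
    | ht m n => simp [smul_tm_right, lin_right]
    | ha s t hs ht => rw [smul_add, map_add, map_add, hs, ht, smul_add]

@[simp] lemma tensorMap_tm (f : M ⟶ M') (g : N ⟶ N') (m : M) (n : N) :
    lin (tensorMap f g) (tm m n) = tm (lin f m) (lin g n) := tensorMapₗ_tm f g m n

/-- For fixed `p`, the linear map `t ↦ t ⊗ p`, reassociated. -/
def assocHomAux (M : Bimodule A B) (N : Bimodule B C) (P : Bimodule C D) (p : P) :
    tensor M N →ₗ[k] tensor M (tensor N P) :=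
  tlift ((tmₗ M (tensor N P)).compl₂ ((tmₗ N P).flip p)) ⟨by
    intro m b n
    simp [tm_balanced, smul_tm_left]⟩

@[simp] lemma assocHomAux_tm (m : M) (n : N) (p : P) :
    assocHomAux M N P p (tm m n) = tm m (tm n p) := by
  rw [assocHomAux, tlift_tm]; rfl

/-- The linear map `(M ⊗ N) ⊗ P → M ⊗ (N ⊗ P)`. -/
def assocHom (M : Bimodule A B) (N : Bimodule B C) (P : Bimodule C D) :
    tensor (tensor M N) P →ₗ[k] tensor M (tensor N P) :=
  tlift (LinearMap.mk₂ k (fun t p => assocHomAux M N P p t)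
    (by intro s t p; exact map_add _ s t)
    (by intro c t p; exact map_smul _ c t)
    (by
      intro t p p'
      exact linearMap_ext (f := assocHomAux M N P (p + p'))
        (g := assocHomAux M N P p + assocHomAux M N P p') (fun m n => by simp [tm_add]) t)
    (by
      intro c t p
      exact linearMap_ext (f := assocHomAux M N P (c • p))
        (g := c • assocHomAux M N P p) (fun m n => by simp [tm_smul]) t)) ⟨by
    intro t c p
    simp only [LinearMap.mk₂_apply]
    exact linearMap_ext (f := assocHomAux M N P p ∘ₗ Algebra.lsmul k k _ (op c))
        (g := assocHomAux M N P (c • p)) (fun m n => by simp [smul_tm_right, tm_balanced]) t⟩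

@[simp] lemma assocHom_tm (m : M) (n : N) (p : P) :
    assocHom M N P (tm (tm m n) p) = tm m (tm n p) := by
  rw [assocHom, tlift_tm, LinearMap.mk₂_apply, assocHomAux_tm]

/-- For fixed `m`, the linear map `t ↦ m ⊗ t`, reassociated. -/
def assocInvAux (M : Bimodule A B) (N : Bimodule B C) (P : Bimodule C D) (m : M) :
    tensor N P →ₗ[k] tensor (tensor M N) P :=
  tlift ((tmₗ (tensor M N) P).comp (tmₗ M N m)) ⟨by
    intro n b p
    simp [← tm_balanced, smul_tm_right]⟩

@[simp] lemma assocInvAux_tm (m : M) (n : N) (p : P) :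
    assocInvAux M N P m (tm n p) = tm (tm m n) p := by
  rw [assocInvAux, tlift_tm]; rfl

/-- The linear map `M ⊗ (N ⊗ P) → (M ⊗ N) ⊗ P`. -/
def assocInv (M : Bimodule A B) (N : Bimodule B C) (P : Bimodule C D) :
    tensor M (tensor N P) →ₗ[k] tensor (tensor M N) P :=
  tlift (LinearMap.mk₂ k (fun m t => assocInvAux M N P m t)
    (by
      intro m m' t
      exact linearMap_ext (f := assocInvAux M N P (m + m'))
        (g := assocInvAux M N P m + assocInvAux M N P m') (fun m n => by simp [add_tm]) t)
    (by
      intro c m t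
      exact linearMap_ext (f := assocInvAux M N P (c • m))
        (g := c • assocInvAux M N P m) (fun m n => by simp [smul_tm]) t)
    (by intro m s t; exact map_add _ s t)
    (by intro c m t; exact map_smul _ c t)) ⟨by
    intro m b t
    simp only [LinearMap.mk₂_apply]
    exact linearMap_ext (f := assocInvAux M N P (op b • m))
        (g := assocInvAux M N P m ∘ₗ Algebra.lsmul k k _ b)
        (fun m n => by simp [smul_tm_left, tm_balanced]) t⟩

@[simp] lemma assocInv_tm (m : M) (n : N) (p : P) :
    assocInv M N P (tm m (tm n p)) = tm (tm m n) p := by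
  rw [assocInv, tlift_tm, LinearMap.mk₂_apply, assocInvAux_tm]

/-- The associator `(M ⊗ N) ⊗ P ≅ M ⊗ (N ⊗ P)`. -/
def assoc (M : Bimodule A B) (N : Bimodule B C) (P : Bimodule C D) :
    tensor (tensor M N) P ≅ tensor M (tensor N P) :=
  mkIso (assocHom M N P) (assocInv M N P)
    (fun a => linearMap_ext₁ (f := assocHom M N P ∘ₗ Algebra.lsmul k k _ a)
      (g := Algebra.lsmul k k _ a ∘ₗ assocHom M N P) (fun m n p => by simp [smul_tm_left]))
    (fun a => linearMap_ext₁ (f := assocHom M N P ∘ₗ Algebra.lsmul k k _ (op a))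
      (g := Algebra.lsmul k k _ (op a) ∘ₗ assocHom M N P) (fun m n p => by
        simp [smul_tm_right]))
    (linearMap_ext₁ (f := assocInv M N P ∘ₗ assocHom M N P) (g := LinearMap.id)
      (fun m n p => by simp))
    (linearMap_ext₂ (f := assocHom M N P ∘ₗ assocInv M N P) (g := LinearMap.id)
      (fun m n p => by simp))

@[simp] lemma assoc_hom_tm (m : M) (n : N) (p : P) :
    lin (assoc M N P).hom (tm (tm m n) p) = tm m (tm n p) := assocHom_tm m n p
@[simp] lemma assoc_inv_tm (m : M) (n : N) (p : P) :
    lin (assoc M N P).inv (tm m (tm n p)) = tm (tm m n) p := assocInv_tm m n p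

lemma smul_toUnit (a b : A) : a • toUnit A b = toUnit A (a * b) := rfl
lemma op_smul_toUnit (a b : A) : op a • toUnit A b = toUnit A (b * a) := rfl
lemma toUnit_eq_smul (a : A) : toUnit A a = op a • toUnit A 1 := by
  rw [op_smul_toUnit, one_mul]
lemma toUnit_eq_smul' (a : A) : toUnit A a = a • toUnit A 1 := by
  rw [smul_toUnit, mul_one]
lemma exists_toUnit (x : unit A) : ∃ a, x = toUnit A a := ⟨x, rfl⟩

/-- The action map `A ⊗_A M → M`. -/
def leftUnitₗ (M : Bimodule A B) : tensor (unit A) M →ₗ[k] M :=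
  tlift ((Algebra.lsmul k k M : A →ₐ[k] Module.End k M).toLinearMap.comp
    (toUnit A).symm.toLinearMap) ⟨by
    intro x a m
    obtain ⟨b, hb⟩ := exists_toUnit x
    simp only [hb, op_smul_toUnit]
    simp⟩

@[simp] lemma leftUnitₗ_tm (a : A) (m : M) : leftUnitₗ M (tm (toUnit A a) m) = a • m := by
  rw [leftUnitₗ, tlift_tm]; rfl

lemma linearMap_ext_left {X : Type*} [AddCommGroup X] [Module k X]
    {f g : tensor (unit A) M →ₗ[k] X}
    (h : ∀ m, f (tm (toUnit A 1) m) = g (tm (toUnit A 1) m)) (t) : f t = g t := by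
  refine linearMap_ext (fun x m => ?_) t
  obtain ⟨b, hb⟩ := exists_toUnit x
  rw [hb, toUnit_eq_smul, tm_balanced, h]

/-- The left unitor `A ⊗_A M ≅ M`. -/
def leftUnit (M : Bimodule A B) : tensor (unit A) M ≅ M :=
  mkIso (leftUnitₗ M) (tmₗ (unit A) M (toUnit A 1))
    (by
      intro a
      exact linearMap_ext_left (f := leftUnitₗ M ∘ₗ Algebra.lsmul k k _ a)
        (g := Algebra.lsmul k k _ a ∘ₗ leftUnitₗ M) (fun m => by simp [smul_tm_left, smul_toUnit]))
    (by
      intro a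
      exact linearMap_ext_left (f := leftUnitₗ M ∘ₗ Algebra.lsmul k k _ (op a))
        (g := Algebra.lsmul k k _ (op a) ∘ₗ leftUnitₗ M) (fun m => by simp [smul_tm_right]))
    (linearMap_ext_left (f := tmₗ (unit A) M (toUnit A 1) ∘ₗ leftUnitₗ M) (g := LinearMap.id)
      (fun m => by simp))
    (by intro m; simp)

@[simp] lemma leftUnit_hom_tm (a : A) (m : M) :
    lin (leftUnit M).hom (tm (toUnit A a) m) = a • m := leftUnitₗ_tm a m
@[simp] lemma leftUnit_inv_apply (m : M) :
    lin (leftUnit M).inv m = tm (toUnit A 1) m := rfl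

/-- The action map `M ⊗_B B → M`. -/
def rightUnitₗ (M : Bimodule A B) : tensor M (unit B) →ₗ[k] M :=
  tlift (((Algebra.lsmul k k M : Bᵐᵒᵖ →ₐ[k] Module.End k M).toLinearMap.comp
    (opLinearEquiv k : B ≃ₗ[k] Bᵐᵒᵖ).toLinearMap).comp (toUnit B).symm.toLinearMap).flip ⟨by
    intro m a x
    obtain ⟨b, hb⟩ := exists_toUnit x
    simp only [hb, smul_toUnit]
    simp⟩

@[simp] lemma rightUnitₗ_tm (m : M) (b : B) :
    rightUnitₗ M (tm m (toUnit B b)) = op b • m := by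
  rw [rightUnitₗ, tlift_tm]; rfl

lemma linearMap_ext_right {X : Type*} [AddCommGroup X] [Module k X]
    {f g : tensor M (unit B) →ₗ[k] X}
    (h : ∀ m, f (tm m (toUnit B 1)) = g (tm m (toUnit B 1))) (t) : f t = g t := by
  refine linearMap_ext (fun m x => ?_) t
  obtain ⟨b, hb⟩ := exists_toUnit x
  rw [hb, toUnit_eq_smul', ← tm_balanced, h]

/-- The right unitor `M ⊗_B B ≅ M`. -/
def rightUnit (M : Bimodule A B) : tensor M (unit B) ≅ M :=
  mkIso (rightUnitₗ M) ((tmₗ M (unit B)).flip (toUnit B 1))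
    (by
      intro a
      exact linearMap_ext_right (f := rightUnitₗ M ∘ₗ Algebra.lsmul k k _ a)
        (g := Algebra.lsmul k k _ a ∘ₗ rightUnitₗ M) (fun m => by simp [smul_tm_left]))
    (by
      intro a
      exact linearMap_ext_right (f := rightUnitₗ M ∘ₗ Algebra.lsmul k k _ (op a))
        (g := Algebra.lsmul k k _ (op a) ∘ₗ rightUnitₗ M)
        (fun m => by simp [smul_tm_right, op_smul_toUnit]))
    (linearMap_ext_right (f := (tmₗ M (unit B)).flip (toUnit B 1) ∘ₗ rightUnitₗ M)
      (g := LinearMap.id) (fun m => by simp))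
    (by intro m; simp)

@[simp] lemma rightUnit_hom_tm (m : M) (b : B) :
    lin (rightUnit M).hom (tm m (toUnit B b)) = op b • m := rightUnitₗ_tm m b
@[simp] lemma rightUnit_inv_apply (m : M) :
    lin (rightUnit M).inv m = tm m (toUnit B 1) := rfl

lemma tensor_hom_ext {X : Bimodule A C} {f g : tensor M N ⟶ X}
    (h : ∀ m n, lin f (tm m n) = lin g (tm m n)) : f = g := hom_ext (linearMap_ext h)
lemma tensor_hom_ext_left {X : Bimodule A B} {f g : tensor (unit A) M ⟶ X}
    (h : ∀ m, lin f (tm (toUnit A 1) m) = lin g (tm (toUnit A 1) m)) : f = g :=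
  hom_ext (linearMap_ext_left h)
lemma tensor_hom_ext_right {X : Bimodule A B} {f g : tensor M (unit B) ⟶ X}
    (h : ∀ m, lin f (tm m (toUnit B 1)) = lin g (tm m (toUnit B 1))) : f = g :=
  hom_ext (linearMap_ext_right h)
lemma tensor_hom_ext₁ {X : Bimodule A D} {f g : tensor (tensor M N) P ⟶ X}
    (h : ∀ m n p, lin f (tm (tm m n) p) = lin g (tm (tm m n) p)) : f = g :=
  hom_ext (linearMap_ext₁ h)
lemma tensor_hom_ext₂ {X : Bimodule A D} {f g : tensor M (tensor N P) ⟶ X}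
    (h : ∀ m n p, lin f (tm m (tm n p)) = lin g (tm m (tm n p))) : f = g :=
  hom_ext (linearMap_ext₂ h)
lemma tensor_hom_ext₃ {E : Bim k} {Q : Bimodule D E} {X : Bimodule A E}
    {f g : tensor (tensor (tensor M N) P) Q ⟶ X}
    (h : ∀ m n p q, lin f (tm (tm (tm m n) p) q) = lin g (tm (tm (tm m n) p) q)) : f = g :=
  hom_ext (linearMap_ext₃ h)

end bicategory

section laws
variable {E : Bim k} {M M' M'' : Bimodule A B} {N N' N'' : Bimodule B C} {P : Bimodule C D}

lemma tensorMap_id (M : Bimodule A B) (N : Bimodule B C) :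
    tensorMap (𝟙 M) (𝟙 N) = 𝟙 (tensor M N) := tensor_hom_ext fun _ _ => by simp

lemma tensorMap_comp (f : M ⟶ M') (f' : M' ⟶ M'') (g : N ⟶ N') (g' : N' ⟶ N'') :
    tensorMap (f ≫ f') (g ≫ g') = tensorMap f g ≫ tensorMap f' g' :=
  tensor_hom_ext fun _ _ => by simp

lemma unit_tensorMap (f : M ⟶ M') :
    tensorMap (𝟙 (unit A)) f = (leftUnit M).hom ≫ f ≫ (leftUnit M').inv :=
  tensor_hom_ext_left fun m => by simp

lemma tensorMap_unit (f : M ⟶ M') :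
    tensorMap f (𝟙 (unit B)) = (rightUnit M).hom ≫ f ≫ (rightUnit M').inv :=
  tensor_hom_ext_right fun m => by simp

lemma assoc_naturality {P' : Bimodule C D} (f : M ⟶ M') (g : N ⟶ N') (h : P ⟶ P') :
    tensorMap (tensorMap f g) h ≫ (assoc M' N' P').hom =
      (assoc M N P).hom ≫ tensorMap f (tensorMap g h) :=
  tensor_hom_ext₁ fun _ _ _ => by simp

lemma pentagon (M : Bimodule A B) (N : Bimodule B C) (P : Bimodule C D) (Q : Bimodule D E) :
    tensorMap (assoc M N P).hom (𝟙 Q) ≫ (assoc M (tensor N P) Q).hom ≫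
      tensorMap (𝟙 M) (assoc N P Q).hom =
        (assoc (tensor M N) P Q).hom ≫ (assoc M N (tensor P Q)).hom :=
  tensor_hom_ext₃ fun _ _ _ _ => by simp

lemma triangle (M : Bimodule A B) (N : Bimodule B C) :
    (assoc M (unit B) N).hom ≫ tensorMap (𝟙 M) (leftUnit N).hom
      = tensorMap (rightUnit M).hom (𝟙 N) :=
  tensor_hom_ext₁ fun m x n => by
    obtain ⟨b, hb⟩ := exists_toUnit x
    simp only [hb, lin_comp, assoc_hom_tm, tensorMap_tm, leftUnit_hom_tm, rightUnit_hom_tm, lin_id]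
    rw [tm_balanced]

end laws

/-- The bicategory of `k`-algebras, bimodules and intertwiners. The composite of an `A`-`B`
bimodule `M` and a `B`-`C` bimodule `N` is `M ⊗_B N`. -/
instance bicategory : Bicategory (Bim k) where
  Hom A B := Bimodule A B
  id A := unit A
  comp M N := tensor M N
  homCategory A B := inferInstanceAs (Category (Bimodule A B))
  whiskerLeft M _ _ g := tensorMap (𝟙 M) g
  whiskerRight f N := tensorMap f (𝟙 N)
  associator M N P := assoc M N P
  leftUnitor M := leftUnit M
  rightUnitor M := rightUnit M
  whiskerLeft_id M N := tensorMap_id M N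
  whiskerLeft_comp M _ _ _ g g' := tensorMap_comp (𝟙 M) (𝟙 M) g g'
  id_whiskerLeft f := unit_tensorMap f
  comp_whiskerLeft M N P P' h := by
    rw [← Category.assoc]
    refine (Iso.eq_comp_inv _).2 ?_
    refine Eq.trans ?_ (assoc_naturality (𝟙 M) (𝟙 N) h)
    exact congrArg (fun x => tensorMap x h ≫ (assoc M N P').hom) (tensorMap_id M N).symm
  id_whiskerRight M N := tensorMap_id M N
  comp_whiskerRight f f' N := tensorMap_comp f f' (𝟙 N) (𝟙 N)
  whiskerRight_id f := tensorMap_unit f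
  whiskerRight_comp {_ _ _ _ M M'} f N P := by
    refine (Iso.eq_inv_comp _).2 ?_
    refine Eq.trans ?_ (assoc_naturality f (𝟙 N) (𝟙 P)).symm
    exact congrArg (fun x => (assoc M N P).hom ≫ tensorMap f x) (tensorMap_id N P).symm
  whisker_assoc M N N' g P := by
    rw [← Category.assoc]
    exact (Iso.eq_comp_inv _).2 (assoc_naturality (𝟙 M) g (𝟙 P))
  whisker_exchange {_ _ _ M M' N N'} f g :=
    ((tensorMap_comp (𝟙 M) f g (𝟙 N')).symm.trans (by
      rw [Category.id_comp, Category.comp_id])).trans (tensorMap_comp f (𝟙 M') (𝟙 N) g |>.symm.trans (by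
      rw [Category.id_comp, Category.comp_id])).symm
  pentagon M N P Q := pentagon M N P Q
  triangle M N := triangle M N

end Bimodule

/-! ### Basic algebras and quiver data -/

/-- The Jacobson radical. -/
abbrev rad (A : Type u) [Ring A] : Ideal A := Ring.jacobson A

/-- A primitive idempotent: a nonzero idempotent which is not the sum of two nonzero orthogonal
idempotents. -/
structure IsPrimitiveIdempotent {A : Type u} [Ring A] (e : A) : Prop where
  idem : IsIdempotentElem e
  ne_zero : e ≠ 0
  indecomposable : ∀ f g : A, IsIdempotentElem f → IsIdempotentElem g → f * g = 0 → g * f = 0 →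
    f + g = e → f = 0 ∨ g = 0

/-- The right ideal `eA`, as a right `A`-module. -/
abbrev rightIdeal {A : Type u} [Ring A] (e : A) : Submodule Aᵐᵒᵖ A := Submodule.span Aᵐᵒᵖ {e}

/-- A finite-dimensional (split) basic algebra: there is a complete set of primitive orthogonal
idempotents `e i` with `e i A ≇ e j A` for `i ≠ j`, and `A / rad A` is a product of copies of `k`
(the latter is automatic over an algebraically closed field). -/
structure IsBasic (k A : Type u) [Field k] [Ring A] [Algebra k A] : Prop where
  finite : Module.Finite k A
  idempotents : ∃ (n : ℕ) (e : Fin n → A), CompleteOrthogonalIdempotents e ∧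
    (∀ i, IsPrimitiveIdempotent (e i)) ∧
    ∀ i j, i ≠ j → IsEmpty (rightIdeal (e i) ≃ₗ[Aᵐᵒᵖ] rightIdeal (e j))
  split : ∃ n : ℕ, Nonempty ((A ⧸ rad A) ≃ₐ[k] (Fin n → k))

/-- The class of `a` in `A / rad A`. -/
abbrev cls₁ {A : Type u} [Ring A] (a : A) : A ⧸ rad A := Ideal.Quotient.mk (rad A) a

/-- The space `rad A / rad² A`. -/
abbrev RadQuot (A : Type u) [Ring A] : Type u := rad A ⧸ (rad A * rad A).submoduleOf (rad A)

/-- The class of `r ∈ rad A` in `rad A / rad² A`. -/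
abbrev cls₂ {A : Type u} [Ring A] (r : rad A) : RadQuot A := Submodule.Quotient.mk r

/-- Quiver data for an algebra. The last field says
`δ₂ (δ₁ x · z · δ₁ y) = δ₁ x · δ₂ z · δ₁ y` for `z` the class of `r` in `rad A / rad² A`. -/
structure QuiverData (k A : Type u) [Field k] [Ring A] [Algebra k A] where
  δ₁ : (A ⧸ rad A) →ₗ[k] A
  δ₂ : RadQuot A →ₗ[k] rad A
  section₁ : ∀ x, cls₁ (δ₁ x) = x
  section₂ : ∀ z, cls₂ (δ₂ z) = z
  map_mul : ∀ x y, δ₁ (x * y) = δ₁ x * δ₁ y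
  equivariant : ∀ (x y : A ⧸ rad A) (r : rad A),
    (δ₂ (cls₂ ⟨δ₁ x * r * δ₁ y, Ideal.mul_mem_right _ _ (Ideal.mul_mem_left _ _ r.2)⟩) : A) =
      δ₁ x * (δ₂ (cls₂ r) : A) * δ₁ y

namespace QuiverData
variable {k A : Type u} [Field k] [Ring A] [Algebra k A] (d : QuiverData k A)

lemma δ₁_one : d.δ₁ 1 = 1 := by
  have hid : d.δ₁ 1 * d.δ₁ 1 = d.δ₁ 1 := by rw [← d.map_mul, one_mul]
  have hr : d.δ₁ 1 - 1 ∈ Ideal.jacobson (⊥ : Ideal A) := by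
    rw [Ideal.jacobson_bot, ← Ideal.Quotient.eq]
    exact (d.section₁ 1).trans (map_one _).symm
  obtain ⟨s, hs⟩ := Ideal.exists_mul_sub_mem_of_sub_one_mem_jacobson _ hr
  rw [Ideal.mem_bot, sub_eq_zero] at hs
  calc d.δ₁ 1 = s * d.δ₁ 1 * d.δ₁ 1 := by rw [hs, one_mul]
    _ = 1 := by rw [mul_assoc, hid, hs]

lemma sub_mem (a : A) : a - d.δ₁ (cls₁ a) ∈ rad A :=
  Ideal.Quotient.eq.1 (d.section₁ _).symm

lemma sub_mem₂ (r : rad A) : ((d.δ₂ (cls₂ r) : A) - r) ∈ rad A * rad A :=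
  (Submodule.Quotient.eq ((rad A * rad A).submoduleOf (rad A))).1 (d.section₂ (cls₂ r))

lemma cls₂_eq {r s : rad A} (h : (r - s : A) ∈ rad A * rad A) : cls₂ r = cls₂ s :=
  (Submodule.Quotient.eq ((rad A * rad A).submoduleOf (rad A))).2 h

lemma δ₂_left (x : A ⧸ rad A) (r : rad A) :
    (d.δ₂ (cls₂ ⟨d.δ₁ x * r, Ideal.mul_mem_left _ _ r.2⟩) : A) = d.δ₁ x * d.δ₂ (cls₂ r) := by
  have := d.equivariant x 1 r
  simpa only [δ₁_one, mul_one] using this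

lemma δ₂_right (x : A ⧸ rad A) (r : rad A) :
    (d.δ₂ (cls₂ ⟨r * d.δ₁ x, Ideal.mul_mem_right _ _ r.2⟩) : A) = d.δ₂ (cls₂ r) * d.δ₁ x := by
  have := d.equivariant 1 x r
  simpa only [δ₁_one, one_mul] using this

end QuiverData

namespace Bimodule
variable {k : Type u} [Field k] {A B C D : Bim k}

/-- The subspace `I P` of `M`, for an ideal `I` of `A` and a subspace `P` of `M`. -/
def lmul (M : Bimodule A B) (I : Ideal A) (P : Submodule k M) : Submodule k M :=
  Submodule.span k {x | ∃ r ∈ I, ∃ m ∈ P, x = r • m}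

/-- The subspace `P J` of `M`, for an ideal `J` of `B` and a subspace `P` of `M`. -/
def rmul (M : Bimodule A B) (J : Ideal B) (P : Submodule k M) : Submodule k M :=
  Submodule.span k {x | ∃ r ∈ J, ∃ m ∈ P, x = op r • m}

/-- The subspace `rad A · M` of `M`, written `rad M` if `M` is radically symmetric. -/
def radl (M : Bimodule A B) : Submodule k M := M.lmul (rad A) ⊤

/-- `M` is radically symmetric if `rad A · M = M · rad B`. -/
def IsRadicallySymmetric (M : Bimodule A B) : Prop := M.lmul (rad A) ⊤ = M.rmul (rad B) ⊤

/-- The subspace `rad² M = rad A · (rad A · M)` of `M`. -/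
def radl₂ (M : Bimodule A B) : Submodule k M := M.lmul (rad A) M.radl

/-- `M` is dualizable if it has a right and a left dual (adjoint) in the bicategory of
bimodules. -/
def IsDualizable (M : Bimodule A B) : Prop :=
  (∃ N : Bimodule B A, Nonempty (Bicategory.Adjunction (B := Bim k) (a := A) (b := B) M N)) ∧
  (∃ N : Bimodule B A, Nonempty (Bicategory.Adjunction (B := Bim k) (a := B) (b := A) N M))

section
variable {M : Bimodule A B} {I : Ideal A} {J : Ideal B} {P P' : Submodule k M}

lemma lmul_mem {r : A} {m : M} (hr : r ∈ I) (hm : m ∈ P) : r • m ∈ M.lmul I P :=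
  Submodule.subset_span ⟨r, hr, m, hm, rfl⟩

lemma rmul_mem {r : B} {m : M} (hr : r ∈ J) (hm : m ∈ P) : op r • m ∈ M.rmul J P :=
  Submodule.subset_span ⟨r, hr, m, hm, rfl⟩

lemma lmul_le {Q : Submodule k M} (h : ∀ r ∈ I, ∀ m ∈ P, r • m ∈ Q) : M.lmul I P ≤ Q := by
  rw [lmul, Submodule.span_le]
  rintro _ ⟨r, hr, m, hm, rfl⟩
  exact h r hr m hm

lemma rmul_le {Q : Submodule k M} (h : ∀ r ∈ J, ∀ m ∈ P, op r • m ∈ Q) : M.rmul J P ≤ Q := by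
  rw [rmul, Submodule.span_le]
  rintro _ ⟨r, hr, m, hm, rfl⟩
  exact h r hr m hm

/-- Left multiplication by `a`, as a linear map. -/
abbrev lm (M : Bimodule A B) (a : A) : M →ₗ[k] M := Algebra.lsmul k k M a
/-- Right multiplication by `b`, as a linear map. -/
abbrev rm (M : Bimodule A B) (b : B) : M →ₗ[k] M := Algebra.lsmul k k M (op b)

lemma smul_mem_lmul [I.IsTwoSided] {x : M} (a : A) (hx : x ∈ M.lmul I P) :
    a • x ∈ M.lmul I P := by
  have : M.lmul I P ≤ (M.lmul I P).comap (M.lm a) := lmul_le fun r hr m hm => by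
    simpa [smul_smul] using lmul_mem (Ideal.mul_mem_left _ a hr) hm
  exact this hx

lemma op_smul_mem_lmul {x : M} (b : B) (hP : ∀ m ∈ P, op b • m ∈ P)
    (hx : x ∈ M.lmul I P) : op b • x ∈ M.lmul I P := by
  have : M.lmul I P ≤ (M.lmul I P).comap (M.rm b) := lmul_le fun r hr m hm => by
    simpa [← smul_comm r (op b) m] using lmul_mem hr (hP m hm)
  exact this hx

lemma smul_mem_radl {x : M} (a : A) (hx : x ∈ M.radl) : a • x ∈ M.radl := smul_mem_lmul a hx
lemma op_smul_mem_radl {x : M} (b : B) (hx : x ∈ M.radl) : op b • x ∈ M.radl :=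
  op_smul_mem_lmul b (fun _ _ => trivial) hx
lemma smul_mem_radl₂ {x : M} (a : A) (hx : x ∈ M.radl₂) : a • x ∈ M.radl₂ := smul_mem_lmul a hx
lemma op_smul_mem_radl₂ {x : M} (b : B) (hx : x ∈ M.radl₂) : op b • x ∈ M.radl₂ :=
  op_smul_mem_lmul b (fun _ h => op_smul_mem_radl b h) hx

lemma rad_smul_mem {r : A} (hr : r ∈ rad A) (m : M) : r • m ∈ M.radl := lmul_mem hr trivial
lemma IsRadicallySymmetric.op_smul_mem (h : M.IsRadicallySymmetric) {r : B} (hr : r ∈ rad B)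
    (m : M) : op r • m ∈ M.radl := by
  rw [radl, h]; exact rmul_mem hr trivial

lemma lmul_rmul_comm (I : Ideal A) (J : Ideal B) (P : Submodule k M) :
    M.lmul I (M.rmul J P) = M.rmul J (M.lmul I P) := by
  apply le_antisymm
  · refine lmul_le fun r hr m hm => ?_
    have : M.rmul J P ≤ (M.rmul J (M.lmul I P)).comap (M.lm r) := rmul_le fun s hs m hm => by
      simpa [smul_comm r (op s) m] using rmul_mem hs (lmul_mem hr hm)
    exact this hm
  · refine rmul_le fun r hr m hm => ?_
    have : M.lmul I P ≤ (M.lmul I (M.rmul J P)).comap (M.rm r) := lmul_le fun s hs m hm => by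
      simpa [← smul_comm s (op r) m] using lmul_mem hs (rmul_mem hr hm)
    exact this hm

lemma IsRadicallySymmetric.radl₂_eq (h : M.IsRadicallySymmetric) :
    M.radl₂ = M.rmul (rad B) (M.rmul (rad B) ⊤) := by
  rw [radl₂, radl, ← h, ← lmul_rmul_comm, h]

lemma IsRadicallySymmetric.op_smul_mem₂ (h : M.IsRadicallySymmetric) {r : B} (hr : r ∈ rad B)
    {m : M} (hm : m ∈ M.radl) : op r • m ∈ M.radl₂ := by
  rw [h.radl₂_eq, ← h]; exact rmul_mem hr hm

lemma lin_mem_lmul {N : Bimodule A B} (f : M ⟶ N) {Q : Submodule k N}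
    (h : ∀ m ∈ P, lin f m ∈ Q) {x : M} (hx : x ∈ M.lmul I P) : lin f x ∈ N.lmul I Q := by
  have : M.lmul I P ≤ (N.lmul I Q).comap (lin f) := lmul_le fun r hr m hm => by
    simpa [lin_left] using lmul_mem hr (h m hm)
  exact this hx

end

section
variable {M : Bimodule A B} {N : Bimodule B C}

lemma lmul_tensor (I : Ideal A) (P : Submodule k M) (Q : Submodule k N) :
    (tensor M N).lmul I (Submodule.map₂ (tmₗ M N) P Q) =
      Submodule.map₂ (tmₗ M N) (M.lmul I P) Q := by
  apply le_antisymm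
  · refine lmul_le fun r hr t ht => ?_
    have : Submodule.map₂ (tmₗ M N) P Q ≤
        (Submodule.map₂ (tmₗ M N) (M.lmul I P) Q).comap ((tensor M N).lm r) :=
      Submodule.map₂_le.2 fun m hm n hn => by
        simpa [smul_tm_left] using Submodule.apply_mem_map₂ (tmₗ M N) (lmul_mem hr hm) hn
    exact this ht
  · refine Submodule.map₂_le.2 fun m hm n hn => ?_
    have : M.lmul I P ≤ ((tensor M N).lmul I (Submodule.map₂ (tmₗ M N) P Q)).comap
        ((tmₗ M N).flip n) := lmul_le fun r hr m hm => by
      simpa [smul_tm_left] using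
        lmul_mem (M := tensor M N) hr (Submodule.apply_mem_map₂ (tmₗ M N) hm hn)
    exact this hm

lemma rmul_tensor (I : Ideal C) (P : Submodule k M) (Q : Submodule k N) :
    (tensor M N).rmul I (Submodule.map₂ (tmₗ M N) P Q) =
      Submodule.map₂ (tmₗ M N) P (N.rmul I Q) := by
  apply le_antisymm
  · refine rmul_le fun r hr t ht => ?_
    have : Submodule.map₂ (tmₗ M N) P Q ≤
        (Submodule.map₂ (tmₗ M N) P (N.rmul I Q)).comap ((tensor M N).rm r) :=
      Submodule.map₂_le.2 fun m hm n hn => by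
        simpa [smul_tm_right] using Submodule.apply_mem_map₂ (tmₗ M N) hm (rmul_mem hr hn)
    exact this ht
  · refine Submodule.map₂_le.2 fun m hm n hn => ?_
    have : N.rmul I Q ≤ ((tensor M N).rmul I (Submodule.map₂ (tmₗ M N) P Q)).comap
        (tmₗ M N m) := rmul_le fun r hr n hn => by
      simpa [smul_tm_right] using
        rmul_mem (M := tensor M N) hr (Submodule.apply_mem_map₂ (tmₗ M N) hm hn)
    exact this hn

lemma map₂_rmul (J : Ideal B) (P : Submodule k M) (Q : Submodule k N) :
    Submodule.map₂ (tmₗ M N) (M.rmul J P) Q = Submodule.map₂ (tmₗ M N) P (N.lmul J Q) := by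
  apply le_antisymm
  · refine Submodule.map₂_le.2 fun m hm n hn => ?_
    have : M.rmul J P ≤ (Submodule.map₂ (tmₗ M N) P (N.lmul J Q)).comap ((tmₗ M N).flip n) :=
      rmul_le fun r hr m hm => by
        simpa [tm_balanced] using Submodule.apply_mem_map₂ (tmₗ M N) hm (lmul_mem hr hn)
    exact this hm
  · refine Submodule.map₂_le.2 fun m hm n hn => ?_
    have : N.lmul J Q ≤ (Submodule.map₂ (tmₗ M N) (M.rmul J P) Q).comap (tmₗ M N m) :=
      lmul_le fun r hr n hn => by
        simpa [tm_balanced] using Submodule.apply_mem_map₂ (tmₗ M N) (rmul_mem hr hm) hn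
    exact this hn

lemma map₂_top : Submodule.map₂ (tmₗ M N) ⊤ ⊤ = ⊤ := by
  refine top_unique fun t _ => ?_
  induction t using tm_induction with
  | h0 => exact zero_mem _
  | ht m n => exact Submodule.apply_mem_map₂ (tmₗ M N) trivial trivial
  | ha s t hs ht => exact add_mem (hs trivial) (ht trivial)

lemma radl_tensor : (tensor M N).radl = Submodule.map₂ (tmₗ M N) M.radl ⊤ := by
  rw [radl, ← map₂_top, lmul_tensor, radl]

lemma radl_tensor' (h : M.IsRadicallySymmetric) :
    (tensor M N).radl = Submodule.map₂ (tmₗ M N) ⊤ N.radl := by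
  rw [radl_tensor, radl, h, map₂_rmul]; rfl

lemma radl₂_tensor : (tensor M N).radl₂ = Submodule.map₂ (tmₗ M N) M.radl₂ ⊤ := by
  rw [radl₂, radl_tensor, lmul_tensor, radl₂]

lemma radl₂_tensor' (h : M.IsRadicallySymmetric) :
    (tensor M N).radl₂ = Submodule.map₂ (tmₗ M N) ⊤ N.radl₂ := by
  rw [radl₂_tensor, h.radl₂_eq, map₂_rmul, map₂_rmul]; rfl

lemma IsRadicallySymmetric.tensor (hM : M.IsRadicallySymmetric) (hN : N.IsRadicallySymmetric) :
    (tensor M N).IsRadicallySymmetric := by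
  have : (Bimodule.tensor M N).radl = (Bimodule.tensor M N).rmul (rad C) ⊤ := by
    rw [radl_tensor' hM, radl, hN, ← rmul_tensor, map₂_top]
  exact this

lemma IsRadicallySymmetric.mem_map₂ (hM : M.IsRadicallySymmetric) {m : M} {n : N}
    (hm : m ∈ M.radl) (hn : n ∈ N.radl) : tm m n ∈ (Bimodule.tensor M N).radl₂ := by
  have : M.rmul (rad B) ⊤ ≤ ((Bimodule.tensor M N).radl₂).comap ((tmₗ M N).flip n) :=
    rmul_le fun r hr m hm => by
      rw [radl₂_tensor' hM]
      have := Submodule.apply_mem_map₂ (tmₗ M N) (Submodule.mem_top (x := m)) (lmul_mem hr hn)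
      simpa only [Submodule.mem_comap, LinearMap.flip_apply, tmₗ_apply, tm_balanced, radl₂] using this
  exact this (hM ▸ hm)

end

lemma toUnit_mem_radl {a : A} : toUnit A a ∈ (unit A).radl ↔ a ∈ rad A := by
  constructor
  · intro h
    have : (unit A).radl ≤ ((rad A).restrictScalars k).comap (toUnit A).symm.toLinearMap :=
      lmul_le fun r hr m _ => Ideal.mul_mem_right ((toUnit A).symm m) (rad A) hr
    exact this h
  · intro h
    rw [toUnit_eq_smul']
    exact rad_smul_mem h _

lemma toUnit_mem_radl₂ {a : A} : toUnit A a ∈ (unit A).radl₂ ↔ a ∈ rad A * rad A := by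
  constructor
  · intro h
    have : (unit A).radl₂ ≤ ((rad A * rad A).restrictScalars k).comap (toUnit A).symm.toLinearMap :=
      lmul_le fun r hr m hm => by
        obtain ⟨b, hb⟩ := exists_toUnit m
        rw [hb, toUnit_mem_radl] at hm
        rw [hb, smul_toUnit]
        change r * b ∈ rad A * rad A
        exact Ideal.mul_mem_mul hr hm
    exact this h
  · intro h
    refine Submodule.smul_induction_on (p := fun a => toUnit A a ∈ (unit A).radl₂) h ?_ ?_
    · intro r hr s hs
      exact lmul_mem (m := toUnit A s) hr (toUnit_mem_radl.2 hs)
    · intro x y hx hy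
      rw [map_add]
      exact add_mem hx hy

lemma isRadicallySymmetric_unit (A : Bim k) : (unit A).IsRadicallySymmetric := by
  apply le_antisymm
  · refine lmul_le fun r hr m _ => ?_
    obtain ⟨b, hb⟩ := exists_toUnit m
    rw [hb, smul_toUnit, toUnit_eq_smul]
    exact rmul_mem (Ideal.mul_mem_right _ _ hr) trivial
  · refine rmul_le fun r hr m _ => ?_
    obtain ⟨b, hb⟩ := exists_toUnit m
    rw [hb, op_smul_toUnit, toUnit_eq_smul']
    exact lmul_mem (Ideal.mul_mem_left _ _ hr) trivial

lemma exists_tensor_sum {M : Bimodule A B} {N : Bimodule B C} (t : tensor M N) :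
    ∃ (n : ℕ) (x : Fin n → M) (y : Fin n → N), t = ∑ i, tm (x i) (y i) := by
  induction t using tm_induction with
  | h0 => exact ⟨0, Fin.elim0, Fin.elim0, by simp⟩
  | ht m n => exact ⟨1, fun _ => m, fun _ => n, by simp⟩
  | ha s t hs ht =>
    obtain ⟨n, x, y, rfl⟩ := hs
    obtain ⟨n', x', y', rfl⟩ := ht
    exact ⟨n + n', Fin.append x x', Fin.append y y', by simp [Fin.sum_univ_add]⟩

lemma leftZigzag_eq {X : Type*} [Bicategory X] {a b : X} {f : a ⟶ b} {g : b ⟶ a}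
    (co : 𝟙 a ⟶ f ≫ g) (ev : g ≫ f ⟶ 𝟙 b) :
    Bicategory.leftZigzag co ev = co ▷ f ≫ (α_ f g f).hom ≫ f ◁ ev := by
  rw [Bicategory.leftZigzag]
  bicategory

lemma exists_dual_basis_of_zigzag {M : Bimodule A B} {N : Bimodule B A}
    (co : unit A ⟶ tensor M N) (ev : tensor N M ⟶ unit B)
    (h : tensorMap co (𝟙 M) ≫ (assoc M N M).hom ≫ tensorMap (𝟙 M) ev =
      (leftUnit M).hom ≫ (rightUnit M).inv) :
    ∃ (n : ℕ) (x : Fin n → M) (φ : Fin n → M →ₗ[k] B),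
      (∀ i m b, φ i (op b • m) = φ i m * b) ∧ ∀ m, ∑ i, op (φ i m) • x i = m := by
  obtain ⟨n, x, y, hxy⟩ := exists_tensor_sum (lin co (toUnit A 1))
  refine ⟨n, x, fun i => (toUnit B).symm.toLinearMap ∘ₗ lin ev ∘ₗ tmₗ N M (y i), ?_, ?_⟩
  · intro i m b
    change lin ev (tm (y i) (op b • m)) = op b • lin ev (tm (y i) m)
    rw [← smul_tm_right, lin_right]
  · intro m
    have h1 := congrArg (fun f => lin (rightUnit M).hom (lin f (tm (toUnit A 1) m))) h
    simp only [lin_comp, tensorMap_tm, leftUnit_hom_tm, hxy, lin_id, rightUnit_inv_apply,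
      rightUnit_hom_tm, one_smul, op_one] at h1
    have h2 : (tm (∑ i, tm (x i) (y i)) m : tensor (tensor M N) M) =
        ∑ i, tm (tm (x i) (y i)) m :=
      map_sum ((tmₗ (tensor M N) M).flip m) _ _
    rw [h2] at h1
    simp only [map_sum, assoc_hom_tm, tensorMap_tm, lin_id] at h1
    refine Eq.trans ?_ h1
    refine Finset.sum_congr rfl fun i _ => ?_
    exact (rightUnit_hom_tm (x i) ((toUnit B).symm (lin ev (tm (y i) m)))).symm

lemma IsDualizable.exists_dual_basis {M : Bimodule A B} (h : M.IsDualizable) :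
    ∃ (n : ℕ) (x : Fin n → M) (φ : Fin n → M →ₗ[k] B),
      (∀ i m b, φ i (op b • m) = φ i m * b) ∧ ∀ m, ∑ i, op (φ i m) • x i = m := by
  obtain ⟨⟨N, ⟨adj⟩⟩, -⟩ := h
  refine exists_dual_basis_of_zigzag (N := N) adj.unit adj.counit ?_
  exact (leftZigzag_eq adj.unit adj.counit).symm.trans adj.left_triangle

lemma isDualizable_unit (A : Bim k) : (unit A).IsDualizable :=
  ⟨⟨unit A, ⟨Bicategory.Adjunction.id (B := Bim k) A⟩⟩,
    ⟨unit A, ⟨Bicategory.Adjunction.id (B := Bim k) A⟩⟩⟩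

lemma IsDualizable.tensor {M : Bimodule A B} {N : Bimodule B C} (hM : M.IsDualizable)
    (hN : N.IsDualizable) : (tensor M N).IsDualizable := by
  obtain ⟨⟨M₁, ⟨a₁⟩⟩, ⟨M₂, ⟨a₂⟩⟩⟩ := hM
  obtain ⟨⟨N₁, ⟨b₁⟩⟩, ⟨N₂, ⟨b₂⟩⟩⟩ := hN
  exact ⟨⟨_, ⟨a₁.comp b₁⟩⟩, ⟨_, ⟨b₂.comp a₂⟩⟩⟩

end Bimodule

/-! ### The bicategory `BSA` -/

/-- An object of `BSA`: a finite-dimensional basic algebra with quiver data. -/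
structure BSA (k : Type u) [Field k] where
  alg : Bim k
  basic : IsBasic k alg
  data : QuiverData k alg

namespace BSA
variable {k : Type u} [Field k]

/-- The space `rad M / rad² M`. -/
abbrev BimRadQuot {A B : Bim k} (M : Bimodule A B) : Type u :=
  M.radl ⧸ M.radl₂.submoduleOf M.radl

/-- The class of `m` in `M / rad M`. -/
abbrev bcls₁ {A B : Bim k} {M : Bimodule A B} (m : M) : M ⧸ M.radl := Submodule.Quotient.mk m

/-- The class of `w ∈ rad M` in `rad M / rad² M`. -/
abbrev bcls₂ {A B : Bim k} {M : Bimodule A B} (w : M.radl) : BimRadQuot M :=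
  Submodule.Quotient.mk w

/-- A 1-morphism of `BSA`: a dualizable radically symmetric bimodule with quiver data. -/
structure Hom (X Y : BSA k) where
  bim : Bimodule X.alg Y.alg
  symm : bim.IsRadicallySymmetric
  dualizable : bim.IsDualizable
  δ₁ : (bim ⧸ bim.radl) →ₗ[k] bim
  δ₂ : BimRadQuot bim →ₗ[k] bim.radl
  section₁ : ∀ u, bcls₁ (δ₁ u) = u
  section₂ : ∀ w, bcls₂ (δ₂ w) = w
  equivariant₁ : ∀ (x : X.alg ⧸ rad X.alg) (y : Y.alg ⧸ rad Y.alg) (m : bim),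
    δ₁ (bcls₁ (X.data.δ₁ x • op (Y.data.δ₁ y) • m)) =
      X.data.δ₁ x • op (Y.data.δ₁ y) • δ₁ (bcls₁ m)
  equivariant₂ : ∀ (x : X.alg ⧸ rad X.alg) (y : Y.alg ⧸ rad Y.alg) (w : bim.radl),
    (δ₂ (bcls₂ ⟨X.data.δ₁ x • op (Y.data.δ₁ y) • (w : bim),
      Bimodule.smul_mem_radl _ (Bimodule.op_smul_mem_radl _ w.2)⟩) : bim) =
      X.data.δ₁ x • op (Y.data.δ₁ y) • (δ₂ (bcls₂ w) : bim)
  compat_left : ∀ (r : rad X.alg) (m : bim),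
    (X.data.δ₂ (cls₂ r) : X.alg) • δ₁ (bcls₁ m) =
      δ₂ (bcls₂ ⟨(r : X.alg) • m, Bimodule.rad_smul_mem r.2 m⟩)
  compat_right : ∀ (r : rad Y.alg) (m : bim),
    op (Y.data.δ₂ (cls₂ r) : Y.alg) • δ₁ (bcls₁ m) =
      δ₂ (bcls₂ ⟨op (r : Y.alg) • m, symm.op_smul_mem r.2 m⟩)

namespace Hom
open Bimodule
variable {X Y Z : BSA k}

/-- A 2-morphism of `BSA`: an intertwiner `f` with `f ∘ δ₁ = δ₁ ∘ f̃`, where `f̃` is the map induced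
by `f` on the quotients by the radicals. -/
structure Hom₂ (M N : Hom X Y) where
  map : M.bim ⟶ N.bim
  compat : ∀ m : M.bim, lin map (M.δ₁ (bcls₁ m)) = N.δ₁ (bcls₁ (lin map m))

@[ext] lemma Hom₂.ext {M N : Hom X Y} {f g : Hom₂ M N} (h : f.map = g.map) : f = g := by
  cases f; cases g; cases h; rfl

instance : Category (Hom X Y) where
  Hom M N := Hom₂ M N
  id M := ⟨𝟙 M.bim, fun _ => rfl⟩
  comp f g := ⟨f.map ≫ g.map, fun m => by simp [f.compat, g.compat]⟩
  id_comp f := Hom₂.ext (Category.id_comp _)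
  comp_id f := Hom₂.ext (Category.comp_id _)
  assoc f g h := Hom₂.ext (Category.assoc _ _ _)

lemma hom₂_ext {M N : Hom X Y} {f g : M ⟶ N} (h : f.map = g.map) : f = g := Hom₂.ext h

/-- An isomorphism of bimodules compatible with the quiver data. -/
def mkIso {M N : Hom X Y} (e : M.bim ≅ N.bim)
    (h : ∀ m : M.bim, lin e.hom (M.δ₁ (bcls₁ m)) = N.δ₁ (bcls₁ (lin e.hom m))) : M ≅ N where
  hom := ⟨e.hom, h⟩
  inv := ⟨e.inv, fun n => by
    have h1 : ∀ x, lin e.hom (lin e.inv x) = x := fun x => by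
      rw [← lin_comp, e.inv_hom_id, lin_id]
    have h2 : ∀ x, lin e.inv (lin e.hom x) = x := fun x => by
      rw [← lin_comp, e.hom_inv_id, lin_id]
    have h3 := congrArg (lin e.inv) (h (lin e.inv n))
    rw [h2, h1] at h3
    exact h3.symm⟩
  hom_inv_id := hom₂_ext e.hom_inv_id
  inv_hom_id := hom₂_ext e.inv_hom_id

section
variable (M : Hom X Y)

/-- The composite `M → M / rad M → M` of the projection and `δ₁`. -/
def d₁ : M.bim →ₗ[k] M.bim := M.δ₁ ∘ₗ M.bim.radl.mkQ

/-- The composite `rad M → rad M / rad² M → rad M` of the projection and `δ₂`. -/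
def d₂ : M.bim.radl →ₗ[k] M.bim :=
  M.bim.radl.subtype ∘ₗ M.δ₂ ∘ₗ (M.bim.radl₂.submoduleOf M.bim.radl).mkQ

lemma d₁_apply (m : M.bim) : M.d₁ m = M.δ₁ (bcls₁ m) := rfl
lemma d₂_apply (w : M.bim.radl) : M.d₂ w = M.δ₂ (bcls₂ w) := rfl

lemma d₁_sub_mem (m : M.bim) : M.d₁ m - m ∈ M.bim.radl :=
  (Submodule.Quotient.eq _).1 (M.section₁ (bcls₁ m))

lemma d₁_eq_zero {m : M.bim} (h : m ∈ M.bim.radl) : M.d₁ m = 0 := by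
  rw [d₁_apply, bcls₁, (Submodule.Quotient.mk_eq_zero _).2 h, map_zero]

lemma d₂_mem (w : M.bim.radl) : M.d₂ w ∈ M.bim.radl := (M.δ₂ (bcls₂ w)).2

lemma d₂_sub_mem (w : M.bim.radl) : M.d₂ w - w ∈ M.bim.radl₂ :=
  (Submodule.Quotient.eq (M.bim.radl₂.submoduleOf M.bim.radl)).1 (M.section₂ (bcls₂ w))

lemma d₂_eq_zero {w : M.bim.radl} (h : (w : M.bim) ∈ M.bim.radl₂) : M.d₂ w = 0 := by
  rw [d₂_apply, bcls₂, (Submodule.Quotient.mk_eq_zero (M.bim.radl₂.submoduleOf M.bim.radl)).2 h,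
    map_zero]
  rfl

lemma d₁_left (x) (m : M.bim) : M.d₁ (X.data.δ₁ x • m) = X.data.δ₁ x • M.d₁ m := by
  have := M.equivariant₁ x 1 m
  simp only [QuiverData.δ₁_one, op_one, one_smul] at this
  exact this

lemma d₁_right (y) (m : M.bim) : M.d₁ (op (Y.data.δ₁ y) • m) = op (Y.data.δ₁ y) • M.d₁ m := by
  have := M.equivariant₁ 1 y m
  simp only [QuiverData.δ₁_one, one_smul] at this
  exact this

lemma d₁_smul (a : X.alg) (m : M.bim) : M.d₁ (a • m) = X.data.δ₁ (cls₁ a) • M.d₁ m := by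
  rw [← d₁_left, ← sub_eq_zero, ← map_sub, ← sub_smul]
  exact M.d₁_eq_zero (rad_smul_mem (X.data.sub_mem a) m)

lemma d₁_op_smul (b : Y.alg) (m : M.bim) :
    M.d₁ (op b • m) = op (Y.data.δ₁ (cls₁ b)) • M.d₁ m := by
  rw [← d₁_right, ← sub_eq_zero, ← map_sub, ← sub_smul, ← MulOpposite.op_sub]
  exact M.d₁_eq_zero (M.symm.op_smul_mem (Y.data.sub_mem b) m)

lemma d₂_left (x) (w : M.bim.radl) :
    M.d₂ ⟨X.data.δ₁ x • (w : M.bim), smul_mem_radl _ w.2⟩ = X.data.δ₁ x • M.d₂ w := by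
  have := M.equivariant₂ x 1 w
  simp only [QuiverData.δ₁_one, op_one, one_smul] at this
  exact this

lemma d₂_right (y) (w : M.bim.radl) :
    M.d₂ ⟨op (Y.data.δ₁ y) • (w : M.bim), op_smul_mem_radl _ w.2⟩ =
      op (Y.data.δ₁ y) • M.d₂ w := by
  have := M.equivariant₂ 1 y w
  simp only [QuiverData.δ₁_one, one_smul] at this
  exact this

lemma d₂_congr {v w : M.bim.radl} (h : (v - w : M.bim) ∈ M.bim.radl₂) : M.d₂ v = M.d₂ w := by
  rw [← sub_eq_zero, ← map_sub]
  exact M.d₂_eq_zero h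

lemma d₂_smul (a : X.alg) (w : M.bim.radl) :
    M.d₂ ⟨a • (w : M.bim), smul_mem_radl _ w.2⟩ = X.data.δ₁ (cls₁ a) • M.d₂ w := by
  rw [← d₂_left]
  refine M.d₂_congr ?_
  rw [← sub_smul]
  exact lmul_mem (X.data.sub_mem a) w.2

lemma compat_left' (r : rad X.alg) (m : M.bim) : (X.data.δ₂ (cls₂ r) : X.alg) • M.d₁ m =
    M.d₂ ⟨(r : X.alg) • m, rad_smul_mem r.2 m⟩ := M.compat_left r m

lemma compat_right' (r : rad Y.alg) (m : M.bim) : op (Y.data.δ₂ (cls₂ r) : Y.alg) • M.d₁ m =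
    M.d₂ ⟨op (r : Y.alg) • m, M.symm.op_smul_mem r.2 m⟩ := M.compat_right r m

end

/-- Construct a 1-morphism of `BSA` from the composites of `δ₁` and `δ₂` with the projections. -/
def ofMaps (M : Bimodule X.alg Y.alg) (hs : M.IsRadicallySymmetric) (hd : M.IsDualizable)
    (e₁ : M →ₗ[k] M) (e₂ : M.radl →ₗ[k] M)
    (h₁ : ∀ m ∈ M.radl, e₁ m = 0) (s₁ : ∀ m, e₁ m - m ∈ M.radl)
    (h₂ : ∀ w : M.radl, (w : M) ∈ M.radl₂ → e₂ w = 0) (s₂ : ∀ w, e₂ w - w ∈ M.radl₂)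
    (l₂ : M.radl₂ ≤ M.radl)
    (q₁ : ∀ x y m, e₁ (X.data.δ₁ x • op (Y.data.δ₁ y) • m) =
      X.data.δ₁ x • op (Y.data.δ₁ y) • e₁ m)
    (q₂ : ∀ x y (w : M.radl), e₂ ⟨X.data.δ₁ x • op (Y.data.δ₁ y) • (w : M),
      smul_mem_radl _ (op_smul_mem_radl _ w.2)⟩ = X.data.δ₁ x • op (Y.data.δ₁ y) • e₂ w)
    (cl : ∀ (r : rad X.alg) m, (X.data.δ₂ (cls₂ r) : X.alg) • e₁ m =
      e₂ ⟨(r : X.alg) • m, rad_smul_mem r.2 m⟩)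
    (cr : ∀ (r : rad Y.alg) m, op (Y.data.δ₂ (cls₂ r) : Y.alg) • e₁ m =
      e₂ ⟨op (r : Y.alg) • m, hs.op_smul_mem r.2 m⟩) : Hom X Y where
  bim := M
  symm := hs
  dualizable := hd
  δ₁ := M.radl.liftQ e₁ (fun m hm => h₁ m hm)
  δ₂ := (M.radl₂.submoduleOf M.radl).liftQ
    (e₂.codRestrict M.radl fun w => by simpa using add_mem (l₂ (s₂ w)) w.2)
    (fun w hw => Subtype.ext (h₂ w hw))
  section₁ u := by
    obtain ⟨m, rfl⟩ := Submodule.Quotient.mk_surjective _ u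
    exact (Submodule.Quotient.eq _).2 (s₁ m)
  section₂ w := by
    obtain ⟨m, rfl⟩ := Submodule.Quotient.mk_surjective _ w
    exact (Submodule.Quotient.eq (M.radl₂.submoduleOf M.radl)).2 (s₂ m)
  equivariant₁ := q₁
  equivariant₂ := q₂
  compat_left := cl
  compat_right := cr

lemma radl₂_le (M : Bimodule X.alg Y.alg) : M.radl₂ ≤ M.radl :=
  lmul_le fun _ hr m _ => rad_smul_mem hr m

/-- The identity 1-morphism: the regular bimodule with the quiver data of the algebra. -/
def unit (X : BSA k) : Hom X X :=
  ofMaps (Bimodule.unit X.alg) (isRadicallySymmetric_unit _) (isDualizable_unit _)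
    ((toUnit X.alg).toLinearMap ∘ₗ X.data.δ₁ ∘ₗ (Ideal.Quotient.mkₐ k (rad X.alg)).toLinearMap ∘ₗ
      (toUnit X.alg).symm.toLinearMap)
    { toFun := fun w => toUnit X.alg
        (X.data.δ₂ (cls₂ ⟨(toUnit X.alg).symm w, toUnit_mem_radl.1 w.2⟩) : X.alg)
      map_add' := fun v w => by
        rw [← map_add, ← Submodule.coe_add, ← map_add]; rfl
      map_smul' := fun c w => by
        rw [RingHom.id_apply, ← map_smul, ← Submodule.coe_smul_of_tower, ← map_smul]; rfl }
    (by
      intro m hm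
      obtain ⟨a, rfl⟩ := (toUnit X.alg).surjective m
      rw [toUnit_mem_radl] at hm
      have h : Ideal.Quotient.mk (rad X.alg) a = 0 := Ideal.Quotient.eq_zero_iff_mem.2 hm
      change toUnit X.alg (X.data.δ₁ (Ideal.Quotient.mk (rad X.alg) a)) = 0
      rw [h, map_zero, map_zero])
    (by
      intro m
      obtain ⟨a, rfl⟩ := (toUnit X.alg).surjective m
      change toUnit X.alg (X.data.δ₁ (cls₁ a)) - toUnit X.alg a ∈ _
      rw [← map_sub, toUnit_mem_radl]
      simpa using neg_mem (X.data.sub_mem a))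
    (by
      rintro ⟨m, hm⟩ hw
      obtain ⟨a, rfl⟩ := (toUnit X.alg).surjective m
      change toUnit X.alg a ∈ _ at hw
      rw [toUnit_mem_radl₂] at hw
      have h : cls₂ (⟨a, toUnit_mem_radl.1 hm⟩ : rad X.alg) = 0 :=
        (Submodule.Quotient.mk_eq_zero ((rad X.alg * rad X.alg).submoduleOf (rad X.alg))).2 hw
      change toUnit X.alg (X.data.δ₂ (cls₂ ⟨a, toUnit_mem_radl.1 hm⟩) : X.alg) = 0
      rw [h, map_zero, Submodule.coe_zero, map_zero])
    (by
      rintro ⟨m, hm⟩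
      obtain ⟨a, rfl⟩ := (toUnit X.alg).surjective m
      change toUnit X.alg (X.data.δ₂ (cls₂ ⟨a, toUnit_mem_radl.1 hm⟩) : X.alg) -
        toUnit X.alg a ∈ _
      rw [← map_sub, toUnit_mem_radl₂]
      exact X.data.sub_mem₂ ⟨a, toUnit_mem_radl.1 hm⟩)
    (radl₂_le _)
    (by
      intro x y m
      obtain ⟨a, rfl⟩ := (toUnit X.alg).surjective m
      change toUnit X.alg (X.data.δ₁ (cls₁ (X.data.δ₁ x * (a * X.data.δ₁ y)))) =
        toUnit X.alg (X.data.δ₁ x * (X.data.δ₁ (cls₁ a) * X.data.δ₁ y))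
      refine congrArg (toUnit X.alg) ?_
      have h : cls₁ (X.data.δ₁ x * (a * X.data.δ₁ y)) = x * (cls₁ a * y) := by
        rw [cls₁, map_mul, map_mul]
        exact congrArg₂ (· * ·) (X.data.section₁ x)
          (congrArg (cls₁ a * ·) (X.data.section₁ y))
      rw [h, X.data.map_mul, X.data.map_mul])
    (by
      rintro x y ⟨m, hm⟩
      obtain ⟨a, rfl⟩ := (toUnit X.alg).surjective m
      have ha := toUnit_mem_radl.1 hm
      have := X.data.equivariant x y ⟨a, ha⟩
      simp only [mul_assoc] at this
      exact congrArg (toUnit X.alg) this)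
    (by
      intro r m
      obtain ⟨a, rfl⟩ := (toUnit X.alg).surjective m
      refine congrArg (toUnit X.alg) (?_ : (X.data.δ₂ (cls₂ r) : X.alg) * X.data.δ₁ (cls₁ a) =
        X.data.δ₂ (cls₂ ⟨r * a, Ideal.mul_mem_right _ _ r.2⟩))
      rw [← QuiverData.δ₂_right]
      congr 2
      refine QuiverData.cls₂_eq ?_
      rw [← mul_sub, ← neg_sub, mul_neg]
      exact neg_mem (Ideal.mul_mem_mul r.2 (X.data.sub_mem a)))
    (by
      intro r m
      obtain ⟨a, rfl⟩ := (toUnit X.alg).surjective m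
      refine congrArg (toUnit X.alg) (?_ : X.data.δ₁ (cls₁ a) * (X.data.δ₂ (cls₂ r) : X.alg) =
        X.data.δ₂ (cls₂ ⟨a * r, Ideal.mul_mem_left _ _ r.2⟩))
      rw [← QuiverData.δ₂_left]
      congr 2
      refine QuiverData.cls₂_eq ?_
      rw [← sub_mul, ← neg_sub, neg_mul]
      exact neg_mem (Ideal.mul_mem_mul (X.data.sub_mem a) r.2))

section tensor
variable (M : Hom X Y) (N : Hom Y Z)

/-- The map `m ⊗ n ↦ δ₁ [m] ⊗ δ₁ [n]`. -/
def tensor₁ : tensor M.bim N.bim →ₗ[k] tensor M.bim N.bim :=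
  tlift ((tmₗ M.bim N.bim).compl₁₂ M.d₁ N.d₁) ⟨by
    intro m b n
    simp [d₁_smul, d₁_op_smul, tm_balanced]⟩

@[simp] lemma tensor₁_tm (m : M.bim) (n : N.bim) :
    tensor₁ M N (tm m n) = tm (M.d₁ m) (N.d₁ n) := by
  rw [tensor₁, tlift_tm]; rfl

lemma tm_mem_radl (m : M.bim) {n : N.bim} (hn : n ∈ N.bim.radl) :
    tm m n ∈ (tensor M.bim N.bim).radl := by
  rw [radl_tensor' M.symm]
  exact Submodule.apply_mem_map₂ (tmₗ M.bim N.bim) trivial hn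

lemma tm_mem_radl' {m : M.bim} (hm : m ∈ M.bim.radl) (n : N.bim) :
    tm m n ∈ (tensor M.bim N.bim).radl := by
  rw [radl_tensor]
  exact Submodule.apply_mem_map₂ (tmₗ M.bim N.bim) hm trivial

lemma radl_induction {P : Submodule k (tensor M.bim N.bim).radl}
    (h : ∀ m n (hn : n ∈ N.bim.radl), (⟨tm m n, tm_mem_radl M N m hn⟩ : (tensor _ _).radl) ∈ P)
    (w) : w ∈ P := by
  have : (tensor M.bim N.bim).radl ≤ P.map (tensor M.bim N.bim).radl.subtype := by
    conv_lhs => rw [radl_tensor' M.symm]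
    exact Submodule.map₂_le.2 fun m _ n hn => ⟨_, h m n hn, rfl⟩
  obtain ⟨v, hv, hvw⟩ := this w.2
  rwa [← Subtype.ext hvw]

/-- The map `m ⊗ n ↦ δ₁ [m] ⊗ δ₂ [n]` exists on `rad (M ⊗ N) = M ⊗ rad N`, because `M` is
projective as a right module. -/
lemma exists_tensor₂ : ∃ D : (tensor M.bim N.bim).radl →ₗ[k] tensor M.bim N.bim,
    ∀ m n (hn : n ∈ N.bim.radl),
      D ⟨tm m n, tm_mem_radl M N m hn⟩ = tm (M.d₁ m) (N.d₂ ⟨n, hn⟩) := by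
  obtain ⟨s, x, φ, hφ, hx⟩ := M.dualizable.exists_dual_basis
  let c : Fin s → tensor M.bim N.bim →ₗ[k] N.bim := fun i =>
    tlift ((Algebra.lsmul k k N.bim : Y.alg →ₐ[k] Module.End k N.bim).toLinearMap ∘ₗ φ i) ⟨by
      intro m b n
      simp [hφ]⟩
  have hc : ∀ i m n, c i (tm m n) = φ i m • n := fun i m n => by
    simp only [c, tlift_tm]; rfl
  have hr : ∀ i, ∀ t ∈ (tensor M.bim N.bim).radl, c i t ∈ N.bim.radl := by
    intro i t ht
    have : (tensor M.bim N.bim).radl ≤ N.bim.radl.comap (c i) := by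
      rw [radl_tensor' M.symm]
      exact Submodule.map₂_le.2 fun m _ n hn => by
        simpa [hc] using smul_mem_radl _ hn
    exact this ht
  refine ⟨∑ i, tmₗ M.bim N.bim (M.d₁ (x i)) ∘ₗ N.d₂ ∘ₗ (c i).restrict (hr i), ?_⟩
  intro m n hn
  have h1 : ∀ i, (c i).restrict (hr i) ⟨tm m n, tm_mem_radl M N m hn⟩ =
      ⟨φ i m • n, smul_mem_radl _ hn⟩ := fun i => Subtype.ext (hc i m n)
  simp only [LinearMap.sum_apply, LinearMap.comp_apply, h1, tmₗ_apply]
  have h2 : ∀ i, tm (M.d₁ (x i)) (N.d₂ ⟨φ i m • n, smul_mem_radl _ hn⟩) =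
      tm (M.d₁ (op (φ i m) • x i)) (N.d₂ ⟨n, hn⟩) := fun i => by
    rw [N.d₂_smul (φ i m) ⟨n, hn⟩, d₁_op_smul, tm_balanced]
  simp only [h2]
  conv_rhs => rw [← hx m, map_sum]
  exact (map_sum ((tmₗ M.bim N.bim).flip (N.d₂ ⟨n, hn⟩)) _ _).symm

/-- The map `m ⊗ n ↦ δ₁ [m] ⊗ δ₂ [n]` on `rad (M ⊗ N) = M ⊗ rad N`; it is determined by this
formula. -/
def tensor₂ : (tensor M.bim N.bim).radl →ₗ[k] tensor M.bim N.bim :=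
  Classical.choose (exists_tensor₂ M N)

lemma tensor₂_tm (m : M.bim) (n : N.bim) (hn : n ∈ N.bim.radl) :
    tensor₂ M N ⟨tm m n, tm_mem_radl M N m hn⟩ = tm (M.d₁ m) (N.d₂ ⟨n, hn⟩) :=
  Classical.choose_spec (exists_tensor₂ M N) m n hn

lemma tensor₂_tm_left (m : M.bim) (n : N.bim) (hm : m ∈ M.bim.radl) :
    tensor₂ M N ⟨tm m n, tm_mem_radl' M N hm n⟩ = tm (M.d₂ ⟨m, hm⟩) (N.d₁ n) := by
  let f : M.bim.radl →ₗ[k] tensor M.bim N.bim := tensor₂ M N ∘ₗ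
    (((tmₗ M.bim N.bim).flip n).restrict fun m hm => tm_mem_radl' M N hm n)
  let g : M.bim.radl →ₗ[k] tensor M.bim N.bim := (tmₗ M.bim N.bim).flip (N.d₁ n) ∘ₗ M.d₂
  have h : M.bim.radl ≤ (LinearMap.eqLocus f g).map M.bim.radl.subtype := by
    refine M.symm.le.trans (rmul_le fun b hb m _ => ?_)
    refine ⟨⟨op b • m, M.symm.op_smul_mem hb m⟩, ?_, rfl⟩
    change tensor₂ M N ⟨tm (op b • m) n, _⟩ = tm (M.d₂ ⟨op b • m, _⟩) (N.d₁ n)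
    simp only [tm_balanced]
    rw [tensor₂_tm M N m (b • n) (rad_smul_mem hb n), ← N.compat_left' ⟨b, hb⟩ n,
      ← M.compat_right' ⟨b, hb⟩ m, tm_balanced]
  obtain ⟨v, hv, hvm⟩ := h hm
  obtain rfl : v = ⟨m, hm⟩ := Subtype.ext hvm
  exact hv

/-- Composition of 1-morphisms: `M ⊗_B N` with `δ₁ [m ⊗ n] = δ₁ [m] ⊗ δ₁ [n]` and
`δ₂ [m ⊗ n] = δ₁ [m] ⊗ δ₂ [n]` for `n ∈ rad N`. -/
def comp : Hom X Z :=
  ofMaps (tensor M.bim N.bim) (M.symm.tensor N.symm) (M.dualizable.tensor N.dualizable)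
    (tensor₁ M N) (tensor₂ M N)
    (by
      have : (tensor M.bim N.bim).radl ≤ LinearMap.ker (tensor₁ M N) := by
        rw [radl_tensor' M.symm]
        exact Submodule.map₂_le.2 fun m _ n hn => by simp [N.d₁_eq_zero hn]
      exact fun m hm => this hm)
    (by
      intro t
      induction t using tm_induction with
      | h0 => simp
      | ht m n =>
        have h : tensor₁ M N (tm m n) - tm m n = tm (M.d₁ m - m) (N.d₁ n) + tm m (N.d₁ n - n) := by
          simp only [← tmₗ_apply, map_sub, LinearMap.sub_apply]
          simp
        rw [h]
        exact add_mem (tm_mem_radl' M N (M.d₁_sub_mem m) _) (tm_mem_radl M N _ (N.d₁_sub_mem n))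
      | ha s t hs ht => simpa [add_sub_add_comm] using add_mem hs ht)
    (by
      have : (tensor M.bim N.bim).radl₂ ≤
          (LinearMap.ker (tensor₂ M N)).map (tensor M.bim N.bim).radl.subtype := by
        rw [radl₂_tensor' M.symm]
        refine Submodule.map₂_le.2 fun m _ n hn =>
          ⟨⟨tm m n, tm_mem_radl M N m (radl₂_le _ hn)⟩, ?_, rfl⟩
        · change tensor₂ M N ⟨tm m n, tm_mem_radl M N m (radl₂_le _ hn)⟩ = 0
          rw [tensor₂_tm M N m n (radl₂_le _ hn), N.d₂_eq_zero hn, tm_zero]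
      intro w hw
      obtain ⟨v, hv, hvw⟩ := this hw
      rwa [← Subtype.ext hvw])
    (by
      intro w
      refine radl_induction M N (P := ((tensor M.bim N.bim).radl₂).comap
        (tensor₂ M N - (tensor M.bim N.bim).radl.subtype)) (fun m n hn => ?_) w
      change tensor₂ M N ⟨tm m n, tm_mem_radl M N m hn⟩ - tm m n ∈ (tensor M.bim N.bim).radl₂
      have h : tensor₂ M N ⟨tm m n, tm_mem_radl M N m hn⟩ - tm m n =
          tm (M.d₁ m - m) (N.d₂ ⟨n, hn⟩) + tm m (N.d₂ ⟨n, hn⟩ - n) := by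
        rw [tensor₂_tm M N m n hn]
        simp only [← tmₗ_apply, map_sub, LinearMap.sub_apply]
        simp
      rw [h]
      refine add_mem (M.symm.mem_map₂ (M.d₁_sub_mem m) (N.d₂_mem _)) ?_
      rw [radl₂_tensor' M.symm]
      exact Submodule.apply_mem_map₂ (tmₗ M.bim N.bim) trivial (N.d₂_sub_mem ⟨n, hn⟩))
    (radl₂_le _)
    (by
      intro x y t
      refine linearMap_ext (f := tensor₁ M N ∘ₗ lm _ (X.data.δ₁ x) ∘ₗ rm _ (Z.data.δ₁ y))
        (g := lm _ (X.data.δ₁ x) ∘ₗ rm _ (Z.data.δ₁ y) ∘ₗ tensor₁ M N) (fun m n => ?_) t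
      simp [smul_tm_left, smul_tm_right, d₁_left, d₁_right])
    (by
      intro x y w
      refine radl_induction M N (P := LinearMap.eqLocus
        (tensor₂ M N ∘ₗ ((lm _ (X.data.δ₁ x) ∘ₗ rm _ (Z.data.δ₁ y)).restrict
          fun t ht => smul_mem_radl _ (op_smul_mem_radl _ ht)))
        (lm _ (X.data.δ₁ x) ∘ₗ rm _ (Z.data.δ₁ y) ∘ₗ tensor₂ M N)) (fun m n hn => ?_) w
      change tensor₂ M N ⟨X.data.δ₁ x • op (Z.data.δ₁ y) • tm m n, _⟩ =
        X.data.δ₁ x • op (Z.data.δ₁ y) • tensor₂ M N ⟨tm m n, _⟩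
      simp only [smul_tm_left, smul_tm_right]
      rw [tensor₂_tm M N _ _ (op_smul_mem_radl _ hn), tensor₂_tm M N m n hn, d₁_left,
        N.d₂_right y ⟨n, hn⟩, smul_tm_right, smul_tm_left])
    (by
      intro r t
      refine linearMap_ext (f := lm _ (X.data.δ₂ (cls₂ r) : X.alg) ∘ₗ tensor₁ M N)
        (g := tensor₂ M N ∘ₗ (lm (tensor M.bim N.bim) (r : X.alg)).codRestrict _
          (fun t => rad_smul_mem r.2 t)) (fun m n => ?_) t
      change (X.data.δ₂ (cls₂ r) : X.alg) • tensor₁ M N (tm m n) =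
        tensor₂ M N ⟨(r : X.alg) • tm m n, rad_smul_mem r.2 _⟩
      simp only [smul_tm_left, tensor₁_tm]
      rw [tensor₂_tm_left M N _ _ (rad_smul_mem r.2 m), M.compat_left'])
    (by
      intro r t
      refine linearMap_ext (f := rm _ (Z.data.δ₂ (cls₂ r) : Z.alg) ∘ₗ tensor₁ M N)
        (g := tensor₂ M N ∘ₗ (rm (tensor M.bim N.bim) (r : Z.alg)).codRestrict _
          (fun t => (M.symm.tensor N.symm).op_smul_mem r.2 t)) (fun m n => ?_) t
      change op (Z.data.δ₂ (cls₂ r) : Z.alg) • tensor₁ M N (tm m n) =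
        tensor₂ M N ⟨op (r : Z.alg) • tm m n, (M.symm.tensor N.symm).op_smul_mem r.2 _⟩
      simp only [smul_tm_right, tensor₁_tm]
      rw [tensor₂_tm M N _ _ (N.symm.op_smul_mem r.2 n), N.compat_right'])

lemma comp_d₁ (m : M.bim) (n : N.bim) :
    (comp M N).δ₁ (bcls₁ (M := tensor M.bim N.bim) (tm m n)) =
      tm (M := M.bim) (N := N.bim) (M.δ₁ (bcls₁ m)) (N.δ₁ (bcls₁ n)) :=
  tensor₁_tm M N m n

end tensor

lemma unit_d₁ (X : BSA k) (a : X.alg) : (unit X).δ₁ (bcls₁ (M := Bimodule.unit X.alg)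
    (toUnit X.alg a)) = toUnit X.alg (X.data.δ₁ (cls₁ a)) := rfl

variable {W : BSA k}

/-- Horizontal composition of 2-morphisms. -/
def comp₂ {M M' : Hom X Y} {N N' : Hom Y Z} (f : M ⟶ M') (g : N ⟶ N') :
    comp M N ⟶ comp M' N' where
  map := tensorMap f.map g.map
  compat t := by
    refine linearMap_ext (f := lin (tensorMap f.map g.map) ∘ₗ tensor₁ M N)
      (g := tensor₁ M' N' ∘ₗ lin (tensorMap f.map g.map)) (fun m n => ?_) t
    simp [d₁_apply, f.compat, g.compat]

/-- The associator. -/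
def associator (M : Hom X Y) (N : Hom Y Z) (P : Hom Z W) :
    comp (comp M N) P ≅ comp M (comp N P) :=
  mkIso (assoc M.bim N.bim P.bim) (fun t => by
    refine linearMap_ext₁
      (f := lin (assoc M.bim N.bim P.bim).hom ∘ₗ tensor₁ (comp M N) P)
      (g := tensor₁ M (comp N P) ∘ₗ lin (assoc M.bim N.bim P.bim).hom) (fun m n p => ?_) t
    have h1 : tensor₁ (comp M N) P (tm (M := (comp M N).bim) (tmul m n) p) =
        tm (M := tensor M.bim N.bim) (tm (M.d₁ m) (N.d₁ n)) (P.d₁ p) :=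
      (tensor₁_tm (comp M N) P (tm (M := M.bim) (N := N.bim) m n) p).trans
        (congrArg (fun x => tm (M := (comp M N).bim) x (P.d₁ p)) (comp_d₁ M N m n))
    have h2 : tensor₁ M (comp N P) (tm (N := (comp N P).bim) m (tmul n p)) =
        tm (N := tensor N.bim P.bim) (M.d₁ m) (tm (N.d₁ n) (P.d₁ p)) :=
      (tensor₁_tm M (comp N P) m (tm (M := N.bim) (N := P.bim) n p)).trans
        (congrArg (fun x => tm (N := (comp N P).bim) (M.d₁ m) x) (comp_d₁ N P n p))
    exact (congrArg (lin (assoc M.bim N.bim P.bim).hom) h1).trans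
      ((assoc_hom_tm _ _ _).trans (h2.symm.trans
        (congrArg (tensor₁ M (comp N P)) (assoc_hom_tm m n p).symm))))

/-- The left unitor. -/
def leftUnitor (M : Hom X Y) : comp (unit X) M ≅ M :=
  mkIso (leftUnit M.bim) (fun t => by
    refine linearMap_ext (f := lin (leftUnit M.bim).hom ∘ₗ tensor₁ (unit X) M)
      (g := M.d₁ ∘ₗ lin (leftUnit M.bim).hom) (fun x m => ?_) t
    obtain ⟨a, hx⟩ := exists_toUnit x
    rw [hx]
    change lin (leftUnit M.bim).hom (tensor₁ (unit X) M
      (tm (M := Bimodule.unit X.alg) (toUnit X.alg a) m)) =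
        M.d₁ (lin (leftUnit M.bim).hom (tm (toUnit X.alg a) m))
    rw [leftUnit_hom_tm, d₁_smul]
    exact (congrArg (lin (leftUnit M.bim).hom) (tensor₁_tm (unit X) M _ _)).trans
      (leftUnit_hom_tm _ _))

/-- The right unitor. -/
def rightUnitor (M : Hom X Y) : comp M (unit Y) ≅ M :=
  mkIso (rightUnit M.bim) (fun t => by
    refine linearMap_ext (f := lin (rightUnit M.bim).hom ∘ₗ tensor₁ M (unit Y))
      (g := M.d₁ ∘ₗ lin (rightUnit M.bim).hom) (fun m x => ?_) t
    obtain ⟨a, hx⟩ := exists_toUnit x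
    rw [hx]
    change lin (rightUnit M.bim).hom (tensor₁ M (unit Y)
      (tm (N := Bimodule.unit Y.alg) m (toUnit Y.alg a))) =
        M.d₁ (lin (rightUnit M.bim).hom (tm m (toUnit Y.alg a)))
    rw [rightUnit_hom_tm, d₁_op_smul]
    exact (congrArg (lin (rightUnit M.bim).hom) (tensor₁_tm M (unit Y) _ _)).trans
      (rightUnit_hom_tm _ _))

end Hom

open Bimodule Hom in
/-- The bicategory of finite-dimensional basic algebras with quiver data, dualizable radically
symmetric bimodules with quiver data, and compatible intertwiners. -/
instance bicategory : Bicategory (BSA k) where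
  Hom X Y := Hom X Y
  id X := Hom.unit X
  comp M N := Hom.comp M N
  homCategory X Y := inferInstanceAs (Category (Hom X Y))
  whiskerLeft M _ _ g := comp₂ (𝟙 M) g
  whiskerRight f N := comp₂ f (𝟙 N)
  associator M N P := Hom.associator M N P
  leftUnitor M := Hom.leftUnitor M
  rightUnitor M := Hom.rightUnitor M
  whiskerLeft_id M N := hom₂_ext (Bicategory.whiskerLeft_id (B := Bim k) M.bim N.bim)
  whiskerLeft_comp M _ _ _ g g' :=
    hom₂_ext (Bicategory.whiskerLeft_comp (B := Bim k) M.bim g.map g'.map)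
  id_whiskerLeft f := hom₂_ext (Bicategory.id_whiskerLeft (B := Bim k) f.map)
  comp_whiskerLeft M N _ _ h :=
    hom₂_ext (Bicategory.comp_whiskerLeft (B := Bim k) M.bim N.bim h.map)
  id_whiskerRight M N := hom₂_ext (Bicategory.id_whiskerRight (B := Bim k) M.bim N.bim)
  comp_whiskerRight f f' N :=
    hom₂_ext (Bicategory.comp_whiskerRight (B := Bim k) f.map f'.map N.bim)
  whiskerRight_id f := hom₂_ext (Bicategory.whiskerRight_id (B := Bim k) f.map)
  whiskerRight_comp f N P :=
    hom₂_ext (Bicategory.whiskerRight_comp (B := Bim k) f.map N.bim P.bim)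
  whisker_assoc M _ _ g P :=
    hom₂_ext (Bicategory.whisker_assoc (B := Bim k) M.bim g.map P.bim)
  whisker_exchange f g := hom₂_ext (Bicategory.whisker_exchange (B := Bim k) f.map g.map)
  pentagon M N P Q := hom₂_ext (Bicategory.pentagon (B := Bim k) M.bim N.bim P.bim Q.bim)
  triangle M N := hom₂_ext (Bicategory.triangle (B := Bim k) M.bim N.bim)

end BSA

/-! ### Quivers, path algebras and connections -/

/-- A quiver: an oriented multigraph with finitely many vertices and edges. -/
structure FinQuiver where
  V : Type u
  [quiver : Quiver.{u} V]
  [finV : Finite V]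
  [finE : ∀ a b : V, Finite (a ⟶ b)]

namespace FinQuiver
instance : CoeSort FinQuiver.{u} (Type u) := ⟨FinQuiver.V⟩
instance (Q : FinQuiver.{u}) : Quiver.{u} Q := Q.quiver
instance (Q : FinQuiver.{u}) : Finite Q := Q.finV
instance (Q : FinQuiver.{u}) (a b : Q) : Finite (a ⟶ b) := Q.finE a b
instance (Q : FinQuiver.{u}) : Fintype Q := Fintype.ofFinite Q
instance (Q : FinQuiver.{u}) : DecidableEq Q := Classical.decEq Q
instance (Q : FinQuiver.{u}) (a b : Q) : Fintype (a ⟶ b) := Fintype.ofFinite _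
instance (Q : FinQuiver.{u}) (a b : Q) : DecidableEq (a ⟶ b) := Classical.decEq _
/-- The edges out of `a`. -/
abbrev Out (Q : FinQuiver.{u}) (a : Q) : Type u := Σ b : Q, (a ⟶ b)
/-- The edges into `b`. -/
abbrev In (Q : FinQuiver.{u}) (b : Q) : Type u := Σ a : Q, (a ⟶ b)
instance (Q : FinQuiver.{u}) (a : Q) : DecidableEq (Q.Out a) := Classical.decEq _
instance (Q : FinQuiver.{u}) (a : Q) : DecidableEq (Q.In a) := Classical.decEq _
end FinQuiver

open Quiver (Path)

/-- The path algebra `kQ`: an element assigns to each pair of vertices `a, b` a finite linear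
combination of paths from `a` to `b`. -/
def PathAlgebra (k : Type u) [Field k] (Q : FinQuiver.{u}) : Type u :=
  ∀ a b : Q, Path a b →₀ k

namespace PathAlgebra
variable {k : Type u} [Field k] {Q : FinQuiver.{u}}

instance : AddCommGroup (PathAlgebra k Q) := inferInstanceAs (AddCommGroup (∀ a b : Q, Path a b →₀ k))
instance : Module k (PathAlgebra k Q) := inferInstanceAs (Module k (∀ a b : Q, Path a b →₀ k))

/-- Concatenation of linear combinations of paths. -/
def concat (a b c : Q) : (Path a b →₀ k) →ₗ[k] (Path b c →₀ k) →ₗ[k] (Path a c →₀ k) :=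
  Finsupp.lsum k fun p => LinearMap.toSpanSingleton k _ (Finsupp.lmapDomain k k fun q => p.comp q)

@[simp] lemma concat_single {a b c : Q} (p : Path a b) (q : Path b c) (r s : k) :
    concat a b c (Finsupp.single p r) (Finsupp.single q s) =
      Finsupp.single (p.comp q) (r * s) := by
  simp [concat]

lemma concat_assoc {a b c d : Q} (x : Path a b →₀ k) (y : Path b c →₀ k) (z : Path c d →₀ k) :
    concat a c d (concat a b c x y) z = concat a b d x (concat b c d y z) := by
  induction x using Finsupp.induction_linear with
  | zero => simp
  | add x x' hx hx' => simp [hx, hx']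
  | single p r =>
    induction y using Finsupp.induction_linear with
    | zero => simp
    | add y y' hy hy' => simp [hy, hy']
    | single q s =>
      induction z using Finsupp.induction_linear with
      | zero => simp
      | add z z' hz hz' => rw [map_add, map_add, map_add, hz, hz']
      | single t u => simp [mul_assoc, -Finsupp.single_mul]

@[simp] lemma nil_concat {a b : Q} (x : Path a b →₀ k) :
    concat a a b (Finsupp.single Path.nil 1) x = x := by
  induction x using Finsupp.induction_linear with
  | zero => simp
  | add y y' hy hy' => simp [hy, hy']
  | single q s => simp

@[simp] lemma concat_nil {a b : Q} (x : Path a b →₀ k) :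
    concat a b b x (Finsupp.single Path.nil 1) = x := by
  induction x using Finsupp.induction_linear with
  | zero => simp
  | add y y' hy hy' => simp [hy, hy']
  | single q s => simp

instance : Mul (PathAlgebra k Q) := ⟨fun x y a c => ∑ b, concat a b c (x a b) (y b c)⟩
instance : One (PathAlgebra k Q) := ⟨fun a => Pi.single a (Finsupp.single Path.nil 1)⟩

lemma mul_apply (x y : PathAlgebra k Q) (a c : Q) :
    (x * y) a c = ∑ b, concat a b c (x a b) (y b c) := rfl
lemma one_apply (a : Q) :
    (1 : PathAlgebra k Q) a = Pi.single a (Finsupp.single Path.nil 1) := rfl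
@[simp] lemma add_apply (x y : PathAlgebra k Q) (a b : Q) : (x + y) a b = x a b + y a b := rfl
@[simp] lemma zero_apply (a b : Q) : (0 : PathAlgebra k Q) a b = 0 := rfl
@[simp] lemma smul_apply (r : k) (x : PathAlgebra k Q) (a b : Q) : (r • x) a b = r • x a b := rfl

@[ext] lemma ext {x y : PathAlgebra k Q} (h : ∀ a b, x a b = y a b) : x = y :=
  funext fun a => funext fun b => h a b

instance : Ring (PathAlgebra k Q) :=
  { (inferInstance : AddCommGroup (PathAlgebra k Q)) with
    mul := (· * ·)
    one := 1
    mul_assoc := fun x y z => by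
      ext1 a d
      simp only [mul_apply, map_sum, LinearMap.sum_apply, concat_assoc]
      exact Finset.sum_comm
    one_mul := fun x => by
      ext1 a c
      rw [mul_apply, Finset.sum_eq_single a]
      · rw [one_apply, Pi.single_eq_same, nil_concat]
      · intro b _ hb
        rw [one_apply, Pi.single_eq_of_ne hb, map_zero, LinearMap.zero_apply]
      · simp
    mul_one := fun x => by
      ext1 a c
      rw [mul_apply, Finset.sum_eq_single c]
      · rw [one_apply, Pi.single_eq_same, concat_nil]
      · intro b _ hb
        rw [one_apply, Pi.single_eq_of_ne hb.symm, map_zero]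
      · simp
    left_distrib := fun x y z => by
      ext1 a c
      simp [mul_apply, Finset.sum_add_distrib]
    right_distrib := fun x y z => by
      ext1 a c
      simp [mul_apply, Finset.sum_add_distrib]
    zero_mul := fun x => by
      ext1 a c
      simp [mul_apply]
    mul_zero := fun x => by
      ext1 a c
      simp [mul_apply] }

instance : Algebra k (PathAlgebra k Q) :=
  Algebra.ofModule
    (fun r x y => by
      ext1 a c
      simp [mul_apply, Finset.smul_sum])
    (fun r x y => by
      ext1 a c
      simp [mul_apply, Finset.smul_sum])

/-- A linear combination of paths from `a` to `b`, as an element of the path algebra. -/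
def of (a b : Q) : (Path a b →₀ k) →ₗ[k] PathAlgebra k Q :=
  LinearMap.single k (fun a : Q => ∀ b : Q, Path a b →₀ k) a ∘ₗ
    LinearMap.single k (fun b : Q => Path a b →₀ k) b

/-- A path, as an element of the path algebra. -/
def path {a b : Q} (p : Path a b) : PathAlgebra k Q := of a b (Finsupp.single p 1)

end PathAlgebra

/-- An ideal `I` of `kQ` is admissible if it lies in the span of the paths of length at least `2`
and contains all paths of length at least `n`, for some `n`. -/
structure IsAdmissible {k : Type u} [Field k] {Q : FinQuiver.{u}} (I : Ideal (PathAlgebra k Q)) :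
    Prop where
  twoSided : I.IsTwoSided
  two_le_length : ∀ x ∈ I, ∀ (a b : Q) (p : Path a b), x a b p ≠ 0 → 2 ≤ p.length
  exists_length : ∃ n : ℕ, ∀ (a b : Q) (p : Path a b), n ≤ p.length → PathAlgebra.path p ∈ I

/-- A connection between the quivers `G` and `H`: finite-dimensional vector spaces `Γ g h` and
isomorphisms `U g h : ⨁_{g'} E_{g,g'} ⊗ Γ g' h ≃ ⨁_{h'} Γ g h' ⊗ E_{h',h}`. As `E_{g,g'}` is the vector
space with basis the edges `g ⟶ g'`, the left hand side is the direct sum of the spaces `Γ g' h`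
over all edges `g ⟶ g'` out of `g`, and the right hand side is the direct sum of the spaces
`Γ g h'` over all edges `h' ⟶ h` into `h`. -/
structure Connection (k : Type u) [Field k] (G H : FinQuiver.{u}) where
  Γ : G → H → Type u
  [addCommGroup : ∀ g h, AddCommGroup (Γ g h)]
  [module : ∀ g h, Module k (Γ g h)]
  [finite : ∀ g h, Module.Finite k (Γ g h)]
  U : ∀ g h, (∀ e : G.Out g, Γ e.1 h) ≃ₗ[k] (∀ e : H.In h, Γ g e.1)

namespace Connection
variable {k : Type u} [Field k] {G H K L : FinQuiver.{u}}

instance (c : Connection k G H) (g h) : AddCommGroup (c.Γ g h) := c.addCommGroup g h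
instance (c : Connection k G H) (g h) : Module k (c.Γ g h) := c.module g h
instance (c : Connection k G H) (g h) : Module.Finite k (c.Γ g h) := c.finite g h

/-- The component `Γ g' h → Γ g h'` of `U g h` at the edges `e : g ⟶ g'` and `e' : h' ⟶ h`. -/
def cell (c : Connection k G H) {g g' : G} {h' h : H} (e : g ⟶ g') (e' : h' ⟶ h) :
    c.Γ g' h →ₗ[k] c.Γ g h' :=
  LinearMap.proj (φ := fun e : H.In h => c.Γ g e.1) ⟨h', e'⟩ ∘ₗ (c.U g h).toLinearMap ∘ₗ
    LinearMap.single k (fun e : G.Out g => c.Γ e.1 h) ⟨g', e⟩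

/-- A morphism of connections: linear maps `f g h : Γ g h → Δ g h` with
`V ∘ (id ⊗ f) = (f ⊗ id) ∘ U`. -/
@[ext]
structure Hom (c d : Connection k G H) where
  map : ∀ g h, c.Γ g h →ₗ[k] d.Γ g h
  comm : ∀ {g g' : G} {h' h : H} (e : g ⟶ g') (e' : h' ⟶ h) (x : c.Γ g' h),
    d.cell e e' (map g' h x) = map g h' (c.cell e e' x)

instance : Category (Connection k G H) where
  Hom c d := Hom c d
  id c := ⟨fun _ _ => LinearMap.id, fun _ _ _ => rfl⟩
  comp f f' := ⟨fun g h => f'.map g h ∘ₗ f.map g h, fun e e' x => by simp [f.comm, f'.comm]⟩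

/-- The linear maps underlying a morphism of connections. -/
def app {c d : Connection k G H} (f : c ⟶ d) (g : G) (h : H) : c.Γ g h →ₗ[k] d.Γ g h :=
  Hom.map f g h

lemma app_comm {c d : Connection k G H} (f : c ⟶ d) {g g' : G} {h' h : H} (e : g ⟶ g')
    (e' : h' ⟶ h) (x : c.Γ g' h) : d.cell e e' (app f g' h x) = app f g h' (c.cell e e' x) :=
  Hom.comm f e e' x

lemma hom_ext {c d : Connection k G H} {f f' : c ⟶ d} (h : ∀ g h x, app f g h x = app f' g h x) :
    f = f' := Hom.ext (funext fun _ => funext fun _ => LinearMap.ext fun x => h _ _ x)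

@[simp] lemma app_id (c : Connection k G H) (g h) (x : c.Γ g h) : app (𝟙 c) g h x = x := rfl
@[simp] lemma app_comp {c d e : Connection k G H} (f : c ⟶ d) (f' : d ⟶ e) (g h) (x : c.Γ g h) :
    app (f ≫ f') g h x = app f' g h (app f g h x) := rfl

end Connection
namespace Connection
variable {k : Type u} [Field k] {G H K L : FinQuiver.{u}}

/-- The identity connection: `Γ g h` is `k` if `g = h` and `0` otherwise, and `U` is the canonical
isomorphism `E_{g,h} ⊗ k ≃ k ⊗ E_{g,h}`. -/
def one (G : FinQuiver.{u}) : Connection k G G where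
  Γ g h := PLift (g = h) → k
  U g h :=
    { toFun := fun x e p => x ⟨h, e.2.cast p.down.symm rfl⟩ ⟨rfl⟩
      invFun := fun y e p => y ⟨g, e.2.cast rfl p.down⟩ ⟨rfl⟩
      map_add' := fun _ _ => rfl
      map_smul' := fun _ _ => rfl
      left_inv := fun x => by
        funext ⟨g', e⟩ ⟨p⟩
        subst p
        rfl
      right_inv := fun x => by
        funext ⟨g', e⟩ ⟨(p : g = g')⟩
        subst p
        rfl }

/-- The basis vector of the space `k` attached to a vertex by the identity connection. -/
def gen (g : G) : (one (k := k) G).Γ g g := fun _ => (1 : k)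

lemma one_cell_gen {g g' h' : G} (e : g ⟶ g') (e' : h' ⟶ g') (p : PLift (g = h')) :
    (one (k := k) G).cell e e' (gen g') p = if e = e'.cast p.down.symm rfl then (1 : k) else 0 := by
  obtain ⟨p⟩ := p
  subst p
  change Pi.single (M := fun e : G.Out g => (one (k := k) G).Γ e.1 g') ⟨g', e⟩ (gen g')
    ⟨g', e'⟩ ⟨rfl⟩ = _
  rw [Quiver.Hom.cast_rfl_rfl]
  split_ifs with he
  · subst he
    rw [Pi.single_eq_same]
    rfl
  · rw [Pi.single_eq_of_ne]
    · rfl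
    · intro h
      cases h
      exact he rfl

variable (c : Connection k G H) (d : Connection k H K)

/-- Exchange of the factors of a double product. -/
def piSwap {ι κ : Type*} (X : ι → κ → Type*) [∀ i j, AddCommGroup (X i j)]
    [∀ i j, Module k (X i j)] : (∀ i j, X i j) ≃ₗ[k] ∀ j i, X i j where
  toFun x j i := x i j
  invFun x i j := x j i
  map_add' _ _ := rfl
  map_smul' _ _ := rfl
  left_inv _ := rfl
  right_inv _ := rfl

/-- `U ⊗ id`. -/
def compU₁ (g : G) (l : K) : (∀ e : G.Out g, ∀ h, c.Γ e.1 h ⊗[k] d.Γ h l) ≃ₗ[k]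
    ∀ h, ∀ e : H.In h, c.Γ g e.1 ⊗[k] d.Γ h l :=
  piSwap (fun (e : G.Out g) h => c.Γ e.1 h ⊗[k] d.Γ h l) ≪≫ₗ
  LinearEquiv.piCongrRight fun h =>
    ((LinearEquiv.piCongrRight fun _ => TensorProduct.comm k _ _) ≪≫ₗ
      (TensorProduct.piRight k k (d.Γ h l) fun e : G.Out g => c.Γ e.1 h).symm ≪≫ₗ
      (c.U g h).lTensor (d.Γ h l) ≪≫ₗ
      (TensorProduct.piRight k k (d.Γ h l) fun e : H.In h => c.Γ g e.1) ≪≫ₗ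
      (LinearEquiv.piCongrRight fun _ => TensorProduct.comm k _ _))

/-- `id ⊗ V`. -/
def compU₂ (g : G) (l : K) : (∀ h, ∀ e : H.Out h, c.Γ g h ⊗[k] d.Γ e.1 l) ≃ₗ[k]
    ∀ e : K.In l, ∀ h, c.Γ g h ⊗[k] d.Γ h e.1 :=
  (LinearEquiv.piCongrRight fun h =>
    ((TensorProduct.piRight k k (c.Γ g h) fun e : H.Out h => d.Γ e.1 l).symm ≪≫ₗ
      (d.U h l).lTensor (c.Γ g h) ≪≫ₗ
      (TensorProduct.piRight k k (c.Γ g h) fun e : K.In l => d.Γ h e.1))) ≪≫ₗ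
  piSwap (fun h (e : K.In l) => c.Γ g h ⊗[k] d.Γ h e.1)

/-- The canonical identification of the target of `U ⊗ id` with the source of `id ⊗ V`. -/
def swapU (g : G) (l : K) : (∀ h, ∀ e : H.In h, c.Γ g e.1 ⊗[k] d.Γ h l) ≃ₗ[k]
    (∀ h, ∀ e : H.Out h, c.Γ g h ⊗[k] d.Γ e.1 l) where
  toFun x h e := x e.1 ⟨h, e.2⟩
  invFun x h e := x e.1 ⟨h, e.2⟩
  map_add' _ _ := rfl
  map_smul' _ _ := rfl
  left_inv _ := rfl
  right_inv _ := rfl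

/-- The composite of connections: `(Γ ⊗ Δ) g l = ⨁_h Γ g h ⊗ Δ h l`, with isomorphism
`(id ⊗ V) ∘ (U ⊗ id)`. -/
def comp : Connection k G K where
  Γ g l := ∀ h, c.Γ g h ⊗[k] d.Γ h l
  U g l := compU₁ c d g l ≪≫ₗ swapU c d g l ≪≫ₗ compU₂ c d g l

/-- The tensor `γ ⊗ δ` in the composite connection. -/
def inj {g : G} {h : H} {l : K} : c.Γ g h →ₗ[k] d.Γ h l →ₗ[k] (comp c d).Γ g l :=
  (TensorProduct.mk k _ _).compr₂ (LinearMap.single k (fun h => c.Γ g h ⊗[k] d.Γ h l) h)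

variable {c d} in
/-- The universal property of the composite connection. -/
def lift {g : G} {l : K} {X : Type*} [AddCommGroup X] [Module k X]
    (f : ∀ h, c.Γ g h →ₗ[k] d.Γ h l →ₗ[k] X) : (comp c d).Γ g l →ₗ[k] X :=
  LinearMap.lsum k (fun h => c.Γ g h ⊗[k] d.Γ h l) k fun h => TensorProduct.lift (f h)

@[simp] lemma lift_inj {g : G} {h : H} {l : K} {X : Type*} [AddCommGroup X] [Module k X]
    (f : ∀ h, c.Γ g h →ₗ[k] d.Γ h l →ₗ[k] X) (x : c.Γ g h) (y : d.Γ h l) :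
    lift f (inj c d x y) = f h x y := by
  exact (LinearMap.lsum_piSingle ..).trans (TensorProduct.lift.tmul ..)

variable {c d} in
lemma ext_inj {g : G} {l : K} {X : Type*} [AddCommGroup X] [Module k X]
    {f f' : (comp c d).Γ g l →ₗ[k] X} (h : ∀ h x y, f (inj c d (h := h) x y) = f' (inj c d x y)) :
    f = f' := by
  refine LinearMap.pi_ext' fun i => TensorProduct.ext' fun x y => h i x y

lemma cell_apply {g g' : G} {h' h : H} (e : g ⟶ g') (e' : h' ⟶ h) (x : c.Γ g' h) :
    c.cell e e' x = c.U g h (Pi.single (M := fun e : G.Out g => c.Γ e.1 h) ⟨g', e⟩ x) ⟨h', e'⟩ := rfl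

lemma inj_apply_same {g : G} {h : H} {l : K} (x : c.Γ g h) (y : d.Γ h l) :
    inj c d x y h = x ⊗ₜ[k] y := Pi.single_eq_same (M := fun h => c.Γ g h ⊗[k] d.Γ h l) ..
lemma inj_apply_of_ne {g : G} {h h' : H} {l : K} (x : c.Γ g h) (y : d.Γ h l) (hh : h' ≠ h) :
    inj c d x y h' = 0 := Pi.single_eq_of_ne (M := fun h => c.Γ g h ⊗[k] d.Γ h l) hh ..

lemma compU₁_apply {g : G} {h : H} {l : K} (e' : H.In h)
    (z : ∀ e : G.Out g, ∀ h, c.Γ e.1 h ⊗[k] d.Γ h l) :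
    compU₁ c d g l z h e' = ∑ e : G.Out g, (c.cell e.2 e'.2).rTensor (d.Γ h l) (z e h) := by
  change TensorProduct.comm k _ _ (TensorProduct.piRight k k (d.Γ h l) (fun e : H.In h => c.Γ g e.1)
    ((c.U g h).lTensor (d.Γ h l) ((TensorProduct.piRight k k (d.Γ h l)
      fun e : G.Out g => c.Γ e.1 h).symm fun e => TensorProduct.comm k _ _ (z e h))) e') = _
  rw [← Finset.univ_sum_single (fun e : G.Out g => TensorProduct.comm k _ _ (z e h))]
  simp only [map_sum, Finset.sum_apply]
  refine Finset.sum_congr rfl fun e _ => ?_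
  generalize z e h = w
  induction w using TensorProduct.induction_on with
  | zero => simp
  | tmul x y =>
    rw [TensorProduct.comm_tmul, TensorProduct.piRight_symm_single, LinearEquiv.lTensor_tmul,
      TensorProduct.piRight_apply, TensorProduct.piRightHom_tmul, TensorProduct.comm_tmul]
    rfl
  | add x y hx hy => rw [map_add, Pi.single_add, map_add, map_add, map_add, Pi.add_apply, map_add,
      hx, hy, map_add]

lemma compU₂_apply {g : G} {l l' : K} (e'' : l' ⟶ l) (h : H)
    (z : ∀ h, ∀ e : H.Out h, c.Γ g h ⊗[k] d.Γ e.1 l) :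
    compU₂ c d g l z ⟨l', e''⟩ h =
     ∑ e : H.Out h, (d.cell e.2 e'').lTensor (c.Γ g h) (z h e) := by
  change TensorProduct.piRight k k (c.Γ g h) (fun e : K.In l => d.Γ h e.1)
    ((d.U h l).lTensor (c.Γ g h) ((TensorProduct.piRight k k (c.Γ g h)
      fun e : H.Out h => d.Γ e.1 l).symm (z h))) ⟨l', e''⟩ = _
  conv_lhs => rw [← Finset.univ_sum_single (z h)]
  simp only [map_sum, Finset.sum_apply]
  refine Finset.sum_congr rfl fun e _ => ?_
  generalize z h e = w
  induction w using TensorProduct.induction_on with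
  | zero => simp
  | tmul x y =>
    rw [TensorProduct.piRight_symm_single, LinearEquiv.lTensor_tmul,
      TensorProduct.piRight_apply, TensorProduct.piRightHom_tmul]
    rfl
  | add x y hx hy => rw [Pi.single_add, map_add, map_add, map_add, Pi.add_apply, hx, hy, map_add]

lemma comp_U_apply {g : G} {l l' : K} (e'' : l' ⟶ l) (h : H)
    (z : ∀ e : G.Out g, (comp c d).Γ e.1 l) :
    (comp c d).U g l z ⟨l', e''⟩ h = ∑ e' : H.Out h, ∑ e : G.Out g,
      (d.cell e'.2 e'').lTensor (c.Γ g h) ((c.cell e.2 e'.2).rTensor _ (z e e'.1)) := by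
  refine (compU₂_apply c d e'' h _).trans (Finset.sum_congr rfl fun e' _ => ?_)
  exact (congrArg _ (compU₁_apply c d ⟨h, e'.2⟩ z)).trans (map_sum _ _ _)

lemma comp_cell_apply {g g' : G} {h : H} {l' l : K} (e : g ⟶ g') (e'' : l' ⟶ l)
    (z : (comp c d).Γ g' l) : (comp c d).cell e e'' z h = ∑ e' : H.Out h,
      (d.cell e'.2 e'').lTensor (c.Γ g h) ((c.cell e e'.2).rTensor _ (z e'.1)) := by
  rw [cell_apply, comp_U_apply]
  refine Finset.sum_congr rfl fun e' _ => ?_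
  rw [Finset.sum_eq_single ⟨g', e⟩]
  · rw [Pi.single_eq_same]
  · intro e₀ _ he
    rw [Pi.single_eq_of_ne he]
    exact (congrArg _ (map_zero _)).trans (map_zero _)
  · simp

lemma comp_cell_inj {g g' : G} {h : H} {l' l : K} (e : g ⟶ g') (e'' : l' ⟶ l) (x : c.Γ g' h)
    (y : d.Γ h l) : (comp c d).cell e e'' (inj c d x y) =
      ∑ e' : H.In h, inj c d (c.cell e e'.2 x) (d.cell e'.2 e'' y) := by
  funext h'
  rw [comp_cell_apply]
  refine Eq.trans ?_ (map_sum (LinearMap.proj (R := k) (φ := fun h => c.Γ g h ⊗[k] d.Γ h l') h')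
    (fun e' : H.In h => inj c d (c.cell e e'.2 x) (d.cell e'.2 e'' y)) Finset.univ).symm
  rw [Fintype.sum_sigma, Fintype.sum_sigma, Finset.sum_eq_single h, Finset.sum_eq_single h']
  · refine Finset.sum_congr rfl fun e' _ => ?_
    rw [inj_apply_same, LinearMap.rTensor_tmul, LinearMap.lTensor_tmul]
    exact (inj_apply_same c d _ _).symm
  · intro h₁ _ hh
    exact Finset.sum_eq_zero fun e' _ => inj_apply_of_ne c d _ _ hh.symm
  · simp
  · intro h₁ _ hh
    refine Finset.sum_eq_zero fun e' _ => ?_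
    rw [inj_apply_of_ne c d _ _ hh, map_zero, map_zero]
  · simp

end Connection
namespace Connection
variable {k : Type u} [Field k] {G H K L : FinQuiver.{u}}
variable {c c' c'' : Connection k G H} {d d' d'' : Connection k H K} {b b' : Connection k K L}

/-- The horizontal composite of morphisms of connections, `f ⊗ f'`. -/
def tensorHom (f : c ⟶ c') (f' : d ⟶ d') : comp c d ⟶ comp c' d' where
  map g l := lift fun h => (inj c' d').compl₁₂ (app f g h) (app f' h l)
  comm e e'' x := by
    refine LinearMap.congr_fun (f := ((comp c' d').cell e e'') ∘ₗ _) (g := _ ∘ₗ (comp c d).cell e e'')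
      (ext_inj fun h x y => ?_) x
    simp only [LinearMap.comp_apply, lift_inj, LinearMap.compl₁₂_apply, comp_cell_inj, map_sum,
      app_comm]

@[simp] lemma app_tensorHom_inj (f : c ⟶ c') (f' : d ⟶ d') {g : G} {h : H} {l : K}
    (x : c.Γ g h) (y : d.Γ h l) :
    app (tensorHom f f') g l (inj c d x y) = inj c' d' (app f g h x) (app f' h l y) :=
  lift_inj ..

lemma hom_ext_inj {z : Connection k G K} {f f' : comp c d ⟶ z}
    (hf : ∀ g h l x y, app f g l (inj c d (h := h) x y) = app f' g l (inj c d x y)) : f = f' :=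
  hom_ext fun g l x => LinearMap.congr_fun (ext_inj fun h x y => hf g h l x y) x

lemma hom_ext_inj₁ {z : Connection k G L} {f f' : comp (comp c d) b ⟶ z}
    (hf : ∀ g h i l x y w, app f g l (inj (comp c d) b (h := i) (inj c d (h := h) x y) w) =
      app f' g l (inj (comp c d) b (inj c d x y) w)) : f = f' :=
  hom_ext_inj fun g i l x w => LinearMap.congr_fun (ext_inj
    (f := app f g l ∘ₗ (inj (comp c d) b).flip w) (f' := app f' g l ∘ₗ (inj (comp c d) b).flip w)
    fun h x y => hf g h i l x y w) x

lemma hom_ext_inj₂ {z : Connection k G L} {f f' : comp c (comp d b) ⟶ z}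
    (hf : ∀ g h i l x y w, app f g l (inj c (comp d b) (h := h) x (inj d b (h := i) y w)) =
      app f' g l (inj c (comp d b) x (inj d b y w))) : f = f' :=
  hom_ext_inj fun g h l x w => LinearMap.congr_fun (ext_inj
    (f := app f g l ∘ₗ inj c (comp d b) x) (f' := app f' g l ∘ₗ inj c (comp d b) x)
    fun i y w => hf g h i l x y w) w

variable (c d b) in
/-- `(γ ⊗ δ) ⊗ β ↦ γ ⊗ (δ ⊗ β)`. -/
def assocHomₗ (g : G) (l : L) :
    (comp (comp c d) b).Γ g l →ₗ[k] (comp c (comp d b)).Γ g l :=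
  lift fun i => lift fun h => LinearMap.mk₂ k
    (fun (x : c.Γ g h) (y : d.Γ h i) => inj c (comp d b) x ∘ₗ inj d b (l := l) y)
    (fun _ _ _ => by ext; simp) (fun _ _ _ => by ext; simp) (fun _ _ _ => by ext; simp)
    (fun _ _ _ => by ext; simp)

@[simp] lemma assocHomₗ_inj {g : G} {h : H} {i : K} {l : L} (x : c.Γ g h) (y : d.Γ h i)
    (w : b.Γ i l) : assocHomₗ c d b g l (inj (comp c d) b (inj c d x y) w) =
      inj c (comp d b) x (inj d b y w) := by
  simp only [assocHomₗ, lift_inj]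
  rfl

variable (c d b) in
/-- `γ ⊗ (δ ⊗ β) ↦ (γ ⊗ δ) ⊗ β`. -/
def assocInvₗ (g : G) (l : L) :
    (comp c (comp d b)).Γ g l →ₗ[k] (comp (comp c d) b).Γ g l :=
  lift fun h => LinearMap.flip (lift fun i => LinearMap.mk₂ k
    (fun (y : d.Γ h i) (w : b.Γ i l) => (inj (comp c d) b).flip w ∘ₗ (inj c d).flip y)
    (fun _ _ _ => by ext; simp) (fun _ _ _ => by ext; simp) (fun _ _ _ => by ext; simp)
    (fun _ _ _ => by ext; simp))

@[simp] lemma assocInvₗ_inj {g : G} {h : H} {i : K} {l : L} (x : c.Γ g h) (y : d.Γ h i)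
    (w : b.Γ i l) : assocInvₗ c d b g l (inj c (comp d b) x (inj d b y w)) =
      inj (comp c d) b (inj c d x y) w := by
  simp only [assocInvₗ, lift_inj, LinearMap.flip_apply]
  rfl

lemma ext_inj₁ {X : Type*} [AddCommGroup X] [Module k X] {g : G} {l : L}
    {f f' : (comp (comp c d) b).Γ g l →ₗ[k] X}
    (hf : ∀ h i x y w, f (inj (comp c d) b (h := i) (inj c d (h := h) x y) w) =
      f' (inj (comp c d) b (inj c d x y) w)) : f = f' :=
  ext_inj fun i x w => LinearMap.congr_fun (ext_inj
    (f := f ∘ₗ (inj (comp c d) b).flip w) (f' := f' ∘ₗ (inj (comp c d) b).flip w)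
    fun h x y => hf h i x y w) x

lemma ext_inj₂ {X : Type*} [AddCommGroup X] [Module k X] {g : G} {l : L}
    {f f' : (comp c (comp d b)).Γ g l →ₗ[k] X}
    (hf : ∀ h i x y w, f (inj c (comp d b) (h := h) x (inj d b (h := i) y w)) =
      f' (inj c (comp d b) x (inj d b y w))) : f = f' :=
  ext_inj fun h x w => LinearMap.congr_fun (ext_inj
    (f := f ∘ₗ inj c (comp d b) x) (f' := f' ∘ₗ inj c (comp d b) x)
    fun i y w => hf h i x y w) w

variable (c d b) in
/-- The associator of the composition of connections. -/
def assoc : comp (comp c d) b ≅ comp c (comp d b) where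
  hom :=
    { map := assocHomₗ c d b
      comm := fun {g g' l' l} e e'' x => by
        refine LinearMap.congr_fun (f := (comp c (comp d b)).cell e e'' ∘ₗ assocHomₗ c d b g' l)
          (g := assocHomₗ c d b g l' ∘ₗ (comp (comp c d) b).cell e e'')
          (ext_inj₁ fun h i x y w => ?_) x
        simp only [LinearMap.comp_apply, assocHomₗ_inj, comp_cell_inj, map_sum,
          LinearMap.sum_apply]
        exact Finset.sum_comm }
  inv :=
    { map := assocInvₗ c d b
      comm := fun {g g' l' l} e e'' x => by
        refine LinearMap.congr_fun (f := (comp (comp c d) b).cell e e'' ∘ₗ assocInvₗ c d b g' l)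
          (g := assocInvₗ c d b g l' ∘ₗ (comp c (comp d b)).cell e e'')
          (ext_inj₂ fun h i x y w => ?_) x
        simp only [LinearMap.comp_apply, assocInvₗ_inj, comp_cell_inj, map_sum,
          LinearMap.sum_apply]
        exact Finset.sum_comm }
  hom_inv_id := hom_ext_inj₁ fun g h i l x y w =>
    (congrArg (assocInvₗ c d b g l) (assocHomₗ_inj x y w)).trans (assocInvₗ_inj x y w)
  inv_hom_id := hom_ext_inj₂ fun g h i l x y w =>
    (congrArg (assocHomₗ c d b g l) (assocInvₗ_inj x y w)).trans (assocHomₗ_inj x y w)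

@[simp] lemma assoc_hom_inj {g : G} {h : H} {i : K} {l : L} (x : c.Γ g h) (y : d.Γ h i)
    (w : b.Γ i l) : app (assoc c d b).hom g l (inj (comp c d) b (inj c d x y) w) =
      inj c (comp d b) x (inj d b y w) := assocHomₗ_inj x y w
@[simp] lemma assoc_inv_inj {g : G} {h : H} {i : K} {l : L} (x : c.Γ g h) (y : d.Γ h i)
    (w : b.Γ i l) : app (assoc c d b).inv g l (inj c (comp d b) x (inj d b y w)) =
      inj (comp c d) b (inj c d x y) w := assocInvₗ_inj x y w

lemma one_eq_zero {g h : G} (hh : g ≠ h) (x : (one (k := k) G).Γ g h) : x = 0 :=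
  funext fun p => (hh p.down).elim

lemma one_eq_smul {g : G} (x : (one (k := k) G).Γ g g) :
    x = (show PLift (g = g) → k from x) ⟨rfl⟩ • gen g := by
  funext p
  exact (mul_one _).symm

lemma one_cell_gen_same {g g' : G} (e : g ⟶ g') :
    (one (k := k) G).cell e e (gen g') = gen g := by
  funext p
  rw [one_cell_gen]
  exact if_pos (Quiver.Hom.cast_rfl_rfl e).symm

lemma one_cell_gen_of_ne {g g' h' : G} (e : g ⟶ g') (e' : h' ⟶ g')
    (he : (⟨h', e'⟩ : G.In g') ≠ ⟨g, e⟩) : (one (k := k) G).cell e e' (gen g') = 0 := by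
  funext ⟨p⟩
  subst p
  rw [one_cell_gen, if_neg]
  · rfl
  · rintro rfl
    exact he rfl

variable (c) in
/-- `1 ⊗ x ↦ x`. -/
def leftUnitₗ (g : G) (h : H) : (comp (one G) c).Γ g h →ₗ[k] c.Γ g h :=
  (TensorProduct.lid k _).toLinearMap ∘ₗ
    LinearMap.rTensor (c.Γ g h) (LinearMap.proj (R := k) (φ := fun _ : PLift (g = g) => k) ⟨rfl⟩) ∘ₗ
    LinearMap.proj (R := k) (φ := fun g' => (one (k := k) G).Γ g g' ⊗[k] c.Γ g' h) g

@[simp] lemma leftUnitₗ_inj {g : G} {h : H} (x : c.Γ g h) :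
    leftUnitₗ c g h (inj (one G) c (gen g) x) = x := by
  change TensorProduct.lid k _ (LinearMap.rTensor (c.Γ g h)
    (LinearMap.proj (R := k) (φ := fun _ : PLift (g = g) => k) ⟨rfl⟩)
    (inj (one G) c (gen g) x g)) = _
  rw [inj_apply_same]
  exact (TensorProduct.lid_tmul _ _).trans (one_smul k x)

lemma ext_left {X : Type*} [AddCommGroup X] [Module k X] {g : G} {h : H}
    {f f' : (comp (one G) c).Γ g h →ₗ[k] X}
    (hf : ∀ x, f (inj (one G) c (gen g) x) = f' (inj (one G) c (gen g) x)) : f = f' :=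
  ext_inj fun g' s x => by
    by_cases hh : g = g'
    · subst hh
      rw [one_eq_smul s]
      simp [hf]
    · rw [one_eq_zero hh s]
      simp

variable (c) in
/-- `x ⊗ 1 ↦ x`. -/
def rightUnitₗ (g : G) (h : H) : (comp c (one H)).Γ g h →ₗ[k] c.Γ g h :=
  (TensorProduct.rid k _).toLinearMap ∘ₗ
    LinearMap.lTensor (c.Γ g h) (LinearMap.proj (R := k) (φ := fun _ : PLift (h = h) => k) ⟨rfl⟩) ∘ₗ
    LinearMap.proj (R := k) (φ := fun h' => c.Γ g h' ⊗[k] (one (k := k) H).Γ h' h) h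

@[simp] lemma rightUnitₗ_inj {g : G} {h : H} (x : c.Γ g h) :
    rightUnitₗ c g h (inj c (one H) x (gen h)) = x := by
  change TensorProduct.rid k _ (LinearMap.lTensor (c.Γ g h)
    (LinearMap.proj (R := k) (φ := fun _ : PLift (h = h) => k) ⟨rfl⟩)
    (inj c (one H) x (gen h) h)) = _
  rw [inj_apply_same]
  exact (TensorProduct.rid_tmul _ _).trans (one_smul k x)

lemma ext_right {X : Type*} [AddCommGroup X] [Module k X] {g : G} {h : H}
    {f f' : (comp c (one H)).Γ g h →ₗ[k] X}
    (hf : ∀ x, f (inj c (one H) x (gen h)) = f' (inj c (one H) x (gen h))) : f = f' :=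
  ext_inj fun g' x s => by
    by_cases hh : g' = h
    · subst hh
      rw [one_eq_smul s]
      simp [hf]
    · rw [one_eq_zero hh s]
      simp

lemma cell_left {g g' : G} {h' h : H} (e : g ⟶ g') (e'' : h' ⟶ h) (x : c.Γ g' h) :
    (comp (one G) c).cell e e'' (inj (one G) c (gen g') x) =
      inj (one G) c (gen g) (c.cell e e'' x) := by
  rw [comp_cell_inj, Finset.sum_eq_single ⟨g, e⟩]
  · rw [one_cell_gen_same]
  · intro e' _ he
    rw [one_cell_gen_of_ne _ _ he]
    simp
  · simp

lemma cell_right {g g' : G} {h' h : H} (e : g ⟶ g') (e'' : h' ⟶ h) (x : c.Γ g' h) :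
    (comp c (one H)).cell e e'' (inj c (one H) x (gen h)) =
      inj c (one H) (c.cell e e'' x) (gen h') := by
  rw [comp_cell_inj, Finset.sum_eq_single ⟨h', e''⟩]
  · rw [one_cell_gen_same]
  · intro e' _ he
    rw [one_cell_gen_of_ne _ _ he.symm]
    simp
  · simp

variable (c) in
/-- The left unitor of the composition of connections. -/
def leftUnit : comp (one G) c ≅ c where
  hom :=
    { map := leftUnitₗ c
      comm := fun {g g' h' h} e e'' x => by
        refine LinearMap.congr_fun (f := c.cell e e'' ∘ₗ leftUnitₗ c g' h)
          (g := leftUnitₗ c g h' ∘ₗ (comp (one G) c).cell e e'') (ext_left fun x => ?_) x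
        simp only [LinearMap.comp_apply, leftUnitₗ_inj, cell_left] }
  inv :=
    { map := fun g _ => inj (one G) c (gen g)
      comm := fun e e'' x => cell_left e e'' x }
  hom_inv_id := hom_ext fun g h x => LinearMap.congr_fun (ext_left
    (f := inj (one G) c (gen g) ∘ₗ leftUnitₗ c g h) (f' := LinearMap.id) fun x => by simp) x
  inv_hom_id := hom_ext fun g h x => leftUnitₗ_inj x

variable (c) in
/-- The right unitor of the composition of connections. -/
def rightUnit : comp c (one H) ≅ c where
  hom :=
    { map := rightUnitₗ c
      comm := fun {g g' h' h} e e'' x => by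
        refine LinearMap.congr_fun (f := c.cell e e'' ∘ₗ rightUnitₗ c g' h)
          (g := rightUnitₗ c g h' ∘ₗ (comp c (one H)).cell e e'') (ext_right fun x => ?_) x
        simp only [LinearMap.comp_apply, rightUnitₗ_inj, cell_right] }
  inv :=
    { map := fun _ h => (inj c (one H)).flip (gen h)
      comm := fun e e'' x => cell_right e e'' x }
  hom_inv_id := hom_ext fun g h x => LinearMap.congr_fun (ext_right
    (f := (inj c (one H)).flip (gen h) ∘ₗ rightUnitₗ c g h) (f' := LinearMap.id) fun x => by simp) x
  inv_hom_id := hom_ext fun g h x => rightUnitₗ_inj x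

@[simp] lemma leftUnit_hom_inj {g : G} {h : H} (x : c.Γ g h) :
    app (leftUnit c).hom g h (inj (one G) c (gen g) x) = x := leftUnitₗ_inj x
@[simp] lemma rightUnit_hom_inj {g : G} {h : H} (x : c.Γ g h) :
    app (rightUnit c).hom g h (inj c (one H) x (gen h)) = x := rightUnitₗ_inj x
@[simp] lemma leftUnit_inv_app {g : G} {h : H} (x : c.Γ g h) :
    app (leftUnit c).inv g h x = inj (one G) c (gen g) x := rfl
@[simp] lemma rightUnit_inv_app {g : G} {h : H} (x : c.Γ g h) :
    app (rightUnit c).inv g h x = inj c (one H) x (gen h) := rfl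

lemma tensorHom_id (c : Connection k G H) (d : Connection k H K) :
    tensorHom (𝟙 c) (𝟙 d) = 𝟙 (comp c d) := hom_ext_inj fun _ _ _ _ _ => by simp

lemma tensorHom_comp (f : c ⟶ c') (f' : c' ⟶ c'') (p : d ⟶ d') (p' : d' ⟶ d'') :
    tensorHom (f ≫ f') (p ≫ p') = tensorHom f p ≫ tensorHom f' p' :=
  hom_ext_inj fun _ _ _ _ _ => by simp

lemma unit_tensorHom (f : c ⟶ c') :
    tensorHom (𝟙 (one G)) f = (leftUnit c).hom ≫ f ≫ (leftUnit c').inv :=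
  hom_ext fun _ _ x => LinearMap.congr_fun (ext_left (f := app _ _ _) (f' := app _ _ _)
    fun x => by simp) x

lemma tensorHom_unit (f : c ⟶ c') :
    tensorHom f (𝟙 (one H)) = (rightUnit c).hom ≫ f ≫ (rightUnit c').inv :=
  hom_ext fun _ _ x => LinearMap.congr_fun (ext_right (f := app _ _ _) (f' := app _ _ _)
    fun x => by simp) x

lemma assoc_naturality (f : c ⟶ c') (p : d ⟶ d') (q : b ⟶ b') :
    tensorHom (tensorHom f p) q ≫ (assoc c' d' b').hom =
      (assoc c d b).hom ≫ tensorHom f (tensorHom p q) :=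
  hom_ext_inj₁ fun _ _ _ _ _ _ _ => by simp

lemma comp_whiskerLeft' (c : Connection k G H) (d : Connection k H K) (q : b ⟶ b') :
    tensorHom (𝟙 (comp c d)) q =
      (assoc c d b).hom ≫ tensorHom (𝟙 c) (tensorHom (𝟙 d) q) ≫ (assoc c d b').inv :=
  hom_ext_inj₁ fun _ _ _ _ _ _ _ => by simp

lemma whiskerRight_comp' (f : c ⟶ c') (d : Connection k H K) (b : Connection k K L) :
    tensorHom f (𝟙 (comp d b)) =
      (assoc c d b).inv ≫ tensorHom (tensorHom f (𝟙 d)) (𝟙 b) ≫ (assoc c' d b).hom :=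
  hom_ext_inj₂ fun _ _ _ _ _ _ _ => by simp

lemma whisker_assoc' (c : Connection k G H) (p : d ⟶ d') (b : Connection k K L) :
    tensorHom (tensorHom (𝟙 c) p) (𝟙 b) =
      (assoc c d b).hom ≫ tensorHom (𝟙 c) (tensorHom p (𝟙 b)) ≫ (assoc c d' b).inv :=
  hom_ext_inj₁ fun _ _ _ _ _ _ _ => by simp

lemma whisker_exchange' (f : c ⟶ c') (p : d ⟶ d') :
    tensorHom (𝟙 c) p ≫ tensorHom f (𝟙 d') = tensorHom f (𝟙 d) ≫ tensorHom (𝟙 c') p :=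
  hom_ext_inj fun _ _ _ _ _ => by simp

lemma pentagon {M : FinQuiver.{u}} (c : Connection k G H) (d : Connection k H K)
    (b : Connection k K L) (a : Connection k L M) :
    tensorHom (assoc c d b).hom (𝟙 a) ≫ (assoc c (comp d b) a).hom ≫
        tensorHom (𝟙 c) (assoc d b a).hom =
      (assoc (comp c d) b a).hom ≫ (assoc c d (comp b a)).hom :=
  hom_ext_inj fun g i l x w => LinearMap.congr_fun (ext_inj₁
    (f := app (tensorHom (assoc c d b).hom (𝟙 a) ≫ (assoc c (comp d b) a).hom ≫
        tensorHom (𝟙 c) (assoc d b a).hom) g l ∘ₗ (inj _ a).flip w)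
    (f' := app ((assoc (comp c d) b a).hom ≫ (assoc c d (comp b a)).hom) g l ∘ₗ
      (inj _ a).flip w) fun h j x y z => by simp) x

lemma triangle (c : Connection k G H) (d : Connection k H K) :
    (assoc c (one H) d).hom ≫ tensorHom (𝟙 c) (leftUnit d).hom =
      tensorHom (rightUnit c).hom (𝟙 d) :=
  hom_ext_inj fun g i l x w => LinearMap.congr_fun (ext_right
    (f := app ((assoc c (one H) d).hom ≫ tensorHom (𝟙 c) (leftUnit d).hom) g l ∘ₗ (inj _ d).flip w)
    (f' := app (tensorHom (rightUnit c).hom (𝟙 d)) g l ∘ₗ (inj _ d).flip w)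
    fun x => by simp) x

end Connection
open Quiver (Path)

namespace Connection
variable {k : Type u} [Field k] {G H K L : FinQuiver.{u}}

/-- The vector space `⨁_h Γ g h ⊗ k[paths h → l]`: linear combinations of paths which consist of an
edge of `Γ` followed by a path in `H`. -/
def PathMod (c : Connection k G H) (g : G) (l : H) : Type u :=
  ∀ h, c.Γ g h ⊗[k] (Path h l →₀ k)

instance (c : Connection k G H) (g l) : AddCommGroup (PathMod c g l) :=
  inferInstanceAs (AddCommGroup (∀ h, c.Γ g h ⊗[k] (Path h l →₀ k)))
instance (c : Connection k G H) (g l) : Module k (PathMod c g l) :=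
  inferInstanceAs (Module k (∀ h, c.Γ g h ⊗[k] (Path h l →₀ k)))

variable (c : Connection k G H)

/-- `γ` followed by a linear combination of paths in `H`. -/
def pin {g : G} {h l : H} : c.Γ g h →ₗ[k] (Path h l →₀ k) →ₗ[k] PathMod c g l :=
  (TensorProduct.mk k _ _).compr₂ (LinearMap.single k (fun h => c.Γ g h ⊗[k] (Path h l →₀ k)) h)

/-- `γ`, as a path of length one. -/
def edge {g : G} {h : H} (γ : c.Γ g h) : PathMod c g h := c.pin γ (Finsupp.single Path.nil 1)

variable {c} in
/-- The universal property of `PathMod`. -/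
def pathLift {g : G} {l : H} {X : Type*} [AddCommGroup X] [Module k X]
    (f : ∀ h, c.Γ g h →ₗ[k] (Path h l →₀ k) →ₗ[k] X) : PathMod c g l →ₗ[k] X :=
  LinearMap.lsum k (fun h => c.Γ g h ⊗[k] (Path h l →₀ k)) k fun h => TensorProduct.lift (f h)

@[simp] lemma pathLift_pin {g : G} {h l : H} {X : Type*} [AddCommGroup X] [Module k X]
    (f : ∀ h, c.Γ g h →ₗ[k] (Path h l →₀ k) →ₗ[k] X) (x : c.Γ g h) (y : Path h l →₀ k) :
    pathLift f (pin c x y) = f h x y :=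
  (LinearMap.lsum_piSingle ..).trans (TensorProduct.lift.tmul ..)

variable {c} in
lemma ext_pin {g : G} {l : H} {X : Type*} [AddCommGroup X] [Module k X]
    {f f' : PathMod c g l →ₗ[k] X} (h : ∀ h x y, f (pin c (h := h) x y) = f' (pin c x y)) :
    f = f' := by
  refine LinearMap.pi_ext' fun i => TensorProduct.ext' fun x y => h i x y

/-- The left action of an edge `e` of `G`: it is moved across `Γ` by means of `U`, and then
concatenated with the path in `H`. -/
def edgeAct {g g' : G} (l : H) (e : g ⟶ g') : PathMod c g' l →ₗ[k] PathMod c g l :=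
  pathLift fun h => ∑ e' : H.In h, (pin c).compl₁₂ (c.cell e e'.2)
    (PathAlgebra.concat e'.1 h l (Finsupp.single e'.2.toPath 1))

lemma edgeAct_pin {g g' : G} {h l : H} (e : g ⟶ g') (x : c.Γ g' h) (y : Path h l →₀ k) :
    edgeAct c l e (pin c x y) = ∑ e' : H.In h, pin c (c.cell e e'.2 x)
      (PathAlgebra.concat e'.1 h l (Finsupp.single e'.2.toPath 1) y) := by
  simp [edgeAct, LinearMap.sum_apply]

/-- The left action of a path in `G`, by iteration of `U`. -/
def pathAct (l : H) {g : G} : ∀ {g' : G}, Path g g' → (PathMod c g' l →ₗ[k] PathMod c g l)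
  | _, .nil => LinearMap.id
  | _, .cons p e => pathAct l p ∘ₗ edgeAct c l e

lemma pathAct_comp (l : H) {g g' g'' : G} (p : Path g g') (q : Path g' g'') :
    pathAct c l (p.comp q) = pathAct c l p ∘ₗ pathAct c l q := by
  induction q with
  | nil => rfl
  | cons q e ih => rw [Path.comp_cons, pathAct, pathAct, ih, LinearMap.comp_assoc]

/-- The left action of linear combinations of paths in `G`. -/
def act {g g' : G} (l : H) : (Path g g' →₀ k) →ₗ[k] PathMod c g' l →ₗ[k] PathMod c g l :=
  Finsupp.lsum k fun p => LinearMap.toSpanSingleton k _ (pathAct c l p)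

@[simp] lemma act_single {g g' : G} (l : H) (p : Path g g') (r : k) (m : PathMod c g' l) :
    act c l (Finsupp.single p r) m = r • pathAct c l p m := by
  simp [act]

lemma act_concat {g g' g'' : G} (l : H) (x : Path g g' →₀ k) (y : Path g' g'' →₀ k)
    (m : PathMod c g'' l) :
    act c l (PathAlgebra.concat g g' g'' x y) m = act c l x (act c l y m) := by
  induction x using Finsupp.induction_linear with
  | zero => simp
  | add x x' hx hx' => simp [hx, hx']
  | single p r =>
    induction y using Finsupp.induction_linear with
    | zero => simp
    | add y y' hy hy' => rw [map_add, map_add, LinearMap.add_apply, hy, hy', map_add,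
        LinearMap.add_apply, map_add]
    | single q s => 
      rw [PathAlgebra.concat_single, act_single, act_single, act_single, map_smul, pathAct_comp,
        mul_smul]
      rfl

/-- The subspace `⨁_h Γ g h ⊗ (J ∩ k[paths h → l])`. -/
def idealPart (J : Ideal (PathAlgebra k H)) (g : G) (l : H) : Submodule k (PathMod c g l) :=
  Submodule.span k {m | ∃ (h : H) (γ : c.Γ g h) (y : Path h l →₀ k),
    PathAlgebra.of h l y ∈ J ∧ m = c.pin γ y}

/-- A connection between the bound quivers `(G, I)` and `(H, J)` is ideally connected if the
isomorphisms given by iterating `U` send `x ⊗ γ`, for `x` a linear combination of paths in `I`, into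
`⨁ Γ ⊗ J`, and their inverses send `γ ⊗ y`, for `y` a linear combination of paths in `J`, into
`⨁ I ⊗ Γ`. -/
structure IsIdeallyConnected (I : Ideal (PathAlgebra k G)) (J : Ideal (PathAlgebra k H)) :
    Prop where
  act_mem : ∀ (g g' : G) (h : H) (x : Path g g' →₀ k), PathAlgebra.of g g' x ∈ I →
    ∀ γ : c.Γ g' h, c.act h x (c.edge γ) ∈ c.idealPart J g h
  pin_mem : ∀ (g : G) (h h' : H) (y : Path h h' →₀ k), PathAlgebra.of h h' y ∈ J →
    ∀ γ : c.Γ g h, c.pin γ y ∈ Submodule.span k {m | ∃ (g' : G) (x : Path g g' →₀ k)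
      (γ' : c.Γ g' h'), PathAlgebra.of g g' x ∈ I ∧ m = c.act h' x (c.edge γ')}

lemma one_act {g g' : G} (x : Path g g' →₀ k) :
    (one (k := k) G).act g' x ((one G).edge (gen g')) = (one G).pin (gen g) x := by
  have key : ∀ {a b c : G} (e : a ⟶ b) (y : Path b c →₀ k),
      (one (k := k) G).edgeAct c e ((one G).pin (gen b) y) =
      (one G).pin (gen a) (PathAlgebra.concat a b c (Finsupp.single e.toPath 1) y) := by
    intro a b c e y
    rw [edgeAct_pin, Finset.sum_eq_single ⟨a, e⟩]
    · rw [one_cell_gen_same]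
    · intro e' _ he
      rw [one_cell_gen_of_ne _ _ he]
      simp
    · simp
  have key' : ∀ {a b c : G} (p : Path a b) (y : Path b c →₀ k),
      (one (k := k) G).pathAct c p ((one G).pin (gen b) y) =
      (one G).pin (gen a) (PathAlgebra.concat a b c (Finsupp.single p 1) y) := by
    intro a b c p
    induction p with
    | nil => intro y; simp [pathAct]
    | cons p e ih =>
      intro y
      rw [pathAct, LinearMap.comp_apply, key, ih, ← PathAlgebra.concat_assoc,
        PathAlgebra.concat_single, mul_one]
      rfl
  induction x using Finsupp.induction_linear with
  | zero => simp
  | add x x' hx hx' => rw [map_add, LinearMap.add_apply, hx, hx', map_add]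
  | single p r =>
    rw [act_single, edge, key', ← map_smul, PathAlgebra.concat_nil, Finsupp.smul_single]
    simp

lemma isIdeallyConnected_one (I : Ideal (PathAlgebra k G)) :
    (one (k := k) G).IsIdeallyConnected I I where
  act_mem g g' h x hx γ := by
    by_cases hh : g' = h
    · subst hh
      rw [one_eq_smul γ, edge, map_smul, LinearMap.smul_apply, map_smul]
      refine Submodule.smul_mem _ _ ?_
      rw [← edge, one_act]
      exact Submodule.subset_span ⟨g, gen g, x, hx, rfl⟩
    · rw [one_eq_zero hh γ, edge, map_zero, LinearMap.zero_apply, map_zero]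
      exact Submodule.zero_mem _
  pin_mem g h h' y hy γ := by
    by_cases hh : g = h
    · subst hh
      rw [one_eq_smul γ, map_smul, LinearMap.smul_apply]
      refine Submodule.smul_mem _ _ (Submodule.subset_span ⟨h', y, gen h', hy, ?_⟩)
      rw [one_act]
    · rw [one_eq_zero hh γ, map_zero, LinearMap.zero_apply]
      exact Submodule.zero_mem _

variable (d : Connection k H K)

/-- Prefix `γ` to linear combinations of paths of `d`. -/
def pre {g : G} {h : H} (l : K) : c.Γ g h →ₗ[k] PathMod d h l →ₗ[k] PathMod (comp c d) g l :=
  LinearMap.flip (pathLift fun i => LinearMap.mk₂ k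
    (fun (δ : d.Γ h i) (y : Path i l →₀ k) => (pin (comp c d)).flip y ∘ₗ (inj c d).flip δ)
    (fun _ _ _ => by ext; simp) (fun _ _ _ => by ext; simp) (fun _ _ _ => by ext; simp)
    (fun _ _ _ => by ext; simp))

@[simp] lemma pre_pin {g : G} {h : H} {i l : K} (γ : c.Γ g h) (δ : d.Γ h i) (y : Path i l →₀ k) :
    pre c d l γ (pin d δ y) = pin (comp c d) (inj c d γ δ) y := by
  simp only [pre, LinearMap.flip_apply, pathLift_pin]
  rfl

lemma edgeAct_pre {g g' : G} {h : H} {l : K} (e : g ⟶ g') (γ : c.Γ g' h) (n : PathMod d h l) :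
    edgeAct (comp c d) l e (pre c d l γ n) =
      ∑ e' : H.In h, pre c d l (c.cell e e'.2 γ) (edgeAct d l e'.2 n) := by
  refine LinearMap.congr_fun (f := edgeAct (comp c d) l e ∘ₗ pre c d l γ)
    (g := ∑ e' : H.In h, pre c d l (c.cell e e'.2 γ) ∘ₗ (edgeAct d l e'.2)) (ext_pin fun i x y => ?_) n
      |>.trans (by simp)
  simp only [LinearMap.comp_apply, LinearMap.sum_apply, pre_pin, edgeAct_pin, comp_cell_inj, map_sum]
  exact Finset.sum_comm

/-- `(γ y, n) ↦ γ (y n)`. -/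
def pair (g : G) (h : H) (l : K) :
    PathMod c g h →ₗ[k] PathMod d h l →ₗ[k] PathMod (comp c d) g l :=
  pathLift fun h' => LinearMap.mk₂ k
    (fun (γ : c.Γ g h') (y : Path h' h →₀ k) => pre c d l γ ∘ₗ act d l y)
    (fun _ _ _ => by ext; simp) (fun _ _ _ => by ext; simp) (fun _ _ _ => by ext; simp)
    (fun _ _ _ => by ext; simp)

@[simp] lemma pair_pin {g : G} {h' h : H} {l : K} (γ : c.Γ g h') (y : Path h' h →₀ k)
    (n : PathMod d h l) : pair c d g h l (pin c γ y) n = pre c d l γ (act d l y n) := by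
  simp only [pair, pathLift_pin]
  rfl

lemma edgeAct_pair {g g' : G} {h : H} {l : K} (e : g ⟶ g') (m : PathMod c g' h)
    (n : PathMod d h l) :
    edgeAct (comp c d) l e (pair c d g' h l m n) = pair c d g h l (edgeAct c h e m) n := by
  refine LinearMap.congr_fun (f := edgeAct (comp c d) l e ∘ₗ (pair c d g' h l).flip n)
    (g := (pair c d g h l).flip n ∘ₗ edgeAct c h e) (ext_pin fun i x y => ?_) m
  simp only [LinearMap.comp_apply, LinearMap.flip_apply, pair_pin, edgeAct_pre, edgeAct_pin,
    map_sum, act_concat, act_single]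
  simp [Quiver.Hom.toPath, pathAct]

lemma act_pair {g g' : G} {h : H} {l : K} (x : Path g g' →₀ k) (m : PathMod c g' h)
    (n : PathMod d h l) :
    act (comp c d) l x (pair c d g' h l m n) = pair c d g h l (act c h x m) n := by
  have key : ∀ {a b : G} (p : Path a b) (m : PathMod c b h),
      pathAct (comp c d) l p (pair c d b h l m n) = pair c d a h l (pathAct c h p m) n := by
    intro a b p
    induction p with
    | nil => intro m; rfl
    | cons p e ih => intro m; simp [pathAct, edgeAct_pair, ih]
  induction x using Finsupp.induction_linear with
  | zero => simp
  | add x x' hx hx' => simp [hx, hx']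
  | single p r => simp [key]

lemma pair_edge {g : G} {h : H} {l : K} (γ : c.Γ g h) (δ : d.Γ h l) :
    pair c d g h l (edge c γ) (edge d δ) = edge (comp c d) (inj c d γ δ) := by
  simp [edge, pathAct]

variable {c d} in
lemma comp_induction {g : G} {l : K} {p : (comp c d).Γ g l → Prop}
    (inj_mem : ∀ (h : H) (x : c.Γ g h) (y : d.Γ h l), p (inj c d x y)) (zero : p 0)
    (add : ∀ x y, p x → p y → p (x + y)) (x : (comp c d).Γ g l) : p x := by
  let f := fun h => LinearMap.single k (fun h => c.Γ g h ⊗[k] d.Γ h l) h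
  have key : ∀ h (w : c.Γ g h ⊗[k] d.Γ h l), p (f h w) := by
    intro h w
    induction w using TensorProduct.induction_on with
    | zero => exact (map_zero (f h)).symm ▸ zero
    | tmul x y => exact inj_mem h x y
    | add x y hx hy => exact (map_add (f h) x y).symm ▸ add _ _ hx hy
  have : x = ∑ h, f h (x h) := (Finset.univ_sum_single (M := fun h => c.Γ g h ⊗[k] d.Γ h l) x).symm
  rw [this]
  exact Finset.sum_induction _ p add zero fun h _ => key h _

variable {c d} in
lemma IsIdeallyConnected.comp {I : Ideal (PathAlgebra k G)} {J : Ideal (PathAlgebra k H)}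
    {I' : Ideal (PathAlgebra k K)} (hc : c.IsIdeallyConnected I J) (hd : d.IsIdeallyConnected J I') :
    (comp c d).IsIdeallyConnected I I' where
  act_mem g g' l x hx ξ := by
    suffices hf : ∀ (h : H) (γ : c.Γ g' h) (δ : d.Γ h l),
        (Connection.comp c d).act l x ((Connection.comp c d).edge (inj c d γ δ)) ∈
          (Connection.comp c d).idealPart I' g l by
      refine comp_induction (p := fun ξ => (Connection.comp c d).act l x
        ((Connection.comp c d).edge ξ) ∈ (Connection.comp c d).idealPart I' g l) hf ?_ ?_ ξ
      · rw [edge, map_zero, LinearMap.zero_apply, map_zero]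
        exact Submodule.zero_mem _
      · intro ξ ξ' h h'
        rw [edge, map_add, LinearMap.add_apply, map_add]
        exact Submodule.add_mem _ h h'
    intro h γ δ
    rw [← pair_edge, act_pair]
    refine Submodule.span_induction (p := fun m _ => c.pair d g h l m (d.edge δ) ∈
      (Connection.comp c d).idealPart I' g l) ?_ ?_ ?_ ?_ (hc.act_mem g g' h x hx γ)
    · rintro _ ⟨h', γ', y, hy, rfl⟩
      rw [pair_pin]
      refine Submodule.span_induction (p := fun n _ => c.pre d l γ' n ∈
        (Connection.comp c d).idealPart I' g l) ?_ ?_ ?_ ?_ (hd.act_mem h' h l y hy δ)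
      · rintro _ ⟨l', δ', z, hz, rfl⟩
        rw [pre_pin]
        exact Submodule.subset_span ⟨l', _, z, hz, rfl⟩
      · simp
      · intro a b _ _ ha hb
        rw [map_add]
        exact Submodule.add_mem _ ha hb
      · intro r a _ ha
        rw [map_smul]
        exact Submodule.smul_mem _ _ ha
    · simp
    · intro a b _ _ ha hb
      rw [map_add, LinearMap.add_apply]
      exact Submodule.add_mem _ ha hb
    · intro r a _ ha
      rw [map_smul, LinearMap.smul_apply]
      exact Submodule.smul_mem _ _ ha
  pin_mem g l l' z hz ξ := by
    refine comp_induction (p := fun ξ => (Connection.comp c d).pin ξ z ∈ Submodule.span k _)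
      ?_ ?_ ?_ ξ
    · intro h γ δ
      rw [← pre_pin]
      refine Submodule.span_induction (p := fun n _ => c.pre d l' γ n ∈ Submodule.span k _)
        ?_ ?_ ?_ ?_ (hd.pin_mem h l l' z hz δ)
      · rintro _ ⟨h', y, δ', hy, rfl⟩
        rw [← pair_pin]
        refine Submodule.span_induction (p := fun m _ => c.pair d g h' l' m (d.edge δ') ∈
          Submodule.span k _) ?_ ?_ ?_ ?_ (hc.pin_mem g h h' y hy γ)
        · rintro _ ⟨g', x, γ', hx, rfl⟩
          rw [← act_pair, pair_edge]
          exact Submodule.subset_span ⟨g', x, _, hx, rfl⟩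
        · simp
        · intro a b _ _ ha hb
          rw [map_add, LinearMap.add_apply]
          exact Submodule.add_mem _ ha hb
        · intro r a _ ha
          rw [map_smul, LinearMap.smul_apply]
          exact Submodule.smul_mem _ _ ha
      · simp
      · intro a b _ _ ha hb
        rw [map_add]
        exact Submodule.add_mem _ ha hb
      · intro r a _ ha
        rw [map_smul]
        exact Submodule.smul_mem _ _ ha
    · simp
    · intro ξ ξ' h h'
      rw [map_add, LinearMap.add_apply]
      exact Submodule.add_mem _ h h'

end Connection

/-! ### The bicategory `BdQuivCon` -/

/-- A bound quiver: a quiver with an admissible ideal of its path algebra. -/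
structure BdQuivCon (k : Type u) [Field k] where
  Q : FinQuiver.{u}
  I : Ideal (PathAlgebra k Q)
  admissible : IsAdmissible I

namespace BdQuivCon
variable {k : Type u} [Field k]

/-- A 1-morphism of `BdQuivCon`: an ideally connected connection. -/
structure Hom (X Y : BdQuivCon k) where
  con : Connection k X.Q Y.Q
  ideal : con.IsIdeallyConnected X.I Y.I

instance (X Y : BdQuivCon k) : Category (Hom X Y) where
  Hom c d := c.con ⟶ d.con
  id c := 𝟙 c.con
  comp f g := (f ≫ g :)
  id_comp f := Category.id_comp (show _ ⟶ _ from f)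
  comp_id f := Category.comp_id (show _ ⟶ _ from f)
  assoc f g h := Category.assoc (show _ ⟶ _ from f) (show _ ⟶ _ from g) (show _ ⟶ _ from h)

/-- A morphism of connections, as a 2-morphism of `BdQuivCon`. -/
def mkHom {X Y : BdQuivCon k} {c d : Hom X Y} (f : c.con ⟶ d.con) : c ⟶ d := f

/-- An isomorphism of connections, as an isomorphism of 1-morphisms of `BdQuivCon`. -/
def mkIso {X Y : BdQuivCon k} {c d : Hom X Y} (f : c.con ≅ d.con) : c ≅ d where
  hom := f.hom
  inv := f.inv
  hom_inv_id := f.hom_inv_id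
  inv_hom_id := f.inv_hom_id

section
open Connection

instance bicategory : Bicategory (BdQuivCon k) where
  Hom X Y := Hom X Y
  id X := ⟨one X.Q, isIdeallyConnected_one X.I⟩
  comp c d := ⟨Connection.comp c.con d.con, c.ideal.comp d.ideal⟩
  homCategory X Y := inferInstanceAs (Category (Hom X Y))
  whiskerLeft c _ _ f := mkHom (tensorHom (𝟙 c.con) f)
  whiskerRight f d := mkHom (tensorHom f (𝟙 d.con))
  associator c d b := mkIso (Connection.assoc c.con d.con b.con)
  leftUnitor c := mkIso (leftUnit c.con)
  rightUnitor c := mkIso (rightUnit c.con)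
  whiskerLeft_id c d := tensorHom_id c.con d.con
  whiskerLeft_comp c _ _ _ f f' :=
    (congrArg (fun x => tensorHom x (f ≫ f' :)) (Category.comp_id (𝟙 c.con)).symm).trans
      (tensorHom_comp (𝟙 c.con) (𝟙 c.con) f f')
  id_whiskerLeft f := unit_tensorHom f
  comp_whiskerLeft c d _ _ f := comp_whiskerLeft' c.con d.con f
  id_whiskerRight c d := tensorHom_id c.con d.con
  comp_whiskerRight f f' d :=
    (congrArg (fun x => tensorHom (f ≫ f' :) x) (Category.comp_id (𝟙 d.con)).symm).trans
      (tensorHom_comp f f' (𝟙 d.con) (𝟙 d.con))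
  whiskerRight_id f := tensorHom_unit f
  whiskerRight_comp f d b := whiskerRight_comp' f d.con b.con
  whisker_assoc c _ _ f b := whisker_assoc' c.con f b.con
  whisker_exchange f g := whisker_exchange' f g
  pentagon c d b a := Connection.pentagon c.con d.con b.con a.con
  triangle c d := Connection.triangle c.con d.con

end
end BdQuivCon

open Quiver (Path)

/-! ### Path bimodules -/

namespace Connection
variable {k : Type u} [Field k] {G H : FinQuiver.{u}} (c : Connection k G H)

/-- The path bimodule `k(ΓH)`: linear combinations of paths consisting of an edge of `Γ` followed by
a path in `H`. -/
def PathBimodule (c : Connection k G H) : Type u := ∀ (g : G) (l : H), PathMod c g l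

instance : AddCommGroup (PathBimodule c) :=
  inferInstanceAs (AddCommGroup (∀ (g : G) (l : H), PathMod c g l))
instance : Module k (PathBimodule c) :=
  inferInstanceAs (Module k (∀ (g : G) (l : H), PathMod c g l))

/-- An element of `PathMod c g l`, as an element of the path bimodule. -/
def ofPathMod (g : G) (l : H) : PathMod c g l →ₗ[k] PathBimodule c :=
  LinearMap.single k (fun g : G => ∀ l : H, PathMod c g l) g ∘ₗ
    LinearMap.single k (fun l : H => PathMod c g l) l

/-- Concatenation with linear combinations of paths in `H`. -/
def concatAct {g : G} (h l : H) : PathMod c g h →ₗ[k] (Path h l →₀ k) →ₗ[k] PathMod c g l :=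
  pathLift fun h' => LinearMap.mk₂ k
    (fun (γ : c.Γ g h') (y : Path h' h →₀ k) => c.pin γ ∘ₗ PathAlgebra.concat h' h l y)
    (fun _ _ _ => by ext; simp) (fun _ _ _ => by ext; simp) (fun _ _ _ => by ext; simp)
    (fun _ _ _ => by ext; simp)

/-- The left action of `kG` on the path bimodule: paths in `G` are moved across `Γ` by means of `U`
and then concatenated. -/
def leftAct (x : PathAlgebra k G) (m : PathBimodule c) : PathBimodule c :=
  fun g l => ∑ g' : G, c.act l (x g g') (m g' l)

/-- The right action of `kH` on the path bimodule, by concatenation. -/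
def rightAct (m : PathBimodule c) (y : PathAlgebra k H) : PathBimodule c :=
  fun g l => ∑ h : H, c.concatAct h l (m g h) (y h l)

/-- The subspace `M J` of the path bimodule `M`, for an ideal `J` of `kH`. -/
def mulIdeal (J : Ideal (PathAlgebra k H)) : Submodule k (PathBimodule c) :=
  Submodule.span k {z | ∃ m : PathBimodule c, ∃ y ∈ J, z = c.rightAct m y}

/-- `γ`, as an element of the path bimodule. -/
def edgeElt {g : G} {h : H} (γ : c.Γ g h) : PathBimodule c := c.ofPathMod g h (c.edge γ)

/-- The path `γ e` for an edge `e` of `H`, as an element of the path bimodule. -/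
def edgeEdgeElt {g : G} {h h' : H} (γ : c.Γ g h) (e : h ⟶ h') : PathBimodule c :=
  c.ofPathMod g h' (c.pin γ (Finsupp.single e.toPath 1))

variable {c} in
/-- The map `f° : k(ΓH) → k(ΔH)`, `∑ γ b ↦ ∑ f(γ) b`, for a morphism of connections `f`. -/
def pathMap {d : Connection k G H} (f : c ⟶ d) (m : PathBimodule c) : PathBimodule d :=
  fun g l => pathLift (fun h => d.pin ∘ₗ app f g h) (m g l)

end Connection

/-! ### Equivalences of 2-categories, and the functor `P` -/

/-- A pseudofunctor is an equivalence of 2-categories (biequivalence) if every object of the target is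
equivalent to one in its image and it induces equivalences between the categories of
1-morphisms. -/
def IsBiequivalence {B C : Type*} [Bicategory B] [Bicategory C] (P : B ⥤ᵖ C) : Prop :=
  (∀ Y : C, ∃ X : B, Nonempty (Bicategory.Equivalence (P.obj X) Y)) ∧
  ∀ X Y : B, (P.mapFunctor X Y).IsEquivalence

instance {k : Type u} [Field k] (X : BdQuivCon k) : X.I.IsTwoSided := X.admissible.twoSided

open BSA Bimodule in
/-- The data exhibiting `P` as the path functor: up to specified isomorphisms `φ` and `ψ` it sends

* a bound quiver `(Q, I)` to the algebra `kQ/I` with quiver data `δ₁ (v + rad) = v` for vertices `v` and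
  `δ₂ (e + rad²) = e` for edges `e`,
* a connection `Γ` from `(G, I)` to `(H, J)` to the bimodule `M/MJ`, where `M = k(ΓH)`, with quiver data
  `δ₁ (γ + rad) = γ` and `δ₂ (γe + rad²) = γe` for edges `γ` of `Γ` and `e` of `H`,
* a morphism of connections `f` to the map induced by `f°`,

and its structural isomorphisms are `1_v ↦ v` and `γ ⊗ δ ↦ γ ⊗ δ`. -/
structure PathFunctorData {k : Type u} [Field k] (P : BdQuivCon k ⥤ᵖ BSA k) where
  φ (X : BdQuivCon k) : (PathAlgebra k X.Q ⧸ X.I) ≃ₐ[k] (P.obj X).alg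
  obj_δ₁ (X : BdQuivCon k) (v : X.Q) :
    (P.obj X).data.δ₁ (cls₁ (φ X (Ideal.Quotient.mk _ (PathAlgebra.path (Path.nil : Path v v))))) =
      φ X (Ideal.Quotient.mk _ (PathAlgebra.path (Path.nil : Path v v)))
  obj_δ₂ (X : BdQuivCon k) {v w : X.Q} (e : v ⟶ w) :
    ∃ h : φ X (Ideal.Quotient.mk _ (PathAlgebra.path e.toPath)) ∈ rad (P.obj X).alg,
      ((P.obj X).data.δ₂ (cls₂ ⟨_, h⟩) : (P.obj X).alg) =
        φ X (Ideal.Quotient.mk _ (PathAlgebra.path e.toPath))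
  ψ {X Y : BdQuivCon k} (Γ : BdQuivCon.Hom X Y) :
    (Γ.con.PathBimodule ⧸ Γ.con.mulIdeal Y.I) ≃ₗ[k]
      Hom.bim (X := P.obj X) (Y := P.obj Y) (P.map Γ)
  ψ_left {X Y : BdQuivCon k} (Γ : BdQuivCon.Hom X Y) (x : PathAlgebra k X.Q)
    (m : Γ.con.PathBimodule) :
    ψ Γ (Submodule.Quotient.mk (Γ.con.leftAct x m)) =
      φ X (Ideal.Quotient.mk _ x) • ψ Γ (Submodule.Quotient.mk m)
  ψ_right {X Y : BdQuivCon k} (Γ : BdQuivCon.Hom X Y) (m : Γ.con.PathBimodule)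
    (y : PathAlgebra k Y.Q) :
    ψ Γ (Submodule.Quotient.mk (Γ.con.rightAct m y)) =
      op (φ Y (Ideal.Quotient.mk _ y)) • ψ Γ (Submodule.Quotient.mk m)
  map_δ₁ {X Y : BdQuivCon k} (Γ : BdQuivCon.Hom X Y) {g : X.Q} {h : Y.Q} (γ : Γ.con.Γ g h) :
    Hom.δ₁ (X := P.obj X) (Y := P.obj Y) (P.map Γ)
      (bcls₁ (ψ Γ (Submodule.Quotient.mk (Γ.con.edgeElt γ)))) =
        ψ Γ (Submodule.Quotient.mk (Γ.con.edgeElt γ))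
  map_δ₂ {X Y : BdQuivCon k} (Γ : BdQuivCon.Hom X Y) {g : X.Q} {h h' : Y.Q} (γ : Γ.con.Γ g h)
    (e : h ⟶ h') :
    ∃ hr : ψ Γ (Submodule.Quotient.mk (Γ.con.edgeEdgeElt γ e)) ∈
        (Hom.bim (X := P.obj X) (Y := P.obj Y) (P.map Γ)).radl,
      (Hom.δ₂ (X := P.obj X) (Y := P.obj Y) (P.map Γ) (bcls₂ ⟨_, hr⟩) :
        Hom.bim (X := P.obj X) (Y := P.obj Y) (P.map Γ)) =
        ψ Γ (Submodule.Quotient.mk (Γ.con.edgeEdgeElt γ e))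
  map₂ {X Y : BdQuivCon k} {Γ Λ : X ⟶ Y} (f : Γ ⟶ Λ) (m : Connection.PathBimodule (BdQuivCon.Hom.con Γ)) :
    lin (Hom.Hom₂.map (P.map₂ f)) (ψ Γ (Submodule.Quotient.mk m)) =
      ψ Λ (Submodule.Quotient.mk (Connection.pathMap f m))
  mapId (X : BdQuivCon k) (v : X.Q) :
    lin (Hom.Hom₂.map (P.mapId X).hom)
      (ψ (𝟙 X) (Submodule.Quotient.mk ((Connection.one X.Q).edgeElt (Connection.gen v)))) =
    toUnit _ (φ X (Ideal.Quotient.mk _ (PathAlgebra.path (Path.nil : Path v v))))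
  mapComp {X Y Z : BdQuivCon k} (Γ : X ⟶ Y) (Λ : Y ⟶ Z) {g : X.Q} {h : Y.Q} {l : Z.Q}
    (γ : (BdQuivCon.Hom.con Γ).Γ g h) (δ : (BdQuivCon.Hom.con Λ).Γ h l) :
    lin (Hom.Hom₂.map (P.mapComp Γ Λ).hom)
      (ψ (Γ ≫ Λ) (Submodule.Quotient.mk (Connection.edgeElt _ (Connection.inj _ _ γ δ)))) =
    tm (ψ Γ (Submodule.Quotient.mk (Connection.edgeElt _ γ)))
      (ψ Λ (Submodule.Quotient.mk (Connection.edgeElt _ δ)))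

end QuiverConnections

end

/-!
The path functor sends a bound quiver `(Q, I)` to `kQ / I` and an ideally connected connection `Γ` to
`M / MJ`, where `M` consists of the combinations of `γ q` with `γ` in `Γ` and `q` a path of the target.
The proof rests on three observations.

*Quiver data are truncated gradings.* The sections `δ¹`, `δ²` of a 1-morphism amount to projections `D₀`
and `D₁` onto parts of degree 0 and 1, multiplicative up to degree 1 (`QuiverData.D₀_mul`,
`QuiverData.D₁_mul`). For `kQ / I` and `M / MJ` these are the parts of path length 0 and 1, which are well
defined because the ideals lie in `R²`. Nothing of degree 2 or more carries any structure besides the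
multiplication, and everything is generated by degrees 0 and 1, since the radical is nilpotent.

*The bimodule `M / MJ` is free on `Γ` from both sides.* It is generated by the elements of `Γ`, subject to
the rule that exchanges edges of the two quivers across `Γ` by means of `U`; this universal property
(`Hom.homLift`) produces all the maps needed, and the coherence laws are checked on generators
(`pathFunctor`). Because `U` is invertible and ideally connected, every element can also be written with
the paths on the left (`sum_ofLeft_toLeft`, `toLeft_leftAct`). A basis of `Γ` is therefore part of a dual
basis for either action, which gives both duals (`isDualizable_bim`). A 2-morphism of connections is
recovered from its map of bimodules, since the elements `γ` and `γ e` are linearly independent in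
`M / MJ` (`gen_injective`, `sum_arrow_injective`), and a map compatible with the quiver data carries
generators to generators (`vertex_part₀`). So the functor is locally fully faithful.

*A dualizable 1-morphism is free on its degree 0 part.* Given a 1-morphism `M` between path algebras, let
`Γ g h` be the space of elements of degree 0 with ends `g` and `h` (`corner`). A dualizable bimodule has dual
bases on both sides, and by Nakayama's lemma a projective module with a minimal set of generators is free
over the vertex idempotents on these generators (`IsNilpotentFiltration.exists_coord`). Radical symmetry
says that the elements of degree 1 are spanned by the products `e γ` and also by the products `γ e`; by
freeness both are direct sums, and comparing them yields `U` (`connection`). Freeness also shows that this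
connection is ideally connected (`isIdeallyConnected_connection`) and that the bimodule it generates is `M`
(`connectionIso`).

For objects, an algebra with quiver data has the quiver whose vertices come from an isomorphism
`A / rad A ≅ kⁿ` and whose edges are bases of the spaces of degree 1 elements between two vertices
(`QuiverData.toBoundQuiver`). Evaluating paths identifies `A` with `kQ / I` (`algEquiv`), and an isomorphism
of algebras that respects quiver data gives an equivalence in `BSA`, by the regular bimodule with one action
twisted (`BSA.nonempty_equivalence`).
-/

noncomputable section

namespace QuiverConnections

/-! ### Dualizable bimodules -/

namespace Bimodule
variable {k : Type u} [Field k] {A B C : Bim k}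

/-- A bimodule from two algebra homomorphisms with commuting values. -/
def ofAlgHoms (A B : Bim k) (P : Type u) [AddCommGroup P] [Module k P]
    (l : A →ₐ[k] Module.End k P) (r : B →ₐ[k] (Module.End k P)ᵐᵒᵖ)
    (comm : ∀ a b m, l a ((r b).unop m) = (r b).unop (l a m)) : Bimodule A B :=
  letI : Module A P := Module.compHom P l.toRingHom
  letI : Module Bᵐᵒᵖ P :=
    { smul := fun b m => (r b.unop).unop m
      one_smul := fun m => by change (r 1).unop m = m; simp
      mul_smul := fun b b' m => by
        change (r (b'.unop * b.unop)).unop m = (r b.unop).unop ((r b'.unop).unop m)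
        simp
      smul_zero := fun b => map_zero _
      smul_add := fun b => map_add _
      add_smul := fun b b' m => by
        change (r (b.unop + b'.unop)).unop m = (r b.unop).unop m + (r b'.unop).unop m
        simp
      zero_smul := fun m => by change (r 0).unop m = 0; simp }
  { carrier := P
    smulComm := ⟨fun a b m => comm a b.unop m⟩
    leftTower := ⟨fun c a m => by
      change l (c • a) m = c • l a m
      simp⟩
    rightTower := ⟨fun c b m => by
      change (r (c • b.unop)).unop m = c • (r b.unop).unop m
      simp⟩ }

section
variable (M : Bimodule A B)

/-- The space of right linear maps `M → B`. -/
def rightDualSpace : Submodule k (M →ₗ[k] B) where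
  carrier := {φ | ∀ m (b : B), φ (op b • m) = φ m * b}
  add_mem' h h' m b := by simp [h m b, h' m b, add_mul]
  zero_mem' m b := by simp
  smul_mem' c φ h m b := by simp [h m b]

/-- The space of left linear maps `M → A`. -/
def leftDualSpace : Submodule k (M →ₗ[k] A) where
  carrier := {φ | ∀ m (a : A), φ (a • m) = a * φ m}
  add_mem' h h' m b := by simp [h m b, h' m b, mul_add]
  zero_mem' m b := by simp
  smul_mem' c φ h m b := by simp [h m b]

/-- The right dual `Hom_B(M, B)`, as a `B`-`A` bimodule. -/
def rightDual : Bimodule B A :=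
  ofAlgHoms B A M.rightDualSpace
    (AlgHom.ofLinearMap
      (LinearMap.mk₂ k (fun (b : B) (φ : M.rightDualSpace) =>
        (⟨LinearMap.mulLeft k b ∘ₗ φ.1, fun m b' => by simp [φ.2 m b', mul_assoc]⟩ :
          M.rightDualSpace))
        (fun _ _ _ => by ext; simp [add_mul]) (fun _ _ _ => by ext; simp)
        (fun _ _ _ => by ext; simp [mul_add]) (fun _ _ _ => by ext; simp))
      (by ext; simp) (fun _ _ => by ext; simp))
    (AlgHom.ofLinearMap
      ((opLinearEquiv k).toLinearMap ∘ₗ LinearMap.mk₂ k (fun (a : A) (φ : M.rightDualSpace) =>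
        (⟨φ.1 ∘ₗ M.lm a, fun m b' => by
          have := φ.2 (a • m) b'
          simpa [smul_comm a (op b') m] using this⟩ : M.rightDualSpace))
        (fun _ _ _ => by ext; simp) (fun _ _ _ => by ext; simp)
        (fun _ _ _ => by ext; simp) (fun _ _ _ => by ext; simp))
      (by apply unop_injective; ext; simp)
      (fun _ _ => by apply unop_injective; ext; simp))
    (fun _ _ _ => by ext; simp)

/-- The left dual `Hom_A(M, A)`, as a `B`-`A` bimodule. -/
def leftDual : Bimodule B A :=
  ofAlgHoms B A M.leftDualSpace
    (AlgHom.ofLinearMap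
      (LinearMap.mk₂ k (fun (b : B) (φ : M.leftDualSpace) =>
        (⟨φ.1 ∘ₗ M.rm b, fun m a => by
          have := φ.2 (op b • m) a
          simpa [smul_comm a (op b) m] using this⟩ : M.leftDualSpace))
        (fun _ _ _ => by ext; simp [add_smul]) (fun _ _ _ => by ext; simp)
        (fun _ _ _ => by ext; simp) (fun _ _ _ => by ext; simp))
      (by ext; simp) (fun _ _ => by ext; simp [mul_smul]))
    (AlgHom.ofLinearMap
      ((opLinearEquiv k).toLinearMap ∘ₗ LinearMap.mk₂ k (fun (a : A) (φ : M.leftDualSpace) =>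
        (⟨LinearMap.mulRight k a ∘ₗ φ.1, fun m a' => by simp [φ.2 m a', mul_assoc]⟩ :
          M.leftDualSpace))
        (fun _ _ _ => by ext; simp [mul_add]) (fun _ _ _ => by ext; simp)
        (fun _ _ _ => by ext; simp [add_mul]) (fun _ _ _ => by ext; simp))
      (by apply unop_injective; ext; simp)
      (fun _ _ => by apply unop_injective; ext; simp [mul_assoc]))
    (fun _ _ _ => by ext; simp)

/-- An element of the right dual, as a linear map. -/
def rightEval : M.rightDual →ₗ[k] M →ₗ[k] B := M.rightDualSpace.subtype

/-- An element of the left dual, as a linear map. -/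
def leftEval : M.leftDual →ₗ[k] M →ₗ[k] A := M.leftDualSpace.subtype

variable {M}

lemma rightEval_op_smul (φ : M.rightDual) (m : M) (b : B) :
    M.rightEval φ (op b • m) = M.rightEval φ m * b := φ.2 m b
lemma rightEval_smul (b : B) (φ : M.rightDual) (m : M) :
    M.rightEval (b • φ) m = b * M.rightEval φ m := rfl
lemma rightEval_smul_op (a : A) (φ : M.rightDual) (m : M) :
    M.rightEval (op a • φ) m = M.rightEval φ (a • m) := rfl
lemma rightDual_ext {φ ψ : M.rightDual} (h : ∀ m, M.rightEval φ m = M.rightEval ψ m) : φ = ψ :=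
  Subtype.ext (LinearMap.ext h)

lemma leftEval_op_smul (φ : M.leftDual) (m : M) (a : A) :
    M.leftEval φ (a • m) = a * M.leftEval φ m := φ.2 m a
lemma leftEval_smul (b : B) (φ : M.leftDual) (m : M) :
    M.leftEval (b • φ) m = M.leftEval φ (op b • m) := rfl
lemma leftEval_smul_op (a : A) (φ : M.leftDual) (m : M) :
    M.leftEval (op a • φ) m = M.leftEval φ m * a := rfl
lemma leftDual_ext {φ ψ : M.leftDual} (h : ∀ m, M.leftEval φ m = M.leftEval ψ m) : φ = ψ :=
  Subtype.ext (LinearMap.ext h)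

lemma rightZigzag_eq {X : Type*} [Bicategory X] {a b : X} {f : a ⟶ b} {g : b ⟶ a}
    (co : 𝟙 a ⟶ f ≫ g) (ev : g ≫ f ⟶ 𝟙 b) :
    Bicategory.rightZigzag co ev = g ◁ co ≫ (α_ g f g).inv ≫ ev ▷ g := by
  rw [Bicategory.rightZigzag]
  bicategory

/-- Evaluation and coevaluation satisfying the triangle identities on elements form an
adjunction. -/
lemma nonempty_adjunction {N : Bimodule B A} {n : ℕ} (x : Fin n → M) (y : Fin n → N)
    (co : Bimodule.unit A ⟶ Bimodule.tensor M N) (hco : lin co (toUnit A 1) = ∑ i, tm (x i) (y i))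
    (ev : Bimodule.tensor N M ⟶ Bimodule.unit B)
    (hx : ∀ m, ∑ i, op ((toUnit B).symm (lin ev (tm (y i) m))) • x i = m)
    (hy : ∀ φ, ∑ i, (toUnit B).symm (lin ev (tm φ (x i))) • y i = φ) :
    Nonempty (Bicategory.Adjunction (B := Bim k) (a := A) (b := B) M N) := by
  have h : ∀ z : Bimodule.unit B, ∀ b, z = toUnit B b → b = (toUnit B).symm z := fun z b h => by
    rw [h, LinearEquiv.symm_apply_apply]
  refine ⟨⟨co, ev, ?_, ?_⟩⟩
  · rw [leftZigzag_eq]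
    refine tensor_hom_ext_left fun m => ?_
    change lin (tensorMap (𝟙 M) ev) (lin (assoc M N M).hom (lin (tensorMap co (𝟙 M))
      (tm (toUnit A 1) m))) = lin (rightUnit M).inv (lin (leftUnit M).hom (tm (toUnit A 1) m))
    rw [tensorMap_tm, hco, leftUnit_hom_tm, rightUnit_inv_apply, one_smul, lin_id]
    have h2 : (tm (∑ i, tm (x i) (y i)) m : tensor (tensor M N) M) =
        ∑ i, tm (tm (x i) (y i)) m := map_sum ((tmₗ (tensor M N) M).flip m) _ _
    rw [h2, map_sum, map_sum]
    simp only [assoc_hom_tm, tensorMap_tm, lin_id]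
    conv_rhs => rw [← hx m]
    refine Eq.trans (Finset.sum_congr rfl fun i _ => ?_)
      (map_sum ((tmₗ M (unit B)).flip (toUnit B 1)) _ _).symm
    obtain ⟨b, hb⟩ := exists_toUnit (lin ev (tm (y i) m))
    rw [hb, LinearMap.flip_apply, tmₗ_apply, LinearEquiv.symm_apply_apply, tm_balanced,
      smul_toUnit, mul_one]
  · rw [rightZigzag_eq]
    refine tensor_hom_ext_right fun φ => ?_
    change lin (tensorMap ev (𝟙 N)) (lin (assoc N M N).inv (lin (tensorMap (𝟙 N) co)
      (tm φ (toUnit A 1)))) = lin (leftUnit N).inv (lin (rightUnit N).hom (tm φ (toUnit A 1)))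
    rw [tensorMap_tm, hco, rightUnit_hom_tm, leftUnit_inv_apply, op_one, one_smul, lin_id]
    have h2 : (tm φ (∑ i, tm (x i) (y i)) : tensor N (tensor M N)) =
        ∑ i, tm φ (tm (x i) (y i)) := map_sum (tmₗ N (tensor M N) φ) _ _
    rw [h2, map_sum, map_sum]
    simp only [assoc_inv_tm, tensorMap_tm, lin_id]
    conv_rhs => rw [← hy φ]
    refine Eq.trans (Finset.sum_congr rfl fun i _ => ?_)
      (map_sum (tmₗ (unit B) N (toUnit B 1)) _ _).symm
    obtain ⟨b, hb⟩ := exists_toUnit (lin ev (tm φ (x i)))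
    rw [hb, tmₗ_apply, LinearEquiv.symm_apply_apply, ← tm_balanced, op_smul_toUnit, one_mul]

/-- The element `∑ xᵢ ⊗ φᵢ` of a dual basis is central, because both of its one-sided translates have the
same coordinates; it therefore defines the coevaluation, and the two dual basis identities are the
triangle identities. -/
lemma nonempty_adjunction_rightDual {n : ℕ} (x : Fin n → M) (φ : Fin n → M.rightDual)
    (hx : ∀ m, ∑ i, op (M.rightEval (φ i) m) • x i = m) :
    Nonempty (Bicategory.Adjunction (B := Bim k) (a := A) (b := B) M M.rightDual) := by
  have hφ : ∀ ψ : M.rightDual, ∑ i, M.rightEval ψ (x i) • φ i = ψ := fun ψ => by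
    refine rightDual_ext fun m => ?_
    conv_rhs => rw [← hx m]
    simp [rightEval_smul, rightEval_op_smul]
  let t : tensor M M.rightDual := ∑ i, tm (x i) (φ i)
  -- centrality: `a xⱼ` is expanded in the `xᵢ`, and the coefficients are moved across the tensor sign
  have ht : ∀ a : A, op a • t = a • t := by
    intro a
    simp only [t, Finset.smul_sum, smul_tm_left, smul_tm_right]
    have h1 : ∀ i, (tm (x i) (op a • φ i) : tensor M M.rightDual) =
        ∑ j, tm (op (M.rightEval (φ i) (a • x j)) • x i) (φ j) := fun i => by
      rw [← hφ (op a • φ i)]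
      refine (map_sum (tmₗ M M.rightDual (x i)) _ _).trans (Finset.sum_congr rfl fun j _ => ?_)
      rw [tmₗ_apply, tm_balanced, rightEval_smul_op]
    simp only [h1]
    rw [Finset.sum_comm]
    refine Finset.sum_congr rfl fun j _ => ?_
    refine (map_sum ((tmₗ M M.rightDual).flip (φ j)) _ _).symm.trans ?_
    rw [hx]
    rfl
  let co : unit A ⟶ tensor M M.rightDual :=
    { toLin := (LinearMap.toSpanSingleton A (tensor M M.rightDual) t).restrictScalars k ∘ₗ
        (toUnit A).symm.toLinearMap
      map_left := fun a m => mul_smul (α := A) a _ t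
      map_right := fun a m => by
        change ((toUnit A).symm m * a) • t = op a • (toUnit A).symm m • t
        rw [← smul_comm _ (op a) t, ht, mul_smul] }
  have hb : IsBalanced (M := M.rightDual) (N := M)
    (LinearMap.compr₂ M.rightEval (toUnit B).toLinearMap) := ⟨fun φ a m => rfl⟩
  let e : tensor M.rightDual M →ₗ[k] unit B := tlift _ hb
  have he : ∀ φ m, e (tm φ m) = toUnit B (M.rightEval φ m) := tlift_tm _ hb
  let ev : tensor M.rightDual M ⟶ unit B :=
    { toLin := e
      map_left := fun b => linearMap_ext (f := e ∘ₗ lm _ b) (g := lm _ b ∘ₗ e) fun φ m => by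
        simp only [LinearMap.comp_apply, lm, Algebra.lsmul_coe, smul_tm_left, he]
        rfl
      map_right := fun b => linearMap_ext (f := e ∘ₗ rm _ b) (g := rm _ b ∘ₗ e) fun φ m => by
        simp only [LinearMap.comp_apply, rm, Algebra.lsmul_coe, smul_tm_right, he]
        exact rightEval_op_smul φ m b }
  have hev : ∀ φ m, lin ev (tm φ m) = toUnit B (M.rightEval φ m) := he
  refine nonempty_adjunction x φ co (one_smul A t) ev (fun m => ?_) (fun ψ => ?_)
  · simp only [hev]
    exact hx m
  · simp only [hev]
    exact hφ ψ

/-- The mirror image of `nonempty_adjunction_rightDual`: the coevaluation is given by the central element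
`∑ φᵢ ⊗ xᵢ`. -/
lemma nonempty_adjunction_leftDual {n : ℕ} (x : Fin n → M) (φ : Fin n → M.leftDual)
    (hx : ∀ m, ∑ i, M.leftEval (φ i) m • x i = m) :
    Nonempty (Bicategory.Adjunction (B := Bim k) (a := B) (b := A) M.leftDual M) := by
  have hφ : ∀ ψ : M.leftDual, ∑ i, op (M.leftEval ψ (x i)) • φ i = ψ := fun ψ => by
    refine leftDual_ext fun m => ?_
    conv_rhs => rw [← hx m]
    simp [leftEval_smul_op, leftEval_op_smul]
  let t : tensor M.leftDual M := ∑ i, tm (φ i) (x i)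
  have ht : ∀ b : B, op b • t = b • t := by
    intro b
    simp only [t, Finset.smul_sum, smul_tm_left, smul_tm_right]
    have h1 : ∀ i, (tm (b • φ i) (x i) : tensor M.leftDual M) =
        ∑ j, tm (φ j) (M.leftEval (φ i) (op b • x j) • x i) := fun i => by
      rw [← hφ (b • φ i)]
      refine (map_sum ((tmₗ M.leftDual M).flip (x i)) _ _).trans
        (Finset.sum_congr rfl fun j _ => ?_)
      rw [LinearMap.flip_apply, tmₗ_apply, tm_balanced, leftEval_smul]
    simp only [h1]
    rw [Finset.sum_comm]
    refine Finset.sum_congr rfl fun j _ => ?_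
    refine Eq.trans ?_ (map_sum (tmₗ M.leftDual M (φ j)) _ _)
    rw [hx]
    rfl
  let co : unit B ⟶ tensor M.leftDual M :=
    { toLin := (LinearMap.toSpanSingleton B (tensor M.leftDual M) t).restrictScalars k ∘ₗ
        (toUnit B).symm.toLinearMap
      map_left := fun b m => mul_smul (α := B) b _ t
      map_right := fun b m => by
        change ((toUnit B).symm m * b) • t = op b • (toUnit B).symm m • t
        rw [← smul_comm _ (op b) t, ht, mul_smul] }
  have hb : IsBalanced (M := M) (N := M.leftDual)
    (LinearMap.compr₂ M.leftEval.flip (toUnit A).toLinearMap) := ⟨fun m b φ => rfl⟩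
  let e : tensor M M.leftDual →ₗ[k] unit A := tlift _ hb
  have he : ∀ m φ, e (tm m φ) = toUnit A (M.leftEval φ m) := tlift_tm _ hb
  let ev : tensor M M.leftDual ⟶ unit A :=
    { toLin := e
      map_left := fun a => linearMap_ext (f := e ∘ₗ lm _ a) (g := lm _ a ∘ₗ e) fun m φ => by
        simp only [LinearMap.comp_apply, lm, Algebra.lsmul_coe, smul_tm_left, he]
        exact leftEval_op_smul φ m a
      map_right := fun a => linearMap_ext (f := e ∘ₗ rm _ a) (g := rm _ a ∘ₗ e) fun m φ => by
        simp only [LinearMap.comp_apply, rm, Algebra.lsmul_coe, smul_tm_right, he]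
        rfl }
  have hev : ∀ m φ, lin ev (tm m φ) = toUnit A (M.leftEval φ m) := he
  refine nonempty_adjunction φ x co (one_smul B t) ev (fun ψ => ?_) (fun m => ?_)
  · simp only [hev]
    exact hφ ψ
  · simp only [hev]
    exact hx m

/-- A bimodule with finite dual bases on both sides is dualizable. -/
lemma isDualizable_of_dual_bases
    (hr : ∃ (n : ℕ) (x : Fin n → M) (φ : Fin n → M →ₗ[k] B),
      (∀ i m b, φ i (op b • m) = φ i m * b) ∧ ∀ m, ∑ i, op (φ i m) • x i = m)
    (hl : ∃ (n : ℕ) (x : Fin n → M) (φ : Fin n → M →ₗ[k] A),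
      (∀ i m a, φ i (a • m) = a * φ i m) ∧ ∀ m, ∑ i, φ i m • x i = m) :
    M.IsDualizable := by
  obtain ⟨n, x, φ, h, hx⟩ := hr
  obtain ⟨n', x', φ', h', hx'⟩ := hl
  exact ⟨⟨_, nonempty_adjunction_rightDual x (fun i => ⟨φ i, h i⟩) hx⟩,
    ⟨_, nonempty_adjunction_leftDual x' (fun i => ⟨φ' i, h' i⟩) hx'⟩⟩

/-- A dualizable bimodule has a finite dual basis on the left. -/
lemma IsDualizable.exists_left_dual_basis (h : M.IsDualizable) :
    ∃ (n : ℕ) (x : Fin n → M) (φ : Fin n → M →ₗ[k] A),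
      (∀ i m a, φ i (a • m) = a * φ i m) ∧ ∀ m, ∑ i, φ i m • x i = m := by
  obtain ⟨-, ⟨N, ⟨adj⟩⟩⟩ := h
  have htri := (rightZigzag_eq adj.unit adj.counit).symm.trans adj.right_triangle
  let co : Bimodule.unit B ⟶ Bimodule.tensor N M := adj.unit
  let ev : Bimodule.tensor M N ⟶ Bimodule.unit A := adj.counit
  obtain ⟨n, y, x, hxy⟩ := exists_tensor_sum (lin co (toUnit B 1))
  refine ⟨n, x, fun i => (toUnit A).symm.toLinearMap ∘ₗ lin ev ∘ₗ (tmₗ M N).flip (y i), ?_, ?_⟩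
  · intro i m a
    change lin ev (tm (a • m) (y i)) = a • lin ev (tm m (y i))
    rw [← smul_tm_left, lin_left]
  · intro m
    have h1 : lin (leftUnit M).hom (lin (tensorMap ev (𝟙 M)) (lin (assoc M N M).inv
        (lin (tensorMap (𝟙 M) co) (tm m (toUnit B 1))))) =
        lin (leftUnit M).hom (lin (leftUnit M).inv (lin (rightUnit M).hom (tm m (toUnit B 1)))) :=
      congrArg (fun f => lin (leftUnit M).hom (lin f (tm m (toUnit B 1)))) htri
    simp only [tensorMap_tm, rightUnit_hom_tm, hxy, lin_id, leftUnit_inv_apply,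
      leftUnit_hom_tm, one_smul, op_one] at h1
    have h2 : (tm m (∑ i, tm (y i) (x i)) : Bimodule.tensor M (Bimodule.tensor N M)) =
        ∑ i, tm m (tm (y i) (x i)) := map_sum (tmₗ M (Bimodule.tensor N M) m) _ _
    rw [h2] at h1
    simp only [map_sum, assoc_inv_tm, tensorMap_tm, lin_id] at h1
    refine Eq.trans ?_ h1
    refine Finset.sum_congr rfl fun i _ => ?_
    exact (leftUnit_hom_tm ((toUnit A).symm (lin ev (tm m (y i)))) (x i)).symm

end
end Bimodule

/-! ### The path algebra and its truncations -/

open Quiver (Path)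

namespace PathAlgebra
variable {k : Type u} [Field k] {Q : FinQuiver.{u}}

/-- The part of a linear combination of paths that consists of paths of length `n`. -/
def degPart (n : ℕ) {a b : Q} : (Path a b →₀ k) →ₗ[k] (Path a b →₀ k) :=
  Finsupp.lsum k fun p => if p.length = n then Finsupp.lsingle p else 0

@[simp] lemma degPart_single (n : ℕ) {a b : Q} (p : Path a b) (r : k) :
    degPart n (Finsupp.single p r) = if p.length = n then Finsupp.single p r else 0 := by
  rw [degPart, Finsupp.lsum_single]
  split_ifs <;> simp

lemma degPart_apply (n : ℕ) {a b : Q} (x : Path a b →₀ k) (p : Path a b) :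
    degPart n x p = if p.length = n then x p else 0 := by
  induction x using Finsupp.induction_linear with
  | zero => simp
  | add x y hx hy => rw [map_add, Finsupp.add_apply, hx, hy, Finsupp.add_apply]; split_ifs <;> simp
  | single q r =>
    rw [degPart_single]
    by_cases h : q = p
    · subst h; split_ifs <;> simp
    · split_ifs <;> simp [Finsupp.single_eq_of_ne' h]

lemma degPart_zero_concat {a b c : Q} (x : Path a b →₀ k) (y : Path b c →₀ k) :
    degPart 0 (concat a b c x y) = concat a b c (degPart 0 x) (degPart 0 y) := by
  induction x using Finsupp.induction_linear with
  | zero => simp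
  | add x x' hx hx' => simp [hx, hx']
  | single p r =>
    induction y using Finsupp.induction_linear with
    | zero => simp
    | add y y' hy hy' => simp only [map_add, hy, hy']
    | single q s =>
      rw [concat_single, degPart_single, degPart_single, degPart_single, Path.length_comp]
      by_cases hp : p.length = 0 <;> by_cases hq : q.length = 0 <;> simp [hp, hq]

lemma degPart_one_concat {a b c : Q} (x : Path a b →₀ k) (y : Path b c →₀ k) :
    degPart 1 (concat a b c x y) =
      concat a b c (degPart 0 x) (degPart 1 y) + concat a b c (degPart 1 x) (degPart 0 y) := by
  induction x using Finsupp.induction_linear with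
  | zero => simp
  | add x x' hx hx' => simp only [map_add, LinearMap.add_apply, hx, hx']; abel
  | single p r =>
    induction y using Finsupp.induction_linear with
    | zero => simp
    | add y y' hy hy' => simp only [map_add, hy, hy']; abel
    | single q s =>
      simp only [concat_single, degPart_single, Path.length_comp]
      by_cases hp : p.length = 0
      · by_cases hq : q.length = 1 <;> simp [hp, hq, -Finsupp.single_mul]
      · by_cases hp' : p.length = 1 <;> by_cases hq : q.length = 0
        · simp [hp', hq]
        · simp [hp', hq]
        · simp [hp, hp', hq]
        · have : p.length + q.length ≠ 1 := by omega
          simp [hp, hp', hq, this]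

/-- The homogeneous part of degree `n` of an element of the path algebra. -/
def deg (n : ℕ) : PathAlgebra k Q →ₗ[k] PathAlgebra k Q where
  toFun x a b := degPart n (x a b)
  map_add' x y := by ext1 a b; exact map_add _ _ _
  map_smul' r x := by ext1 a b; exact map_smul (degPart n) _ _

lemma deg_apply (n : ℕ) (x : PathAlgebra k Q) (a b : Q) : deg n x a b = degPart n (x a b) := rfl

lemma deg_zero_mul (x y : PathAlgebra k Q) : deg 0 (x * y) = deg 0 x * deg 0 y := by
  ext1 a c
  simp only [deg_apply, mul_apply, map_sum, degPart_zero_concat]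

lemma deg_one_mul (x y : PathAlgebra k Q) :
    deg 1 (x * y) = deg 0 x * deg 1 y + deg 1 x * deg 0 y := by
  ext1 a c
  simp only [deg_apply, mul_apply, map_sum, degPart_one_concat, add_apply,
    Finset.sum_add_distrib]

lemma of_apply_same {a b : Q} (x : Path a b →₀ k) : of a b x a b = x := by
  change Pi.single (M := fun a : Q => ∀ b : Q, Path a b →₀ k) a
    (Pi.single (M := fun b : Q => Path a b →₀ k) b x) a b = x
  rw [Pi.single_eq_same, Pi.single_eq_same]

lemma of_apply_of_ne {a b a' b' : Q} (x : Path a b →₀ k) (h : ¬ (a = a' ∧ b = b')) :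
    of a b x a' b' = 0 := by
  change Pi.single (M := fun a : Q => ∀ b : Q, Path a b →₀ k) a
    (Pi.single (M := fun b : Q => Path a b →₀ k) b x) a' b' = 0
  by_cases ha : a = a'
  · subst ha
    rw [Pi.single_eq_same, Pi.single_eq_of_ne fun hb => h ⟨rfl, hb.symm⟩]
  · rw [Pi.single_eq_of_ne (Ne.symm ha)]
    rfl

lemma deg_of (n : ℕ) {a b : Q} (x : Path a b →₀ k) : deg n (of a b x) = of a b (degPart n x) := by
  ext1 a' b'
  rw [deg_apply]
  by_cases h : a = a' ∧ b = b'
  · obtain ⟨rfl, rfl⟩ := h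
    rw [of_apply_same, of_apply_same]
  · rw [of_apply_of_ne _ h, of_apply_of_ne _ h, map_zero]

lemma of_mul_of {a b c : Q} (x : Path a b →₀ k) (y : Path b c →₀ k) :
    of a b x * of b c y = of a c (concat a b c x y) := by
  ext1 a' c'
  rw [mul_apply]
  by_cases h : a = a' ∧ c = c'
  · obtain ⟨rfl, rfl⟩ := h
    rw [of_apply_same, Finset.sum_eq_single b]
    · rw [of_apply_same, of_apply_same]
    · intro b' _ hb
      rw [of_apply_of_ne x fun h => hb h.2.symm, map_zero, LinearMap.zero_apply]
    · simp
  · rw [of_apply_of_ne _ h]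
    refine Finset.sum_eq_zero fun b' _ => ?_
    by_cases ha : a = a'
    · rw [of_apply_of_ne y fun hh => h ⟨ha, hh.2⟩, map_zero]
    · rw [of_apply_of_ne x fun hh => ha hh.1, map_zero, LinearMap.zero_apply]

lemma of_mul_of_ne {a b b' c : Q} (h : b ≠ b') (x : Path a b →₀ k) (y : Path b' c →₀ k) :
    of a b x * of b' c y = 0 := by
  ext1 a' c'
  rw [mul_apply]
  refine Finset.sum_eq_zero fun d _ => ?_
  by_cases hd : b = d
  · rw [of_apply_of_ne y fun hh => h (hd.trans hh.1.symm), map_zero]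
  · rw [of_apply_of_ne x fun hh => hd hh.2, map_zero, LinearMap.zero_apply]

/-- The vertex `v`, as an element of the path algebra. -/
abbrev vertex (v : Q) : PathAlgebra k Q := path (Path.nil : Path v v)

/-- The edge `e`, as an element of the path algebra. -/
abbrev arrow {v w : Q} (e : v ⟶ w) : PathAlgebra k Q := path e.toPath

lemma path_mul_path {a b c : Q} (p : Path a b) (q : Path b c) :
    (path p * path q : PathAlgebra k Q) = path (p.comp q) := by
  rw [path, path, of_mul_of, concat_single, mul_one, path]

lemma path_mul_path_of_ne {a b b' c : Q} (h : b ≠ b') (p : Path a b) (q : Path b' c) :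
    (path p * path q : PathAlgebra k Q) = 0 := of_mul_of_ne h _ _

lemma path_cons {a b c : Q} (p : Path a b) (e : b ⟶ c) :
    (path (p.cons e) : PathAlgebra k Q) = path p * arrow e := by
  rw [path_mul_path]; rfl

lemma vertex_mul_vertex (v w : Q) :
    (vertex v * vertex w : PathAlgebra k Q) = if v = w then vertex v else 0 := by
  split_ifs with h
  · subst h; exact path_mul_path _ _
  · exact path_mul_path_of_ne h _ _

lemma of_eq_smul_path {a b : Q} (p : Path a b) (r : k) :
    of a b (Finsupp.single p r) = r • path p := by
  rw [path, ← map_smul, Finsupp.smul_single, smul_eq_mul, mul_one]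

lemma sum_of (x : PathAlgebra k Q) : ∑ a, ∑ b, of a b (x a b) = x := by
  ext1 a b
  have h (f : Q → PathAlgebra k Q) (a b : Q) : (∑ i, f i) a b = ∑ i, f i a b :=
    map_sum (AddMonoidHom.mk' (fun x : PathAlgebra k Q => x a b) fun _ _ => rfl) _ _
  rw [h, Finset.sum_eq_single a, h, Finset.sum_eq_single b, of_apply_same]
  · intro b' _ hb
    exact of_apply_of_ne _ fun hh => hb hh.2
  · simp
  · intro a' _ ha
    rw [h]
    exact Finset.sum_eq_zero fun b' _ => of_apply_of_ne _ fun hh => ha hh.1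
  · simp

lemma sum_vertex : ∑ v : Q, (vertex v : PathAlgebra k Q) = 1 := by
  rw [← sum_of (1 : PathAlgebra k Q)]
  refine Finset.sum_congr rfl fun v _ => ?_
  rw [Finset.sum_eq_single v]
  · rw [one_apply, Pi.single_eq_same]; rfl
  · intro b _ hb
    rw [one_apply, Pi.single_eq_of_ne hb, map_zero]
  · simp

/-- Paths span the path algebra. -/
lemma path_induction {p : PathAlgebra k Q → Prop} (path : ∀ {a b : Q} (q : Path a b), p (path q))
    (zero : p 0) (add : ∀ x y, p x → p y → p (x + y)) (smul : ∀ (r : k) x, p x → p (r • x))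
    (x : PathAlgebra k Q) : p x := by
  rw [← sum_of x]
  refine Finset.sum_induction _ p add zero fun a _ => Finset.sum_induction _ p add zero fun b _ => ?_
  induction x a b using Finsupp.induction_linear with
  | zero => rw [map_zero]; exact zero
  | add y y' h h' => rw [map_add]; exact add _ _ h h'
  | single q r => rw [of_eq_smul_path]; exact smul _ _ (path q)

/-- The path algebra is generated by the vertices and the edges. -/
lemma generator_induction {p : PathAlgebra k Q → Prop} (vertex : ∀ v : Q, p (vertex v))
    (arrow : ∀ {a b : Q} (e : a ⟶ b), p (arrow e))
    (zero : p 0) (add : ∀ x y, p x → p y → p (x + y)) (smul : ∀ (r : k) x, p x → p (r • x))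
    (mul : ∀ x y, p x → p y → p (x * y)) (x : PathAlgebra k Q) : p x := by
  refine path_induction (fun {a b} q => ?_) zero add smul x
  induction q with
  | nil => exact vertex a
  | cons q e ih => rw [path_cons]; exact mul _ _ ih (arrow e)

lemma vertex_mul_mul_vertex (x : PathAlgebra k Q) (v w : Q) :
    vertex v * x * vertex w = of v w (x v w) := by
  conv_lhs => rw [← sum_of x]
  rw [Finset.mul_sum, Finset.sum_mul, Finset.sum_eq_single v, Finset.mul_sum, Finset.sum_mul,
    Finset.sum_eq_single w]
  · rw [vertex, path, of_mul_of, vertex, path, of_mul_of, nil_concat, concat_nil]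
  · intro b _ hb
    rw [mul_assoc, vertex, vertex, path, path, of_mul_of_ne hb, mul_zero]
  · simp
  · intro a _ ha
    rw [Finset.mul_sum, Finset.sum_mul]
    refine Finset.sum_eq_zero fun b _ => ?_
    rw [vertex, path, of_mul_of_ne ha.symm, zero_mul]
  · simp

lemma of_mem {I : Ideal (PathAlgebra k Q)} [I.IsTwoSided] {x : PathAlgebra k Q} (hx : x ∈ I)
    (v w : Q) : of v w (x v w) ∈ I := by
  rw [← vertex_mul_mul_vertex]
  exact Ideal.mul_mem_right _ _ (Ideal.mul_mem_left _ _ hx)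

lemma deg_path (n : ℕ) {a b : Q} (p : Path a b) :
    deg n (path p : PathAlgebra k Q) = if p.length = n then path p else 0 := by
  rw [path, deg_of, degPart_single]
  split_ifs
  · rfl
  · rw [map_zero]

lemma deg_deg (m n : ℕ) (x : PathAlgebra k Q) : deg m (deg n x) = if m = n then deg n x else 0 := by
  induction x using path_induction with
  | path q =>
    rw [deg_path]
    split_ifs with h h' h'
    · rw [deg_path, if_pos (h.trans h'.symm)]
    · rw [deg_path, if_neg (by omega)]
    · rw [map_zero]
    · rw [map_zero]
  | zero => simp
  | add x y hx hy => rw [map_add, map_add, hx, hy]; split_ifs <;> simp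
  | smul r x hx => rw [map_smul, map_smul, hx]; split_ifs <;> simp

/-- The span of the paths of length at least `n`. -/
def lengthGE (k : Type u) [Field k] (Q : FinQuiver.{u}) (n : ℕ) : Submodule k (PathAlgebra k Q) :=
  Submodule.span k {x | ∃ (a b : Q) (p : Path a b), n ≤ p.length ∧ x = path p}

lemma path_mem_lengthGE {n : ℕ} {a b : Q} {p : Path a b} (h : n ≤ p.length) :
    path p ∈ lengthGE k Q n := Submodule.subset_span ⟨a, b, p, h, rfl⟩

lemma mul_mem_lengthGE {m n : ℕ} {x y : PathAlgebra k Q} (hx : x ∈ lengthGE k Q m)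
    (hy : y ∈ lengthGE k Q n) : x * y ∈ lengthGE k Q (m + n) := by
  induction hx using Submodule.span_induction with
  | zero => rw [zero_mul]; exact zero_mem _
  | add x x' _ _ h h' => rw [add_mul]; exact add_mem h h'
  | smul r x _ h => rw [smul_mul_assoc]; exact Submodule.smul_mem _ _ h
  | mem x hx =>
    obtain ⟨a, b, p, hp, rfl⟩ := hx
    induction hy using Submodule.span_induction with
    | zero => rw [mul_zero]; exact zero_mem _
    | add x x' _ _ h h' => rw [mul_add]; exact add_mem h h'
    | smul r x _ h => rw [mul_smul_comm]; exact Submodule.smul_mem _ _ h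
    | mem y hy =>
      obtain ⟨b', c, q, hq, rfl⟩ := hy
      by_cases h : b = b'
      · subst h
        rw [path_mul_path]
        exact path_mem_lengthGE (by rw [Path.length_comp]; omega)
      · rw [path_mul_path_of_ne h]
        exact zero_mem _

lemma sub_deg_zero_mem (x : PathAlgebra k Q) : x - deg 0 x ∈ lengthGE k Q 1 := by
  induction x using path_induction with
  | path q =>
    rw [deg_path]
    split_ifs with h
    · rw [sub_self]; exact zero_mem _
    · rw [sub_zero]; exact path_mem_lengthGE (by omega)
  | zero => simp
  | add x y hx hy => rw [map_add, add_sub_add_comm]; exact add_mem hx hy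
  | smul r x hx => rw [map_smul, ← smul_sub]; exact Submodule.smul_mem _ _ hx

lemma sub_deg_one_mem (x : PathAlgebra k Q) : x - deg 0 x - deg 1 x ∈ lengthGE k Q 2 := by
  induction x using path_induction with
  | path q =>
    rw [deg_path, deg_path]
    split_ifs with h h' h'
    · omega
    · simp
    · simp
    · rw [sub_zero, sub_zero]; exact path_mem_lengthGE (by omega)
  | zero => simp
  | add x y hx hy => rw [map_add, map_add, add_sub_add_comm, add_sub_add_comm]; exact add_mem hx hy
  | smul r x hx => rw [map_smul, map_smul, ← smul_sub, ← smul_sub]; exact Submodule.smul_mem _ _ hx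

lemma deg_eq_zero_of_mem {m n : ℕ} (h : m < n) {x : PathAlgebra k Q} (hx : x ∈ lengthGE k Q n) :
    deg m x = 0 := by
  induction hx using Submodule.span_induction with
  | zero => simp
  | add x x' _ _ h h' => rw [map_add, h, h', add_zero]
  | smul r x _ h => rw [map_smul, h, smul_zero]
  | mem x hx =>
    obtain ⟨a, b, p, hp, rfl⟩ := hx
    rw [deg_path, if_neg (by omega)]

/-- The coefficients of the vertices in an element of the path algebra. -/
def nilCoeff : PathAlgebra k Q →ₗ[k] (Q → k) where
  toFun x v := x v v Path.nil
  map_add' _ _ := rfl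
  map_smul' _ _ := rfl

lemma nilCoeff_apply (x : PathAlgebra k Q) (v : Q) : nilCoeff x v = x v v Path.nil := rfl

lemma nilCoeff_vertex (v : Q) : nilCoeff (vertex v : PathAlgebra k Q) = Pi.single v 1 := by
  funext w
  rw [nilCoeff_apply]
  by_cases h : v = w
  · subst h
    rw [vertex, path, of_apply_same, Finsupp.single_eq_same, Pi.single_eq_same]
  · rw [vertex, path, of_apply_of_ne _ fun hh => h hh.1, Pi.single_eq_of_ne (Ne.symm h)]
    rfl

lemma nilCoeff_deg_zero (x : PathAlgebra k Q) : nilCoeff (deg 0 x) = nilCoeff x := by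
  funext v
  rw [nilCoeff_apply, deg_apply, degPart_apply, if_pos (by rfl)]
  rfl

lemma nilCoeff_eq_zero {x : PathAlgebra k Q} (hx : deg 0 x = 0) : nilCoeff x = 0 := by
  rw [← nilCoeff_deg_zero, hx, map_zero]

lemma single_mul_single_of_ne {v w : Q} (h : v ≠ w) :
    (Pi.single v 1 * Pi.single w 1 : Q → k) = 0 := by
  funext i
  by_cases hi : i = v
  · rw [Pi.mul_apply, Pi.single_eq_of_ne (fun h' => h (hi.symm.trans h')), mul_zero, Pi.zero_apply]
  · rw [Pi.mul_apply, Pi.single_eq_of_ne hi, zero_mul, Pi.zero_apply]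

lemma nilCoeff_mul (x y : PathAlgebra k Q) : nilCoeff (x * y) = nilCoeff x * nilCoeff y := by
  induction x using path_induction with
  | zero => simp
  | add x y hx hy => rw [add_mul, map_add, hx, hy, map_add, add_mul]
  | smul r x hx => rw [smul_mul_assoc, map_smul, hx, map_smul, smul_mul_assoc]
  | path p =>
    induction y using path_induction with
    | zero => simp
    | add x y hx hy => rw [mul_add, map_add, hx, hy, map_add, mul_add]
    | smul r x hx => rw [mul_smul_comm, map_smul, hx, map_smul, mul_smul_comm]
    | path q =>
      have h1 : ∀ {n : ℕ} {z : PathAlgebra k Q}, z ∈ lengthGE k Q n → 0 < n → nilCoeff z = 0 :=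
        fun h hn => nilCoeff_eq_zero (deg_eq_zero_of_mem hn h)
      cases p with
      | cons p e =>
        have hp : path (p.cons e) ∈ lengthGE k Q (p.length + 1) := path_mem_lengthGE le_rfl
        rw [h1 hp (by omega), zero_mul]
        exact h1 (mul_mem_lengthGE hp (path_mem_lengthGE (Nat.zero_le q.length))) (by omega)
      | nil =>
        cases q with
        | cons q e =>
          have hq : path (q.cons e) ∈ lengthGE k Q (q.length + 1) := path_mem_lengthGE le_rfl
          rw [h1 hq (by omega), mul_zero]
          exact h1 (mul_mem_lengthGE (path_mem_lengthGE (Nat.zero_le _)) hq) (by omega)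
        | nil =>
          rw [vertex_mul_vertex, nilCoeff_vertex, nilCoeff_vertex]
          split_ifs with h
          · subst h
            rw [nilCoeff_vertex, ← Pi.single_mul, mul_one]
          · rw [map_zero]
            exact (single_mul_single_of_ne h).symm

lemma nilCoeff_one : nilCoeff (1 : PathAlgebra k Q) = 1 := by
  funext v
  rw [nilCoeff_apply, one_apply, Pi.single_eq_same, Finsupp.single_eq_same, Pi.one_apply]

lemma deg_zero_eq_sum (x : PathAlgebra k Q) : deg 0 x = ∑ v, nilCoeff x v • vertex v := by
  induction x using path_induction with
  | zero => simp
  | add x y hx hy => simp [hx, hy, add_smul, Finset.sum_add_distrib]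
  | smul r x hx => simp [hx, Finset.smul_sum, mul_smul]
  | path q =>
    cases q with
    | nil =>
      rw [deg_path, if_pos (by rfl), nilCoeff_vertex, Finset.sum_eq_single]
      · rw [Pi.single_eq_same, one_smul]
      · intro b _ hb
        rw [Pi.single_eq_of_ne hb, zero_smul]
      · simp
    | cons q e =>
      have h : deg 0 (path (q.cons e) : PathAlgebra k Q) = 0 := by
        rw [deg_path, if_neg (by simp)]
      rw [h, nilCoeff_eq_zero h]
      simp

end PathAlgebra

namespace IsAdmissible
open PathAlgebra
variable {k : Type u} [Field k] {Q : FinQuiver.{u}} {I : Ideal (PathAlgebra k Q)}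

lemma deg_eq_zero (h : IsAdmissible I) {x : PathAlgebra k Q} (hx : x ∈ I) {n : ℕ} (hn : n < 2) :
    deg n x = 0 := by
  ext1 a b
  ext p
  rw [deg_apply, degPart_apply]
  split_ifs with hp
  · by_contra hne
    have := h.two_le_length x hx a b p hne
    omega
  · rfl

lemma exists_lengthGE (h : IsAdmissible I) :
    ∃ n : ℕ, ∀ x ∈ lengthGE k Q n, x ∈ I := by
  obtain ⟨n, hn⟩ := h.exists_length
  refine ⟨n, fun x hx => ?_⟩
  have : lengthGE k Q n ≤ I.restrictScalars k := by
    rw [lengthGE, Submodule.span_le]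
    rintro _ ⟨a, b, p, hp, rfl⟩
    exact hn a b p hp
  exact this hx

end IsAdmissible

/-! ### Quiver data from truncated gradings; the algebra of a bound quiver -/

open Quiver (Path)

/-- A linear map out of a quotient by a submodule over a `k`-algebra, linear over `k` only. -/
def liftRestrict {k A M N : Type*} [Field k] [Ring A] [Algebra k A] [AddCommGroup M] [Module k M]
    [Module A M] [IsScalarTower k A M] [AddCommGroup N] [Module k N] (p : Submodule A M)
    (f : M →ₗ[k] N) (h : ∀ m ∈ p, f m = 0) : (M ⧸ p) →ₗ[k] N :=
  (p.restrictScalars k).liftQ f h ∘ₗ (Submodule.Quotient.restrictScalarsEquiv k p).symm.toLinearMap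

section
variable {k A : Type u} [Field k] [Ring A] [Algebra k A]

/-- Quiver data from the parts `D₀` and `D₁` of degree `0` and `1` of a truncated grading. -/
def QuiverData.ofMaps (D₀ D₁ : A →ₗ[k] A) (h₀ : ∀ x ∈ rad A, D₀ x = 0)
    (s₀ : ∀ x, D₀ x - x ∈ rad A) (h₁ : ∀ x ∈ rad A * rad A, D₁ x = 0)
    (s₁ : ∀ x ∈ rad A, D₁ x - x ∈ rad A * rad A) (m₀ : ∀ x y, D₀ (x * y) = D₀ x * D₀ y)
    (m₁ : ∀ x y, D₁ (x * y) = D₀ x * D₁ y + D₁ x * D₀ y) : QuiverData k A where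
  δ₁ := liftRestrict (rad A) D₀ h₀
  δ₂ := liftRestrict ((rad A * rad A).submoduleOf (rad A))
    ((D₁ ∘ₗ ((rad A).restrictScalars k).subtype).codRestrict ((rad A).restrictScalars k) fun r => by
      have := add_mem (Ideal.mul_le_left (s₁ r r.2)) r.2
      rwa [sub_add_cancel] at this)
    fun r hr => Subtype.ext (h₁ r hr)
  section₁ x := by
    obtain ⟨a, rfl⟩ := Ideal.Quotient.mk_surjective x
    exact Ideal.Quotient.eq.2 (s₀ a)
  section₂ z := by
    obtain ⟨r, rfl⟩ := Submodule.Quotient.mk_surjective _ z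
    exact (Submodule.Quotient.eq ((rad A * rad A).submoduleOf (rad A))).2 (s₁ r r.2)
  map_mul x y := by
    obtain ⟨a, rfl⟩ := Ideal.Quotient.mk_surjective x
    obtain ⟨b, rfl⟩ := Ideal.Quotient.mk_surjective y
    exact m₀ a b
  equivariant x y r := by
    obtain ⟨a, rfl⟩ := Ideal.Quotient.mk_surjective x
    obtain ⟨b, rfl⟩ := Ideal.Quotient.mk_surjective y
    have h00 : ∀ x, D₀ (D₀ x) = D₀ x := fun x => by
      rw [← sub_eq_zero, ← map_sub, h₀ _ (s₀ x)]
    change D₁ (D₀ a * r * D₀ b) = D₀ a * D₁ r * D₀ b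
    rw [m₁, m₁, m₀, h₀ _ r.2, h00, h00, mul_zero, zero_mul, mul_zero, add_zero, zero_add]

namespace QuiverData
variable (d : QuiverData k A)

/-- The part of degree `0` of an element of an algebra with quiver data. -/
def D₀ : A →ₗ[k] A := d.δ₁ ∘ₗ (Ideal.Quotient.mkₐ k (rad A)).toLinearMap

lemma D₀_apply (a : A) : d.D₀ a = d.δ₁ (cls₁ a) := rfl

/-- The part of degree `1` of an element of an algebra with quiver data. -/
def D₁ : A →ₗ[k] A where
  toFun a := d.δ₂ (cls₂ ⟨a - d.δ₁ (cls₁ a), d.sub_mem a⟩)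
  map_add' a b := by
    rw [← Submodule.coe_add, ← map_add, ← Submodule.Quotient.mk_add]
    congr 4
    change a + b - d.D₀ (a + b) = (a - d.D₀ a) + (b - d.D₀ b)
    rw [map_add]; abel
  map_smul' r a := by
    rw [RingHom.id_apply, ← Submodule.coe_smul_of_tower, ← map_smul, ← Submodule.Quotient.mk_smul]
    congr 4
    change r • a - d.D₀ (r • a) = r • (a - d.D₀ a)
    rw [map_smul, smul_sub]

lemma D₁_apply (a : A) : d.D₁ a = d.δ₂ (cls₂ ⟨a - d.δ₁ (cls₁ a), d.sub_mem a⟩) := rfl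

lemma D₀_mul (x y : A) : d.D₀ (x * y) = d.D₀ x * d.D₀ y := by
  exact (congrArg d.δ₁ (_root_.map_mul (Ideal.Quotient.mk (rad A)) x y)).trans (d.map_mul _ _)

lemma D₀_eq_zero {x : A} (h : x ∈ rad A) : d.D₀ x = 0 := by
  rw [D₀_apply, cls₁, Ideal.Quotient.eq_zero_iff_mem.2 h, map_zero]

lemma D₀_sub_mem (x : A) : x - d.D₀ x ∈ rad A := d.sub_mem x

lemma D₀_D₀ (x : A) : d.D₀ (d.D₀ x) = d.D₀ x := by
  rw [D₀_apply, D₀_apply, d.section₁]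

lemma D₁_of_mem {r : A} (hr : r ∈ rad A) : d.D₁ r = d.δ₂ (cls₂ ⟨r, hr⟩) := by
  rw [D₁_apply]
  congr 3
  refine Subtype.ext ?_
  change r - d.D₀ r = r
  rw [d.D₀_eq_zero hr, sub_zero]

lemma D₁_mem (x : A) : d.D₁ x ∈ rad A := (d.δ₂ _).2

lemma D₁_sub_mem {r : A} (hr : r ∈ rad A) : d.D₁ r - r ∈ rad A * rad A := by
  rw [D₁_of_mem d hr]; exact d.sub_mem₂ ⟨r, hr⟩

lemma D₁_eq_zero {r : A} (hr : r ∈ rad A * rad A) : d.D₁ r = 0 := by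
  rw [d.D₁_of_mem (Ideal.mul_le_left hr), cls₂,
    (Submodule.Quotient.mk_eq_zero ((rad A * rad A).submoduleOf (rad A))).2 hr, map_zero,
    Submodule.coe_zero]

lemma D₁_D₁ (x : A) : d.D₁ (d.D₁ x) = d.D₁ x := by
  rw [d.D₁_of_mem (d.D₁_mem x)]
  refine congrArg (fun z => (d.δ₂ z : A)) ?_
  exact d.section₂ (cls₂ ⟨x - d.δ₁ (cls₁ x), d.sub_mem x⟩)

lemma D₁_D₀ (x : A) : d.D₁ (d.D₀ x) = 0 := by
  rw [D₁_apply]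
  have : (⟨d.D₀ x - d.δ₁ (cls₁ (d.D₀ x)), d.sub_mem _⟩ : rad A) = 0 := Subtype.ext (by
    change d.D₀ x - d.D₀ (d.D₀ x) = 0
    rw [D₀_D₀, sub_self])
  rw [this, cls₂, Submodule.Quotient.mk_zero, map_zero, Submodule.coe_zero]

lemma D₁_mul (x y : A) : d.D₁ (x * y) = d.D₀ x * d.D₁ y + d.D₁ x * d.D₀ y := by
  have hx := d.D₀_sub_mem x
  have hy := d.D₀_sub_mem y
  have e1 : d.D₁ (d.D₀ x * (y - d.D₀ y)) = d.D₀ x * d.D₁ y := by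
    rw [d.D₁_of_mem (Ideal.mul_mem_left _ _ hy)]
    exact d.δ₂_left (cls₁ x) ⟨_, hy⟩
  have e2 : d.D₁ ((x - d.D₀ x) * d.D₀ y) = d.D₁ x * d.D₀ y := by
    rw [d.D₁_of_mem (Ideal.mul_mem_right _ _ hx)]
    exact d.δ₂_right (cls₁ y) ⟨_, hx⟩
  have e3 : x * y = d.D₀ (x * y) + d.D₀ x * (y - d.D₀ y) + (x - d.D₀ x) * d.D₀ y +
      (x - d.D₀ x) * (y - d.D₀ y) := by
    rw [D₀_mul]; noncomm_ring
  rw [e3, map_add, map_add, map_add, D₁_D₀, e1, e2, d.D₁_eq_zero (Ideal.mul_mem_mul hx hy),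
    zero_add, add_zero]

end QuiverData

/-- An element which generates a nil left ideal lies in the radical. -/
lemma mem_rad_of_isNilpotent {A : Type u} [Ring A] {x : A} (h : ∀ y, IsNilpotent (y * x)) :
    x ∈ rad A := by
  rw [rad, Ring.jacobson_eq_sInf_isMaximal, Ideal.mem_sInf]
  intro m hm
  by_contra hx
  have : m ⊔ Ideal.span {x} = ⊤ :=
    hm.1.2 _ (lt_of_le_of_ne le_sup_left fun he => hx (he ▸ Ideal.mem_sup_right
      (Ideal.subset_span rfl)))
  obtain ⟨μ, hμ, z, hz, h1⟩ := Submodule.mem_sup.1 ((Ideal.eq_top_iff_one _).1 this)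
  obtain ⟨y, rfl⟩ := Ideal.mem_span_singleton'.1 hz
  have hu : IsUnit μ := by
    rw [eq_sub_of_add_eq h1]
    exact (h y).isUnit_one_sub
  exact hm.1.1 (Ideal.eq_top_of_isUnit_mem _ hμ hu)

lemma eq_zero_of_isIdempotentElem_of_isNilpotent {A : Type u} [Ring A] {x : A}
    (h : IsIdempotentElem x) (h' : IsNilpotent x) : x = 0 := by
  obtain ⟨n, hn⟩ := h'
  rw [← h.pow_succ_eq n, pow_succ, hn, zero_mul]

end

namespace BdQuivCon
open PathAlgebra
variable {k : Type u} [Field k] (X : BdQuivCon k)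

/-- The algebra `kQ/I` of a bound quiver. -/
def alg : Bim k := ⟨PathAlgebra k X.Q ⧸ X.I⟩

/-- The projection `kQ → kQ/I`. -/
def proj : PathAlgebra k X.Q →ₐ[k] X.alg := Ideal.Quotient.mkₐ k X.I

lemma proj_surjective : Function.Surjective X.proj := Ideal.Quotient.mk_surjective

lemma proj_eq_zero {x : PathAlgebra k X.Q} : X.proj x = 0 ↔ x ∈ X.I := Ideal.Quotient.eq_zero_iff_mem

/-- A linear map out of `kQ/I`. -/
def algLift {N : Type*} [AddCommGroup N] [Module k N] (f : PathAlgebra k X.Q →ₗ[k] N)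
    (h : ∀ x ∈ X.I, f x = 0) : X.alg →ₗ[k] N :=
  liftRestrict X.I f h

/-- The homogeneous parts of degree `0` and `1` of an element of `kQ/I`. -/
def D (n : Fin 2) : X.alg →ₗ[k] X.alg :=
  X.algLift (X.proj.toLinearMap ∘ₗ deg n) fun x hx => by
    rw [LinearMap.comp_apply, X.admissible.deg_eq_zero hx n.2, map_zero]

lemma D_proj (n : Fin 2) (x : PathAlgebra k X.Q) : X.D n (X.proj x) = X.proj (deg n x) := rfl

/-- The coefficients of the vertices in an element of `kQ/I`. -/
def vertexCoeff : X.alg →ₐ[k] (X.Q → k) :=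
  AlgHom.ofLinearMap
    (X.algLift nilCoeff fun x hx => nilCoeff_eq_zero (X.admissible.deg_eq_zero hx two_pos))
    nilCoeff_one
    (by
      intro a b
      obtain ⟨x, rfl⟩ := X.proj_surjective a
      obtain ⟨y, rfl⟩ := X.proj_surjective b
      exact nilCoeff_mul x y)

lemma vertexCoeff_proj (x : PathAlgebra k X.Q) : X.vertexCoeff (X.proj x) = nilCoeff x := rfl

lemma isNilpotent_proj {x : PathAlgebra k X.Q} (h : deg 0 x = 0) : IsNilpotent (X.proj x) := by
  obtain ⟨n, hn⟩ := X.admissible.exists_lengthGE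
  refine ⟨n, ?_⟩
  rw [← map_pow, proj_eq_zero]
  have h1 : x ∈ lengthGE k X.Q 1 := by
    have := sub_deg_zero_mem x
    rwa [h, sub_zero] at this
  have h2 : ∀ m, x ^ m ∈ lengthGE k X.Q m := fun m => by
    induction m with
    | zero =>
      rw [pow_zero, ← sum_vertex]
      exact sum_mem fun v _ => path_mem_lengthGE (Nat.zero_le _)
    | succ m ih => rw [pow_succ]; exact mul_mem_lengthGE ih h1
  exact hn _ (h2 n)

lemma proj_mem_rad {x : PathAlgebra k X.Q} : X.proj x ∈ rad X.alg ↔ deg 0 x = 0 := by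
  constructor
  · intro h
    have h1 : X.proj x ∈ Ideal.comap X.vertexCoeff.toRingHom (Ring.jacobson (X.Q → k)) := by
      have hs : Function.Surjective X.vertexCoeff.toRingHom := fun f => ⟨X.proj (∑ v, f v • vertex v), by
        change X.vertexCoeff _ = f
        rw [vertexCoeff_proj, map_sum]
        simp only [map_smul, nilCoeff_vertex]
        funext w
        simp [Finset.sum_apply, Pi.single_apply]⟩
      have : RingHomSurjective X.vertexCoeff.toRingHom := ⟨hs⟩
      exact Ring.le_comap_jacobson X.vertexCoeff.toRingHom h
    rw [IsSemisimpleRing.jacobson_eq_bot, Ideal.mem_comap, Ideal.mem_bot] at h1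
    have h2 : nilCoeff x = 0 := h1
    rw [deg_zero_eq_sum, h2]
    simp
  · intro h
    refine mem_rad_of_isNilpotent fun b => ?_
    obtain ⟨y, rfl⟩ := X.proj_surjective b
    rw [← map_mul]
    exact X.isNilpotent_proj (by rw [deg_zero_mul, h, mul_zero])

/-- Since `I ⊆ R²`, the degrees 0 and 1 of an element of `kQ / I` are well defined, and `rad²` consists of the
elements in which both vanish. -/
lemma proj_mem_rad_sq {x : PathAlgebra k X.Q} :
    X.proj x ∈ rad X.alg * rad X.alg ↔ deg 0 x = 0 ∧ deg 1 x = 0 := by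
  constructor
  · intro h
    have key : ∀ a ∈ rad X.alg * rad X.alg, X.D 0 a = 0 ∧ X.D 1 a = 0 := by
      intro a ha
      refine Submodule.smul_induction_on ha ?_ ?_
      · intro r hr s hs
        obtain ⟨y, rfl⟩ := X.proj_surjective r
        obtain ⟨z, rfl⟩ := X.proj_surjective s
        rw [proj_mem_rad] at hr hs
        rw [smul_eq_mul, ← map_mul, D_proj, D_proj]
        change X.proj (deg 0 (y * z)) = 0 ∧ X.proj (deg 1 (y * z)) = 0
        rw [deg_zero_mul, deg_one_mul, hr, hs]
        simp
      · intro a b ha hb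
        rw [map_add, map_add, ha.1, ha.2, hb.1, hb.2, add_zero]
        exact ⟨rfl, rfl⟩
    have h0 : X.proj (deg 0 x) = 0 := (key _ h).1
    have h1 : X.proj (deg 1 x) = 0 := (key _ h).2
    rw [proj_eq_zero] at h0 h1
    have h0 := X.admissible.deg_eq_zero h0 (n := 0) (by omega)
    have h1 := X.admissible.deg_eq_zero h1 (n := 1) (by omega)
    rw [deg_deg, if_pos rfl] at h0 h1
    exact ⟨h0, h1⟩
  · rintro ⟨h0, h1⟩
    have h2 := sub_deg_one_mem x
    rw [h0, h1, sub_zero, sub_zero] at h2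
    have : lengthGE k X.Q 2 ≤
        ((rad X.alg * rad X.alg).restrictScalars k).comap X.proj.toLinearMap := by
      rw [lengthGE, Submodule.span_le]
      rintro _ ⟨a, b, p, hp, rfl⟩
      cases p with
      | nil => simp at hp
      | cons p e =>
        change X.proj (path (p.cons e)) ∈ rad X.alg * rad X.alg
        rw [path_cons, map_mul]
        refine Ideal.mul_mem_mul (X.proj_mem_rad.2 ?_) (X.proj_mem_rad.2 ?_)
        · rw [deg_path, if_neg]
          simp at hp
          omega
        · rw [deg_path, if_neg (by simp [Quiver.Hom.toPath])]
    exact this h2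

/-- The quiver data of `kQ/I`: the sections `δ₁` and `δ₂` are given by the vertices and the edges. -/
def quiverData : QuiverData k X.alg :=
  QuiverData.ofMaps (X.D 0) (X.D 1)
    (by
      intro a ha
      obtain ⟨x, rfl⟩ := X.proj_surjective a
      rw [D_proj]
      change X.proj (deg 0 x) = 0
      rw [X.proj_mem_rad.1 ha, map_zero])
    (by
      intro a
      obtain ⟨x, rfl⟩ := X.proj_surjective a
      rw [D_proj, ← map_sub, proj_mem_rad, map_sub]
      change deg 0 (deg 0 x) - deg 0 x = 0
      rw [deg_deg, if_pos rfl, sub_self])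
    (by
      intro a ha
      obtain ⟨x, rfl⟩ := X.proj_surjective a
      rw [D_proj]
      change X.proj (deg 1 x) = 0
      rw [(X.proj_mem_rad_sq.1 ha).2, map_zero])
    (by
      intro a ha
      obtain ⟨x, rfl⟩ := X.proj_surjective a
      rw [proj_mem_rad] at ha
      rw [D_proj, ← map_sub, proj_mem_rad_sq, map_sub, map_sub]
      change deg 0 (deg 1 x) - deg 0 x = 0 ∧ deg 1 (deg 1 x) - deg 1 x = 0
      rw [deg_deg, deg_deg, if_neg zero_ne_one, if_pos rfl, ha, sub_self, sub_self]
      exact ⟨rfl, rfl⟩)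
    (by
      intro a b
      obtain ⟨x, rfl⟩ := X.proj_surjective a
      obtain ⟨y, rfl⟩ := X.proj_surjective b
      rw [← map_mul, D_proj, D_proj, D_proj, ← map_mul]
      exact congrArg X.proj (deg_zero_mul x y))
    (by
      intro a b
      obtain ⟨x, rfl⟩ := X.proj_surjective a
      obtain ⟨y, rfl⟩ := X.proj_surjective b
      rw [← map_mul, D_proj, D_proj, D_proj, D_proj, D_proj, ← map_mul, ← map_mul, ← map_add]
      exact congrArg X.proj (deg_one_mul x y))

lemma quiverData_D₀ (x : PathAlgebra k X.Q) : X.quiverData.D₀ (X.proj x) = X.proj (deg 0 x) := rfl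

lemma quiverData_δ₂ {x : PathAlgebra k X.Q} (hx : X.proj x ∈ rad X.alg) :
    (X.quiverData.δ₂ (cls₂ ⟨X.proj x, hx⟩) : X.alg) = X.proj (deg 1 x) := rfl

/-- With `Rⁿ ⊆ I`, the algebra is a power of the span of the finitely many vertices and edges. -/
lemma finite_alg : Module.Finite k X.alg := by
  let S : Submodule k X.alg := Submodule.span k
    (Set.range (fun v : X.Q => X.proj (vertex v)) ∪
      Set.range (fun e : Σ a b : X.Q, (a ⟶ b) => X.proj (arrow e.2.2)))
  have hS : S.FG := Submodule.fg_span ((Set.finite_range _).union (Set.finite_range _))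
  have hv : ∀ v : X.Q, X.proj (vertex v) ∈ S := fun v => Submodule.subset_span (Or.inl ⟨v, rfl⟩)
  have he : ∀ {a b : X.Q} (e : a ⟶ b), X.proj (arrow e) ∈ S := fun {a b} e =>
    Submodule.subset_span (Or.inr ⟨⟨a, b, e⟩, rfl⟩)
  obtain ⟨n, hn⟩ := X.admissible.exists_length
  -- vertices are idempotent, so a path of length at most `m` is a product of exactly `m + 1` factors in `S`
  have hp : ∀ (m : ℕ) {a b : X.Q} (p : Path a b), p.length ≤ m → X.proj (path p) ∈ S ^ (m + 1) := by
    intro m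
    induction m with
    | zero =>
      intro a b p hp
      cases p with
      | nil => rw [zero_add, pow_one]; exact hv a
      | cons p e => simp at hp
    | succ m ih =>
      intro a b p hp
      rw [pow_succ]
      cases p with
      | nil =>
        rw [show X.proj (path (Path.nil : Path a a)) = X.proj (vertex a) * X.proj (vertex a) by
          rw [← map_mul, vertex_mul_vertex, if_pos rfl]]
        exact Submodule.mul_mem_mul (ih _ (Nat.zero_le _)) (hv a)
      | cons p e =>
        rw [path_cons, map_mul]
        exact Submodule.mul_mem_mul (ih _ (by simpa using hp)) (he e)
  refine ⟨?_⟩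
  have htop : (⊤ : Submodule k X.alg) = S ^ (n + 1) := by
    refine (top_unique fun a _ => ?_).symm
    obtain ⟨x, rfl⟩ := X.proj_surjective a
    induction x using path_induction with
    | zero => rw [map_zero]; exact zero_mem _
    | add x y hx hy => rw [map_add]; exact add_mem (hx trivial) (hy trivial)
    | smul r x hx => rw [map_smul]; exact Submodule.smul_mem _ _ (hx trivial)
    | path q =>
      by_cases h : q.length ≤ n
      · exact hp n q h
      · rw [X.proj_eq_zero.2 (hn _ _ q (by omega))]
        exact zero_mem _
  rw [htop]
  exact hS.pow _

/-- Idempotents are compared through their coefficients at the vertices, which form an algebra map to `kⁿ`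
with nilpotent kernel. -/
lemma isBasic_alg : IsBasic k X.alg where
  finite := X.finite_alg
  idempotents := by
    let σ := (Fintype.equivFin X.Q).symm
    have hne : ∀ v, X.proj (vertex v) ≠ 0 := fun v h => by
      have := X.admissible.deg_eq_zero (X.proj_eq_zero.1 h) two_pos
      have h1 := congrFun (nilCoeff_eq_zero this) v
      rw [nilCoeff_vertex, Pi.single_eq_same] at h1
      exact one_ne_zero h1
    have hidem : ∀ v, IsIdempotentElem (X.proj (vertex v)) := fun v => by
      rw [IsIdempotentElem, ← map_mul, vertex_mul_vertex, if_pos rfl]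
    have hnil : ∀ f : X.alg, IsIdempotentElem f → X.vertexCoeff f = 0 → f = 0 := by
      intro f hf h0
      obtain ⟨x, rfl⟩ := X.proj_surjective f
      have h1 : nilCoeff x = 0 := h0
      exact eq_zero_of_isIdempotentElem_of_isNilpotent hf (X.isNilpotent_proj (by
        rw [deg_zero_eq_sum, h1]; simp))
    refine ⟨_, fun i => X.proj (vertex (σ i)), ?_, ?_, ?_⟩
    · refine ⟨⟨fun i => hidem _, fun i j hij => ?_⟩, ?_⟩
      · change X.proj (vertex (σ i)) * X.proj (vertex (σ j)) = 0
        rw [← map_mul, vertex_mul_vertex, if_neg (σ.injective.ne hij), map_zero]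
      · rw [← map_sum, Equiv.sum_comp σ (fun v => vertex v), sum_vertex, map_one]
    · intro i
      refine ⟨hidem _, hne _, fun f g hf hg hfg hgf h => ?_⟩
      have h1 : X.vertexCoeff f * X.vertexCoeff g = 0 := by rw [← map_mul, hfg, map_zero]
      have h2 : X.vertexCoeff f + X.vertexCoeff g = Pi.single (σ i) 1 := by
        rw [← map_add, h]; exact nilCoeff_vertex _
      have h3 : ∀ w, w ≠ σ i → X.vertexCoeff f w = 0 ∧ X.vertexCoeff g w = 0 := by
        intro w hw
        have h4 := congrFun h1 w
        have h5 := congrFun h2 w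
        rw [Pi.single_eq_of_ne hw] at h5
        rcases mul_eq_zero.1 h4 with h | h
        · rw [Pi.add_apply, h, zero_add] at h5; exact ⟨h, h5⟩
        · rw [Pi.add_apply, h, add_zero] at h5; exact ⟨h5, h⟩
      rcases mul_eq_zero.1 (congrFun h1 (σ i)) with h | h
      · refine Or.inl (hnil f hf (funext fun w => ?_))
        by_cases hw : w = σ i
        · rw [hw]; exact h
        · exact (h3 w hw).1
      · refine Or.inr (hnil g hg (funext fun w => ?_))
        by_cases hw : w = σ i
        · rw [hw]; exact h
        · exact (h3 w hw).2
    · refine fun i j hij => ⟨fun f => ?_⟩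
      have hmem : ∀ (v : X.Q) (x : rightIdeal (X.proj (vertex v))),
          X.proj (vertex v) * x.1 = x.1 := by
        intro v x
        obtain ⟨a, ha⟩ := Submodule.mem_span_singleton.1 x.2
        rw [← ha]
        change X.proj (vertex v) * (X.proj (vertex v) * a.unop) = X.proj (vertex v) * a.unop
        rw [← mul_assoc, hidem v]
      let ei : rightIdeal (X.proj (vertex (σ i))) := ⟨_, Submodule.mem_span_singleton_self _⟩
      let ej : rightIdeal (X.proj (vertex (σ j))) := ⟨_, Submodule.mem_span_singleton_self _⟩
      let y := f.symm ej
      have h1 : X.proj (vertex (σ j)) = (f ei).1 * y.1 := by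
        have h2 : op y.1 • ei = y := Subtype.ext (hmem _ y)
        have h3 : f (op y.1 • ei) = ej := by rw [h2]; exact f.apply_symm_apply ej
        rw [map_smul] at h3
        exact (congrArg Subtype.val h3).symm
      have h2 : (f ei).1 = X.proj (vertex (σ j)) * (f ei).1 * X.proj (vertex (σ i)) := by
        rw [hmem]
        have h3 : op (X.proj (vertex (σ i))) • ei = ei := Subtype.ext (hidem _)
        conv_lhs => rw [← h3, map_smul]
        rfl
      -- `e_j = f(e_i) y` has no vertex coefficients, as `f(e_i) = e_j f(e_i) e_i` with `i ≠ j`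
      refine hne (σ j) (hnil _ (hidem _) ?_)
      rw [h1, h2, map_mul, map_mul, map_mul, vertexCoeff_proj, vertexCoeff_proj, nilCoeff_vertex,
        nilCoeff_vertex, mul_right_comm (Pi.single (σ j) 1), single_mul_single_of_ne (σ.injective.ne hij).symm,
        zero_mul, zero_mul]
  split := by
    have hs : Function.Surjective X.vertexCoeff := fun f => ⟨X.proj (∑ v, f v • vertex v), by
      rw [vertexCoeff_proj, map_sum]
      simp only [map_smul, nilCoeff_vertex]
      funext w
      simp [Finset.sum_apply, Pi.single_apply]⟩
    have hk : rad X.alg = RingHom.ker X.vertexCoeff := by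
      ext a
      obtain ⟨x, rfl⟩ := X.proj_surjective a
      rw [proj_mem_rad, RingHom.mem_ker, vertexCoeff_proj]
      refine ⟨nilCoeff_eq_zero, fun h => ?_⟩
      rw [deg_zero_eq_sum, h]
      simp
    refine ⟨Fintype.card X.Q, ⟨(Ideal.quotientEquivAlgOfEq k hk).trans
      ((Ideal.quotientKerAlgEquivOfSurjective hs).trans ?_)⟩⟩
    exact AlgEquiv.piCongrLeft k (fun _ : Fin (Fintype.card X.Q) => k) (Fintype.equivFin X.Q)

end BdQuivCon

/-! ### The path bimodule of a connection -/

open Quiver (Path)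

namespace Connection
open PathAlgebra
variable {k : Type u} [Field k] {G H : FinQuiver.{u}} (c : Connection k G H)

/-- The element `γ q` of the path bimodule. -/
def elt {g : G} {h l : H} (q : Path h l) : c.Γ g h →ₗ[k] PathBimodule c :=
  c.ofPathMod g l ∘ₗ c.pin.flip (Finsupp.single q 1)

lemma elt_apply {g : G} {h l : H} (q : Path h l) (γ : c.Γ g h) :
    c.elt q γ = c.ofPathMod g l (c.pin γ (Finsupp.single q 1)) := rfl

lemma ofPathMod_apply_same {g : G} {l : H} (m : PathMod c g l) : c.ofPathMod g l m g l = m := by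
  change Pi.single (M := fun g : G => ∀ l : H, PathMod c g l) g
    (Pi.single (M := fun l : H => PathMod c g l) l m) g l = m
  rw [Pi.single_eq_same, Pi.single_eq_same]

lemma ofPathMod_apply_of_ne {g g' : G} {l l' : H} (m : PathMod c g l) (h : ¬ (g = g' ∧ l = l')) :
    c.ofPathMod g l m g' l' = 0 := by
  change Pi.single (M := fun g : G => ∀ l : H, PathMod c g l) g
    (Pi.single (M := fun l : H => PathMod c g l) l m) g' l' = 0
  by_cases hg : g = g'
  · subst hg
    rw [Pi.single_eq_same, Pi.single_eq_of_ne fun hl => h ⟨rfl, hl.symm⟩]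
  · rw [Pi.single_eq_of_ne (Ne.symm hg)]
    rfl

lemma pathBimodule_ext {m n : PathBimodule c} (h : ∀ g l, m g l = n g l) : m = n :=
  funext fun g => funext fun l => h g l

lemma sum_apply {ι : Type*} (s : Finset ι) (f : ι → PathBimodule c) (g : G) (l : H) :
    (∑ i ∈ s, f i) g l = ∑ i ∈ s, f i g l :=
  map_sum (AddMonoidHom.mk' (fun x : PathBimodule c => x g l) fun _ _ => rfl) _ _

lemma sum_ofPathMod (m : PathBimodule c) : ∑ g, ∑ l, c.ofPathMod g l (m g l) = m := by
  refine c.pathBimodule_ext fun g l => ?_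
  rw [sum_apply, Finset.sum_eq_single g, sum_apply, Finset.sum_eq_single l, ofPathMod_apply_same]
  · intro l' _ hl
    exact c.ofPathMod_apply_of_ne _ fun hh => hl hh.2
  · simp
  · intro g' _ hg
    rw [sum_apply]
    exact Finset.sum_eq_zero fun l' _ => c.ofPathMod_apply_of_ne _ fun hh => hg hh.1
  · simp

variable {c} in
lemma ext_ofPathMod {X : Type*} [AddCommGroup X] [Module k X] {f f' : PathBimodule c →ₗ[k] X}
    (hf : ∀ (g : G) (h l : H) (γ : c.Γ g h) (y : Path h l →₀ k),
      f (c.ofPathMod g l (c.pin γ y)) = f' (c.ofPathMod g l (c.pin γ y))) : f = f' := by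
  ext m
  rw [← c.sum_ofPathMod m]
  simp only [map_sum]
  refine Finset.sum_congr rfl fun g _ => Finset.sum_congr rfl fun l _ => ?_
  exact LinearMap.congr_fun (f := f ∘ₗ c.ofPathMod g l) (g := f' ∘ₗ c.ofPathMod g l)
    (ext_pin fun h γ y => hf g h l γ y) _

variable {c} in
lemma ext_elt {X : Type*} [AddCommGroup X] [Module k X] {f f' : PathBimodule c →ₗ[k] X}
    (hf : ∀ {g : G} {h l : H} (q : Path h l) (γ : c.Γ g h), f (c.elt q γ) = f' (c.elt q γ)) : f = f' := by
  refine ext_ofPathMod fun g i l γ y => ?_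
  refine LinearMap.congr_fun (f := f ∘ₗ c.ofPathMod g l ∘ₗ c.pin γ)
    (g := f' ∘ₗ c.ofPathMod g l ∘ₗ c.pin γ) (Finsupp.lhom_ext' fun q => LinearMap.ext_ring ?_) y
  exact hf q γ

/-- The elements `γ q` span the path bimodule. -/
lemma mem_of_elt_mem {S : Submodule k (PathBimodule c)}
    (hS : ∀ {g : G} {h l : H} (q : Path h l) (γ : c.Γ g h), c.elt q γ ∈ S) (m : PathBimodule c) : m ∈ S := by
  have : S.mkQ = 0 := ext_elt fun q γ => by
    rw [LinearMap.zero_apply, Submodule.mkQ_apply, Submodule.Quotient.mk_eq_zero]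
    exact hS q γ
  rw [← Submodule.ker_mkQ S, this]
  trivial

/-- The left action on the path bimodule, as a bilinear map. -/
def leftActₗ : PathAlgebra k G →ₗ[k] PathBimodule c →ₗ[k] PathBimodule c :=
  LinearMap.mk₂ k c.leftAct
    (fun x y m => c.pathBimodule_ext fun g l => by
      change ∑ g', c.act l (x g g' + y g g') (m g' l) = ∑ g', _ + ∑ g', _
      simp [Finset.sum_add_distrib])
    (fun r x m => c.pathBimodule_ext fun g l => by
      change ∑ g', c.act l (r • x g g') (m g' l) = r • ∑ g', _
      simp [Finset.smul_sum])
    (fun x m n => c.pathBimodule_ext fun g l => by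
      change ∑ g', c.act l (x g g') (m g' l + n g' l) = ∑ g', _ + ∑ g', _
      simp [Finset.sum_add_distrib])
    (fun r x m => c.pathBimodule_ext fun g l => by
      change ∑ g', c.act l (x g g') (r • m g' l) = r • ∑ g', _
      simp [Finset.smul_sum])

/-- The right action on the path bimodule, as a bilinear map. -/
def rightActₗ : PathBimodule c →ₗ[k] PathAlgebra k H →ₗ[k] PathBimodule c :=
  LinearMap.mk₂ k c.rightAct
    (fun m n y => c.pathBimodule_ext fun g l => by
      change ∑ h, c.concatAct h l (m g h + n g h) (y h l) = ∑ h, _ + ∑ h, _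
      simp [Finset.sum_add_distrib])
    (fun r m y => c.pathBimodule_ext fun g l => by
      change ∑ h, c.concatAct h l (r • m g h) (y h l) = r • ∑ h, _
      simp [Finset.smul_sum])
    (fun m x y => c.pathBimodule_ext fun g l => by
      change ∑ h, c.concatAct h l (m g h) (x h l + y h l) = ∑ h, _ + ∑ h, _
      simp [Finset.sum_add_distrib])
    (fun r m y => c.pathBimodule_ext fun g l => by
      change ∑ h, c.concatAct h l (m g h) (r • y h l) = r • ∑ h, _
      simp [Finset.smul_sum])

lemma leftActₗ_apply (x : PathAlgebra k G) (m : PathBimodule c) :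
    c.leftActₗ x m = c.leftAct x m := rfl
lemma rightActₗ_apply (m : PathBimodule c) (y : PathAlgebra k H) :
    c.rightActₗ m y = c.rightAct m y := rfl

lemma concatAct_pin {g : G} {h' h l : H} (γ : c.Γ g h') (x : Path h' h →₀ k)
    (y : Path h l →₀ k) : c.concatAct h l (c.pin γ x) y = c.pin γ (concat h' h l x y) := by
  simp only [concatAct, pathLift_pin]
  rfl

lemma leftAct_of_ofPathMod {g g' : G} {l : H} (x : Path g g' →₀ k) (m : PathMod c g' l) :
    c.leftAct (of g g' x) (c.ofPathMod g' l m) = c.ofPathMod g l (c.act l x m) := by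
  refine c.pathBimodule_ext fun g₁ l₁ => ?_
  change ∑ g₂, c.act l₁ (of g g' x g₁ g₂) (c.ofPathMod g' l m g₂ l₁) = _
  by_cases h : g = g₁ ∧ l = l₁
  · obtain ⟨rfl, rfl⟩ := h
    rw [Finset.sum_eq_single g', of_apply_same, ofPathMod_apply_same, ofPathMod_apply_same]
    · intro g₂ _ h₂
      rw [of_apply_of_ne _ fun hh => h₂ hh.2.symm, map_zero, LinearMap.zero_apply]
    · simp
  · rw [ofPathMod_apply_of_ne _ _ h]
    refine Finset.sum_eq_zero fun g₂ _ => ?_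
    by_cases hg : g = g₁
    · rw [ofPathMod_apply_of_ne _ _ fun hh => h ⟨hg, hh.2⟩, map_zero]
    · rw [of_apply_of_ne _ fun hh => hg hh.1, map_zero, LinearMap.zero_apply]

lemma leftAct_of_ofPathMod_of_ne {g g' g₁ : G} {l : H} (h : g' ≠ g₁) (x : Path g g' →₀ k)
    (m : PathMod c g₁ l) : c.leftAct (of g g' x) (c.ofPathMod g₁ l m) = 0 := by
  refine c.pathBimodule_ext fun g₂ l₂ => Finset.sum_eq_zero fun g₃ _ => ?_
  by_cases h₃ : g' = g₃
  · rw [ofPathMod_apply_of_ne _ _ fun hh => h (h₃.trans hh.1.symm), map_zero]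
  · rw [of_apply_of_ne _ fun hh => h₃ hh.2, map_zero, LinearMap.zero_apply]

lemma rightAct_ofPathMod_of {g : G} {h l : H} (m : PathMod c g h) (y : Path h l →₀ k) :
    c.rightAct (c.ofPathMod g h m) (of h l y) = c.ofPathMod g l (c.concatAct h l m y) := by
  refine c.pathBimodule_ext fun g₁ l₁ => ?_
  change ∑ h₂, c.concatAct h₂ l₁ (c.ofPathMod g h m g₁ h₂) (of h l y h₂ l₁) = _
  by_cases hh : g = g₁ ∧ l = l₁
  · obtain ⟨rfl, rfl⟩ := hh
    rw [Finset.sum_eq_single h, of_apply_same, ofPathMod_apply_same, ofPathMod_apply_same]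
    · intro g₂ _ h₂
      rw [of_apply_of_ne _ fun hh => h₂ hh.1.symm, map_zero]
    · simp
  · rw [ofPathMod_apply_of_ne _ _ hh]
    refine Finset.sum_eq_zero fun h₂ _ => ?_
    by_cases hg : g = g₁
    · rw [of_apply_of_ne _ fun h' => hh ⟨hg, h'.2⟩, map_zero]
    · rw [ofPathMod_apply_of_ne _ _ fun hh => hg hh.1, map_zero, LinearMap.zero_apply]

lemma rightAct_ofPathMod_of_ne {g : G} {h h' l : H} (hh : h ≠ h') (m : PathMod c g h)
    (y : Path h' l →₀ k) : c.rightAct (c.ofPathMod g h m) (of h' l y) = 0 := by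
  refine c.pathBimodule_ext fun g₂ l₂ => Finset.sum_eq_zero fun h₃ _ => ?_
  by_cases h₄ : h = h₃
  · rw [of_apply_of_ne _ fun h₅ => hh (h₄.trans h₅.1.symm), map_zero]
  · rw [ofPathMod_apply_of_ne _ _ fun h₅ => h₄ h₅.2, map_zero, LinearMap.zero_apply]

lemma rightAct_elt_path {g : G} {h i l : H} (q : Path h i) (p : Path i l) (γ : c.Γ g h) :
    c.rightAct (c.elt q γ) (path p) = c.elt (q.comp p) γ := by
  rw [elt_apply, path, rightAct_ofPathMod_of, concatAct_pin, concat_single, mul_one, elt_apply]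

lemma rightAct_elt_path_of_ne {g : G} {h i i' l : H} (hi : i ≠ i') (q : Path h i) (p : Path i' l)
    (γ : c.Γ g h) : c.rightAct (c.elt q γ) (path p) = 0 :=
  c.rightAct_ofPathMod_of_ne hi _ _

lemma leftAct_vertex_elt {g : G} {h i : H} (q : Path h i) (γ : c.Γ g h) :
    c.leftAct (vertex g) (c.elt q γ) = c.elt q γ := by
  rw [elt_apply, vertex, path, leftAct_of_ofPathMod, act_single, one_smul]
  rfl

lemma leftAct_vertex_elt_of_ne {g g' : G} {h i : H} (hg : g' ≠ g) (q : Path h i) (γ : c.Γ g h) :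
    c.leftAct (vertex g') (c.elt q γ) = 0 :=
  c.leftAct_of_ofPathMod_of_ne hg _ _

lemma leftAct_arrow_elt {g g' : G} {h i : H} (e : g ⟶ g') (q : Path h i) (γ : c.Γ g' h) :
    c.leftAct (arrow e) (c.elt q γ) =
      ∑ e' : H.In h, c.elt (e'.2.toPath.comp q) (c.cell e e'.2 γ) := by
  rw [elt_apply, arrow, path, leftAct_of_ofPathMod, act_single, one_smul]
  change c.ofPathMod g i (c.edgeAct i e (c.pin γ (Finsupp.single q 1))) = _
  rw [edgeAct_pin, map_sum]
  refine Finset.sum_congr rfl fun e' _ => ?_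
  rw [concat_single, mul_one, elt_apply]

lemma leftAct_arrow_elt_of_ne {g g' g₁ : G} {h i : H} (hg : g' ≠ g₁) (e : g ⟶ g') (q : Path h i)
    (γ : c.Γ g₁ h) : c.leftAct (arrow e) (c.elt q γ) = 0 :=
  c.leftAct_of_ofPathMod_of_ne hg _ _

lemma leftAct_mul (x y : PathAlgebra k G) (m : PathBimodule c) :
    c.leftAct (x * y) m = c.leftAct x (c.leftAct y m) := by
  refine c.pathBimodule_ext fun g l => ?_
  change ∑ g', c.act l ((x * y) g g') (m g' l) =
    ∑ g₁, c.act l (x g g₁) (∑ g', c.act l (y g₁ g') (m g' l))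
  simp only [mul_apply, map_sum, LinearMap.sum_apply, act_concat]
  exact Finset.sum_comm

lemma leftAct_one (m : PathBimodule c) : c.leftAct 1 m = m := by
  refine LinearMap.congr_fun (f := c.leftActₗ 1) (g := LinearMap.id) (ext_elt fun {g h l} q γ => ?_) m
  rw [← sum_vertex, map_sum, LinearMap.sum_apply, Finset.sum_eq_single g]
  · exact c.leftAct_vertex_elt q γ
  · intro g' _ hg
    exact c.leftAct_vertex_elt_of_ne hg q γ
  · simp

lemma rightAct_mul (m : PathBimodule c) (x y : PathAlgebra k H) :
    c.rightAct m (x * y) = c.rightAct (c.rightAct m x) y := by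
  have key : ∀ {g : G} {h i l : H} (m : PathMod c g h) (x : Path h i →₀ k) (y : Path i l →₀ k),
      c.concatAct h l m (concat h i l x y) = c.concatAct i l (c.concatAct h i m x) y := by
    intro g h i l m x y
    refine LinearMap.congr_fun (f := (c.concatAct h l).flip (concat h i l x y))
      (g := (c.concatAct i l).flip y ∘ₗ (c.concatAct h i).flip x) (ext_pin fun j γ z => ?_) m
    simp only [LinearMap.flip_apply, LinearMap.comp_apply, concatAct_pin, concat_assoc]
  refine c.pathBimodule_ext fun g l => ?_
  change ∑ h, c.concatAct h l (m g h) ((x * y) h l) =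
    ∑ i, c.concatAct i l (∑ h, c.concatAct h i (m g h) (x h i)) (y i l)
  simp only [mul_apply, map_sum, LinearMap.sum_apply, key]
  exact Finset.sum_comm

lemma rightAct_vertex_elt {g : G} {h i : H} (q : Path h i) (γ : c.Γ g h) :
    c.rightAct (c.elt q γ) (vertex i) = c.elt q γ := c.rightAct_elt_path q Path.nil γ

lemma rightAct_one (m : PathBimodule c) : c.rightAct m 1 = m := by
  refine LinearMap.congr_fun (f := c.rightActₗ.flip 1) (g := LinearMap.id)
    (ext_elt fun {g h l} q γ => ?_) m
  rw [← sum_vertex, map_sum, LinearMap.sum_apply, Finset.sum_eq_single l]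
  · exact c.rightAct_vertex_elt q γ
  · intro l' _ hl
    exact c.rightAct_elt_path_of_ne (Ne.symm hl) q _ γ
  · simp

/-- Moving a path of `G` across `Γ` only prepends paths of `H`, so it commutes with appending paths of `H` on
the right. -/
lemma leftAct_rightAct (x : PathAlgebra k G) (m : PathBimodule c) (y : PathAlgebra k H) :
    c.leftAct x (c.rightAct m y) = c.rightAct (c.leftAct x m) y := by
  induction x using generator_induction generalizing m with
  | zero => simp [← leftActₗ_apply, ← rightActₗ_apply]
  | add x x' h h' => simpa [← leftActₗ_apply, ← rightActₗ_apply] using congrArg₂ (· + ·) (h m) (h' m)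
  | smul r x h => simpa [← leftActₗ_apply, ← rightActₗ_apply] using congrArg (r • ·) (h m)
  | mul x x' h h' => rw [leftAct_mul, h', h, leftAct_mul]
  -- both sides are bilinear: it suffices to consider `m = γ q` and a path `y`
  | vertex v =>
    refine LinearMap.congr_fun (f := c.leftActₗ (vertex v) ∘ₗ c.rightActₗ.flip y)
      (g := c.rightActₗ.flip y ∘ₗ c.leftActₗ (vertex v)) (ext_elt fun {g h l} q γ => ?_) m
    refine LinearMap.congr_fun (f := c.leftActₗ (vertex v) ∘ₗ c.rightActₗ (c.elt q γ))
      (g := c.rightActₗ (c.leftActₗ (vertex v) (c.elt q γ))) ?_ y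
    ext y
    induction y using path_induction with
    | zero => simp
    | add x x' h h' => rw [map_add, map_add, h, h']
    | smul r x h => rw [map_smul, map_smul, h]
    | @path a b p =>
      simp only [LinearMap.comp_apply, leftActₗ_apply, rightActₗ_apply]
      by_cases hl : l = a
      · subst hl
        by_cases hv : v = g
        · subst hv
          rw [rightAct_elt_path, leftAct_vertex_elt, leftAct_vertex_elt, rightAct_elt_path]
        · rw [rightAct_elt_path, leftAct_vertex_elt_of_ne _ hv, leftAct_vertex_elt_of_ne _ hv,
            ← rightActₗ_apply, map_zero, LinearMap.zero_apply]
      · rw [rightAct_elt_path_of_ne _ hl, ← leftActₗ_apply, map_zero]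
        by_cases hv : v = g
        · subst hv
          rw [leftAct_vertex_elt, rightAct_elt_path_of_ne _ hl]
        · rw [leftAct_vertex_elt_of_ne _ hv, ← rightActₗ_apply, map_zero, LinearMap.zero_apply]
  | @arrow v w e =>
    refine LinearMap.congr_fun (f := c.leftActₗ (arrow e) ∘ₗ c.rightActₗ.flip y)
      (g := c.rightActₗ.flip y ∘ₗ c.leftActₗ (arrow e)) (ext_elt fun {g h l} q γ => ?_) m
    refine LinearMap.congr_fun (f := c.leftActₗ (arrow e) ∘ₗ c.rightActₗ (c.elt q γ))
      (g := c.rightActₗ (c.leftActₗ (arrow e) (c.elt q γ))) ?_ y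
    ext y
    induction y using path_induction with
    | zero => simp
    | add x x' h h' => rw [map_add, map_add, h, h']
    | smul r x h => rw [map_smul, map_smul, h]
    | @path a b p =>
      simp only [LinearMap.comp_apply, leftActₗ_apply, rightActₗ_apply]
      by_cases hv : w = g
      · subst hv
        rw [leftAct_arrow_elt, ← c.rightActₗ_apply (∑ _, _) (path p), map_sum, LinearMap.sum_apply]
        by_cases hl : l = a
        · subst hl
          rw [rightAct_elt_path, leftAct_arrow_elt]
          refine Finset.sum_congr rfl fun e' _ => ?_
          rw [rightActₗ_apply, rightAct_elt_path, Path.comp_assoc]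
        · rw [rightAct_elt_path_of_ne _ hl, ← leftActₗ_apply, map_zero]
          exact (Finset.sum_eq_zero fun e' _ => c.rightAct_elt_path_of_ne hl _ _ _).symm
      · rw [leftAct_arrow_elt_of_ne _ hv, ← c.rightActₗ_apply 0, map_zero, LinearMap.zero_apply]
        by_cases hl : l = a
        · subst hl
          rw [rightAct_elt_path, leftAct_arrow_elt_of_ne _ hv]
        · rw [rightAct_elt_path_of_ne _ hl, ← leftActₗ_apply, map_zero]

lemma mulIdeal_le {J : Ideal (PathAlgebra k H)} [J.IsTwoSided] {S : Submodule k (PathBimodule c)}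
    (hS : ∀ {g : G} {h l : H} (γ : c.Γ g h) (y : Path h l →₀ k), of h l y ∈ J →
      c.ofPathMod g l (c.pin γ y) ∈ S) : c.mulIdeal J ≤ S := by
  rw [mulIdeal, Submodule.span_le]
  rintro _ ⟨m, y, hy, rfl⟩
  refine c.mem_of_elt_mem (S := S.comap (c.rightActₗ.flip y)) (fun {g h l} q γ => ?_) m
  change c.rightAct (c.elt q γ) y ∈ S
  rw [← rightActₗ_apply, ← sum_of y, map_sum]
  refine sum_mem fun a _ => ?_
  rw [map_sum]
  refine sum_mem fun b _ => ?_
  rw [rightActₗ_apply]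
  by_cases hl : l = a
  · subst hl
    rw [elt_apply, rightAct_ofPathMod_of, concatAct_pin]
    refine hS _ _ ?_
    rw [← of_mul_of]
    exact Ideal.mul_mem_left _ _ (of_mem hy _ _)
  · rw [elt_apply, c.rightAct_ofPathMod_of_ne hl]
    exact zero_mem _

lemma rightAct_mem_mulIdeal {J : Ideal (PathAlgebra k H)} {m : PathBimodule c}
    {y : PathAlgebra k H} (hy : y ∈ J) : c.rightAct m y ∈ c.mulIdeal J :=
  Submodule.subset_span ⟨m, y, hy, rfl⟩

lemma ofPathMod_pin_mem {J : Ideal (PathAlgebra k H)} {g : G} {h l : H} (γ : c.Γ g h)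
    {y : Path h l →₀ k} (hy : of h l y ∈ J) : c.ofPathMod g l (c.pin γ y) ∈ c.mulIdeal J := by
  have : c.ofPathMod g l (c.pin γ y) = c.rightAct (c.edgeElt γ) (of h l y) := by
    rw [edgeElt, edge, rightAct_ofPathMod_of, concatAct_pin, nil_concat]
  rw [this]
  exact c.rightAct_mem_mulIdeal hy

lemma leftAct_mem_mulIdeal {J : Ideal (PathAlgebra k H)} {m : PathBimodule c}
    (x : PathAlgebra k G) (hm : m ∈ c.mulIdeal J) : c.leftAct x m ∈ c.mulIdeal J := by
  have : c.mulIdeal J ≤ (c.mulIdeal J).comap (c.leftActₗ x) := by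
    conv_lhs => rw [mulIdeal]
    rw [Submodule.span_le]
    rintro _ ⟨m, y, hy, rfl⟩
    change c.leftAct x (c.rightAct m y) ∈ c.mulIdeal J
    rw [leftAct_rightAct]
    exact c.rightAct_mem_mulIdeal hy
  exact this hm

lemma rightAct_mem_mulIdeal' {J : Ideal (PathAlgebra k H)} [J.IsTwoSided] {m : PathBimodule c}
    (x : PathAlgebra k H) (hm : m ∈ c.mulIdeal J) : c.rightAct m x ∈ c.mulIdeal J := by
  have : c.mulIdeal J ≤ (c.mulIdeal J).comap (c.rightActₗ.flip x) := by
    conv_lhs => rw [mulIdeal]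
    rw [Submodule.span_le]
    rintro _ ⟨m, y, hy, rfl⟩
    change c.rightAct (c.rightAct m y) x ∈ c.mulIdeal J
    rw [← rightAct_mul]
    exact c.rightAct_mem_mulIdeal (Ideal.mul_mem_right _ _ hy)
  exact this hm

variable {c} in
/-- The ideal of relations of the source moves the path bimodule into `M J`. -/
lemma IsIdeallyConnected.leftAct_mem {I : Ideal (PathAlgebra k G)} [I.IsTwoSided]
    {J : Ideal (PathAlgebra k H)} [J.IsTwoSided] (hc : c.IsIdeallyConnected I J)
    {x : PathAlgebra k G} (hx : x ∈ I) (m : PathBimodule c) : c.leftAct x m ∈ c.mulIdeal J := by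
  refine c.mem_of_elt_mem (S := (c.mulIdeal J).comap (c.leftActₗ x)) (fun {g h l} q γ => ?_) m
  change c.leftAct x (c.elt q γ) ∈ c.mulIdeal J
  have h1 : c.elt q γ = c.rightAct (c.edgeElt γ) (path q) := by
    rw [show c.edgeElt γ = c.elt Path.nil γ from rfl, rightAct_elt_path, Path.nil_comp]
  rw [h1, leftAct_rightAct]
  refine c.rightAct_mem_mulIdeal' _ ?_
  rw [← leftActₗ_apply, ← sum_of x, map_sum, LinearMap.sum_apply]
  refine sum_mem fun a _ => ?_
  rw [map_sum, LinearMap.sum_apply]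
  refine sum_mem fun b _ => ?_
  rw [leftActₗ_apply, edgeElt]
  by_cases hb : b = g
  · subst hb
    rw [leftAct_of_ofPathMod]
    have h2 : c.idealPart J a h ≤ (c.mulIdeal J).comap (c.ofPathMod a h) := by
      rw [idealPart, Submodule.span_le]
      rintro _ ⟨h', γ', y, hy, rfl⟩
      exact c.ofPathMod_pin_mem γ' hy
    exact h2 (hc.act_mem a b h _ (of_mem hx _ _) γ)
  · rw [leftAct_of_ofPathMod_of_ne _ hb]
    exact zero_mem _

end Connection

/-! ### The bimodule of an ideally connected connection -/

open Quiver (Path)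

namespace Bimodule

/-- The right action on a bimodule, as a homomorphism of algebras. -/
def rightHom {k : Type u} [Field k] {A B : Bim k} (N : Bimodule A B) :
    B →ₐ[k] (Module.End k N)ᵐᵒᵖ :=
  AlgHom.ofLinearMap
    ((opLinearEquiv k).toLinearMap ∘ₗ
      (Algebra.lsmul k k N : Bᵐᵒᵖ →ₐ[k] Module.End k N).toLinearMap ∘ₗ
        (opLinearEquiv k).toLinearMap)
    (unop_injective (LinearMap.ext fun m => one_smul Bᵐᵒᵖ m))
    (fun a b => unop_injective (LinearMap.ext fun m => mul_smul (op b) (op a) m))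

end Bimodule

namespace Connection
variable {k : Type u} [Field k] {G H : FinQuiver.{u}} (c : Connection k G H)

variable {c} in
/-- The universal property of the path bimodule, as a vector space. -/
def pathBimoduleLift {N : Type*} [AddCommGroup N] [Module k N]
    (F : ∀ (g : G) (h l : H), c.Γ g h →ₗ[k] (Path h l →₀ k) →ₗ[k] N) : PathBimodule c →ₗ[k] N :=
  LinearMap.lsum k (fun g : G => ∀ l : H, PathMod c g l) k fun g =>
    LinearMap.lsum k (fun l : H => PathMod c g l) k fun l => pathLift fun h => F g h l

variable {c} in
lemma pathBimoduleLift_pin {N : Type*} [AddCommGroup N] [Module k N]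
    (F : ∀ (g : G) (h l : H), c.Γ g h →ₗ[k] (Path h l →₀ k) →ₗ[k] N) {g : G} {h l : H}
    (γ : c.Γ g h) (y : Path h l →₀ k) :
    pathBimoduleLift F (c.ofPathMod g l (c.pin γ y)) = F g h l γ y :=
  (LinearMap.lsum_piSingle ..).trans ((LinearMap.lsum_piSingle ..).trans (pathLift_pin ..))

/-- The component `Γ g h' → Γ g' h` of the inverse of `U g h` at the edges `e : g ⟶ g'` and
`e' : h' ⟶ h`. -/
def cellInv {g g' : G} {h' h : H} (e : g ⟶ g') (e' : h' ⟶ h) : c.Γ g h' →ₗ[k] c.Γ g' h :=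
  LinearMap.proj (φ := fun e : G.Out g => c.Γ e.1 h) ⟨g', e⟩ ∘ₗ (c.U g h).symm.toLinearMap ∘ₗ
    LinearMap.single k (fun e : H.In h => c.Γ g e.1) ⟨h', e'⟩

lemma sum_cellInv_cell {g g' : G} {h : H} (e : g ⟶ g') (γ : c.Γ g' h) (e₁ : G.Out g) :
    ∑ e' : H.In h, c.cellInv e₁.2 e'.2 (c.cell e e'.2 γ) =
      Pi.single (M := fun e : G.Out g => c.Γ e.1 h) ⟨g', e⟩ γ e₁ := by
  let x := c.U g h (Pi.single (M := fun e : G.Out g => c.Γ e.1 h) ⟨g', e⟩ γ)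
  have h1 := congrFun (congrArg (c.U g h).symm (Finset.univ_sum_single x)) e₁
  rw [map_sum, Finset.sum_apply, LinearEquiv.symm_apply_apply] at h1
  exact h1

lemma sum_cell_cellInv {g : G} {h' h : H} (e' : h' ⟶ h) (γ : c.Γ g h') (e₁ : H.In h) :
    ∑ e : G.Out g, c.cell e.2 e₁.2 (c.cellInv e.2 e' γ) =
      Pi.single (M := fun e : H.In h => c.Γ g e.1) ⟨h', e'⟩ γ e₁ := by
  let x := (c.U g h).symm (Pi.single (M := fun e : H.In h => c.Γ g e.1) ⟨h', e'⟩ γ)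
  have h1 := congrFun (congrArg (c.U g h) (Finset.univ_sum_single x)) e₁
  rw [map_sum, Finset.sum_apply, LinearEquiv.apply_symm_apply] at h1
  exact h1

end Connection

namespace BdQuivCon.Hom
open PathAlgebra Connection Bimodule
variable {k : Type u} [Field k] {X Y : BdQuivCon k} (Γ : BdQuivCon.Hom X Y)

/-- The space underlying the bimodule of a connection: the quotient `M / MJ` of the path
bimodule. -/
abbrev PathQuot : Type u := Γ.con.PathBimodule ⧸ Γ.con.mulIdeal Y.I

/-- The left action of `kG/I` on `M / MJ`. -/
def leftActHom : X.alg →ₐ[k] Module.End k Γ.PathQuot :=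
  AlgHom.ofLinearMap
    (X.algLift
      { toFun := fun x => (Γ.con.mulIdeal Y.I).mapQ _ (Γ.con.leftActₗ x)
          fun _ hm => Γ.con.leftAct_mem_mulIdeal x hm
        map_add' := fun x y => by ext m; simp [Submodule.mapQ]
        map_smul' := fun r x => by ext m; simp [Submodule.mapQ] }
      fun x hx => by
        ext m
        exact (Submodule.Quotient.mk_eq_zero _).2 (Γ.ideal.leftAct_mem hx m))
    (by
      ext m
      exact congrArg (Submodule.mkQ _) (Γ.con.leftAct_one m))
    (by
      intro a b
      obtain ⟨x, rfl⟩ := X.proj_surjective a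
      obtain ⟨y, rfl⟩ := X.proj_surjective b
      rw [← map_mul]
      ext m
      exact congrArg (Submodule.mkQ _) (Γ.con.leftAct_mul x y m))

/-- The right action of `kH/J` on `M / MJ`. -/
def rightActHom : Y.alg →ₐ[k] (Module.End k Γ.PathQuot)ᵐᵒᵖ :=
  AlgHom.ofLinearMap
    ((opLinearEquiv k).toLinearMap ∘ₗ Y.algLift
      { toFun := fun y => (Γ.con.mulIdeal Y.I).mapQ _ (Γ.con.rightActₗ.flip y)
          fun _ hm => Γ.con.rightAct_mem_mulIdeal' y hm
        map_add' := fun x y => by ext m; simp [Submodule.mapQ]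
        map_smul' := fun r x => by ext m; simp [Submodule.mapQ] }
      fun y hy => by
        ext m
        exact (Submodule.Quotient.mk_eq_zero _).2 (Γ.con.rightAct_mem_mulIdeal hy))
    (by
      refine unop_injective ?_
      ext m
      exact congrArg (Submodule.mkQ _) (Γ.con.rightAct_one m))
    (by
      intro a b
      obtain ⟨x, rfl⟩ := Y.proj_surjective a
      obtain ⟨y, rfl⟩ := Y.proj_surjective b
      rw [← map_mul]
      refine unop_injective ?_
      ext m
      exact congrArg (Submodule.mkQ _) (Γ.con.rightAct_mul m x y))

/-- The bimodule `M / MJ` of an ideally connected connection, where `M` is the path bimodule. -/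
def bim : Bimodule X.alg Y.alg :=
  ofAlgHoms X.alg Y.alg Γ.PathQuot Γ.leftActHom Γ.rightActHom (by
    intro a b m
    obtain ⟨x, rfl⟩ := X.proj_surjective a
    obtain ⟨y, rfl⟩ := Y.proj_surjective b
    obtain ⟨m, rfl⟩ := Submodule.mkQ_surjective _ m
    exact congrArg (Submodule.mkQ _) (Γ.con.leftAct_rightAct x m y))

/-- The projection `M → M / MJ`. -/
def proj : Γ.con.PathBimodule →ₗ[k] Γ.bim := (Γ.con.mulIdeal Y.I).mkQ

lemma proj_surjective : Function.Surjective Γ.proj := Submodule.mkQ_surjective _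

lemma proj_leftAct (x : PathAlgebra k X.Q) (m : Γ.con.PathBimodule) :
    Γ.proj (Γ.con.leftAct x m) = X.proj x • Γ.proj m := rfl

lemma proj_rightAct (m : Γ.con.PathBimodule) (y : PathAlgebra k Y.Q) :
    Γ.proj (Γ.con.rightAct m y) = op (Y.proj y) • Γ.proj m := rfl

lemma proj_eq_zero {m : Γ.con.PathBimodule} : Γ.proj m = 0 ↔ m ∈ Γ.con.mulIdeal Y.I :=
  Submodule.Quotient.mk_eq_zero _

/-- The generator of `M / MJ` given by `γ ∈ Γ g h`. -/
def gen {g : X.Q} {h : Y.Q} : Γ.con.Γ g h →ₗ[k] Γ.bim := Γ.proj ∘ₗ Γ.con.elt Path.nil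

lemma proj_elt {g : X.Q} {h l : Y.Q} (q : Path h l) (γ : Γ.con.Γ g h) :
    Γ.proj (Γ.con.elt q γ) = op (Y.proj (path q)) • Γ.gen γ := by
  rw [gen, LinearMap.comp_apply, ← proj_rightAct, rightAct_elt_path, Path.nil_comp]

lemma vertex_smul_gen {g : X.Q} {h : Y.Q} (γ : Γ.con.Γ g h) :
    X.proj (vertex g) • Γ.gen γ = Γ.gen γ :=
  congrArg Γ.proj (Γ.con.leftAct_vertex_elt Path.nil γ)

lemma op_vertex_smul_gen {g : X.Q} {h : Y.Q} (γ : Γ.con.Γ g h) :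
    op (Y.proj (vertex h)) • Γ.gen γ = Γ.gen γ :=
  congrArg Γ.proj (Γ.con.rightAct_vertex_elt Path.nil γ)

/-- Edges of `G` are moved across `Γ` by means of the isomorphisms `U`. -/
lemma arrow_smul_gen {g g' : X.Q} {h : Y.Q} (e : g ⟶ g') (γ : Γ.con.Γ g' h) :
    X.proj (arrow e) • Γ.gen γ =
      ∑ e' : Y.Q.In h, op (Y.proj (arrow e'.2)) • Γ.gen (Γ.con.cell e e'.2 γ) := by
  change Γ.proj (Γ.con.leftAct (arrow e) (Γ.con.elt Path.nil γ)) = _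
  rw [leftAct_arrow_elt, map_sum]
  exact Finset.sum_congr rfl fun e' _ => Γ.proj_elt _ _

lemma op_arrow_smul_gen {g : X.Q} {h h' : Y.Q} (e' : h' ⟶ h) (γ : Γ.con.Γ g h') :
    op (Y.proj (arrow e')) • Γ.gen γ =
      ∑ e : X.Q.Out g, X.proj (arrow e.2) • Γ.gen (Γ.con.cellInv e.2 e' γ) := by
  simp only [arrow_smul_gen]
  rw [Finset.sum_comm]
  simp only [← Finset.smul_sum, ← map_sum, sum_cell_cellInv]
  rw [Finset.sum_eq_single ⟨h', e'⟩]
  · rw [Pi.single_eq_same]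
  · intro e₁ _ he
    rw [Pi.single_eq_of_ne he, map_zero, smul_zero]
  · simp

variable {Γ} in
lemma linearMap_ext {N : Type*} [AddCommGroup N] [Module k N] {f f' : Γ.bim →ₗ[k] N}
    (hf : ∀ {g : X.Q} {h l : Y.Q} (q : Path h l) (γ : Γ.con.Γ g h),
      f (op (Y.proj (path q)) • Γ.gen γ) = f' (op (Y.proj (path q)) • Γ.gen γ)) : f = f' := by
  ext m
  obtain ⟨m, rfl⟩ := Γ.proj_surjective m
  refine LinearMap.congr_fun (f := f ∘ₗ Γ.proj) (g := f' ∘ₗ Γ.proj) (ext_elt fun q γ => ?_) m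
  rw [LinearMap.comp_apply, LinearMap.comp_apply, proj_elt, hf]

lemma mem_of_gen_mem {S : Submodule k Γ.bim}
    (hS : ∀ {g : X.Q} {h l : Y.Q} (q : Path h l) (γ : Γ.con.Γ g h),
      op (Y.proj (path q)) • Γ.gen γ ∈ S) (m : Γ.bim) : m ∈ S := by
  have : S.mkQ = 0 := linearMap_ext fun q γ => by
    rw [LinearMap.zero_apply, Submodule.mkQ_apply, Submodule.Quotient.mk_eq_zero]
    exact hS q γ
  rw [← Submodule.ker_mkQ S, this]
  trivial

/-- The bimodule is generated by the elements of `Γ` as a right module. -/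
lemma linearMap_ext_right {N : Type*} [AddCommGroup N] [Module k N] {f f' : Γ.bim →ₗ[k] N}
    (r : Y.alg → N → N) (hf : ∀ b m, f (op b • m) = r b (f m))
    (hf' : ∀ b m, f' (op b • m) = r b (f' m))
    (hg : ∀ {g : X.Q} {h : Y.Q} (γ : Γ.con.Γ g h), f (Γ.gen γ) = f' (Γ.gen γ)) : f = f' :=
  linearMap_ext fun q γ => by rw [hf, hf', hg]

lemma hom_ext {N : Bimodule X.alg Y.alg} {f f' : Γ.bim ⟶ N}
    (hg : ∀ {g : X.Q} {h : Y.Q} (γ : Γ.con.Γ g h), lin f (Γ.gen γ) = lin f' (Γ.gen γ)) : f = f' :=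
  Bimodule.hom_ext <| LinearMap.congr_fun <|
    Γ.linearMap_ext_right (fun b n => op b • n) (lin_right f) (lin_right f') hg

section lift
variable {N : Type*} [AddCommGroup N] [Module k N] (r : Y.alg →ₐ[k] (Module.End k N)ᵐᵒᵖ)
  (f : ∀ g h, Γ.con.Γ g h →ₗ[k] N)

/-- The universal property of `M / MJ` as a right module: linear maps on the spaces `Γ g h` with
values in a right module extend. -/
def bimLift : Γ.bim →ₗ[k] N :=
  (Γ.con.mulIdeal Y.I).liftQ
    (pathBimoduleLift fun g h l => (LinearMap.llcomp k _ _ _).flip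
      (((opLinearEquiv k).symm.toLinearMap ∘ₗ r.toLinearMap ∘ₗ Y.proj.toLinearMap ∘ₗ of h l)) ∘ₗ
        LinearMap.applyₗ ∘ₗ f g h)
    (Γ.con.mulIdeal_le fun γ y hy => by
      rw [LinearMap.mem_ker, pathBimoduleLift_pin]
      change (r (Y.proj (of _ _ y))).unop (f _ _ γ) = 0
      rw [Y.proj_eq_zero.2 hy, map_zero]
      rfl)

lemma bimLift_path {g : X.Q} {h l : Y.Q} (q : Path h l) (γ : Γ.con.Γ g h) :
    Γ.bimLift r f (op (Y.proj (path q)) • Γ.gen γ) = (r (Y.proj (path q))).unop (f g h γ) := by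
  rw [← proj_elt]
  exact pathBimoduleLift_pin _ γ (Finsupp.single q 1)

lemma bimLift_gen (hf : ∀ g h γ, (r (Y.proj (vertex h))).unop (f g h γ) = f g h γ) {g : X.Q}
    {h : Y.Q} (γ : Γ.con.Γ g h) : Γ.bimLift r f (Γ.gen γ) = f g h γ := by
  rw [← op_vertex_smul_gen, bimLift_path, hf]

lemma bimLift_op_smul (b : Y.alg) (m : Γ.bim) :
    Γ.bimLift r f (op b • m) = (r b).unop (Γ.bimLift r f m) := by
  obtain ⟨y, rfl⟩ := Y.proj_surjective b
  induction y using path_induction with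
  | zero => simp
  | add x x' h h' => rw [map_add, MulOpposite.op_add, add_smul, map_add, h, h', map_add]; rfl
  | smul t x h => rw [_root_.map_smul Y.proj, MulOpposite.op_smul, smul_assoc, map_smul, h, _root_.map_smul r]; rfl
  | @path a b p =>
    refine LinearMap.congr_fun (f := Γ.bimLift r f ∘ₗ rm _ (Y.proj (path p)))
      (g := (r (Y.proj (path p))).unop ∘ₗ Γ.bimLift r f) (linearMap_ext fun {g h l} q γ => ?_) m
    change Γ.bimLift r f (op (Y.proj (path p)) • op (Y.proj (path q)) • Γ.gen γ) =
      (r (Y.proj (path p))).unop (Γ.bimLift r f (op (Y.proj (path q)) • Γ.gen γ))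
    rw [bimLift_path, smul_smul, ← op_mul, ← map_mul]
    have h1 : (r (Y.proj (path p))).unop ((r (Y.proj (path q))).unop (f g h γ)) =
        (r (Y.proj (path q * path p))).unop (f g h γ) := by
      rw [map_mul, map_mul]; rfl
    rw [h1]
    by_cases hl : l = a
    · subst hl
      rw [path_mul_path, bimLift_path]
    · rw [path_mul_path_of_ne hl]
      simp

end lift

section homLift
variable (N : Bimodule X.alg Y.alg) (f : ∀ g h, Γ.con.Γ g h →ₗ[k] N)

/-- A family of maps from the spaces `Γ g h` to a bimodule which is compatible with the vertices and
with moving edges across `Γ`. -/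
structure IsCompatible : Prop where
  left : ∀ g h γ, X.proj (vertex g) • f g h γ = f g h γ
  right : ∀ g h γ, op (Y.proj (vertex h)) • f g h γ = f g h γ
  arrow : ∀ {g g' : X.Q} {h : Y.Q} (e : g ⟶ g') (γ : Γ.con.Γ g' h), X.proj (arrow e) • f g' h γ =
    ∑ e' : Y.Q.In h, op (Y.proj (arrow e'.2)) • f g e'.1 (Γ.con.cell e e'.2 γ)

variable {Γ N f}

/-- The universal property of `M / MJ` as a bimodule. -/
def homLift (hf : Γ.IsCompatible N f) : Γ.bim ⟶ N where
  toLin := Γ.bimLift N.rightHom f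
  map_right b m := Γ.bimLift_op_smul _ f b m
  map_left a m := by
    obtain ⟨x, rfl⟩ := X.proj_surjective a
    have hgen : ∀ {g : X.Q} {h : Y.Q} (γ : Γ.con.Γ g h),
        Γ.bimLift N.rightHom f (Γ.gen γ) = f g h γ := Γ.bimLift_gen N.rightHom f hf.right
    -- it suffices to compare the values at the generators, for vertices and edges of the source
    have key : ∀ x : PathAlgebra k X.Q, (∀ {g : X.Q} {h : Y.Q} (γ : Γ.con.Γ g h),
        Γ.bimLift N.rightHom f (X.proj x • Γ.gen γ) = X.proj x • f g h γ) →
        ∀ m, Γ.bimLift N.rightHom f (X.proj x • m) = X.proj x • Γ.bimLift N.rightHom f m := by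
      intro x hx
      refine LinearMap.congr_fun (f := Γ.bimLift N.rightHom f ∘ₗ lm _ (X.proj x))
        (g := lm _ (X.proj x) ∘ₗ Γ.bimLift N.rightHom f)
        (Γ.linearMap_ext_right (fun b n => op b • n) ?_ ?_ ?_)
      · intro b m
        change Γ.bimLift N.rightHom f (X.proj x • op b • m) = _
        rw [smul_comm]
        exact Γ.bimLift_op_smul _ f b _
      · intro b m
        change X.proj x • Γ.bimLift N.rightHom f (op b • m) = op b • X.proj x • Γ.bimLift N.rightHom f m
        rw [← smul_comm]
        exact congrArg (X.proj x • ·) (Γ.bimLift_op_smul _ f b _)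
      · intro g h γ
        exact (hx γ).trans (congrArg (X.proj x • ·) (hgen γ).symm)
    induction x using generator_induction generalizing m with
    | zero => simp
    | add x x' h h' => rw [map_add, add_smul, map_add, h, h', add_smul]
    | smul t x h => rw [_root_.map_smul X.proj, smul_assoc, map_smul, h, smul_assoc]
    | mul x x' h h' => rw [map_mul, mul_smul, h, h', mul_smul]
    | vertex v =>
      refine key _ (fun {g h} γ => ?_) m
      rw [← vertex_smul_gen, ← hf.left, smul_smul, smul_smul, ← map_mul]
      by_cases hv : v = g
      · subst hv
        rw [path_mul_path, Path.comp_nil, vertex_smul_gen, hf.left, hgen]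
      · rw [path_mul_path_of_ne hv, map_zero, zero_smul, zero_smul, map_zero]
    | @arrow v w e =>
      refine key _ (fun {g h} γ => ?_) m
      by_cases hv : w = g
      · subst hv
        rw [arrow_smul_gen, map_sum, hf.arrow]
        refine Finset.sum_congr rfl fun e' _ => ?_
        rw [bimLift_op_smul, hgen]
        rfl
      · rw [← vertex_smul_gen, ← hf.left, smul_smul, smul_smul, ← map_mul,
          path_mul_path_of_ne hv, map_zero, zero_smul, zero_smul, map_zero]

@[simp] lemma homLift_gen (hf : Γ.IsCompatible N f) {g : X.Q} {h : Y.Q} (γ : Γ.con.Γ g h) :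
    lin (homLift hf) (Γ.gen γ) = f g h γ := Γ.bimLift_gen N.rightHom f hf.right γ

end homLift

end BdQuivCon.Hom

/-! ### Quiver data on the bimodule of a connection -/

open Quiver (Path)

namespace QuiverData
variable {k A : Type u} [Field k] [Ring A] [Algebra k A] (d : QuiverData k A)

lemma D₀_one : d.D₀ 1 = 1 := d.δ₁_one

lemma D₁_one : d.D₁ 1 = 0 := by
  rw [← d.D₀_one, D₁_D₀]

lemma D₀_δ₁ (x : A ⧸ rad A) : d.D₀ (d.δ₁ x) = d.δ₁ x := by
  rw [D₀_apply, d.section₁]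

lemma D₁_δ₁ (x : A ⧸ rad A) : d.D₁ (d.δ₁ x) = 0 := by
  rw [← d.D₀_δ₁, D₁_D₀]

end QuiverData

lemma BdQuivCon.quiverData_D₁ {k : Type u} [Field k] (X : BdQuivCon k)
    (x : PathAlgebra k X.Q) : X.quiverData.D₁ (X.proj x) = X.proj (PathAlgebra.deg 1 x) := by
  have h : X.proj (x - PathAlgebra.deg 0 x) ∈ rad X.alg := by
    rw [proj_mem_rad, map_sub, PathAlgebra.deg_deg]; simp
  have h1 : X.quiverData.D₁ (X.proj x) = X.quiverData.D₁ (X.proj (x - PathAlgebra.deg 0 x)) := by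
    rw [map_sub, map_sub, ← quiverData_D₀, QuiverData.D₁_D₀, sub_zero]
  rw [h1, QuiverData.D₁_of_mem _ h, quiverData_δ₂, map_sub, PathAlgebra.deg_deg]; simp

namespace Bimodule
variable {k : Type u} [Field k] {A B : Bim k} (dA : QuiverData k A) (dB : QuiverData k B)
  (M : Bimodule A B)

/-- The bimodule `M ⊗ k[ε]`, `ε² = 0`, on which `a` acts as `D₀ a + ε D₁ a`, on both sides. A map of
bimodules `M → M ⊗ k[ε]` is a pair of maps that are compatible with the parts of degree `0` and `1` of
elements of the algebras. -/
def firstOrder : Bimodule A B :=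
  ofAlgHoms A B (M × M)
    (AlgHom.ofLinearMap
      { toFun := fun a => (M.lm (dA.D₀ a) ∘ₗ LinearMap.fst k M M).prod
          (M.lm (dA.D₀ a) ∘ₗ LinearMap.snd k M M + M.lm (dA.D₁ a) ∘ₗ LinearMap.fst k M M)
        map_add' := fun a b => LinearMap.ext fun m => by
          refine Prod.ext (?_ : dA.D₀ (a + b) • m.1 = dA.D₀ a • m.1 + dA.D₀ b • m.1)
            (?_ : dA.D₀ (a + b) • m.2 + dA.D₁ (a + b) • m.1 =
              (dA.D₀ a • m.2 + dA.D₁ a • m.1) + (dA.D₀ b • m.2 + dA.D₁ b • m.1))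
          · rw [map_add, add_smul]
          · rw [map_add, map_add, add_smul, add_smul]; abel
        map_smul' := fun r a => LinearMap.ext fun m => by
          refine Prod.ext (?_ : dA.D₀ (r • a) • m.1 = r • dA.D₀ a • m.1)
            (?_ : dA.D₀ (r • a) • m.2 + dA.D₁ (r • a) • m.1 =
              r • (dA.D₀ a • m.2 + dA.D₁ a • m.1))
          · rw [map_smul, smul_assoc]
          · rw [map_smul, map_smul, smul_add, smul_assoc, smul_assoc] }
      (LinearMap.ext fun m => by
        refine Prod.ext (?_ : dA.D₀ 1 • m.1 = m.1) (?_ : dA.D₀ 1 • m.2 + dA.D₁ 1 • m.1 = m.2)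
        · rw [dA.D₀_one, one_smul]
        · rw [dA.D₀_one, dA.D₁_one, one_smul, zero_smul, add_zero])
      (fun a b => LinearMap.ext fun m => by
        refine Prod.ext (?_ : dA.D₀ (a * b) • m.1 = dA.D₀ a • dA.D₀ b • m.1)
          (?_ : dA.D₀ (a * b) • m.2 + dA.D₁ (a * b) • m.1 =
            dA.D₀ a • (dA.D₀ b • m.2 + dA.D₁ b • m.1) + dA.D₁ a • dA.D₀ b • m.1)
        · rw [dA.D₀_mul, mul_smul]
        · rw [dA.D₀_mul, dA.D₁_mul, add_smul, smul_add, mul_smul, mul_smul, mul_smul, add_assoc]))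
    (AlgHom.ofLinearMap
      ((opLinearEquiv k).toLinearMap ∘ₗ
      { toFun := fun b => (M.rm (dB.D₀ b) ∘ₗ LinearMap.fst k M M).prod
          (M.rm (dB.D₀ b) ∘ₗ LinearMap.snd k M M + M.rm (dB.D₁ b) ∘ₗ LinearMap.fst k M M)
        map_add' := fun a b => LinearMap.ext fun m => by
          refine Prod.ext (?_ : op (dB.D₀ (a + b)) • m.1 = op (dB.D₀ a) • m.1 + op (dB.D₀ b) • m.1)
            (?_ : op (dB.D₀ (a + b)) • m.2 + op (dB.D₁ (a + b)) • m.1 =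
              (op (dB.D₀ a) • m.2 + op (dB.D₁ a) • m.1) +
                (op (dB.D₀ b) • m.2 + op (dB.D₁ b) • m.1))
          · rw [map_add, MulOpposite.op_add, add_smul]
          · rw [map_add, map_add, MulOpposite.op_add, MulOpposite.op_add, add_smul, add_smul]; abel
        map_smul' := fun r a => LinearMap.ext fun m => by
          refine Prod.ext (?_ : op (dB.D₀ (r • a)) • m.1 = r • op (dB.D₀ a) • m.1)
            (?_ : op (dB.D₀ (r • a)) • m.2 + op (dB.D₁ (r • a)) • m.1 =
              r • (op (dB.D₀ a) • m.2 + op (dB.D₁ a) • m.1))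
          · rw [map_smul, MulOpposite.op_smul, smul_assoc]
          · rw [map_smul, map_smul, MulOpposite.op_smul, MulOpposite.op_smul, smul_add, smul_assoc,
              smul_assoc] })
      (unop_injective (LinearMap.ext fun m => by
        refine Prod.ext (?_ : op (dB.D₀ 1) • m.1 = m.1)
          (?_ : op (dB.D₀ 1) • m.2 + op (dB.D₁ 1) • m.1 = m.2)
        · rw [dB.D₀_one, op_one, one_smul]
        · rw [dB.D₀_one, dB.D₁_one, op_one, op_zero, one_smul, zero_smul, add_zero]))
      (fun a b => unop_injective (LinearMap.ext fun m => by
        refine Prod.ext (?_ : op (dB.D₀ (a * b)) • m.1 = op (dB.D₀ b) • op (dB.D₀ a) • m.1)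
          (?_ : op (dB.D₀ (a * b)) • m.2 + op (dB.D₁ (a * b)) • m.1 =
            op (dB.D₀ b) • (op (dB.D₀ a) • m.2 + op (dB.D₁ a) • m.1) +
              op (dB.D₁ b) • op (dB.D₀ a) • m.1)
        · rw [dB.D₀_mul, op_mul, mul_smul]
        · rw [dB.D₀_mul, dB.D₁_mul, MulOpposite.op_add, op_mul, op_mul, op_mul, add_smul, smul_add,
            mul_smul, mul_smul, mul_smul]
          abel)))
    (fun a b m => by
      refine Prod.ext (?_ : dA.D₀ a • op (dB.D₀ b) • m.1 = op (dB.D₀ b) • dA.D₀ a • m.1)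
        (?_ : dA.D₀ a • (op (dB.D₀ b) • m.2 + op (dB.D₁ b) • m.1) +
            dA.D₁ a • op (dB.D₀ b) • m.1 =
          op (dB.D₀ b) • (dA.D₀ a • m.2 + dA.D₁ a • m.1) + op (dB.D₁ b) • dA.D₀ a • m.1)
      · rw [smul_comm]
      · rw [smul_add, smul_add, smul_comm (dA.D₀ a), smul_comm (dA.D₀ a), smul_comm (dA.D₁ a)]
        abel)

variable {dA dB M}

/-- The element `m + ε n` of `M ⊗ k[ε]`. -/
def firstOrder.mk : (M × M) ≃ₗ[k] firstOrder dA dB M := LinearEquiv.refl k (M × M)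

lemma firstOrder.smul_mk (a : A) (m n : M) : a • (mk (m, n) : firstOrder dA dB M) =
    mk (dA.D₀ a • m, dA.D₀ a • n + dA.D₁ a • m) := rfl

lemma firstOrder.op_smul_mk (b : B) (m n : M) : op b • (mk (m, n) : firstOrder dA dB M) =
    mk (op (dB.D₀ b) • m, op (dB.D₀ b) • n + op (dB.D₁ b) • m) := rfl

/-- The component of degree `0` of a map `M → M ⊗ k[ε]`. -/
def part₀ (E : M ⟶ firstOrder dA dB M) : M →ₗ[k] M :=
  LinearMap.fst k M M ∘ₗ firstOrder.mk.symm.toLinearMap ∘ₗ lin E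

/-- The component of degree `1` of a map `M → M ⊗ k[ε]`. -/
def part₁ (E : M ⟶ firstOrder dA dB M) : M →ₗ[k] M :=
  LinearMap.snd k M M ∘ₗ firstOrder.mk.symm.toLinearMap ∘ₗ lin E

lemma lin_eq_mk (E : M ⟶ firstOrder dA dB M) (m : M) :
    lin E m = firstOrder.mk (part₀ E m, part₁ E m) := rfl

section
variable (E : M ⟶ firstOrder dA dB M)

lemma part₀_smul (a : A) (m : M) : part₀ E (a • m) = dA.D₀ a • part₀ E m := by
  have := lin_left E a m
  rw [lin_eq_mk E m, firstOrder.smul_mk] at this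
  exact congrArg Prod.fst this

lemma part₁_smul (a : A) (m : M) :
    part₁ E (a • m) = dA.D₀ a • part₁ E m + dA.D₁ a • part₀ E m := by
  have := lin_left E a m
  rw [lin_eq_mk E m, firstOrder.smul_mk] at this
  exact congrArg Prod.snd this

lemma part₀_op_smul (b : B) (m : M) : part₀ E (op b • m) = op (dB.D₀ b) • part₀ E m := by
  have := lin_right E b m
  rw [lin_eq_mk E m, firstOrder.op_smul_mk] at this
  exact congrArg Prod.fst this

lemma part₁_op_smul (b : B) (m : M) :
    part₁ E (op b • m) = op (dB.D₀ b) • part₁ E m + op (dB.D₁ b) • part₀ E m := by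
  have := lin_right E b m
  rw [lin_eq_mk E m, firstOrder.op_smul_mk] at this
  exact congrArg Prod.snd this

lemma part₀_eq_zero {m : M} (hm : m ∈ M.radl) : part₀ E m = 0 := by
  have : M.radl ≤ LinearMap.ker (part₀ E) := lmul_le fun r hr m _ => by
    rw [LinearMap.mem_ker, part₀_smul, dA.D₀_eq_zero hr, zero_smul]
  exact this hm

lemma part₁_eq_zero {m : M} (hm : m ∈ M.radl₂) : part₁ E m = 0 := by
  have : M.radl₂ ≤ LinearMap.ker (part₁ E) := lmul_le fun r hr m hm => by
    rw [LinearMap.mem_ker, part₁_smul, dA.D₀_eq_zero hr, zero_smul, zero_add, part₀_eq_zero E hm,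
      smul_zero]
  exact this hm

end
end Bimodule

namespace BSA.Hom
open Bimodule
variable {k : Type u} [Field k] {X Y : BSA k}

/-- A 1-morphism of `BSA` from a bimodule with components of degree `0` and `1`. -/
def ofGrading (M : Bimodule X.alg Y.alg) (hs : M.IsRadicallySymmetric) (hd : M.IsDualizable)
    (E : M ⟶ firstOrder X.data Y.data M) (s₁ : ∀ m, m - part₀ E m ∈ M.radl)
    (s₂ : ∀ m, m - part₀ E m - part₁ E m ∈ M.radl₂) : Hom X Y :=
  ofMaps M hs hd (part₀ E) (part₁ E ∘ₗ M.radl.subtype)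
    (fun m hm => part₀_eq_zero E hm)
    (fun m => by rw [← neg_sub]; exact neg_mem (s₁ m))
    (fun w hw => part₁_eq_zero E hw)
    (fun w => by
      have := neg_mem (s₂ w)
      rw [part₀_eq_zero E w.2, sub_zero, neg_sub] at this
      exact this)
    (radl₂_le M)
    (fun x y m => by
      rw [part₀_smul, part₀_op_smul, QuiverData.D₀_δ₁, QuiverData.D₀_δ₁])
    (fun x y w => by
      change part₁ E (X.data.δ₁ x • op (Y.data.δ₁ y) • (w : M)) =
        X.data.δ₁ x • op (Y.data.δ₁ y) • part₁ E (w : M)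
      rw [part₁_smul, part₁_op_smul, QuiverData.D₀_δ₁, QuiverData.D₀_δ₁, QuiverData.D₁_δ₁,
        QuiverData.D₁_δ₁, op_zero, zero_smul, zero_smul, add_zero, add_zero])
    (fun r m => by
      change _ = part₁ E ((r : X.alg) • m)
      rw [part₁_smul, X.data.D₀_eq_zero r.2, zero_smul, zero_add, X.data.D₁_of_mem r.2])
    (fun r m => by
      change _ = part₁ E (op (r : Y.alg) • m)
      rw [part₁_op_smul, Y.data.D₀_eq_zero r.2, op_zero, zero_smul, zero_add,
        Y.data.D₁_of_mem r.2])

end BSA.Hom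

namespace BdQuivCon
variable {k : Type u} [Field k]

/-- The algebra `kQ/I`, as an object of `BSA`. -/
abbrev toBSA (X : BdQuivCon k) : BSA k := ⟨X.alg, X.isBasic_alg, X.quiverData⟩

namespace Hom
open PathAlgebra Connection Bimodule
variable {X Y : BdQuivCon k} (Γ : BdQuivCon.Hom X Y)

lemma proj_arrow_mem_rad (X : BdQuivCon k) {g g' : X.Q} (e : g ⟶ g') :
    X.proj (arrow e) ∈ rad X.alg := by
  rw [proj_mem_rad, arrow, deg_path, if_neg (by simp)]

lemma isCompatible_inl : Γ.IsCompatible (firstOrder X.quiverData Y.quiverData Γ.bim)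
    fun _ _ => firstOrder.mk.toLinearMap ∘ₗ LinearMap.inl k Γ.bim Γ.bim ∘ₗ Γ.gen where
  left g h γ := by
    change X.proj (vertex g) • firstOrder.mk (Γ.gen γ, 0) = firstOrder.mk (Γ.gen γ, 0)
    rw [firstOrder.smul_mk, quiverData_D₀, quiverData_D₁, vertex, deg_path, deg_path]
    simp only [Path.length_nil, if_true, zero_ne_one, if_false, map_zero, zero_smul, smul_zero,
      add_zero]
    rw [← vertex, vertex_smul_gen]
  right g h γ := by
    change op (Y.proj (vertex h)) • firstOrder.mk (Γ.gen γ, 0) = firstOrder.mk (Γ.gen γ, 0)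
    rw [firstOrder.op_smul_mk, quiverData_D₀, quiverData_D₁, vertex, deg_path, deg_path]
    simp only [Path.length_nil, if_true, zero_ne_one, if_false, map_zero, op_zero, zero_smul,
      smul_zero, add_zero]
    rw [← vertex, op_vertex_smul_gen]
  arrow {g g' h} e γ := by
    have h0 : ∀ (X : BdQuivCon k) {g g' : X.Q} (e : g ⟶ g'), X.quiverData.D₀ (X.proj (arrow e)) = 0 ∧
        X.quiverData.D₁ (X.proj (arrow e)) = X.proj (arrow e) := fun X g g' e => by
      rw [quiverData_D₀, quiverData_D₁, PathAlgebra.arrow, deg_path, deg_path]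
      simp
    change X.proj (PathAlgebra.arrow e) • firstOrder.mk (Γ.gen γ, 0) =
      ∑ e' : Y.Q.In h, op (Y.proj (PathAlgebra.arrow e'.2)) •
        firstOrder.mk (Γ.gen (Γ.con.cell e e'.2 γ), 0)
    simp only [firstOrder.smul_mk, firstOrder.op_smul_mk, (h0 X e).1, (h0 X e).2,
      fun e' : Y.Q.In h => (h0 Y e'.2).1, fun e' : Y.Q.In h => (h0 Y e'.2).2, op_zero, zero_smul,
      smul_zero, zero_add, ← map_sum]
    refine congrArg firstOrder.mk (Prod.ext ?_ ?_)
    · rw [Prod.fst_sum]; simp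
    · rw [Prod.snd_sum]; exact Γ.arrow_smul_gen e γ

/-- The parts of degree `0` and `1` of an element of the bimodule of a connection. -/
def grading : Γ.bim ⟶ firstOrder X.quiverData Y.quiverData Γ.bim := homLift Γ.isCompatible_inl

lemma part₀_gen {g : X.Q} {h : Y.Q} (γ : Γ.con.Γ g h) : part₀ Γ.grading (Γ.gen γ) = Γ.gen γ :=
  congrArg Prod.fst (homLift_gen Γ.isCompatible_inl γ)

lemma part₁_gen {g : X.Q} {h : Y.Q} (γ : Γ.con.Γ g h) : part₁ Γ.grading (Γ.gen γ) = 0 :=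
  congrArg Prod.snd (homLift_gen Γ.isCompatible_inl γ)

lemma part₀_path {g : X.Q} {h l : Y.Q} (q : Path h l) (γ : Γ.con.Γ g h) :
    part₀ Γ.grading (op (Y.proj (path q)) • Γ.gen γ) =
      if q.length = 0 then op (Y.proj (path q)) • Γ.gen γ else 0 := by
  rw [part₀_op_smul, part₀_gen, quiverData_D₀, deg_path]
  split_ifs
  · rfl
  · rw [map_zero, op_zero, zero_smul]

lemma part₁_path {g : X.Q} {h l : Y.Q} (q : Path h l) (γ : Γ.con.Γ g h) :
    part₁ Γ.grading (op (Y.proj (path q)) • Γ.gen γ) =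
      if q.length = 1 then op (Y.proj (path q)) • Γ.gen γ else 0 := by
  rw [part₁_op_smul, part₀_gen, part₁_gen, quiverData_D₁, deg_path, smul_zero, zero_add]
  split_ifs
  · rfl
  · rw [map_zero, op_zero, zero_smul]

lemma path_cons_smul_gen_mem {g : X.Q} {h i l : Y.Q} (q : Path h i) (e : i ⟶ l)
    (γ : Γ.con.Γ g h) : op (Y.proj (path (q.cons e))) • Γ.gen γ ∈ Γ.bim.radl := by
  induction q generalizing l with
  | nil =>
    change op (Y.proj (arrow e)) • Γ.gen γ ∈ Γ.bim.radl
    rw [op_arrow_smul_gen]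
    exact sum_mem fun e' _ => rad_smul_mem (proj_arrow_mem_rad X _) _
  | cons q e' ih =>
    rw [path_cons, map_mul, op_mul, mul_smul]
    exact op_smul_mem_radl _ (ih e')

lemma sub_part₀_mem (m : Γ.bim) : m - part₀ Γ.grading m ∈ Γ.bim.radl := by
  refine Γ.mem_of_gen_mem (S := Γ.bim.radl.comap (LinearMap.id - part₀ Γ.grading))
    (fun {g h l} q γ => ?_) m
  change _ - part₀ Γ.grading _ ∈ Γ.bim.radl
  rw [part₀_path]
  cases q with
  | nil => simp
  | cons q e => simpa using Γ.path_cons_smul_gen_mem q e γ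

lemma sub_part₀_mem_rmul (m : Γ.bim) : m - part₀ Γ.grading m ∈ Γ.bim.rmul (rad Y.alg) ⊤ := by
  refine Γ.mem_of_gen_mem (S := (Γ.bim.rmul (rad Y.alg) ⊤).comap (LinearMap.id - part₀ Γ.grading))
    (fun {g h l} q γ => ?_) m
  change op (Y.proj (path q)) • Γ.gen γ - part₀ Γ.grading _ ∈ Γ.bim.rmul (rad Y.alg) ⊤
  rw [part₀_path]
  split_ifs with h
  · simp
  · rw [sub_zero]
    refine rmul_mem (M := Γ.bim) (P := ⊤) (m := Γ.gen γ) ?_ Submodule.mem_top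
    rwa [proj_mem_rad, deg_path, if_neg]

lemma isRadicallySymmetric_bim : Γ.bim.IsRadicallySymmetric := by
  apply le_antisymm
  · refine lmul_le fun r hr m _ => ?_
    have := Γ.sub_part₀_mem_rmul (r • m)
    rwa [part₀_eq_zero _ (rad_smul_mem hr m), sub_zero] at this
  · refine rmul_le fun r hr m _ => ?_
    have := Γ.sub_part₀_mem (op r • m)
    rwa [part₀_op_smul, QuiverData.D₀_eq_zero _ hr, op_zero, zero_smul, sub_zero] at this

lemma sub_part₁_mem (m : Γ.bim) :
    m - part₀ Γ.grading m - part₁ Γ.grading m ∈ Γ.bim.radl₂ := by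
  refine Γ.mem_of_gen_mem (S := Γ.bim.radl₂.comap (LinearMap.id - part₀ Γ.grading - part₁ Γ.grading))
    (fun {g h l} q γ => ?_) m
  change _ - part₀ Γ.grading _ - part₁ Γ.grading _ ∈ Γ.bim.radl₂
  rw [part₀_path, part₁_path]
  cases q with
  | nil => simp
  | cons q e =>
    cases q with
    | nil => simp
    | cons q e' =>
      simp only [Path.length_cons, Nat.add_eq_zero_iff, one_ne_zero, and_false, if_false, sub_zero,
        Nat.add_eq_right]
      rw [path_cons, map_mul, op_mul, mul_smul]
      exact Γ.isRadicallySymmetric_bim.op_smul_mem₂ (proj_arrow_mem_rad Y e)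
        (Γ.path_cons_smul_gen_mem q e' γ)

end Hom
end BdQuivCon

/-! ### The bimodule of a connection is dualizable -/

open Quiver (Path)

namespace Connection
open PathAlgebra
variable {k : Type u} [Field k] {G H : FinQuiver.{u}} (c : Connection k G H)

/-- The space `⨁_g kG ⊗ Γ g h`: linear combinations of paths in `G` followed by an edge of `Γ` with
target `h`. No condition is imposed on the ends of the paths. -/
abbrev LeftPathMod (h : H) : Type u := ∀ g : G, PathAlgebra k G ⊗[k] c.Γ g h

/-- A path in `G` followed by an edge of `Γ`. -/
def leftPin {g : G} {h : H} : PathAlgebra k G →ₗ[k] c.Γ g h →ₗ[k] c.LeftPathMod h :=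
  (TensorProduct.mk k _ _).compr₂ (LinearMap.single k (fun g => PathAlgebra k G ⊗[k] c.Γ g h) g)

variable {c} in
/-- The universal property of `LeftPathMod`. -/
def leftLift {h : H} {N : Type*} [AddCommGroup N] [Module k N]
    (f : ∀ g, PathAlgebra k G →ₗ[k] c.Γ g h →ₗ[k] N) : c.LeftPathMod h →ₗ[k] N :=
  LinearMap.lsum k (fun g => PathAlgebra k G ⊗[k] c.Γ g h) k fun g => TensorProduct.lift (f g)

@[simp] lemma leftLift_leftPin {g : G} {h : H} {N : Type*} [AddCommGroup N] [Module k N]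
    (f : ∀ g, PathAlgebra k G →ₗ[k] c.Γ g h →ₗ[k] N) (x : PathAlgebra k G) (γ : c.Γ g h) :
    leftLift f (c.leftPin x γ) = f g x γ :=
  (LinearMap.lsum_piSingle ..).trans (TensorProduct.lift.tmul ..)

variable {c} in
lemma ext_leftPin {h : H} {N : Type*} [AddCommGroup N] [Module k N]
    {f f' : c.LeftPathMod h →ₗ[k] N}
    (hf : ∀ (g : G) x (γ : c.Γ g h), f (c.leftPin x γ) = f' (c.leftPin x γ)) : f = f' := by
  refine LinearMap.pi_ext' fun i => TensorProduct.ext' fun x y => hf i x y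

/-- Left multiplication on `LeftPathMod`. -/
def leftPathMul (h : H) (x : PathAlgebra k G) : c.LeftPathMod h →ₗ[k] c.LeftPathMod h :=
  leftLift fun _ => c.leftPin ∘ₗ LinearMap.mulLeft k x

@[simp] lemma leftPathMul_leftPin {g : G} {h : H} (x y : PathAlgebra k G) (γ : c.Γ g h) :
    c.leftPathMul h x (c.leftPin y γ) = c.leftPin (x * y) γ := by
  simp [leftPathMul]

/-- The right action of an edge `e'` of `H` on `LeftPathMod`: the edge is moved across `Γ` by means of
the inverse of `U`. -/
def rightEdge {h' h : H} (e' : h' ⟶ h) : c.LeftPathMod h' →ₗ[k] c.LeftPathMod h :=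
  leftLift fun g => ∑ e : G.Out g, c.leftPin.compl₁₂
    (LinearMap.mulRight k (arrow e.2 : PathAlgebra k G)) (c.cellInv e.2 e')

@[simp] lemma rightEdge_leftPin {g : G} {h' h : H} (e' : h' ⟶ h) (x : PathAlgebra k G)
    (γ : c.Γ g h') : c.rightEdge e' (c.leftPin x γ) =
      ∑ e : G.Out g, c.leftPin (x * arrow e.2) (c.cellInv e.2 e' γ) := by
  simp [rightEdge, LinearMap.sum_apply]

/-- The right action of a path in `H`, by iteration of the inverse of `U`. -/
def rightPath {h : H} : ∀ {i : H}, Path h i → (c.LeftPathMod h →ₗ[k] c.LeftPathMod i)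
  | _, .nil => LinearMap.id
  | _, .cons q e => c.rightEdge e ∘ₗ rightPath q

lemma rightPath_comp {h i l : H} (q : Path h i) (p : Path i l) :
    c.rightPath (q.comp p) = c.rightPath p ∘ₗ c.rightPath q := by
  induction p with
  | nil => rfl
  | cons p e ih => rw [Path.comp_cons, rightPath, rightPath, ih, LinearMap.comp_assoc]

lemma rightPath_mul {h i : H} (q : Path h i) (x : PathAlgebra k G) (t : c.LeftPathMod h) :
    c.rightPath q (c.leftPathMul h x t) = c.leftPathMul i x (c.rightPath q t) := by
  induction q with
  | nil => rfl
  | @cons i l q e ih =>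
    rw [rightPath, LinearMap.comp_apply, ih, LinearMap.comp_apply]
    refine LinearMap.congr_fun (f := c.rightEdge e ∘ₗ c.leftPathMul i x)
      (g := c.leftPathMul l x ∘ₗ c.rightEdge e) (ext_leftPin fun g y γ => ?_) _
    simp [mul_assoc]

/-- The isomorphism from the path bimodule to `LeftPathMod`, which moves the paths in `H` across
`Γ`. -/
def toLeft : PathBimodule c →ₗ[k] ∀ h : H, c.LeftPathMod h :=
  pathBimoduleLift fun g h l => (Finsupp.lsum k fun q : Path h l =>
    LinearMap.toSpanSingleton k _ (LinearMap.single k c.LeftPathMod l ∘ₗ c.rightPath q ∘ₗ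
      c.leftPin (vertex g))).flip

lemma toLeft_elt {g : G} {h l : H} (q : Path h l) (γ : c.Γ g h) :
    c.toLeft (c.elt q γ) = LinearMap.single k c.LeftPathMod l
      (c.rightPath q (c.leftPin (vertex g) γ)) := by
  rw [elt_apply, toLeft, pathBimoduleLift_pin]
  simp

/-- The inverse of `toLeft`. -/
def ofLeft (h : H) : c.LeftPathMod h →ₗ[k] PathBimodule c :=
  leftLift fun _ => c.leftActₗ.compl₂ (c.elt Path.nil)

@[simp] lemma ofLeft_leftPin {g : G} {h : H} (x : PathAlgebra k G) (γ : c.Γ g h) :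
    c.ofLeft h (c.leftPin x γ) = c.leftAct x (c.elt Path.nil γ) := by
  simp [ofLeft, leftActₗ_apply]

lemma ofLeft_rightEdge {h' h : H} (e' : h' ⟶ h) (t : c.LeftPathMod h') :
    c.ofLeft h (c.rightEdge e' t) = c.rightAct (c.ofLeft h' t) (arrow e') := by
  refine LinearMap.congr_fun (f := c.ofLeft h ∘ₗ c.rightEdge e')
    (g := c.rightActₗ.flip (arrow e') ∘ₗ c.ofLeft h') (ext_leftPin fun g x γ => ?_) t
  change c.ofLeft h (c.rightEdge e' (c.leftPin x γ)) =
    c.rightAct (c.ofLeft h' (c.leftPin x γ)) (arrow e')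
  simp only [rightEdge_leftPin, map_sum, ofLeft_leftPin, leftAct_mul, leftAct_arrow_elt]
  rw [← leftAct_rightAct, arrow, rightAct_elt_path]
  simp only [← leftActₗ_apply]
  rw [← map_sum, Finset.sum_comm]
  refine congrArg _ ?_
  simp only [← map_sum, sum_cell_cellInv]
  rw [Finset.sum_eq_single ⟨h', e'⟩]
  · rw [Pi.single_eq_same]; rfl
  · intro e₁ _ he
    rw [Pi.single_eq_of_ne he, map_zero]
  · simp

/-- Every element is recovered from its expression with the paths of `G` on the left. Since `toLeft` is left
linear, this yields a dual basis for the left action. -/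
lemma sum_ofLeft_toLeft (m : PathBimodule c) : ∑ l, c.ofLeft l (c.toLeft m l) = m := by
  have key : ∀ {h l : H} (q : Path h l) (t : c.LeftPathMod h),
      c.ofLeft l (c.rightPath q t) = c.rightAct (c.ofLeft h t) (path q) := by
    intro h l q t
    induction q with
    | nil => 
      refine LinearMap.congr_fun (f := c.ofLeft h) (g := c.rightActₗ.flip (path Path.nil) ∘ₗ c.ofLeft h)
        (ext_leftPin fun g x γ => ?_) t
      change _ = c.rightAct _ _
      rw [ofLeft_leftPin, ← leftAct_rightAct, rightAct_elt_path, Path.nil_comp]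
    | cons q e ih =>
      rw [rightPath, LinearMap.comp_apply, ofLeft_rightEdge, ih, path_cons, rightAct_mul]
  have h1 : ∑ l, c.ofLeft l (c.toLeft m l) =
      (∑ l, c.ofLeft l ∘ₗ LinearMap.proj l ∘ₗ c.toLeft) m := by
    simp [LinearMap.sum_apply]
  rw [h1]
  refine LinearMap.congr_fun (g := LinearMap.id) (ext_elt fun {g h l} q γ => ?_) m
  rw [LinearMap.sum_apply, Finset.sum_eq_single l]
  · simp only [LinearMap.comp_apply, toLeft_elt, LinearMap.proj_apply, LinearMap.single_apply,
      Pi.single_eq_same, key, ofLeft_leftPin, leftAct_vertex_elt, rightAct_elt_path]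
    rw [Path.nil_comp, LinearMap.id_apply]
  · intro l' _ hl
    simp only [LinearMap.comp_apply, toLeft_elt, LinearMap.proj_apply, LinearMap.single_apply,
      Pi.single_eq_of_ne hl, map_zero]
  · simp

/-- Writing an element with the paths of `G` on the left, which uses `U⁻¹`, turns the left action into
multiplication of paths. -/
lemma toLeft_leftAct (x : PathAlgebra k G) (m : PathBimodule c) (l : H) :
    c.toLeft (c.leftAct x m) l = c.leftPathMul l x (c.toLeft m l) := by
  have key : ∀ x : PathAlgebra k G, (∀ {g : G} {h i : H} (q : Path h i) (γ : c.Γ g h),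
      c.toLeft (c.leftAct x (c.elt q γ)) l = c.leftPathMul l x (c.toLeft (c.elt q γ) l)) →
      ∀ m, c.toLeft (c.leftAct x m) l = c.leftPathMul l x (c.toLeft m l) := fun x hx =>
    LinearMap.congr_fun (f := LinearMap.proj l ∘ₗ c.toLeft ∘ₗ c.leftActₗ x)
      (g := c.leftPathMul l x ∘ₗ LinearMap.proj l ∘ₗ c.toLeft) (ext_elt hx)
  have single : ∀ {g : G} {h i : H} (q : Path h i) (γ : c.Γ g h) (x : PathAlgebra k G),
      c.leftPathMul l x (c.toLeft (c.elt q γ) l) = LinearMap.single k c.LeftPathMod i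
        (c.rightPath q (c.leftPin (x * vertex g) γ)) l := by
    intro g h i q γ x
    rw [toLeft_elt, ← leftPathMul_leftPin, rightPath_mul]
    by_cases hl : l = i
    · subst hl
      simp
    · simp [Pi.single_eq_of_ne hl]
  have hadd : ∀ x y, c.leftPathMul l (x + y) = c.leftPathMul l x + c.leftPathMul l y := fun x y =>
    ext_leftPin fun g z γ => by simp [add_mul]
  have hsmul : ∀ (r : k) x, c.leftPathMul l (r • x) = r • c.leftPathMul l x := fun r x =>
    ext_leftPin fun g z γ => by simp
  have hzero : c.leftPathMul l 0 = 0 := ext_leftPin fun g z γ => by simp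
  have hmul : ∀ x y, c.leftPathMul l (x * y) = c.leftPathMul l x ∘ₗ c.leftPathMul l y := fun x y =>
    ext_leftPin fun g z γ => by simp [mul_assoc]
  induction x using generator_induction generalizing m with
  | zero => rw [← leftActₗ_apply, hzero]; simp
  | add x x' h h' =>
    rw [hadd, LinearMap.add_apply, ← h, ← h', ← leftActₗ_apply, map_add, LinearMap.add_apply, map_add]
    rfl
  | smul r x h =>
    rw [hsmul, LinearMap.smul_apply, ← h, ← leftActₗ_apply, map_smul, LinearMap.smul_apply, map_smul]
    rfl
  | mul x x' h h' => rw [leftAct_mul, h, h', hmul, LinearMap.comp_apply]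
  | vertex v =>
    refine key _ (fun {g h i} q γ => ?_) m
    rw [single]
    by_cases hv : v = g
    · subst hv
      rw [leftAct_vertex_elt, toLeft_elt, vertex, path_mul_path, Path.comp_nil]
    · rw [leftAct_vertex_elt_of_ne _ hv, vertex, vertex, path_mul_path_of_ne hv]
      simp
  | @arrow v w e =>
    refine key _ (fun {g h i} q γ => ?_) m
    rw [single]
    by_cases hv : w = g
    · subst hv
      rw [leftAct_arrow_elt, map_sum]
      simp only [toLeft_elt, rightPath_comp, LinearMap.comp_apply]
      rw [← map_sum, ← map_sum]
      have h1 : ∀ e' : H.In h, c.rightPath e'.2.toPath (c.leftPin (vertex v) (c.cell e e'.2 γ)) =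
          ∑ e₁ : G.Out v, c.leftPin (arrow e₁.2) (c.cellInv e₁.2 e'.2 (c.cell e e'.2 γ)) := by
        intro e'
        change c.rightEdge e'.2 _ = _
        rw [rightEdge_leftPin]
        refine Finset.sum_congr rfl fun e₁ _ => ?_
        rw [vertex, arrow, path_mul_path, Path.nil_comp]
      simp only [h1]
      rw [Finset.sum_comm]
      -- `U` moves the edge `e` to the right and `U⁻¹` moves it back
      simp only [← map_sum, sum_cellInv_cell]
      rw [Finset.sum_eq_single ⟨w, e⟩]
      · rw [Pi.single_eq_same, vertex, arrow, path_mul_path, Path.comp_nil]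
      · intro e₁ _ he
        rw [Pi.single_eq_of_ne he, map_zero]
      · simp
    · rw [leftAct_arrow_elt_of_ne _ hv, vertex, arrow, path_mul_path_of_ne hv]
      simp

end Connection

namespace BdQuivCon.Hom
open PathAlgebra Connection Bimodule
variable {k : Type u} [Field k] {X Y : BdQuivCon k} (Γ : BdQuivCon.Hom X Y)

/-- The direct sum of the spaces `Γ g h`. -/
abbrev Total : Type u := ∀ g h, Γ.con.Γ g h

/-- The inclusion of `Γ g h` in the direct sum. -/
def incl (g : X.Q) (h : Y.Q) : Γ.con.Γ g h →ₗ[k] Γ.Total :=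
  LinearMap.single k (fun g => ∀ h, Γ.con.Γ g h) g ∘ₗ LinearMap.single k (fun h => Γ.con.Γ g h) h

/-- The map from the direct sum of the spaces `Γ g h` to the bimodule. -/
def totalGen : Γ.Total →ₗ[k] Γ.bim :=
  ∑ g, ∑ h, Γ.gen ∘ₗ LinearMap.proj (φ := fun h => Γ.con.Γ g h) h ∘ₗ
    LinearMap.proj (φ := fun g => ∀ h, Γ.con.Γ g h) g

lemma totalGen_incl {g : X.Q} {h : Y.Q} (γ : Γ.con.Γ g h) : Γ.totalGen (Γ.incl g h γ) = Γ.gen γ := by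
  simp only [totalGen, LinearMap.sum_apply, LinearMap.comp_apply, LinearMap.proj_apply, incl,
    LinearMap.single_apply]
  rw [Finset.sum_eq_single g, Finset.sum_eq_single h]
  · rw [Pi.single_eq_same, Pi.single_eq_same]
  · intro h' _ hh
    rw [Pi.single_eq_same, Pi.single_eq_of_ne hh, map_zero]
  · simp
  · intro g' _ hg
    refine Finset.sum_eq_zero fun h' _ => ?_
    rw [Pi.single_eq_of_ne hg]
    exact map_zero _
  · simp

/-- A basis of the direct sum of the spaces `Γ g h`. -/
def basis : Module.Basis (Fin (Module.finrank k Γ.Total)) k Γ.Total := Module.finBasis k _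

/-- The coordinates for the basis, as right linear maps on the bimodule. -/
def rightCoord (i : Fin (Module.finrank k Γ.Total)) : Γ.bim →ₗ[k] Bimodule.unit Y.alg :=
  Γ.bimLift (Bimodule.unit Y.alg).rightHom fun g h =>
    LinearMap.toSpanSingleton k _ (toUnit Y.alg (Y.proj (vertex h))) ∘ₗ Γ.basis.coord i ∘ₗ
      Γ.incl g h

lemma rightCoord_gen (i) {g : X.Q} {h : Y.Q} (γ : Γ.con.Γ g h) : Γ.rightCoord i (Γ.gen γ) =
    Γ.basis.coord i (Γ.incl g h γ) • toUnit Y.alg (Y.proj (vertex h)) := by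
  refine Γ.bimLift_gen _ _ (fun g h γ => ?_) γ
  change op (Y.proj (vertex h)) • Γ.basis.coord i (Γ.incl g h γ) • toUnit Y.alg (Y.proj (vertex h)) =
    Γ.basis.coord i (Γ.incl g h γ) • toUnit Y.alg (Y.proj (vertex h))
  rw [smul_comm, op_smul_toUnit, ← map_mul, vertex_mul_vertex, if_pos rfl]

lemma sum_rightCoord (m : Γ.bim) :
    ∑ i, op ((toUnit Y.alg).symm (Γ.rightCoord i m)) • Γ.totalGen (Γ.basis i) = m := by
  let F : Γ.bim →ₗ[k] Γ.bim := ∑ i, ((Algebra.lsmul k k Γ.bim :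
    Y.algᵐᵒᵖ →ₐ[k] Module.End k Γ.bim).toLinearMap ∘ₗ
      (opLinearEquiv k : Y.alg ≃ₗ[k] Y.algᵐᵒᵖ).toLinearMap).flip (Γ.totalGen (Γ.basis i)) ∘ₗ
        (toUnit Y.alg).symm.toLinearMap ∘ₗ Γ.rightCoord i
  have hF : ∀ m, F m = ∑ i, op ((toUnit Y.alg).symm (Γ.rightCoord i m)) • Γ.totalGen (Γ.basis i) :=
    fun m => by simp [F, LinearMap.sum_apply]
  rw [← hF]
  refine LinearMap.congr_fun (f := F) (g := LinearMap.id)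
    (Γ.linearMap_ext_right (fun b n => op b • n) (fun b m => ?_) (fun _ _ => rfl)
      (fun {g h} γ => ?_)) m
  · rw [hF, hF, Finset.smul_sum]
    refine Finset.sum_congr rfl fun i _ => ?_
    rw [smul_smul, ← op_mul]
    have : Γ.rightCoord i (op b • m) = op b • Γ.rightCoord i m := Γ.bimLift_op_smul _ _ b m
    rw [this]
    rfl
  · rw [hF]
    have h1 : ∀ i, op ((toUnit Y.alg).symm (Γ.rightCoord i (Γ.gen γ))) • Γ.totalGen (Γ.basis i) =
        op (Y.proj (vertex h)) • Γ.totalGen (Γ.basis.coord i (Γ.incl g h γ) • Γ.basis i) := by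
      intro i
      rw [rightCoord_gen, map_smul, LinearEquiv.symm_apply_apply, MulOpposite.op_smul, smul_assoc,
        map_smul, smul_comm]
    simp only [h1, ← Finset.smul_sum, ← map_sum]
    simp only [Module.Basis.coord_apply, Γ.basis.sum_repr, totalGen_incl, op_vertex_smul_gen]
    rfl

/-- The coordinates for the basis on `LeftPathMod`, with values in `kG/I`. -/
def leftCoordAux (i : Fin (Module.finrank k Γ.Total)) (h : Y.Q) :
    Γ.con.LeftPathMod h →ₗ[k] X.alg :=
  leftLift fun g => (LinearMap.lsmul k X.alg).flip.compl₂ (Γ.basis.coord i ∘ₗ Γ.incl g h) ∘ₗ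
    X.proj.toLinearMap

lemma leftCoordAux_leftPin (i) {g : X.Q} {h : Y.Q} (x : PathAlgebra k X.Q) (γ : Γ.con.Γ g h) :
    Γ.leftCoordAux i h (Γ.con.leftPin x γ) = Γ.basis.coord i (Γ.incl g h γ) • X.proj x := by
  rw [leftCoordAux, leftLift_leftPin]
  rfl

lemma leftCoordAux_mul (i) {h : Y.Q} (x : PathAlgebra k X.Q) (t : Γ.con.LeftPathMod h) :
    Γ.leftCoordAux i h (Γ.con.leftPathMul h x t) = X.proj x * Γ.leftCoordAux i h t := by
  refine LinearMap.congr_fun (f := Γ.leftCoordAux i h ∘ₗ Γ.con.leftPathMul h x)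
    (g := LinearMap.mulLeft k (X.proj x) ∘ₗ Γ.leftCoordAux i h) (ext_leftPin fun g y γ => ?_) t
  simp only [LinearMap.comp_apply, leftPathMul_leftPin, leftCoordAux_leftPin, LinearMap.mulLeft_apply,
    map_mul, mul_smul_comm]

/-- The coordinates for the basis on the path bimodule, with values in `kG/I`. -/
def leftCoordPath (i : Fin (Module.finrank k Γ.Total)) : Γ.con.PathBimodule →ₗ[k] X.alg :=
  ∑ h, Γ.leftCoordAux i h ∘ₗ LinearMap.proj h ∘ₗ Γ.con.toLeft

lemma leftCoordPath_apply (i) (m : Γ.con.PathBimodule) :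
    Γ.leftCoordPath i m = ∑ h, Γ.leftCoordAux i h (Γ.con.toLeft m h) := by
  simp [leftCoordPath, LinearMap.sum_apply]

lemma leftCoordPath_leftAct (i) (x : PathAlgebra k X.Q) (m : Γ.con.PathBimodule) :
    Γ.leftCoordPath i (Γ.con.leftAct x m) = X.proj x * Γ.leftCoordPath i m := by
  simp only [leftCoordPath_apply, toLeft_leftAct, leftCoordAux_mul, Finset.mul_sum]

/-- The coordinates for the basis, as left linear maps on the bimodule. They are well defined because
the inverse of `U` moves the relations of the target into the relations of the source. -/
def leftCoord (i : Fin (Module.finrank k Γ.Total)) : Γ.bim →ₗ[k] X.alg :=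
  (Γ.con.mulIdeal Y.I).liftQ (Γ.leftCoordPath i) (Γ.con.mulIdeal_le fun {g h l} γ y hy => by
    have h1 : Submodule.span k {m | ∃ (g' : X.Q) (x : Path g g' →₀ k) (γ' : Γ.con.Γ g' l),
        of g g' x ∈ X.I ∧ m = Γ.con.act l x (Γ.con.edge γ')} ≤
          (LinearMap.ker (Γ.leftCoordPath i)).comap (Γ.con.ofPathMod g l) := by
      rw [Submodule.span_le]
      rintro _ ⟨g', x, γ', hx, rfl⟩
      change Γ.leftCoordPath i (Γ.con.ofPathMod g l (Γ.con.act l x (Γ.con.edge γ'))) = 0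
      rw [← leftAct_of_ofPathMod, leftCoordPath_leftAct, X.proj_eq_zero.2 hx, zero_mul]
    exact h1 (Γ.ideal.pin_mem g h l y hy γ))

lemma leftCoord_proj (i) (m : Γ.con.PathBimodule) :
    Γ.leftCoord i (Γ.proj m) = Γ.leftCoordPath i m := rfl

lemma sum_leftCoord (m : Γ.bim) : ∑ i, Γ.leftCoord i m • Γ.totalGen (Γ.basis i) = m := by
  obtain ⟨m, rfl⟩ := Γ.proj_surjective m
  have key : ∀ h (t : Γ.con.LeftPathMod h),
      ∑ i, Γ.leftCoordAux i h t • Γ.totalGen (Γ.basis i) = Γ.proj (Γ.con.ofLeft h t) := by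
    intro h t
    let F : Γ.con.LeftPathMod h →ₗ[k] Γ.bim := ∑ i, (Algebra.lsmul k k Γ.bim :
      X.alg →ₐ[k] Module.End k Γ.bim).toLinearMap.flip (Γ.totalGen (Γ.basis i)) ∘ₗ
        Γ.leftCoordAux i h
    have hF : ∀ t, F t = ∑ i, Γ.leftCoordAux i h t • Γ.totalGen (Γ.basis i) :=
      fun m => by simp [F, LinearMap.sum_apply]
    rw [← hF]
    refine LinearMap.congr_fun (f := F) (g := Γ.proj ∘ₗ Γ.con.ofLeft h)
      (ext_leftPin fun g x γ => ?_) t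
    rw [hF, LinearMap.comp_apply, ofLeft_leftPin, proj_leftAct]
    have h1 : ∀ i, Γ.leftCoordAux i h (Γ.con.leftPin x γ) • Γ.totalGen (Γ.basis i) =
        X.proj x • Γ.totalGen (Γ.basis.coord i (Γ.incl g h γ) • Γ.basis i) := fun i => by
      rw [leftCoordAux_leftPin, smul_assoc, map_smul, smul_comm]
    simp only [h1, ← Finset.smul_sum, ← map_sum]
    simp only [Module.Basis.coord_apply, Γ.basis.sum_repr, totalGen_incl]
    rfl
  simp only [leftCoord_proj, leftCoordPath_apply, Finset.sum_smul]
  rw [Finset.sum_comm]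
  simp only [key]
  rw [← map_sum, sum_ofLeft_toLeft]

lemma isDualizable_bim : Γ.bim.IsDualizable :=
  isDualizable_of_dual_bases
    ⟨_, fun i => Γ.totalGen (Γ.basis i), fun i => (toUnit Y.alg).symm.toLinearMap ∘ₗ Γ.rightCoord i,
      fun i m b => congrArg (toUnit Y.alg).symm (Γ.bimLift_op_smul _ _ b m), Γ.sum_rightCoord⟩
    ⟨_, fun i => Γ.totalGen (Γ.basis i), Γ.leftCoord, fun i m a => by
      obtain ⟨x, rfl⟩ := X.proj_surjective a
      obtain ⟨m, rfl⟩ := Γ.proj_surjective m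
      exact Γ.leftCoordPath_leftAct i x m, Γ.sum_leftCoord⟩

/-- The bimodule of an ideally connected connection, as a 1-morphism of `BSA`. -/
def toBSA : BSA.Hom X.toBSA Y.toBSA :=
  BSA.Hom.ofGrading (X := X.toBSA) (Y := Y.toBSA) Γ.bim Γ.isRadicallySymmetric_bim
    Γ.isDualizable_bim Γ.grading Γ.sub_part₀_mem Γ.sub_part₁_mem

end BdQuivCon.Hom

/-! ### Unit and composition isomorphisms -/

open Quiver (Path)

namespace Bimodule
variable {k : Type u} [Field k] {A B : Bim k}

/-- An intertwiner with an inverse map is an isomorphism of bimodules. -/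
def isoOfInverse {M N : Bimodule A B} (f : M ⟶ N) (g : N →ₗ[k] M) (hfg : ∀ m, g (lin f m) = m)
    (hgf : ∀ n, lin f (g n) = n) : M ≅ N :=
  mkIso (lin f) g (lin_left f) (lin_right f) hfg hgf

end Bimodule

namespace BdQuivCon
open PathAlgebra Connection Bimodule
variable {k : Type u} [Field k]

namespace Hom
variable {X Y : BdQuivCon k} {Γ Λ : BdQuivCon.Hom X Y}

section map
variable (f : Γ.con ⟶ Λ.con)

lemma isCompatible_map : Γ.IsCompatible Λ.bim fun g h => Λ.gen ∘ₗ app f g h where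
  left g h γ := Λ.vertex_smul_gen _
  right g h γ := Λ.op_vertex_smul_gen _
  arrow e γ := by
    simp only [LinearMap.comp_apply, arrow_smul_gen, app_comm]

/-- The map of bimodules induced by a morphism of connections. -/
def bimMap : Γ.bim ⟶ Λ.bim := homLift (isCompatible_map f)

@[simp] lemma bimMap_gen {g : X.Q} {h : Y.Q} (γ : Γ.con.Γ g h) :
    lin (bimMap f) (Γ.gen γ) = Λ.gen (app f g h γ) := homLift_gen _ γ

lemma bimMap_proj (m : Γ.con.PathBimodule) : lin (bimMap f) (Γ.proj m) = Λ.proj (pathMap f m) := by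
  let F : Γ.con.PathBimodule →ₗ[k] Λ.con.PathBimodule :=
    { toFun := pathMap f
      map_add' := fun m n => Λ.con.pathBimodule_ext fun g l => map_add (pathLift _) _ _
      map_smul' := fun r m => Λ.con.pathBimodule_ext fun g l => map_smul (pathLift _) _ _ }
  refine LinearMap.congr_fun (f := lin (bimMap f) ∘ₗ Γ.proj) (g := Λ.proj ∘ₗ F)
    (ext_elt fun {g h l} q γ => ?_) m
  have h1 : F (Γ.con.elt q γ) = Λ.con.elt q (app f g h γ) := by
    refine Λ.con.pathBimodule_ext fun g' l' => ?_
    change pathLift _ (Γ.con.elt q γ g' l') = _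
    rw [elt_apply, elt_apply]
    by_cases hh : g = g' ∧ l = l'
    · obtain ⟨rfl, rfl⟩ := hh
      rw [ofPathMod_apply_same, ofPathMod_apply_same, pathLift_pin]
      rfl
    · rw [ofPathMod_apply_of_ne _ _ hh, ofPathMod_apply_of_ne _ _ hh, map_zero]
  rw [LinearMap.comp_apply, LinearMap.comp_apply, h1, proj_elt, proj_elt, lin_right, bimMap_gen]

end map

lemma lin_part₀ {M : Bimodule X.alg Y.alg} {D : M →ₗ[k] M}
    (hD : ∀ b m, D (op b • m) = op (Y.quiverData.D₀ b) • D m) (f : Γ.bim ⟶ M)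
    (hf : ∀ {g : X.Q} {h : Y.Q} (γ : Γ.con.Γ g h), D (lin f (Γ.gen γ)) = lin f (Γ.gen γ))
    (m : Γ.bim) : lin f (part₀ Γ.grading m) = D (lin f m) := by
  refine LinearMap.congr_fun (f := lin f ∘ₗ part₀ Γ.grading) (g := D ∘ₗ lin f)
    (Γ.linearMap_ext_right (fun b n => op (Y.quiverData.D₀ b) • n) (fun b m => ?_)
      (fun b m => ?_) fun {g h} γ => ?_) m
  · rw [LinearMap.comp_apply, part₀_op_smul, lin_right, LinearMap.comp_apply]
  · rw [LinearMap.comp_apply, lin_right, hD, LinearMap.comp_apply]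
  · rw [LinearMap.comp_apply, part₀_gen, LinearMap.comp_apply, hf]

variable (Γ) in
/-- A map from the bimodule of a connection is compatible with quiver data if it sends the elements of
`Γ` to elements of degree `0`. -/
def hom₂ (M : BSA.Hom X.toBSA Y.toBSA) (f : Γ.bim ⟶ M.bim)
    (hf : ∀ {g : X.Q} {h : Y.Q} (γ : Γ.con.Γ g h), M.d₁ (lin f (Γ.gen γ)) = lin f (Γ.gen γ)) :
    Γ.toBSA ⟶ M :=
  BSA.Hom.Hom₂.mk (M := Γ.toBSA) f (lin_part₀ (D := M.d₁) (fun b m => M.d₁_op_smul b m) f hf)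

variable (Γ) in
/-- An isomorphism of bimodules is compatible with quiver data if it sends the elements of `Γ` to
elements of degree `0`. -/
def iso₂ (M : BSA.Hom X.toBSA Y.toBSA) (e : Γ.bim ≅ M.bim)
    (he : ∀ {g : X.Q} {h : Y.Q} (γ : Γ.con.Γ g h),
      M.d₁ (lin e.hom (Γ.gen γ)) = lin e.hom (Γ.gen γ)) : Γ.toBSA ≅ M :=
  BSA.Hom.mkIso (M := Γ.toBSA) e (BSA.Hom.Hom₂.compat (Γ.hom₂ M e.hom he))

end Hom

open Hom

section unit
variable (X : BdQuivCon k)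

/-- The identity connection, as an ideally connected connection. -/
abbrev idHom : BdQuivCon.Hom X X := ⟨one X.Q, isIdeallyConnected_one X.I⟩

/-- The map from the identity connection to the regular bimodule, `1_v ↦ v`. -/
def unitFun (g h : X.Q) : (one (k := k) X.Q).Γ g h →ₗ[k] Bimodule.unit X.alg :=
  open Classical in
  if hh : g = h then LinearMap.toSpanSingleton k _ (toUnit X.alg (X.proj (vertex g))) ∘ₗ
    LinearMap.proj (R := k) (φ := fun _ : PLift (g = h) => k) ⟨hh⟩ else 0

lemma unitFun_gen (v : X.Q) : X.unitFun v v (Connection.gen v) = toUnit X.alg (X.proj (vertex v)) := by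
  rw [unitFun, dif_pos rfl]
  exact one_smul k (toUnit X.alg (X.proj (vertex v)))

variable {X} in
lemma one_ext {N : Type*} [AddCommGroup N] [Module k N] {f f' : ∀ g h : X.Q,
    (one (k := k) X.Q).Γ g h →ₗ[k] N}
    (hf : ∀ v, f v v (Connection.gen v) = f' v v (Connection.gen v)) (g h : X.Q)
    (γ : (one (k := k) X.Q).Γ g h) : f g h γ = f' g h γ := by
  by_cases hh : g = h
  · subst hh
    rw [one_eq_smul γ, map_smul, map_smul, hf]
  · rw [one_eq_zero hh γ, map_zero, map_zero]

lemma isCompatible_unitFun : X.idHom.IsCompatible (Bimodule.unit X.alg) X.unitFun where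
  left := one_ext (f := fun g h => lm _ (X.proj (vertex g)) ∘ₗ X.unitFun g h) fun v => by
    change X.proj (vertex v) • X.unitFun v v (Connection.gen v) = X.unitFun v v (Connection.gen v)
    rw [unitFun_gen, smul_toUnit, ← map_mul, vertex_mul_vertex, if_pos rfl]
  right := one_ext (f := fun g h => rm _ (X.proj (vertex h)) ∘ₗ X.unitFun g h) fun v => by
    change op (X.proj (vertex v)) • X.unitFun v v (Connection.gen v) = X.unitFun v v (Connection.gen v)
    rw [unitFun_gen, op_smul_toUnit, ← map_mul, vertex_mul_vertex, if_pos rfl]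
  arrow {g g' h} e γ := by
    by_cases hh : g' = h
    · subst hh
      have h1 : γ = (show PLift (g' = g') → k from γ) ⟨rfl⟩ • Connection.gen g' := one_eq_smul γ
      rw [h1]
      simp only [map_smul]
      rw [smul_comm, unitFun_gen, smul_toUnit, ← map_mul, vertex, arrow, path_mul_path, Path.comp_nil,
        Finset.sum_eq_single ⟨g, e⟩]
      · rw [one_cell_gen_same, unitFun_gen, smul_comm, op_smul_toUnit, ← map_mul, vertex, arrow,
          path_mul_path, Path.nil_comp]
      · intro e' _ he
        rw [one_cell_gen_of_ne _ _ he, map_zero, smul_zero, smul_zero]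
      · simp
    · have h1 : γ = 0 := one_eq_zero hh γ
      rw [h1]
      simp

/-- The inverse of the unit isomorphism. -/
def unitInv : Bimodule.unit X.alg →ₗ[k] X.idHom.bim :=
  ((Algebra.lsmul k k X.idHom.bim : X.algᵐᵒᵖ →ₐ[k] Module.End k X.idHom.bim).toLinearMap ∘ₗ
    (opLinearEquiv k : X.alg ≃ₗ[k] X.algᵐᵒᵖ).toLinearMap ∘ₗ
      (toUnit X.alg).symm.toLinearMap).flip (∑ v, X.idHom.gen (Connection.gen v))

lemma unitInv_toUnit (b : X.alg) :
    X.unitInv (toUnit X.alg b) = op b • ∑ v, X.idHom.gen (Connection.gen v) := rfl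

lemma homLift_unitFun_gen (v : X.Q) :
    lin (homLift X.isCompatible_unitFun) (X.idHom.gen (Connection.gen v)) =
      toUnit X.alg (X.proj (vertex v)) :=
  (homLift_gen X.isCompatible_unitFun (Connection.gen v)).trans (X.unitFun_gen v)

/-- The isomorphism from the bimodule of the identity connection to the regular bimodule. -/
def unitIso : X.idHom.bim ≅ Bimodule.unit X.alg :=
  isoOfInverse (homLift X.isCompatible_unitFun) X.unitInv
    (by
      refine LinearMap.congr_fun (f := X.unitInv ∘ₗ lin (homLift X.isCompatible_unitFun))
        (g := LinearMap.id)
        (X.idHom.linearMap_ext_right (fun b n => op b • n) (fun b m => ?_) (fun _ _ => rfl)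
          fun {g h} γ => ?_)
      · rw [LinearMap.comp_apply, lin_right]
        obtain ⟨a, ha⟩ := exists_toUnit (lin (homLift X.isCompatible_unitFun) m)
        rw [LinearMap.comp_apply, ha, op_smul_toUnit]
        exact mul_smul (op b) (op a) _
      · refine one_ext (f := fun g h => X.unitInv ∘ₗ lin (homLift X.isCompatible_unitFun) ∘ₗ
          X.idHom.gen (g := g) (h := h)) (f' := fun g h => X.idHom.gen) (fun v => ?_) g h γ
        change X.unitInv (lin (homLift X.isCompatible_unitFun) (X.idHom.gen (Connection.gen v))) =
          X.idHom.gen (Connection.gen v)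
        rw [homLift_unitFun_gen, unitInv_toUnit, Finset.smul_sum, Finset.sum_eq_single v]
        · exact X.idHom.op_vertex_smul_gen _
        · intro w _ hw
          rw [← X.idHom.op_vertex_smul_gen, smul_smul, ← op_mul, ← map_mul, vertex_mul_vertex,
            if_neg hw, map_zero, op_zero, zero_smul]
        · simp)
    (fun x => by
      obtain ⟨b, rfl⟩ := (toUnit X.alg).surjective x
      rw [unitInv_toUnit, lin_right, map_sum, Finset.sum_congr rfl fun v _ => X.homLift_unitFun_gen v,
        ← map_sum, ← map_sum, sum_vertex, map_one, op_smul_toUnit, one_mul])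

lemma unitIso_gen (v : X.Q) : lin X.unitIso.hom (X.idHom.gen (Connection.gen v)) =
    toUnit X.alg (X.proj (vertex v)) := X.homLift_unitFun_gen v

end unit

section comp
variable {X Y Z : BdQuivCon k} (Γ : BdQuivCon.Hom X Y) (Λ : BdQuivCon.Hom Y Z)

/-- The composite of ideally connected connections. -/
abbrev compHom : BdQuivCon.Hom X Z := ⟨Connection.comp Γ.con Λ.con, Γ.ideal.comp Λ.ideal⟩

/-- The map `γ ⊗ δ ↦ γ ⊗ δ` from the composite connection to the tensor product. -/
def compFun (g : X.Q) (l : Z.Q) : (Connection.comp Γ.con Λ.con).Γ g l →ₗ[k] tensor Γ.bim Λ.bim :=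
  Connection.lift fun _ => (tmₗ Γ.bim Λ.bim).compl₁₂ Γ.gen Λ.gen

lemma compFun_inj {g : X.Q} {h : Y.Q} {l : Z.Q} (γ : Γ.con.Γ g h) (δ : Λ.con.Γ h l) :
    compFun Γ Λ g l (inj _ _ γ δ) = tm (Γ.gen γ) (Λ.gen δ) :=
  Connection.lift_inj ..

lemma isCompatible_compFun : (compHom Γ Λ).IsCompatible (tensor Γ.bim Λ.bim) (compFun Γ Λ) where
  left g l γ := by
    refine LinearMap.congr_fun (f := lm _ (X.proj (vertex g)) ∘ₗ compFun Γ Λ g l)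
      (g := compFun Γ Λ g l) (ext_inj fun h γ δ => ?_) γ
    change X.proj (vertex g) • compFun Γ Λ g l _ = _
    rw [compFun_inj, smul_tm_left, vertex_smul_gen]
  right g l γ := by
    refine LinearMap.congr_fun (f := rm _ (Z.proj (vertex l)) ∘ₗ compFun Γ Λ g l)
      (g := compFun Γ Λ g l) (ext_inj fun h γ δ => ?_) γ
    change op (Z.proj (vertex l)) • compFun Γ Λ g l _ = _
    rw [compFun_inj, smul_tm_right, op_vertex_smul_gen]
  arrow {g g' l} e γ := by
    have key := LinearMap.congr_fun (f := lm _ (X.proj (arrow e)) ∘ₗ compFun Γ Λ g' l)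
      (g := ∑ e' : Z.Q.In l, rm _ (Z.proj (arrow e'.2)) ∘ₗ compFun Γ Λ g e'.1 ∘ₗ
        (Connection.comp Γ.con Λ.con).cell e e'.2) (ext_inj fun h γ δ => ?_) γ
    · rw [LinearMap.sum_apply] at key
      exact key
    · rw [LinearMap.sum_apply]
      change X.proj (arrow e) • compFun Γ Λ g' l _ = ∑ e' : Z.Q.In l,
        op (Z.proj (arrow e'.2)) • compFun Γ Λ g e'.1 ((Connection.comp Γ.con Λ.con).cell e e'.2 _)
      simp only [compFun_inj, comp_cell_inj, map_sum, Finset.smul_sum, smul_tm_left, smul_tm_right]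
      rw [Finset.sum_comm, arrow_smul_gen, ← tmₗ_apply, map_sum, LinearMap.sum_apply]
      refine Finset.sum_congr rfl fun e' _ => ?_
      rw [tmₗ_apply, tm_balanced, arrow_smul_gen, ← tmₗ_apply, map_sum]
      rfl

/-- Precomposition with the left action, as a right action on spaces of linear maps. -/
def precompHom (P : Type u) [AddCommGroup P] [Module k P] :
    Y.alg →ₐ[k] (Module.End k (Λ.bim →ₗ[k] P))ᵐᵒᵖ :=
  AlgHom.ofLinearMap
    ((opLinearEquiv k).toLinearMap ∘ₗ (LinearMap.llcomp k Λ.bim Λ.bim P).flip ∘ₗ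
      (Algebra.lsmul k k Λ.bim : Y.alg →ₐ[k] Module.End k Λ.bim).toLinearMap)
    (unop_injective (LinearMap.ext fun φ => LinearMap.ext fun m =>
      congrArg φ (one_smul Y.alg m)))
    (fun a b => unop_injective (LinearMap.ext fun φ => LinearMap.ext fun m =>
      congrArg φ (mul_smul a b m)))

lemma precompHom_apply (P : Type u) [AddCommGroup P] [Module k P] (b : Y.alg) (φ : Λ.bim →ₗ[k] P)
    (m : Λ.bim) : (precompHom Λ P b).unop φ m = φ (b • m) := rfl

/-- For `γ ∈ Γ g h`, the right linear map `δ ↦ γ ⊗ δ` from the bimodule of `Λ`; it is zero on the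
elements of `Λ` that do not start at `h`. -/
def compInvFun (g : X.Q) (h : Y.Q) : Γ.con.Γ g h →ₗ[k] Λ.bim →ₗ[k] (compHom Γ Λ).bim where
  toFun γ := Λ.bimLift (compHom Γ Λ).bim.rightHom fun h' l => (compHom Γ Λ).gen ∘ₗ
    inj Γ.con Λ.con γ ∘ₗ LinearMap.proj h ∘ₗ LinearMap.single k (fun h => Λ.con.Γ h l) h'
  map_add' γ γ' := linearMap_ext fun q δ => by
    rw [LinearMap.add_apply, bimLift_path, bimLift_path, bimLift_path, ← map_add]
    simp
  map_smul' r γ := linearMap_ext fun q δ => by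
    rw [LinearMap.smul_apply, bimLift_path, bimLift_path, RingHom.id_apply, ← map_smul]
    simp

lemma compInvFun_op_smul {g : X.Q} {h : Y.Q} (γ : Γ.con.Γ g h) (b : Z.alg) (n : Λ.bim) :
    compInvFun Γ Λ g h γ (op b • n) = op b • compInvFun Γ Λ g h γ n :=
  Λ.bimLift_op_smul _ _ b n

lemma compInvFun_gen_aux {g : X.Q} {h h' : Y.Q} {l : Z.Q} (γ : Γ.con.Γ g h) (δ : Λ.con.Γ h' l) :
    compInvFun Γ Λ g h γ (Λ.gen δ) = (compHom Γ Λ).gen (inj Γ.con Λ.con γ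
      (Pi.single (M := fun h => Λ.con.Γ h l) h' δ h)) :=
  Λ.bimLift_gen _ _ (fun _ _ _ => (compHom Γ Λ).op_vertex_smul_gen _) δ

lemma compInvFun_gen {g : X.Q} {h : Y.Q} {l : Z.Q} (γ : Γ.con.Γ g h) (δ : Λ.con.Γ h l) :
    compInvFun Γ Λ g h γ (Λ.gen δ) = (compHom Γ Λ).gen (inj Γ.con Λ.con γ δ) := by
  rw [compInvFun_gen_aux, Pi.single_eq_same]

lemma compInvFun_vertex {g : X.Q} {h : Y.Q} (γ : Γ.con.Γ g h) :
    (precompHom Λ (compHom Γ Λ).bim (Y.proj (vertex h))).unop (compInvFun Γ Λ g h γ) =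
      compInvFun Γ Λ g h γ := by
  refine Λ.linearMap_ext_right (fun b n => op b • n) (fun b n => ?_)
    (fun b n => compInvFun_op_smul Γ Λ γ b n) fun {h' l} δ => ?_
  · rw [precompHom_apply, precompHom_apply, smul_comm, compInvFun_op_smul]
  · rw [precompHom_apply]
    by_cases hh : h = h'
    · subst hh
      rw [vertex_smul_gen]
    · rw [← Λ.vertex_smul_gen, smul_smul, ← map_mul, vertex_mul_vertex, if_neg hh, Λ.vertex_smul_gen,
        compInvFun_gen_aux, Pi.single_eq_of_ne hh]
      simp

/-- The map `(γ, δ) ↦ γ ⊗ δ`, on the bimodules. -/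
def compInvAux : Γ.bim →ₗ[k] Λ.bim →ₗ[k] (compHom Γ Λ).bim :=
  Γ.bimLift (precompHom Λ (compHom Γ Λ).bim) (compInvFun Γ Λ)

lemma compInvAux_gen {g : X.Q} {h : Y.Q} {l : Z.Q} (γ : Γ.con.Γ g h) (δ : Λ.con.Γ h l) :
    compInvAux Γ Λ (Γ.gen γ) (Λ.gen δ) = (compHom Γ Λ).gen (inj Γ.con Λ.con γ δ) := by
  rw [compInvAux, Γ.bimLift_gen _ _ (fun _ _ γ => compInvFun_vertex Γ Λ γ), compInvFun_gen]

lemma compInvAux_op_smul (m : Γ.bim) (c : Z.alg) (n : Λ.bim) :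
    compInvAux Γ Λ m (op c • n) = op c • compInvAux Γ Λ m n := by
  refine LinearMap.congr_fun (f := (compInvAux Γ Λ).flip (op c • n))
    (g := rm _ c ∘ₗ (compInvAux Γ Λ).flip n) (Γ.linearMap_ext fun q γ => ?_) m
  change compInvAux Γ Λ _ _ = op c • compInvAux Γ Λ _ _
  rw [compInvAux, bimLift_path, precompHom_apply, precompHom_apply, smul_comm, compInvFun_op_smul]

/-- The inverse of the composition isomorphism. -/
def compInv : tensor Γ.bim Λ.bim →ₗ[k] (compHom Γ Λ).bim :=
  tlift (compInvAux Γ Λ) ⟨fun m b n =>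
    LinearMap.congr_fun (Γ.bimLift_op_smul (precompHom Λ (compHom Γ Λ).bim) (compInvFun Γ Λ) b m) n⟩

lemma compInv_tm (m : Γ.bim) (n : Λ.bim) : compInv Γ Λ (tm m n) = compInvAux Γ Λ m n :=
  tlift_tm ..

variable {Γ Λ} in
lemma tensor_linearMap_ext {N : Type*} [AddCommGroup N] [Module k N]
    {f f' : tensor Γ.bim Λ.bim →ₗ[k] N} (r : Z.alg → N → N)
    (hf : ∀ b m, f (op b • m) = r b (f m)) (hf' : ∀ b m, f' (op b • m) = r b (f' m))
    (hg : ∀ {g : X.Q} {h : Y.Q} {l : Z.Q} (γ : Γ.con.Γ g h) (δ : Λ.con.Γ h l),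
      f (tm (Γ.gen γ) (Λ.gen δ)) = f' (tm (Γ.gen γ) (Λ.gen δ))) (t) : f t = f' t := by
  refine Bimodule.linearMap_ext (fun m n => ?_) t
  -- the right factor is reduced to a generator by equivariance, the left factor by balancedness
  have h1 : ∀ {g : X.Q} {h : Y.Q} (γ : Γ.con.Γ g h) n, f (tm (Γ.gen γ) n) = f' (tm (Γ.gen γ) n) := by
    intro g h γ n
    refine LinearMap.congr_fun (f := f ∘ₗ tmₗ _ _ (Γ.gen γ)) (g := f' ∘ₗ tmₗ _ _ (Γ.gen γ))
      (Λ.linearMap_ext_right r (fun b n => ?_) (fun b n => ?_) fun {h' l} δ => ?_) n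
    · rw [LinearMap.comp_apply, tmₗ_apply, ← smul_tm_right, hf]; rfl
    · rw [LinearMap.comp_apply, tmₗ_apply, ← smul_tm_right, hf']; rfl
    · change f (tm _ _) = f' (tm _ _)
      by_cases hh : h = h'
      · subst hh
        exact hg γ δ
      · have : tm (Γ.gen γ) (Λ.gen δ) = 0 := by
          rw [← Γ.op_vertex_smul_gen, ← Λ.vertex_smul_gen, tm_balanced, smul_smul, ← map_mul,
            vertex_mul_vertex, if_neg hh, map_zero, zero_smul, tm_zero]
        rw [this, map_zero, map_zero]
  refine LinearMap.congr_fun (f := f ∘ₗ (tmₗ _ _).flip n) (g := f' ∘ₗ (tmₗ _ _).flip n)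
      (Γ.linearMap_ext fun q γ => ?_) m
  change f (tm _ _) = f' (tm _ _)
  rw [tm_balanced, h1]

lemma compHom_linearMap_ext {N : Type*} [AddCommGroup N] [Module k N]
    {f f' : (compHom Γ Λ).bim →ₗ[k] N} (r : Z.alg → N → N)
    (hf : ∀ b m, f (op b • m) = r b (f m)) (hf' : ∀ b m, f' (op b • m) = r b (f' m))
    (hg : ∀ {g : X.Q} {h : Y.Q} {l : Z.Q} (γ : Γ.con.Γ g h) (δ : Λ.con.Γ h l),
      f ((compHom Γ Λ).gen (inj _ _ γ δ)) = f' ((compHom Γ Λ).gen (inj _ _ γ δ))) : f = f' :=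
  (compHom Γ Λ).linearMap_ext_right r hf hf' fun {g l} γ =>
    LinearMap.congr_fun (f := f ∘ₗ (compHom Γ Λ).gen (g := g) (h := l))
      (g := f' ∘ₗ (compHom Γ Λ).gen (g := g) (h := l)) (ext_inj fun _ γ δ => hg γ δ) γ

/-- The composition isomorphism `γ ⊗ δ ↦ γ ⊗ δ`. -/
def compIso : (compHom Γ Λ).bim ≅ tensor Γ.bim Λ.bim :=
  isoOfInverse (homLift (isCompatible_compFun Γ Λ)) (compInv Γ Λ)
    (by
      refine LinearMap.congr_fun (f := compInv Γ Λ ∘ₗ lin (homLift (isCompatible_compFun Γ Λ)))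
        (g := LinearMap.id) (compHom_linearMap_ext Γ Λ (fun b n => op b • n) (fun b m => ?_)
          (fun _ _ => rfl) fun γ δ => ?_)
      · rw [LinearMap.comp_apply, lin_right, LinearMap.comp_apply]
        generalize lin (homLift (isCompatible_compFun Γ Λ)) m = t
        refine Bimodule.linearMap_ext (f := compInv Γ Λ ∘ₗ rm _ b) (g := rm _ b ∘ₗ compInv Γ Λ)
          (fun m n => ?_) t
        change compInv Γ Λ (op b • tm m n) = op b • compInv Γ Λ (tm m n)
        rw [smul_tm_right, compInv_tm, compInv_tm, compInvAux_op_smul]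
      · rw [LinearMap.comp_apply, homLift_gen, compFun_inj, compInv_tm, compInvAux_gen]
        rfl)
    (by
      refine tensor_linearMap_ext (f := lin (homLift (isCompatible_compFun Γ Λ)) ∘ₗ compInv Γ Λ)
        (f' := LinearMap.id) (fun b n => op b • n) (fun b t => ?_) (fun _ _ => rfl) fun γ δ => ?_
      · refine Bimodule.linearMap_ext (f := lin (homLift (isCompatible_compFun Γ Λ)) ∘ₗ
          compInv Γ Λ ∘ₗ rm _ b) (g := rm _ b ∘ₗ lin (homLift (isCompatible_compFun Γ Λ)) ∘ₗ
            compInv Γ Λ) (fun m n => ?_) t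
        change lin (homLift (isCompatible_compFun Γ Λ)) (compInv Γ Λ (op b • tm m n)) =
          op b • lin (homLift (isCompatible_compFun Γ Λ)) (compInv Γ Λ (tm m n))
        rw [smul_tm_right, compInv_tm, compInv_tm, compInvAux_op_smul, lin_right]
      · rw [LinearMap.comp_apply, compInv_tm, compInvAux_gen, homLift_gen, compFun_inj]
        rfl)

@[simp] lemma compIso_hom_gen {g : X.Q} {h : Y.Q} {l : Z.Q} (γ : Γ.con.Γ g h) (δ : Λ.con.Γ h l) :
    lin (compIso Γ Λ).hom ((compHom Γ Λ).gen (inj _ _ γ δ)) = tm (Γ.gen γ) (Λ.gen δ) :=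
  (homLift_gen (isCompatible_compFun Γ Λ) _).trans (compFun_inj Γ Λ γ δ)

@[simp] lemma compIso_inv_tm {g : X.Q} {h : Y.Q} {l : Z.Q} (γ : Γ.con.Γ g h) (δ : Λ.con.Γ h l) :
    lin (compIso Γ Λ).inv (tm (Γ.gen γ) (Λ.gen δ)) = (compHom Γ Λ).gen (inj _ _ γ δ) :=
  (compInv_tm Γ Λ _ _).trans (compInvAux_gen Γ Λ γ δ)

variable {Γ Λ} in
lemma compHom_hom_ext {N : Bimodule X.alg Z.alg} {f f' : (compHom Γ Λ).bim ⟶ N}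
    (hg : ∀ {g : X.Q} {h : Y.Q} {l : Z.Q} (γ : Γ.con.Γ g h) (δ : Λ.con.Γ h l),
      lin f ((compHom Γ Λ).gen (inj _ _ γ δ)) = lin f' ((compHom Γ Λ).gen (inj _ _ γ δ))) :
    f = f' :=
  Bimodule.hom_ext <| LinearMap.congr_fun <|
    compHom_linearMap_ext Γ Λ (fun b n => op b • n) (lin_right f) (lin_right f') hg

end comp

section coherence
variable {W X Y Z : BdQuivCon k}

lemma bimMap_inj {Γ : BdQuivCon.Hom X Y} {Λ : BdQuivCon.Hom Y Z} {Θ : BdQuivCon.Hom X Z}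
    (f : Connection.comp Γ.con Λ.con ⟶ Θ.con) {g : X.Q} {h : Y.Q} {l : Z.Q} (γ : Γ.con.Γ g h)
    (δ : Λ.con.Γ h l) : lin (bimMap (Γ := compHom Γ Λ) f) ((compHom Γ Λ).gen (inj _ _ γ δ)) =
      Θ.gen (app f g l (inj _ _ γ δ)) := bimMap_gen (Γ := compHom Γ Λ) f _

lemma bimMap_whiskerLeft (Γ : BdQuivCon.Hom X Y) {Λ Λ' : BdQuivCon.Hom Y Z} (f : Λ.con ⟶ Λ'.con) :
    bimMap (Γ := compHom Γ Λ) (Λ := compHom Γ Λ') (tensorHom (𝟙 Γ.con) f) =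
      (compIso Γ Λ).hom ≫ tensorMap (𝟙 Γ.bim) (bimMap f) ≫ (compIso Γ Λ').inv :=
  compHom_hom_ext fun γ δ => by
    rw [bimMap_inj, app_tensorHom_inj, app_id, lin_comp, lin_comp, compIso_hom_gen, tensorMap_tm,
      lin_id, bimMap_gen, compIso_inv_tm]

lemma bimMap_whiskerRight {Γ Γ' : BdQuivCon.Hom X Y} (f : Γ.con ⟶ Γ'.con) (Λ : BdQuivCon.Hom Y Z) :
    bimMap (Γ := compHom Γ Λ) (Λ := compHom Γ' Λ) (tensorHom f (𝟙 Λ.con)) =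
      (compIso Γ Λ).hom ≫ tensorMap (bimMap f) (𝟙 Λ.bim) ≫ (compIso Γ' Λ).inv :=
  compHom_hom_ext fun γ δ => by
    rw [bimMap_inj, app_tensorHom_inj, app_id, lin_comp, lin_comp, compIso_hom_gen, tensorMap_tm,
      lin_id, bimMap_gen, compIso_inv_tm]

lemma bimMap_associator (Γ : BdQuivCon.Hom W X) (Λ : BdQuivCon.Hom X Y) (Θ : BdQuivCon.Hom Y Z) :
    bimMap (Γ := compHom (compHom Γ Λ) Θ) (Λ := compHom Γ (compHom Λ Θ))
        (Connection.assoc Γ.con Λ.con Θ.con).hom =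
      (compIso (compHom Γ Λ) Θ).hom ≫ tensorMap (compIso Γ Λ).hom (𝟙 Θ.bim) ≫
        (Bimodule.assoc Γ.bim Λ.bim Θ.bim).hom ≫ tensorMap (𝟙 Γ.bim) (compIso Λ Θ).inv ≫
          (compIso Γ (compHom Λ Θ)).inv :=
  compHom_hom_ext fun {g i l} γ ω => by
    refine LinearMap.congr_fun
      (f := lin (bimMap (Γ := compHom (compHom Γ Λ) Θ) (Λ := compHom Γ (compHom Λ Θ))
        (Connection.assoc Γ.con Λ.con Θ.con).hom) ∘ₗ (compHom (compHom Γ Λ) Θ).gen ∘ₗ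
          (inj (Connection.comp Γ.con Λ.con) Θ.con).flip ω)
      (g := lin ((compIso (compHom Γ Λ) Θ).hom ≫ tensorMap (compIso Γ Λ).hom (𝟙 Θ.bim) ≫
        (Bimodule.assoc Γ.bim Λ.bim Θ.bim).hom ≫ tensorMap (𝟙 Γ.bim) (compIso Λ Θ).inv ≫
          (compIso Γ (compHom Λ Θ)).inv) ∘ₗ (compHom (compHom Γ Λ) Θ).gen ∘ₗ
            (inj (Connection.comp Γ.con Λ.con) Θ.con).flip ω) (ext_inj fun h γ δ => ?_) γ
    change lin (bimMap (Γ := compHom (compHom Γ Λ) Θ) (Λ := compHom Γ (compHom Λ Θ))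
        (Connection.assoc Γ.con Λ.con Θ.con).hom)
          ((compHom (compHom Γ Λ) Θ).gen (inj _ _ (inj _ _ γ δ) ω)) =
      lin (compIso Γ (compHom Λ Θ)).inv (lin (tensorMap (𝟙 Γ.bim) (compIso Λ Θ).inv)
        (lin (Bimodule.assoc Γ.bim Λ.bim Θ.bim).hom
          (lin (tensorMap (compIso Γ Λ).hom (𝟙 Θ.bim)) (lin (compIso (compHom Γ Λ) Θ).hom
            ((compHom (compHom Γ Λ) Θ).gen (inj _ _ (inj _ _ γ δ) ω))))))
    rw [bimMap_inj (Γ := compHom Γ Λ) (Λ := Θ) (Θ := compHom Γ (compHom Λ Θ)), compIso_hom_gen,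
      tensorMap_tm, compIso_hom_gen, lin_id, assoc_hom_tm, tensorMap_tm, compIso_inv_tm, lin_id,
      compIso_inv_tm, assoc_hom_inj]

lemma bimMap_leftUnitor (Γ : BdQuivCon.Hom X Y) :
    bimMap (Γ := compHom X.idHom Γ) (Λ := Γ) (leftUnit Γ.con).hom =
      (compIso X.idHom Γ).hom ≫ tensorMap X.unitIso.hom (𝟙 Γ.bim) ≫
        (Bimodule.leftUnit Γ.bim).hom :=
  hom_ext _ fun {g l} γ => by
    refine LinearMap.congr_fun (f := lin (bimMap (Γ := compHom X.idHom Γ) (leftUnit Γ.con).hom) ∘ₗ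
      (compHom X.idHom Γ).gen) (g := lin ((compIso X.idHom Γ).hom ≫
        tensorMap X.unitIso.hom (𝟙 Γ.bim) ≫ (Bimodule.leftUnit Γ.bim).hom) ∘ₗ
          (compHom X.idHom Γ).gen) (ext_left fun γ => ?_) γ
    rw [LinearMap.comp_apply, LinearMap.comp_apply, lin_comp, lin_comp,
      bimMap_inj (Γ := X.idHom) (Λ := Γ) (Θ := Γ), compIso_hom_gen (Γ := X.idHom),
      tensorMap_tm, unitIso_gen, lin_id, leftUnit_hom_tm, vertex_smul_gen, leftUnit_hom_inj]

lemma bimMap_rightUnitor (Γ : BdQuivCon.Hom X Y) :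
    bimMap (Γ := compHom Γ Y.idHom) (Λ := Γ) (rightUnit Γ.con).hom =
      (compIso Γ Y.idHom).hom ≫ tensorMap (𝟙 Γ.bim) Y.unitIso.hom ≫
        (Bimodule.rightUnit Γ.bim).hom :=
  hom_ext _ fun {g l} γ => by
    refine LinearMap.congr_fun (f := lin (bimMap (Γ := compHom Γ Y.idHom) (rightUnit Γ.con).hom) ∘ₗ
      (compHom Γ Y.idHom).gen) (g := lin ((compIso Γ Y.idHom).hom ≫
        tensorMap (𝟙 Γ.bim) Y.unitIso.hom ≫ (Bimodule.rightUnit Γ.bim).hom) ∘ₗ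
          (compHom Γ Y.idHom).gen) (ext_right fun γ => ?_) γ
    rw [LinearMap.comp_apply, LinearMap.comp_apply, lin_comp, lin_comp,
      bimMap_inj (Γ := Γ) (Λ := Y.idHom) (Θ := Γ), compIso_hom_gen (Λ := Y.idHom),
      tensorMap_tm, unitIso_gen, lin_id, rightUnit_hom_tm, op_vertex_smul_gen, rightUnit_hom_inj]

end coherence
end BdQuivCon

/-! ### The pseudofunctor -/

lemma PathAlgebra.deg_one_arrow {k : Type u} [Field k] {Q : FinQuiver.{u}} {a b : Q} (e : a ⟶ b) :
    deg 1 (arrow e : PathAlgebra k Q) = arrow e := deg_path 1 e.toPath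

namespace BdQuivCon
open PathAlgebra Connection Bimodule Hom
variable {k : Type u} [Field k]

namespace Hom
variable {X Y Z : BdQuivCon k}

lemma d₁_gen (Γ : BdQuivCon.Hom X Y) {g : X.Q} {h : Y.Q} (γ : Γ.con.Γ g h) :
    Γ.toBSA.d₁ (Γ.gen γ) = Γ.gen γ := Γ.part₀_gen γ

/-- The 2-morphism of `BSA` induced by a morphism of connections. -/
def map₂ {Γ Λ : BdQuivCon.Hom X Y} (f : Γ.con ⟶ Λ.con) : Γ.toBSA ⟶ Λ.toBSA :=
  Γ.hom₂ Λ.toBSA (bimMap f) fun γ => by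
    change Λ.toBSA.d₁ (lin (bimMap f) _) = lin (bimMap f) _
    rw [bimMap_gen, d₁_gen]

end Hom

/-- The unit isomorphism, compatible with quiver data. -/
def mapId (X : BdQuivCon k) : X.idHom.toBSA ≅ BSA.Hom.unit X.toBSA :=
  X.idHom.iso₂ (BSA.Hom.unit X.toBSA) X.unitIso fun {g h} γ => by
    refine one_ext (f := fun g h => (BSA.Hom.unit X.toBSA).d₁ ∘ₗ lin X.unitIso.hom ∘ₗ X.idHom.gen)
      (f' := fun g h => lin X.unitIso.hom ∘ₗ X.idHom.gen) (fun v => ?_) g h γ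
    have h1 : X.quiverData.D₀ (X.proj (vertex v)) = X.proj (vertex v) := by
      rw [quiverData_D₀, vertex, deg_path]
      rfl
    exact (congrArg (BSA.Hom.unit X.toBSA).d₁ (X.unitIso_gen v)).trans <|
      (BSA.Hom.unit_d₁ X.toBSA (X.proj (vertex v))).trans <|
        (congrArg (toUnit X.alg) h1).trans (X.unitIso_gen v).symm

/-- The composition isomorphism, compatible with quiver data. -/
def mapComp {X Y Z : BdQuivCon k} (Γ : BdQuivCon.Hom X Y) (Λ : BdQuivCon.Hom Y Z) :
    (compHom Γ Λ).toBSA ≅ BSA.Hom.comp Γ.toBSA Λ.toBSA :=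
  (compHom Γ Λ).iso₂ (BSA.Hom.comp Γ.toBSA Λ.toBSA) (compIso Γ Λ) fun {g l} γ => by
    refine LinearMap.congr_fun
      (f := (BSA.Hom.comp Γ.toBSA Λ.toBSA).d₁ ∘ₗ lin (compIso Γ Λ).hom ∘ₗ (compHom Γ Λ).gen)
      (g := lin (compIso Γ Λ).hom ∘ₗ (compHom Γ Λ).gen) (ext_inj fun h γ δ => ?_) γ
    exact (congrArg (BSA.Hom.comp Γ.toBSA Λ.toBSA).d₁ (compIso_hom_gen Γ Λ γ δ)).trans <|
      (BSA.Hom.comp_d₁ Γ.toBSA Λ.toBSA (Γ.gen γ) (Λ.gen δ)).trans <|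
        (congrArg₂ tm (Γ.d₁_gen γ) (Λ.d₁_gen δ)).trans (compIso_hom_gen Γ Λ γ δ).symm

/-- The path functor: a bound quiver is sent to the quotient of its path algebra, and an ideally
connected connection to the quotient of its path bimodule. -/
def pathFunctor (k : Type u) [Field k] : BdQuivCon k ⥤ᵖ BSA k where
  obj := toBSA
  map Γ := Hom.toBSA Γ
  map₂ f := Hom.map₂ f
  map₂_id Γ := BSA.Hom.hom₂_ext <| Hom.hom_ext _ fun γ => bimMap_gen (𝟙 (Hom.con Γ)) γ
  map₂_comp {X Y Γ Λ Θ} f f' := BSA.Hom.hom₂_ext <| Hom.hom_ext _ fun γ => by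
    refine (bimMap_gen (Γ := Γ) (Λ := Θ) (f ≫ f' :) γ).trans ?_
    refine ((congrArg (lin (bimMap f')) (bimMap_gen f γ)).trans (bimMap_gen f' _)).symm
  mapId := mapId
  mapComp Γ Λ := mapComp Γ Λ
  map₂_whisker_left Γ _ _ f := BSA.Hom.hom₂_ext (bimMap_whiskerLeft Γ f)
  map₂_whisker_right f Λ := BSA.Hom.hom₂_ext (bimMap_whiskerRight f Λ)
  map₂_associator Γ Λ Θ := BSA.Hom.hom₂_ext (bimMap_associator Γ Λ Θ)
  map₂_left_unitor Γ := BSA.Hom.hom₂_ext (bimMap_leftUnitor Γ)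
  map₂_right_unitor Γ := BSA.Hom.hom₂_ext (bimMap_rightUnitor Γ)

namespace Hom
variable {X Y : BdQuivCon k} (Γ : BdQuivCon.Hom X Y)

lemma proj_edgeEdgeElt {g : X.Q} {h h' : Y.Q} (γ : Γ.con.Γ g h) (e : h ⟶ h') :
    Γ.proj (Γ.con.edgeEdgeElt γ e) = op (Y.proj (arrow e)) • Γ.gen γ :=
  Γ.proj_elt e.toPath γ

lemma proj_edgeEdgeElt_mem {g : X.Q} {h h' : Y.Q} (γ : Γ.con.Γ g h) (e : h ⟶ h') :
    Γ.proj (Γ.con.edgeEdgeElt γ e) ∈ Γ.bim.radl := by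
  rw [proj_edgeEdgeElt]
  exact Γ.path_cons_smul_gen_mem Quiver.Path.nil e γ

end Hom

/-- The path functor has the prescribed values. -/
def pathFunctorData : PathFunctorData (pathFunctor k) where
  φ X := AlgEquiv.refl
  obj_δ₁ X v := by
    have h1 : X.quiverData.D₀ (X.proj (vertex v)) = X.proj (vertex v) := by
      rw [quiverData_D₀, vertex, deg_path]
      rfl
    exact h1
  obj_δ₂ X {v w} e := ⟨Hom.proj_arrow_mem_rad X e, by
    refine (X.quiverData_δ₂ (Hom.proj_arrow_mem_rad X e)).trans ?_
    rw [deg_one_arrow]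
    rfl⟩
  ψ Γ := LinearEquiv.refl k _
  ψ_left Γ x m := rfl
  ψ_right Γ m y := rfl
  map_δ₁ {X Y} Γ {g h} γ := Γ.d₁_gen γ
  map_δ₂ {X Y} Γ {g h h'} γ e := ⟨Γ.proj_edgeEdgeElt_mem γ e, by
    have h1 : part₁ Γ.grading (Γ.proj (Γ.con.edgeEdgeElt γ e)) = Γ.proj (Γ.con.edgeEdgeElt γ e) := by
      rw [proj_edgeEdgeElt]
      exact (Γ.part₁_path e.toPath γ).trans (if_pos rfl)
    exact h1⟩
  map₂ f m := bimMap_proj f m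
  mapId X v := X.unitIso_gen v
  mapComp {X Y Z} Γ Λ {g h l} γ δ := compIso_hom_gen (X := X) (Y := Y) (Z := Z) Γ Λ γ δ

end BdQuivCon

/-! ### The path functor is locally fully faithful -/

open Quiver (Path)

namespace Connection
open PathAlgebra
variable {k : Type u} [Field k] {G H : FinQuiver.{u}} (c : Connection k G H)

/-- The coefficient in `Γ g h` of the path `p` from `h` to `l`, in an element of the path
bimodule. -/
def pathCoeff (g : G) {h l : H} (p : Path h l) : PathBimodule c →ₗ[k] c.Γ g h :=
  (TensorProduct.rid k (c.Γ g h)).toLinearMap ∘ₗ (Finsupp.lapply p).lTensor (c.Γ g h) ∘ₗ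
    LinearMap.proj (φ := fun h => c.Γ g h ⊗[k] (Path h l →₀ k)) h ∘ₗ
      LinearMap.proj (φ := fun l => PathMod c g l) l ∘ₗ
        LinearMap.proj (φ := fun g => ∀ l : H, PathMod c g l) g

lemma pathCoeff_pin (g : G) {h l : H} (p : Path h l) (γ : c.Γ g h) (y : Path h l →₀ k) :
    c.pathCoeff g p (c.ofPathMod g l (c.pin γ y)) = y p • γ := by
  change TensorProduct.rid k (c.Γ g h) ((Finsupp.lapply p).lTensor (c.Γ g h)
    (c.ofPathMod g l (c.pin γ y) g l h)) = _
  rw [ofPathMod_apply_same]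
  change TensorProduct.rid k (c.Γ g h) ((Finsupp.lapply p).lTensor (c.Γ g h)
    (Pi.single (M := fun h => c.Γ g h ⊗[k] (Path h l →₀ k)) h (γ ⊗ₜ y) h)) = _
  rw [Pi.single_eq_same, LinearMap.lTensor_tmul, TensorProduct.rid_tmul, Finsupp.lapply_apply]

lemma pathCoeff_pin_of_ne {g g' : G} {h l h' l' : H} (p : Path h l)
    (hne : ¬(g = g' ∧ h = h' ∧ l = l')) (γ : c.Γ g' h') (y : Path h' l' →₀ k) :
    c.pathCoeff g p (c.ofPathMod g' l' (c.pin γ y)) = 0 := by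
  change TensorProduct.rid k (c.Γ g h) ((Finsupp.lapply p).lTensor (c.Γ g h)
    (c.ofPathMod g' l' (c.pin γ y) g l h)) = _
  suffices hs : c.ofPathMod g' l' (c.pin γ y) g l h = 0 by rw [hs, map_zero, map_zero]
  by_cases hgl : g' = g ∧ l' = l
  · obtain ⟨rfl, rfl⟩ := hgl
    rw [ofPathMod_apply_same]
    exact Pi.single_eq_of_ne (fun hh => hne ⟨rfl, hh, rfl⟩) _
  · rw [ofPathMod_apply_of_ne _ _ hgl]
    rfl

lemma pathCoeff_elt (g : G) {h l : H} (p : Path h l) (γ : c.Γ g h) :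
    c.pathCoeff g p (c.elt p γ) = γ := by
  rw [elt_apply, pathCoeff_pin, Finsupp.single_eq_same, one_smul]

lemma pathCoeff_elt_of_ne {g g' : G} {h l h' l' : H} (p : Path h l) (q : Path h' l')
    (hne : (⟨g, h, l, p⟩ : Σ (_ : G) (h l : H), Path h l) ≠ ⟨g', h', l', q⟩) (γ : c.Γ g' h') :
    c.pathCoeff g p (c.elt q γ) = 0 := by
  rw [elt_apply]
  by_cases hh : g = g' ∧ h = h' ∧ l = l'
  · obtain ⟨rfl, rfl, rfl⟩ := hh
    rw [pathCoeff_pin, Finsupp.single_eq_of_ne (fun hp => hne (by rw [hp])), zero_smul]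
  · exact c.pathCoeff_pin_of_ne p hh γ _

end Connection

namespace BdQuivCon
open PathAlgebra Connection Bimodule
variable {k : Type u} [Field k]

namespace Hom
variable {X Y : BdQuivCon k} (Γ : BdQuivCon.Hom X Y)

/-- The coefficient of a path of length less than `2`, in an element of the bimodule of a
connection. -/
def coeff (g : X.Q) {h l : Y.Q} (p : Path h l) (hp : p.length < 2) : Γ.bim →ₗ[k] Γ.con.Γ g h :=
  (Γ.con.mulIdeal Y.I).liftQ (Γ.con.pathCoeff g p) (Γ.con.mulIdeal_le fun {g' h' l'} γ y hy => by
    rw [LinearMap.mem_ker]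
    by_cases hh : g = g' ∧ h = h' ∧ l = l'
    · obtain ⟨rfl, rfl, rfl⟩ := hh
      rw [pathCoeff_pin]
      by_contra hne
      refine hp.not_ge (Y.admissible.two_le_length _ hy _ _ p ?_)
      rw [of_apply_same]
      exact fun h0 => hne (by rw [h0, zero_smul])
    · exact Γ.con.pathCoeff_pin_of_ne p hh γ y)

lemma coeff_path (g : X.Q) {h l : Y.Q} (p : Path h l) (hp : p.length < 2) (γ : Γ.con.Γ g h) :
    Γ.coeff g p hp (op (Y.proj (path p)) • Γ.gen γ) = γ := by
  rw [← proj_elt]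
  exact Γ.con.pathCoeff_elt g p γ

lemma coeff_path_of_ne {g g' : X.Q} {h l h' l' : Y.Q} (p : Path h l) (hp : p.length < 2)
    (q : Path h' l') (hne : (⟨g, h, l, p⟩ : Σ (_ : X.Q) (h l : Y.Q), Path h l) ≠ ⟨g', h', l', q⟩)
    (γ : Γ.con.Γ g' h') : Γ.coeff g p hp (op (Y.proj (path q)) • Γ.gen γ) = 0 := by
  rw [← proj_elt]
  exact Γ.con.pathCoeff_elt_of_ne p q hne γ

lemma nil_length_lt {h : Y.Q} : (Path.nil : Path h h).length < 2 := two_pos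

lemma toPath_length_lt {h l : Y.Q} (e : h ⟶ l) : e.toPath.length < 2 := one_lt_two

lemma gen_injective {g : X.Q} {h : Y.Q} : Function.Injective (Γ.gen (g := g) (h := h)) := by
  refine Function.LeftInverse.injective (g := Γ.coeff g (Path.nil : Path h h) nil_length_lt) fun γ => ?_
  rw [← op_vertex_smul_gen]
  exact Γ.coeff_path g Path.nil nil_length_lt γ

/-- The elements `γ e` for edges `e` of `H` are linearly independent over `Γ`. -/
lemma sum_arrow_injective {g : X.Q} {l : Y.Q} {γ δ : ∀ e : Y.Q.In l, Γ.con.Γ g e.1}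
    (h : ∑ e : Y.Q.In l, op (Y.proj (arrow e.2)) • Γ.gen (γ e) =
      ∑ e : Y.Q.In l, op (Y.proj (arrow e.2)) • Γ.gen (δ e)) : γ = δ := by
  have key : ∀ (γ : ∀ e : Y.Q.In l, Γ.con.Γ g e.1) (e : Y.Q.In l),
      Γ.coeff g e.2.toPath (toPath_length_lt _) (∑ e : Y.Q.In l, op (Y.proj (arrow e.2)) • Γ.gen (γ e)) =
        γ e := by
    intro γ e
    rw [map_sum, Finset.sum_eq_single e]
    · exact Γ.coeff_path g e.2.toPath (toPath_length_lt _) (γ e)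
    · intro e' _ he
      refine Γ.coeff_path_of_ne e.2.toPath (toPath_length_lt _) e'.2.toPath (fun hh => he ?_) (γ e')
      obtain ⟨h, e⟩ := e
      obtain ⟨h', e'⟩ := e'
      cases hh
      rfl
    · simp
  funext e
  rw [← key γ e, h, key]

/-- The component in `Γ g h` of an element of the bimodule can be read off from its degree 0 part. -/
lemma vertex_part₀ (g : X.Q) (h : Y.Q) (m : Γ.bim) :
    X.proj (vertex g) • op (Y.proj (vertex h)) • part₀ Γ.grading m =
      Γ.gen (Γ.coeff g (Path.nil : Path h h) nil_length_lt m) := by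
  refine LinearMap.congr_fun (f := lm _ (X.proj (vertex g)) ∘ₗ rm _ (Y.proj (vertex h)) ∘ₗ
    part₀ Γ.grading) (g := Γ.gen ∘ₗ Γ.coeff g (Path.nil : Path h h) nil_length_lt)
      (Γ.linearMap_ext fun {g' h' l} q γ => ?_) m
  change X.proj (vertex g) • op (Y.proj (vertex h)) • part₀ Γ.grading _ =
    Γ.gen (Γ.coeff g (Path.nil : Path h h) nil_length_lt _)
  rw [part₀_path]
  by_cases hne : (⟨g, h, h, Path.nil⟩ : Σ (_ : X.Q) (h l : Y.Q), Path h l) = ⟨g', h', l, q⟩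
  · cases hne
    rw [coeff_path, Path.length_nil, if_pos rfl, op_vertex_smul_gen, op_vertex_smul_gen,
      vertex_smul_gen]
  · rw [Γ.coeff_path_of_ne _ _ _ hne, map_zero]
    cases q with
    | nil =>
      rw [Path.length_nil, if_pos rfl, ← vertex, op_vertex_smul_gen]
      by_cases hh : h = h'
      · subst hh
        have hg : g ≠ g' := fun hg => hne (by rw [hg])
        rw [op_vertex_smul_gen, ← vertex_smul_gen, smul_smul, ← map_mul, vertex_mul_vertex,
          if_neg hg, map_zero, zero_smul]
      · rw [← op_vertex_smul_gen, smul_smul, ← op_mul, ← map_mul, vertex_mul_vertex,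
          if_neg (Ne.symm hh), map_zero, op_zero, zero_smul, smul_zero]
    | cons q e => rw [if_neg (by simp), smul_zero, smul_zero]

variable {Γ} {Λ : BdQuivCon.Hom X Y}

lemma bimMap_injective {f f' : Γ.con ⟶ Λ.con} (h : bimMap f = bimMap f') : f = f' :=
  Connection.hom_ext fun g h' γ => Λ.gen_injective (by rw [← bimMap_gen, h, bimMap_gen])

section preimage
variable (η : Γ.toBSA ⟶ Λ.toBSA)

/-- The map of bimodules underlying a 2-morphism of `BSA`. -/
def toBimHom : Γ.bim ⟶ Λ.bim := BSA.Hom.Hom₂.map η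

lemma part₀_toBimHom (m : Γ.bim) :
    part₀ Λ.grading (lin (toBimHom η) m) = lin (toBimHom η) (part₀ Γ.grading m) :=
  (BSA.Hom.Hom₂.compat η m).symm

/-- The linear maps between the spaces of two connections underlying a 2-morphism of `BSA`. -/
def preimageMap (g : X.Q) (h : Y.Q) : Γ.con.Γ g h →ₗ[k] Λ.con.Γ g h :=
  Λ.coeff g (Path.nil : Path h h) nil_length_lt ∘ₗ lin (toBimHom η) ∘ₗ
    Γ.gen

lemma gen_preimageMap {g : X.Q} {h : Y.Q} (γ : Γ.con.Γ g h) : Λ.gen (preimageMap η g h γ) =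
    lin (toBimHom η) (Γ.gen γ) := by
  rw [preimageMap, LinearMap.comp_apply, LinearMap.comp_apply, ← vertex_part₀, part₀_toBimHom,
    part₀_gen, ← lin_right, ← lin_left, op_vertex_smul_gen, vertex_smul_gen]

/-- The morphism of connections underlying a 2-morphism of `BSA`. -/
def preimage : Γ.con ⟶ Λ.con where
  map := preimageMap η
  comm {g g' h' h} e e' γ := by
    have h1 := congrArg (lin (toBimHom η))
      (Γ.arrow_smul_gen (h := h) e γ)
    rw [lin_left, ← gen_preimageMap, arrow_smul_gen, map_sum] at h1
    simp only [lin_right, ← gen_preimageMap] at h1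
    exact congrFun (Λ.sum_arrow_injective (γ := fun e' => Λ.con.cell e e'.2 (preimageMap η g' h γ))
      (δ := fun e' => preimageMap η g e'.1 (Γ.con.cell e e'.2 γ)) h1) ⟨h', e'⟩

lemma bimMap_preimage : bimMap (preimage η) = toBimHom η :=
  hom_ext _ fun γ => (bimMap_gen (preimage η) γ).trans (gen_preimageMap η γ)

end preimage
end Hom

instance (X Y : BdQuivCon k) : ((pathFunctor k).mapFunctor X Y).Faithful where
  map_injective h := Hom.bimMap_injective (congrArg BSA.Hom.Hom₂.map h)

instance (X Y : BdQuivCon k) : ((pathFunctor k).mapFunctor X Y).Full where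
  map_surjective η := ⟨Hom.preimage η, BSA.Hom.hom₂_ext (Hom.bimMap_preimage η)⟩

end BdQuivCon

/-! ### Modules that are free over vertex idempotents -/

section coordinates
variable {R : Type*} [Ring R]

/-- A descending sequence of additive subgroups of a ring, like the powers of a nilpotent ideal. -/
structure IsNilpotentFiltration (J : ℕ → AddSubgroup R) : Prop where
  zero : J 0 = ⊤
  mul_mem : ∀ {n : ℕ} {a b : R}, a ∈ J n → b ∈ J 1 → a * b ∈ J (n + 1)
  exists_eq_bot : ∃ N, ∀ n, N ≤ n → J n = ⊥

variable {M : Type*} [AddCommGroup M] [Module R M] {J : ℕ → AddSubgroup R}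

/-- Nakayama's lemma for a nilpotent filtration. -/
lemma IsNilpotentFiltration.eq_top {k : Type*} [Field k] [Algebra k R] [Module k M]
    [IsScalarTower k R M] (hJ : IsNilpotentFiltration J) {S : Submodule R M}
    (hS : ∀ m, ∃ s ∈ S, m - s ∈ Submodule.span k {x : M | ∃ r ∈ J 1, ∃ m, x = r • m}) : S = ⊤ := by
  obtain ⟨N, hN⟩ := hJ.exists_eq_bot
  have key : ∀ t n, N ≤ n + t → ∀ b ∈ J n, ∀ m : M, b • m ∈ S := by
    intro t
    induction t with
    | zero =>
      intro n hn b hb m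
      rw [hN n hn, AddSubgroup.mem_bot] at hb
      rw [hb, zero_smul]
      exact zero_mem _
    | succ t ih =>
      intro n hn b hb m
      obtain ⟨s, hs, hm⟩ := hS m
      have h1 : b • (m - s) ∈ S := by
        generalize m - s = m' at hm
        induction hm using Submodule.span_induction with
        | mem x hx =>
          obtain ⟨r, hr, y, rfl⟩ := hx
          rw [smul_smul]
          exact ih (n + 1) (by omega) _ (hJ.mul_mem hb hr) y
        | zero => simp
        | add x y _ _ hx hy => rw [smul_add]; exact add_mem hx hy
        | smul c x _ hx =>
          rw [smul_algebra_smul_comm]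
          exact S.smul_of_tower_mem c hx
      simpa [smul_sub] using add_mem h1 (S.smul_mem b hs)
  refine Submodule.eq_top_iff'.2 fun m => ?_
  simpa using key N 0 (by omega) 1 (by rw [hJ.zero]; trivial) m

/-- A finitely generated projective module `M`, given by a dual basis, with generators
`γ j = ε j • γ j` for idempotents `ε j` which satisfy no relations modulo `J 1`, is the direct sum of the
modules `R ε j`: there are coordinate maps. -/
lemma IsNilpotentFiltration.exists_coord (hJ : IsNilpotentFiltration J) {ι κ : Type*} [Fintype ι]
    [Fintype κ] [DecidableEq ι] (x : κ → M) (φ : κ → M →ₗ[R] R) (hx : ∀ m, ∑ i, φ i m • x i = m)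
    (γ : ι → M) (ε' : ι → R) (hε : ∀ j, ε' j * ε' j = ε' j) (hγ : ∀ j, ε' j • γ j = γ j)
    (hspan : Submodule.span R (Set.range γ) = ⊤)
    (hind : ∀ b : ι → R, ∑ j, b j • γ j = 0 → ∀ j, b j * ε' j ∈ J 1) :
    ∃ ψ : ι → M →ₗ[R] R, ∀ j l, ψ j (γ l) = if l = j then ε' j else 0 := by
  have hs : ∀ i, ∃ s : ι → R, ∑ j, s j • γ j = x i := fun i =>
    (Submodule.mem_span_range_iff_exists_fun R).1 (hspan ▸ Submodule.mem_top)
  choose s hs using hs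
  let ψ : ι → M →ₗ[R] R := fun j => ∑ i, (LinearMap.toSpanSingleton R R (s i j * ε' j)) ∘ₗ φ i
  have hψ : ∀ j m, ψ j m = ∑ i, φ i m * (s i j * ε' j) := fun j m => by
    simp [ψ, LinearMap.sum_apply]
  have hψε : ∀ j m, ψ j m * ε' j = ψ j m := fun j m => by
    rw [hψ, Finset.sum_mul]
    simp only [mul_assoc, hε]
  -- the error terms `E l` are relations; as such they lie in `J 1`, and as they are fixed by the
  -- matrix `E`, in all the other terms of the filtration
  let E : ι → ι → R := fun l j => (if l = j then ε' j else 0) - ψ j (γ l)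
  have hsum : ∀ b : ι → R, ∑ j, ψ j (∑ l, b l • γ l) • γ j = ∑ l, b l • γ l := by
    intro b
    generalize ∑ l, b l • γ l = m
    simp only [hψ, Finset.sum_smul]
    rw [Finset.sum_comm]
    refine Eq.trans ?_ (hx m)
    refine Finset.sum_congr rfl fun i _ => ?_
    rw [← hs i, Finset.smul_sum]
    refine Finset.sum_congr rfl fun j _ => ?_
    rw [mul_smul, mul_smul, hγ]
  have hE0 : ∀ l, ∑ j, E l j • γ j = 0 := by
    intro l
    simp only [E, sub_smul, Finset.sum_sub_distrib, ite_smul, zero_smul]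
    have h1 := hsum (Pi.single l 1)
    have h2 : ∑ l', (Pi.single l 1 : ι → R) l' • γ l' = γ l := by
      rw [Finset.sum_eq_single l]
      · simp
      · intro l' _ hl
        rw [Pi.single_eq_of_ne hl, zero_smul]
      · simp
    rw [h2] at h1
    rw [h1]
    simp [hγ]
  have hEε : ∀ l j, E l j * ε' j = E l j := by
    intro l j
    simp only [E, sub_mul, hψε]
    split_ifs
    · rw [hε]
    · rw [zero_mul]
  have hEE : ∀ l j, ∑ i, E l i * E i j = E l j := by
    intro l j
    have h1 : ψ j (∑ i, E l i • γ i) = 0 := by rw [hE0, map_zero]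
    have h2 : ∀ i, E l i * E i j = (if i = j then E l i * ε' j else 0) - ψ j (E l i • γ i) := by
      intro i
      rw [map_smul, smul_eq_mul]
      change E l i * ((if i = j then ε' j else 0) - ψ j (γ i)) = _
      rw [mul_sub]
      split_ifs
      · rfl
      · rw [mul_zero]
    simp only [h2, Finset.sum_sub_distrib, ← map_sum, h1]
    simp [hEε]
  have hmem : ∀ n l j, E l j ∈ J (n + 1) := by
    intro n
    induction n with
    | zero =>
      intro l j
      rw [← hEε]
      exact hind (E l) (hE0 l) j
    | succ n ih =>
      intro l j
      rw [← hEE]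
      exact sum_mem fun i _ => hJ.mul_mem (ih l i) (hind (E i) (hE0 i) j |> fun h => by rwa [hEε] at h)
  obtain ⟨N, hN⟩ := hJ.exists_eq_bot
  refine ⟨ψ, fun j l => ?_⟩
  have h1 := hmem N l j
  rw [hN (N + 1) (by omega), AddSubgroup.mem_bot] at h1
  exact (sub_eq_zero.1 h1).symm

end coordinates

section rad
variable {k A : Type u} [Field k] [Ring A] [Algebra k A]

lemma exists_rad_pow_eq_zero [Module.Finite k A] : ∃ N, ∀ n, N ≤ n → rad A ^ n = ⊥ := by
  have : IsArtinianRing A := IsArtinianRing.of_finite k A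
  obtain ⟨N, hN⟩ := IsArtinianRing.isNilpotent_jacobson_bot (R := A)
  rw [Ideal.jacobson_bot] at hN
  refine ⟨N, fun n hn => ?_⟩
  exact le_bot_iff.1 ((Ideal.pow_le_pow_right hn).trans_eq hN)

variable (k A)

lemma isNilpotentFiltration_rad [Module.Finite k A] :
    IsNilpotentFiltration fun n => (rad A ^ n).toAddSubgroup where
  zero := by simp only [Submodule.pow_zero, Ideal.one_eq_top]; rfl
  mul_mem {n a b} ha hb := by
    change a * b ∈ rad A ^ (n + 1)
    rw [Submodule.pow_succ]
    exact Ideal.mul_mem_mul ha (by simpa [Submodule.pow_one] using hb)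
  exists_eq_bot := by
    obtain ⟨N, hN⟩ := exists_rad_pow_eq_zero (k := k) (A := A)
    exact ⟨N, fun n hn => by rw [hN n hn]; rfl⟩

lemma isNilpotentFiltration_rad_op [Module.Finite k A] :
    IsNilpotentFiltration fun n =>
      (rad A ^ n).toAddSubgroup.comap (opAddEquiv (α := A)).symm.toAddMonoidHom where
  zero := by simp only [Submodule.pow_zero, Ideal.one_eq_top]; rfl
  mul_mem {n a b} ha hb := by
    change b.unop * a.unop ∈ rad A ^ (n + 1)
    rw [Ideal.IsTwoSided.pow_succ]
    exact Ideal.mul_mem_mul (by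
      have : b.unop ∈ rad A ^ 1 := hb
      simpa [Submodule.pow_one] using this) ha
  exists_eq_bot := by
    obtain ⟨N, hN⟩ := exists_rad_pow_eq_zero (k := k) (A := A)
    refine ⟨N, fun n hn => ?_⟩
    simp only [hN n hn]
    ext a
    change a.unop = 0 ↔ a = 0
    rw [unop_eq_zero_iff]

end rad

/-! ### The elements of degree zero of a 1-morphism -/

namespace BdQuivCon
open PathAlgebra Bimodule
variable {k : Type u} [Field k]

lemma vertexCoeff_vertex (X : BdQuivCon k) (v : X.Q) :
    X.vertexCoeff (X.proj (vertex v)) = Pi.single v 1 := nilCoeff_vertex v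

lemma mem_rad_of_vertexCoeff {X : BdQuivCon k} {a : X.alg} (h : X.vertexCoeff a = 0) :
    a ∈ rad X.alg := by
  obtain ⟨x, rfl⟩ := X.proj_surjective a
  rw [vertexCoeff_proj] at h
  rw [proj_mem_rad, deg_zero_eq_sum, h]
  simp

lemma D₀_eq_sum (X : BdQuivCon k) (a : X.alg) :
    X.quiverData.D₀ a = ∑ v, X.vertexCoeff a v • X.proj (vertex v) := by
  obtain ⟨x, rfl⟩ := X.proj_surjective a
  rw [quiverData_D₀, deg_zero_eq_sum, map_sum]
  simp only [_root_.map_smul X.proj]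
  rfl

lemma vertex_mul_vertex_proj (X : BdQuivCon k) (v w : X.Q) :
    X.proj (vertex v) * X.proj (vertex w) = if v = w then X.proj (vertex v) else 0 := by
  rw [← map_mul, vertex_mul_vertex]
  split_ifs
  · rfl
  · exact map_zero _

lemma D₀_vertex (X : BdQuivCon k) (v : X.Q) :
    X.quiverData.D₀ (X.proj (vertex v)) = X.proj (vertex v) := by
  rw [quiverData_D₀, vertex, deg_path]
  rfl

variable {X Y : BdQuivCon k} (M : BSA.Hom X.toBSA Y.toBSA)

lemma d₁_smul_eq (a : X.alg) (m : M.bim) : M.d₁ (a • m) = X.quiverData.D₀ a • M.d₁ m :=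
  M.d₁_smul a m

lemma d₁_op_smul_eq (b : Y.alg) (m : M.bim) :
    M.d₁ (op b • m) = op (Y.quiverData.D₀ b) • M.d₁ m :=
  M.d₁_op_smul b m

lemma d₁_d₁ (m : M.bim) : M.d₁ (M.d₁ m) = M.d₁ m := by
  rw [← sub_eq_zero, ← map_sub]
  exact M.d₁_eq_zero (M.d₁_sub_mem m)

/-- The space `Γ g h` of elements of degree `0` of a bimodule with quiver data, with ends `g` and
`h`. -/
def corner (g : X.Q) (h : Y.Q) : Submodule k M.bim where
  carrier := {m | M.d₁ m = m ∧ X.proj (vertex g) • m = m ∧ op (Y.proj (vertex h)) • m = m}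
  add_mem' := fun {m n} hm hn => ⟨by rw [map_add, hm.1, hn.1], by rw [smul_add, hm.2.1, hn.2.1],
    by rw [smul_add, hm.2.2, hn.2.2]⟩
  zero_mem' := ⟨map_zero _, smul_zero _, smul_zero _⟩
  smul_mem' := fun c m hm => ⟨by rw [map_smul, hm.1], by rw [smul_comm, hm.2.1],
    by rw [smul_comm, hm.2.2]⟩

variable {M}

lemma D₀_smul_corner {g : X.Q} {h : Y.Q} {m : M.bim} (hm : m ∈ corner M g h) (a : X.alg) :
    X.quiverData.D₀ a • m = X.vertexCoeff a g • m := by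
  rw [D₀_eq_sum, Finset.sum_smul, Finset.sum_eq_single g]
  · rw [smul_assoc, hm.2.1]
  · intro v _ hv
    rw [← hm.2.1, smul_smul, smul_mul_assoc, vertex_mul_vertex_proj, if_neg hv, smul_zero, zero_smul]
  · simp

lemma op_D₀_smul_corner {g : X.Q} {h : Y.Q} {m : M.bim} (hm : m ∈ corner M g h) (b : Y.alg) :
    op (Y.quiverData.D₀ b) • m = Y.vertexCoeff b h • m := by
  rw [D₀_eq_sum, Finset.op_sum, Finset.sum_smul, Finset.sum_eq_single h]
  · rw [MulOpposite.op_smul, smul_assoc, hm.2.2]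
  · intro v _ hv
    rw [← hm.2.2, smul_smul, ← op_mul, mul_smul_comm, vertex_mul_vertex_proj, if_neg (Ne.symm hv),
      smul_zero, op_zero, zero_smul]
  · simp

lemma vertex_smul_corner {g g' : X.Q} {h : Y.Q} {m : M.bim} (hm : m ∈ corner M g h) :
    X.proj (vertex g') • m = if g' = g then m else 0 := by
  rw [← D₀_vertex, D₀_smul_corner hm, vertexCoeff_vertex, Pi.single_apply]
  simp only [eq_comm (a := g), ite_smul, one_smul, zero_smul]

lemma op_vertex_smul_corner {g : X.Q} {h h' : Y.Q} {m : M.bim} (hm : m ∈ corner M g h) :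
    op (Y.proj (vertex h')) • m = if h' = h then m else 0 := by
  rw [← D₀_vertex, op_D₀_smul_corner hm, vertexCoeff_vertex, Pi.single_apply]
  simp only [eq_comm (a := h), ite_smul, one_smul, zero_smul]

variable (M) in
lemma vertex_d₁_mem (g : X.Q) (h : Y.Q) (m : M.bim) :
    X.proj (vertex g) • op (Y.proj (vertex h)) • M.d₁ m ∈ corner M g h := by
  refine ⟨?_, ?_, ?_⟩
  · rw [d₁_smul_eq, d₁_op_smul_eq, d₁_d₁, D₀_vertex, D₀_vertex]
  · rw [smul_smul, vertex_mul_vertex_proj, if_pos rfl]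
  · rw [← smul_comm, smul_smul (op _), ← op_mul, vertex_mul_vertex_proj, if_pos rfl]

lemma sum_vertex_smul (m : M.bim) :
    ∑ g, ∑ h, X.proj (vertex g) • op (Y.proj (vertex h)) • m = m := by
  simp only [← Finset.smul_sum, ← Finset.sum_smul, ← Finset.op_sum, ← map_sum, sum_vertex, map_one,
    op_one, one_smul]

variable (M) in
/-- A dual basis for the right action generates `M` over a finite-dimensional algebra. -/
lemma finite_bim : Module.Finite k M.bim := by
  obtain ⟨n, x, φ, -, hx⟩ := M.dualizable.exists_dual_basis
  have := Y.finite_alg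
  let F : (Fin n → Y.alg) →ₗ[k] M.bim := ∑ i,
    (LinearMap.flip (Algebra.lsmul k k M.bim : Y.algᵐᵒᵖ →ₐ[k] Module.End k M.bim).toLinearMap (x i)) ∘ₗ
      (opLinearEquiv k : Y.alg ≃ₗ[k] Y.algᵐᵒᵖ).toLinearMap ∘ₗ LinearMap.proj i
  refine Module.Finite.of_surjective F fun m => ⟨fun i => φ i m, ?_⟩
  rw [LinearMap.sum_apply]
  exact hx m

variable (M) in
/-- The index set of a basis of the space of elements of degree `0`. -/
abbrev CornerIndex : Type u := Σ (g : X.Q) (h : Y.Q), Fin (Module.finrank k (corner M g h))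

variable (M) in
/-- A basis of the space of elements of degree `0` which is adapted to the vertices. -/
def cornerBasis (j : CornerIndex M) : M.bim :=
  haveI := finite_bim M
  (Module.finBasis k (corner M j.1 j.2.1) j.2.2 : M.bim)

lemma cornerBasis_mem (j : CornerIndex M) : cornerBasis M j ∈ corner M j.1 j.2.1 :=
  Subtype.property _

lemma sum_repr_smul_cornerBasis {g : X.Q} {h : Y.Q} (γ : corner M g h) :
    haveI := finite_bim M
    ∑ i, (Module.finBasis k (corner M g h)).repr γ i • cornerBasis M ⟨g, h, i⟩ = γ := by
  have := finite_bim M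
  have h1 := congrArg Subtype.val ((Module.finBasis k (corner M g h)).sum_repr γ)
  rw [AddSubmonoidClass.coe_finsetSum] at h1
  exact h1

/-- Multiplication by a pair of vertices isolates one corner, so independence holds corner by corner. -/
lemma cornerBasis_independent {c : CornerIndex M → k} (hc : ∑ j, c j • cornerBasis M j = 0)
    (j : CornerIndex M) : c j = 0 := by
  have := finite_bim M
  obtain ⟨g, h, i⟩ := j
  have h1 := congrArg (fun m => X.proj (vertex g) • op (Y.proj (vertex h)) • m) hc
  simp only [Finset.smul_sum, smul_zero] at h1
  simp only [Fintype.sum_sigma] at h1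
  rw [Finset.sum_eq_single g, Finset.sum_eq_single h] at h1
  · have h2 : ∑ i, c ⟨g, h, i⟩ • Module.finBasis k (corner M g h) i = 0 := by
      refine Subtype.ext ?_
      rw [AddSubmonoidClass.coe_finsetSum]
      refine Eq.trans (Finset.sum_congr rfl fun i _ => ?_) h1
      have hm := cornerBasis_mem (M := M) ⟨g, h, i⟩
      rw [smul_comm (op _) (c _), smul_comm _ (c _), hm.2.2, hm.2.1]
      rfl
    exact Fintype.linearIndependent_iff.1 (Module.finBasis k (corner M g h)).linearIndependent _ h2 i
  · intro h' _ hh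
    refine Finset.sum_eq_zero fun i _ => ?_
    have hm := cornerBasis_mem (M := M) ⟨g, h', i⟩
    rw [smul_comm (op _) (c _), op_vertex_smul_corner hm, if_neg (Ne.symm hh), smul_zero, smul_zero]
  · simp
  · intro g' _ hg
    refine Finset.sum_eq_zero fun h' _ => Finset.sum_eq_zero fun i _ => ?_
    have hm := cornerBasis_mem (M := M) ⟨g', h', i⟩
    rw [smul_comm (X.proj (vertex g)) (op _), smul_comm (X.proj (vertex g)) (c _),
      vertex_smul_corner hm, if_neg (Ne.symm hg), smul_zero, smul_zero]
  · simp

lemma d₁_mem_span {R : Type*} [Ring R] [Algebra k R] [Module R M.bim] [IsScalarTower k R M.bim]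
    (m : M.bim) : M.d₁ m ∈ Submodule.span R (Set.range (cornerBasis M)) := by
  rw [← sum_vertex_smul (M.d₁ m)]
  refine sum_mem fun g _ => sum_mem fun h _ => ?_
  have h1 := sum_repr_smul_cornerBasis ⟨_, vertex_d₁_mem M g h m⟩
  change _ = X.proj (vertex g) • op (Y.proj (vertex h)) • M.d₁ m at h1
  rw [← h1]
  exact sum_mem fun i _ => Submodule.smul_of_tower_mem _ _ (Submodule.subset_span ⟨_, rfl⟩)

/-- Left dualizability makes `M` projective over the left algebra, and the elements of the corners are a
minimal generating set; hence `M` is free over the vertex idempotents and has coordinate functions. -/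
lemma exists_left_coord : ∃ ψ : CornerIndex M → M.bim →ₗ[X.alg] X.alg,
    ∀ j l, ψ j (cornerBasis M l) = if l = j then X.proj (vertex j.1) else 0 := by
  classical
  obtain ⟨n, x, φ, hφ, hx⟩ := M.dualizable.exists_left_dual_basis
  have := X.finite_alg
  refine (isNilpotentFiltration_rad k X.alg).exists_coord x
    (fun i => { (φ i) with map_smul' := fun a m => hφ i m a }) hx (cornerBasis M) (fun j => X.proj (vertex j.1))
    (fun j => by rw [vertex_mul_vertex_proj, if_pos rfl]) (fun j => (cornerBasis_mem j).2.1)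
    ((isNilpotentFiltration_rad k X.alg).eq_top (k := k) fun m =>
      ⟨M.d₁ m, d₁_mem_span m, ?_⟩) fun b hb j => ?_
  · rw [← neg_sub]
    refine neg_mem (Submodule.span_mono ?_ (M.d₁_sub_mem m))
    rintro _ ⟨r, hr, m, -, rfl⟩
    exact ⟨r, by simpa [Submodule.pow_one] using hr, m, rfl⟩
  · have h1 : ∑ j, X.vertexCoeff (b j) j.1 • cornerBasis M j = 0 := by
      have h2 := congrArg M.d₁ hb
      rw [map_sum, map_zero] at h2
      refine Eq.trans (Finset.sum_congr rfl fun j _ => ?_) h2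
      rw [d₁_smul_eq, (cornerBasis_mem j).1, D₀_smul_corner (cornerBasis_mem j)]
    have h3 : b j * X.proj (vertex j.1) ∈ rad X.alg := by
      refine mem_rad_of_vertexCoeff ?_
      rw [map_mul, vertexCoeff_vertex]
      funext v
      rw [Pi.mul_apply, Pi.single_apply]
      split_ifs with hv
      · rw [hv, cornerBasis_independent h1 j, zero_mul]; rfl
      · rw [mul_zero]; rfl
    simpa [Submodule.pow_one] using h3

/-- As a left module, `M` is the direct sum of the modules `A e_g ⊗ Γ g h`. -/
lemma exists_left_functional (g : X.Q) (h : Y.Q) (ξ : corner M g h →ₗ[k] k) :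
    ∃ Ψ : M.bim →ₗ[k] X.alg, (∀ a m, Ψ (a • m) = a * Ψ m) ∧
      (∀ γ : corner M g h, Ψ γ = ξ γ • X.proj (vertex g)) ∧
        ∀ g' h', ¬ (g' = g ∧ h' = h) → ∀ γ : corner M g' h', Ψ γ = 0 := by
  have := finite_bim M
  obtain ⟨ψ, hψ⟩ := exists_left_coord (M := M)
  let Ψ : M.bim →ₗ[k] X.alg := ∑ i, ξ (Module.finBasis k (corner M g h) i) •
    (ψ ⟨g, h, i⟩).restrictScalars k
  have hΨ : ∀ m, Ψ m = ∑ i, ξ (Module.finBasis k (corner M g h) i) • ψ ⟨g, h, i⟩ m := fun m => by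
    simp [Ψ, LinearMap.sum_apply]
  refine ⟨Ψ, fun a m => ?_, fun γ => ?_, fun g' h' hne γ => ?_⟩
  · simp only [hΨ, map_smul, smul_eq_mul, Finset.mul_sum, mul_smul_comm]
  · conv_lhs => rw [← sum_repr_smul_cornerBasis γ]
    conv_rhs => rw [← (Module.finBasis k (corner M g h)).sum_repr γ]
    rw [map_sum, map_sum, Finset.sum_smul]
    refine Finset.sum_congr rfl fun i _ => ?_
    rw [map_smul, map_smul, hΨ, Finset.sum_eq_single i]
    · rw [hψ, if_pos rfl, smul_assoc]
    · intro i' _ hi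
      rw [hψ, if_neg, smul_zero]
      rintro hh
      cases hh
      exact hi rfl
    · simp
  · rw [← sum_repr_smul_cornerBasis γ, map_sum]
    refine Finset.sum_eq_zero fun i _ => ?_
    rw [map_smul, hΨ, Finset.sum_eq_zero, smul_zero]
    intro i' _
    rw [hψ, if_neg, smul_zero]
    rintro hh
    cases hh
    exact hne ⟨rfl, rfl⟩

variable (M) in
lemma span_op_cornerBasis : Submodule.span Y.algᵐᵒᵖ (Set.range (cornerBasis M)) = ⊤ := by
  have := Y.finite_alg
  refine (isNilpotentFiltration_rad_op k Y.alg).eq_top (k := k) fun m => ⟨M.d₁ m, d₁_mem_span m, ?_⟩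
  have h1 := M.d₁_sub_mem m
  rw [radl, M.symm] at h1
  rw [← neg_sub]
  refine neg_mem (Submodule.span_mono ?_ h1)
  rintro _ ⟨r, hr, m, -, rfl⟩
  refine ⟨op r, ?_, m, rfl⟩
  change r ∈ rad Y.alg ^ 1
  rwa [Submodule.pow_one]

/-- The mirror image of `exists_left_coord`, from the dual basis for the right action. -/
lemma exists_right_coord : ∃ ψ : CornerIndex M → M.bim →ₗ[Y.algᵐᵒᵖ] Y.algᵐᵒᵖ,
    ∀ j l, ψ j (cornerBasis M l) = if l = j then op (Y.proj (vertex j.2.1)) else 0 := by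
  classical
  obtain ⟨n, x, φ, hφ, hx⟩ := M.dualizable.exists_dual_basis
  have := Y.finite_alg
  refine (isNilpotentFiltration_rad_op k Y.alg).exists_coord x
    (fun i => { (opLinearEquiv k : Y.alg ≃ₗ[k] Y.algᵐᵒᵖ).toLinearMap ∘ₗ φ i with
      map_smul' := fun b m => congrArg op (hφ i m b.unop) }) hx (cornerBasis M)
    (fun j => op (Y.proj (vertex j.2.1)))
    (fun j => by rw [← op_mul, vertex_mul_vertex_proj, if_pos rfl]) (fun j => (cornerBasis_mem j).2.2)
    (span_op_cornerBasis M) fun b hb j => ?_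
  have h1 : ∑ j, Y.vertexCoeff (b j).unop j.2.1 • cornerBasis M j = 0 := by
    have h2 := congrArg M.d₁ hb
    rw [map_sum, map_zero] at h2
    refine Eq.trans (Finset.sum_congr rfl fun j _ => ?_) h2
    have h3 := d₁_op_smul_eq M (b j).unop (cornerBasis M j)
    rw [op_unop] at h3
    rw [h3, (cornerBasis_mem j).1, op_D₀_smul_corner (cornerBasis_mem j)]
  change Y.proj (vertex j.2.1) * (b j).unop ∈ rad Y.alg ^ 1
  rw [Submodule.pow_one]
  refine mem_rad_of_vertexCoeff ?_
  rw [map_mul, vertexCoeff_vertex]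
  funext v
  rw [Pi.mul_apply, Pi.single_apply]
  split_ifs with hv
  · rw [hv, cornerBasis_independent h1 j, mul_zero]; rfl
  · rw [zero_mul]; rfl

/-- As a right module, `M` is the direct sum of the modules `Γ g h ⊗ e_h B`. -/
lemma exists_right_functional (g : X.Q) (h : Y.Q) (ξ : corner M g h →ₗ[k] k) :
    ∃ Ψ : M.bim →ₗ[k] Y.alg, (∀ b m, Ψ (op b • m) = Ψ m * b) ∧
      (∀ γ : corner M g h, Ψ γ = ξ γ • Y.proj (vertex h)) ∧
        ∀ g' h', ¬ (g' = g ∧ h' = h) → ∀ γ : corner M g' h', Ψ γ = 0 := by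
  have := finite_bim M
  obtain ⟨ψ, hψ⟩ := exists_right_coord (M := M)
  let Ψ : M.bim →ₗ[k] Y.alg := ∑ i, ξ (Module.finBasis k (corner M g h) i) •
    ((opLinearEquiv k).symm.toLinearMap ∘ₗ (ψ ⟨g, h, i⟩).restrictScalars k)
  have hΨ : ∀ m, Ψ m = ∑ i, ξ (Module.finBasis k (corner M g h) i) • (ψ ⟨g, h, i⟩ m).unop :=
    fun m => by simp [Ψ, LinearMap.sum_apply]
  refine ⟨Ψ, fun b m => ?_, fun γ => ?_, fun g' h' hne γ => ?_⟩
  · simp only [hΨ, map_smul, smul_eq_mul, Finset.sum_mul, smul_mul_assoc, unop_mul, unop_op]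
  · conv_lhs => rw [← sum_repr_smul_cornerBasis γ]
    conv_rhs => rw [← (Module.finBasis k (corner M g h)).sum_repr γ]
    rw [map_sum, map_sum, Finset.sum_smul]
    refine Finset.sum_congr rfl fun i _ => ?_
    rw [map_smul, map_smul, hΨ, Finset.sum_eq_single i]
    · rw [hψ, if_pos rfl, smul_assoc, unop_op]
    · intro i' _ hi
      rw [hψ, if_neg, unop_zero, smul_zero]
      rintro hh
      cases hh
      exact hi rfl
    · simp
  · rw [← sum_repr_smul_cornerBasis γ, map_sum]
    refine Finset.sum_eq_zero fun i _ => ?_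
    rw [map_smul, hΨ, Finset.sum_eq_zero, smul_zero]
    intro i' _
    rw [hψ, if_neg, unop_zero, smul_zero]
    rintro hh
    cases hh
    exact hne ⟨rfl, rfl⟩

end BdQuivCon

/-! ### The connection of a 1-morphism -/

open Quiver (Path)

namespace PathAlgebra
variable {k : Type u} [Field k] {Q : FinQuiver.{u}}

lemma deg_one_mem_span (x : PathAlgebra k Q) :
    deg 1 x ∈ Submodule.span k (Set.range fun e : Σ a b : Q, (a ⟶ b) => (arrow e.2.2 : PathAlgebra k Q)) := by
  induction x using path_induction with
  | zero => rw [map_zero]; exact zero_mem _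
  | add x y hx hy => rw [map_add]; exact add_mem hx hy
  | smul r x hx => rw [map_smul]; exact Submodule.smul_mem _ _ hx
  | @path a b p =>
    rw [deg_path]
    split_ifs with hp
    · cases p with
      | nil => cases hp
      | cons p e =>
        cases p with
        | nil => exact Submodule.subset_span ⟨⟨_, _, e⟩, rfl⟩
        | cons p e' => simp at hp
    · exact zero_mem _

end PathAlgebra

namespace BdQuivCon
open PathAlgebra Bimodule
variable {k : Type u} [Field k]

/-- The coefficient of an edge in an element of `kQ/I`. -/
def arrowCoeff (X : BdQuivCon k) {a b : X.Q} (e : a ⟶ b) : X.alg →ₗ[k] k :=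
  X.algLift (Finsupp.lapply e.toPath ∘ₗ LinearMap.proj (φ := fun b : X.Q => Path a b →₀ k) b ∘ₗ
    LinearMap.proj (φ := fun a : X.Q => ∀ b : X.Q, Path a b →₀ k) a) fun x hx => by
      by_contra hne
      exact absurd (X.admissible.two_le_length x hx a b e.toPath hne) (by simp)

lemma arrowCoeff_arrow (X : BdQuivCon k) {a b : X.Q} (e : a ⟶ b) :
    X.arrowCoeff e (X.proj (arrow e)) = 1 := by
  change (of a b (Finsupp.single e.toPath 1) : PathAlgebra k X.Q) a b e.toPath = 1
  rw [of_apply_same, Finsupp.single_eq_same]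

lemma arrowCoeff_arrow_of_ne (X : BdQuivCon k) {a b a' b' : X.Q} (e : a ⟶ b) (e' : a' ⟶ b')
    (hne : (⟨a, b, e⟩ : Σ a b : X.Q, (a ⟶ b)) ≠ ⟨a', b', e'⟩) :
    X.arrowCoeff e (X.proj (arrow e')) = 0 := by
  change (of a' b' (Finsupp.single e'.toPath 1) : PathAlgebra k X.Q) a b e.toPath = 0
  by_cases h : a' = a ∧ b' = b
  · obtain ⟨rfl, rfl⟩ := h
    rw [of_apply_same, Finsupp.single_eq_of_ne]
    intro h
    refine hne ?_
    cases h
    rfl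
  · rw [of_apply_of_ne _ h]
    rfl

variable {X Y : BdQuivCon k} (M : BSA.Hom X.toBSA Y.toBSA)

/-- The map `(γ_e)_e ↦ ∑ e γ_e`, for `e` the edges out of `g`. -/
def sumLeft (g : X.Q) (h : Y.Q) : (∀ e : X.Q.Out g, corner M e.1 h) →ₗ[k] M.bim :=
  ∑ e : X.Q.Out g, M.bim.lm (X.proj (arrow e.2)) ∘ₗ (corner M e.1 h).subtype ∘ₗ
    LinearMap.proj (φ := fun e : X.Q.Out g => corner M e.1 h) e

/-- The map `(γ_e)_e ↦ ∑ γ_e e`, for `e` the edges into `h`. -/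
def sumRight (g : X.Q) (h : Y.Q) : (∀ e : Y.Q.In h, corner M g e.1) →ₗ[k] M.bim :=
  ∑ e : Y.Q.In h, M.bim.rm (Y.proj (arrow e.2)) ∘ₗ (corner M g e.1).subtype ∘ₗ
    LinearMap.proj (φ := fun e : Y.Q.In h => corner M g e.1) e

variable {M}

lemma sumLeft_apply {g : X.Q} {h : Y.Q} (γ : ∀ e : X.Q.Out g, corner M e.1 h) :
    sumLeft M g h γ = ∑ e : X.Q.Out g, X.proj (arrow e.2) • (γ e : M.bim) := by
  rw [sumLeft, LinearMap.sum_apply]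
  rfl

lemma sumRight_apply {g : X.Q} {h : Y.Q} (γ : ∀ e : Y.Q.In h, corner M g e.1) :
    sumRight M g h γ = ∑ e : Y.Q.In h, op (Y.proj (arrow e.2)) • (γ e : M.bim) := by
  rw [sumRight, LinearMap.sum_apply]
  rfl

lemma sumLeft_single {g g' : X.Q} {h : Y.Q} (e : g ⟶ g') (γ : corner M g' h) :
    sumLeft M g h (Pi.single (M := fun e : X.Q.Out g => corner M e.1 h) ⟨g', e⟩ γ) =
      X.proj (arrow e) • (γ : M.bim) := by
  rw [sumLeft_apply, Finset.sum_eq_single ⟨g', e⟩]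
  · rw [Pi.single_eq_same]
  · intro e' _ he
    rw [Pi.single_eq_of_ne he, ZeroMemClass.coe_zero, smul_zero]
  · simp

lemma sumRight_single {g : X.Q} {h' h : Y.Q} (e : h' ⟶ h) (γ : corner M g h') :
    sumRight M g h (Pi.single (M := fun e : Y.Q.In h => corner M g e.1) ⟨h', e⟩ γ) =
      op (Y.proj (arrow e)) • (γ : M.bim) := by
  rw [sumRight_apply, Finset.sum_eq_single ⟨h', e⟩]
  · rw [Pi.single_eq_same]
  · intro e' _ he
    rw [Pi.single_eq_of_ne he, ZeroMemClass.coe_zero, smul_zero]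
  · simp

/-- The coordinate functionals on the left followed by the coefficients at the edges separate the summands;
these coefficients are well defined because `I ⊆ R²`. -/
lemma sumLeft_injective (g : X.Q) (h : Y.Q) : Function.Injective (sumLeft M g h) := by
  rw [← LinearMap.ker_eq_bot, LinearMap.ker_eq_bot']
  intro γ hγ
  funext e
  refine (Module.forall_dual_apply_eq_zero_iff k _).1 fun ξ => ?_
  obtain ⟨Ψ, hΨ, hΨ₁, hΨ₀⟩ := exists_left_functional e.1 h ξ
  have h1 := congrArg (fun m => X.arrowCoeff e.2 (Ψ m)) hγ
  simp only [sumLeft_apply, map_sum, hΨ, map_zero] at h1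
  rw [Finset.sum_eq_single e, hΨ₁, mul_smul_comm, ← map_mul, path_mul_path, Path.comp_nil, map_smul,
    arrowCoeff_arrow, smul_eq_mul, mul_one] at h1
  · exact h1
  · intro e' _ he
    by_cases hh : e'.1 = e.1
    · obtain ⟨g', e⟩ := e
      obtain ⟨g'', e'⟩ := e'
      dsimp only at hh
      subst hh
      rw [hΨ₁, mul_smul_comm, ← map_mul, path_mul_path, Path.comp_nil, map_smul,
        X.arrowCoeff_arrow_of_ne, smul_zero]
      rintro h2
      cases h2
      exact he rfl
    · rw [hΨ₀ _ _ fun h2 => hh h2.1, mul_zero, map_zero]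
  · simp

/-- The mirror image of `sumLeft_injective`. -/
lemma sumRight_injective (g : X.Q) (h : Y.Q) : Function.Injective (sumRight M g h) := by
  rw [← LinearMap.ker_eq_bot, LinearMap.ker_eq_bot']
  intro γ hγ
  funext e
  refine (Module.forall_dual_apply_eq_zero_iff k _).1 fun ξ => ?_
  obtain ⟨Ψ, hΨ, hΨ₁, hΨ₀⟩ := exists_right_functional g e.1 ξ
  have h1 := congrArg (fun m => Y.arrowCoeff e.2 (Ψ m)) hγ
  simp only [sumRight_apply, map_sum, hΨ, map_zero] at h1
  rw [Finset.sum_eq_single e, hΨ₁, smul_mul_assoc, ← map_mul, path_mul_path, Path.nil_comp, map_smul,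
    arrowCoeff_arrow, smul_eq_mul, mul_one] at h1
  · exact h1
  · intro e' _ he
    by_cases hh : e'.1 = e.1
    · obtain ⟨h', e⟩ := e
      obtain ⟨h'', e'⟩ := e'
      dsimp only at hh
      subst hh
      rw [hΨ₁, smul_mul_assoc, ← map_mul, path_mul_path, Path.nil_comp, map_smul,
        Y.arrowCoeff_arrow_of_ne, smul_zero]
      rintro h2
      cases h2
      exact he rfl
    · rw [hΨ₀ _ _ fun h2 => hh h2.2, zero_mul, map_zero]
  · simp

variable (M) in
/-- The projection of `rad M` to the elements of degree `1` with ends `g` and `h`. -/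
def cornerOne (g : X.Q) (h : Y.Q) : M.bim.radl →ₗ[k] M.bim :=
  M.bim.lm (X.proj (vertex g)) ∘ₗ M.bim.rm (Y.proj (vertex h)) ∘ₗ M.d₂

lemma cornerOne_apply {g : X.Q} {h : Y.Q} (w : M.bim.radl) : cornerOne M g h w =
    X.proj (vertex g) • op (Y.proj (vertex h)) • M.d₂ w := rfl

lemma arrow_smul_corner {g g' : X.Q} {h : Y.Q} (e : g ⟶ g') (γ : corner M g' h) :
    X.proj (arrow e) • (γ : M.bim) =
      M.d₂ ⟨X.proj (arrow e) • (γ : M.bim), rad_smul_mem (Hom.proj_arrow_mem_rad X e) _⟩ := by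
  have h1 := M.compat_left' ⟨X.proj (arrow e), Hom.proj_arrow_mem_rad X e⟩ γ
  have h2 := X.quiverData_δ₂ (Hom.proj_arrow_mem_rad X e)
  rw [deg_one_arrow] at h2
  exact (congrArg₂ (· • ·) h2 γ.2.1).symm.trans h1

lemma op_arrow_smul_corner {g : X.Q} {h h' : Y.Q} (e : h' ⟶ h) (γ : corner M g h') :
    op (Y.proj (arrow e)) • (γ : M.bim) = M.d₂ ⟨op (Y.proj (arrow e)) • (γ : M.bim),
      M.symm.op_smul_mem (Hom.proj_arrow_mem_rad Y e) _⟩ := by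
  have h1 := M.compat_right' ⟨Y.proj (arrow e), Hom.proj_arrow_mem_rad Y e⟩ γ
  have h2 := Y.quiverData_δ₂ (Hom.proj_arrow_mem_rad Y e)
  rw [deg_one_arrow] at h2
  exact (congrArg₂ (· • ·) (congrArg op h2) γ.2.1).symm.trans h1

/-- The products of an edge on the left with elements of degree 0 span the elements of degree 1 with ends `g`
and `h`. -/
lemma range_sumLeft (g : X.Q) (h : Y.Q) :
    LinearMap.range (sumLeft M g h) = LinearMap.range (cornerOne M g h) := by
  apply le_antisymm
  · rintro _ ⟨γ, rfl⟩
    rw [sumLeft_apply]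
    refine sum_mem fun e _ => ⟨⟨_, rad_smul_mem (Hom.proj_arrow_mem_rad X e.2) (γ e).1⟩, ?_⟩
    rw [cornerOne_apply, ← arrow_smul_corner, ← smul_comm (X.proj (arrow e.2)), (γ e).2.2.2, smul_smul,
      ← map_mul, path_mul_path, Path.nil_comp]
  · rintro _ ⟨⟨w, hw⟩, rfl⟩
    refine Submodule.span_induction (p := fun w hw => cornerOne M g h ⟨w, hw⟩ ∈
      LinearMap.range (sumLeft M g h)) ?_ ?_ ?_ ?_ hw
    · rintro _ ⟨r, hr, m, -, rfl⟩
      obtain ⟨x, rfl⟩ := X.proj_surjective r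
      -- by the compatibility of quiver data, `D₁ (x m) = D₁ x · D₀ m`
      have h1 := M.compat_left' ⟨X.proj x, hr⟩ m
      have h2 := X.quiverData_δ₂ hr
      have h3 : cornerOne M g h ⟨X.proj x • m, rad_smul_mem hr m⟩ =
          X.proj (vertex g) • op (Y.proj (vertex h)) • X.proj (deg 1 x) • M.d₁ m := by
        rw [cornerOne_apply, ← h2]
        exact congrArg (fun m => X.proj (vertex g) • op (Y.proj (vertex h)) • m) h1.symm
      rw [h3]
      have key : ∀ z ∈ Submodule.span k (Set.range fun e : Σ a b : X.Q, (a ⟶ b) =>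
          (arrow e.2.2 : PathAlgebra k X.Q)), X.proj (vertex g) • op (Y.proj (vertex h)) • X.proj z •
            M.d₁ m ∈ LinearMap.range (sumLeft M g h) := by
        intro z hz
        induction hz using Submodule.span_induction with
        | zero => rw [map_zero, zero_smul, smul_zero, smul_zero]; exact zero_mem _
        | add x y _ _ hx hy =>
          rw [map_add, add_smul, smul_add, smul_add]
          exact add_mem hx hy
        | smul c x _ hx =>
          rw [_root_.map_smul X.proj, smul_assoc, smul_comm _ c, smul_comm _ c]
          exact Submodule.smul_mem _ _ hx
        | mem z hz =>
          obtain ⟨⟨a, b, e⟩, rfl⟩ := hz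
          rw [← smul_comm (X.proj (arrow e)), smul_smul, ← map_mul]
          by_cases ha : g = a
          · subst ha
            rw [path_mul_path, Path.nil_comp]
            refine ⟨Pi.single ⟨b, e⟩ ⟨_, vertex_d₁_mem M b h m⟩, ?_⟩
            rw [sumLeft_single, smul_smul, ← map_mul, path_mul_path, Path.comp_nil]
          · rw [path_mul_path_of_ne ha, map_zero, zero_smul]
            exact zero_mem _
      exact key _ (deg_one_mem_span x)
    · exact (map_zero (cornerOne M g h)).symm ▸ zero_mem _
    · intro x y hx hy h1 h2
      exact (map_add (cornerOne M g h) ⟨x, hx⟩ ⟨y, hy⟩).symm ▸ add_mem h1 h2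
    · intro c x hx h1
      exact (map_smul (cornerOne M g h) c ⟨x, hx⟩).symm ▸ Submodule.smul_mem _ c h1

/-- The products of elements of degree 0 with an edge on the right span the same space as in `range_sumLeft`.
Together with injectivity of both sums, this gives the isomorphism `U` of the connection. -/
lemma range_sumRight (g : X.Q) (h : Y.Q) :
    LinearMap.range (sumRight M g h) = LinearMap.range (cornerOne M g h) := by
  apply le_antisymm
  · rintro _ ⟨γ, rfl⟩
    rw [sumRight_apply]
    refine sum_mem fun e _ => ⟨⟨_, M.symm.op_smul_mem (Hom.proj_arrow_mem_rad Y e.2) (γ e).1⟩, ?_⟩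
    rw [cornerOne_apply, ← op_arrow_smul_corner, smul_smul (op _), ← op_mul, ← map_mul, path_mul_path,
      Path.comp_nil, smul_comm, (γ e).2.2.1]
  · rintro _ ⟨⟨w, hw⟩, rfl⟩
    have hw' : w ∈ M.bim.rmul (rad Y.alg) ⊤ := M.symm ▸ hw
    refine Submodule.span_induction (p := fun w hw => ∀ hw' : w ∈ M.bim.radl, cornerOne M g h ⟨w, hw'⟩ ∈
      LinearMap.range (sumRight M g h)) ?_ ?_ ?_ ?_ hw' hw
    · rintro _ ⟨r, hr, m, -, rfl⟩ _
      obtain ⟨x, rfl⟩ := Y.proj_surjective r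
      have h1 := M.compat_right' ⟨Y.proj x, hr⟩ m
      have h2 := Y.quiverData_δ₂ hr
      have h3 : cornerOne M g h ⟨op (Y.proj x) • m, M.symm.op_smul_mem hr m⟩ =
          X.proj (vertex g) • op (Y.proj (vertex h)) • op (Y.proj (deg 1 x)) • M.d₁ m := by
        rw [cornerOne_apply, ← h2]
        exact congrArg (fun m => X.proj (vertex g) • op (Y.proj (vertex h)) • m) h1.symm
      rw [h3]
      have key : ∀ z ∈ Submodule.span k (Set.range fun e : Σ a b : Y.Q, (a ⟶ b) =>
          (arrow e.2.2 : PathAlgebra k Y.Q)), X.proj (vertex g) • op (Y.proj (vertex h)) •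
            op (Y.proj z) • M.d₁ m ∈ LinearMap.range (sumRight M g h) := by
        intro z hz
        induction hz using Submodule.span_induction with
        | zero => rw [map_zero, op_zero, zero_smul, smul_zero, smul_zero]; exact zero_mem _
        | add x y _ _ hx hy =>
          rw [map_add, MulOpposite.op_add, add_smul, smul_add, smul_add]
          exact add_mem hx hy
        | smul c x _ hx =>
          rw [_root_.map_smul Y.proj, MulOpposite.op_smul, smul_assoc, smul_comm _ c, smul_comm _ c]
          exact Submodule.smul_mem _ _ hx
        | mem z hz =>
          obtain ⟨⟨a, b, e⟩, rfl⟩ := hz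
          rw [smul_smul (op _), ← op_mul, ← map_mul]
          by_cases hb : b = h
          · subst hb
            rw [path_mul_path, Path.comp_nil]
            refine ⟨Pi.single ⟨a, e⟩ ⟨_, vertex_d₁_mem M g a m⟩, ?_⟩
            rw [sumRight_single, ← smul_comm, smul_smul, ← op_mul, ← map_mul, path_mul_path,
              Path.nil_comp]
          · rw [path_mul_path_of_ne hb, map_zero, op_zero, zero_smul, smul_zero]
            exact zero_mem _
      exact key _ (deg_one_mem_span x)
    · intro h0
      exact (map_zero (cornerOne M g h)).symm ▸ zero_mem _
    · intro x y hx hy h1 h2 h3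
      have hx' : x ∈ M.bim.radl := by rw [radl, M.symm]; exact hx
      have hy' : y ∈ M.bim.radl := by rw [radl, M.symm]; exact hy
      exact (map_add (cornerOne M g h) ⟨x, hx'⟩ ⟨y, hy'⟩).symm ▸ add_mem (h1 hx') (h2 hy')
    · intro c x hx h1 h2
      have hx' : x ∈ M.bim.radl := by rw [radl, M.symm]; exact hx
      exact (map_smul (cornerOne M g h) c ⟨x, hx'⟩).symm ▸ Submodule.smul_mem _ c (h1 hx')

variable (M) in
/-- The connection on the elements of degree `0`: the isomorphisms `U` compare the two ways of writing
the elements of degree `1`. -/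
def connection : Connection k X.Q Y.Q :=
  haveI := finite_bim M
  { Γ := fun g h => corner M g h
    U := fun g h => LinearEquiv.ofInjective _ (sumLeft_injective g h) ≪≫ₗ
      LinearEquiv.ofEq _ _ ((range_sumLeft g h).trans (range_sumRight g h).symm) ≪≫ₗ
        (LinearEquiv.ofInjective _ (sumRight_injective g h)).symm }

lemma sumRight_U (g : X.Q) (h : Y.Q) (γ : ∀ e : X.Q.Out g, corner M e.1 h) :
    sumRight M g h ((connection M).U g h γ) = sumLeft M g h γ :=
  congrArg Subtype.val ((LinearEquiv.ofInjective _ (sumRight_injective g h)).apply_symm_apply _)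

/-- The inclusion of the elements of degree `0`. -/
def cornerIncl (g : X.Q) (h : Y.Q) : (connection M).Γ g h →ₗ[k] M.bim := (corner M g h).subtype

lemma arrow_smul_incl {g g' : X.Q} {h : Y.Q} (e : g ⟶ g') (γ : (connection M).Γ g' h) :
    X.proj (arrow e) • cornerIncl g' h γ = ∑ e' : Y.Q.In h,
      op (Y.proj (arrow e'.2)) • cornerIncl g e'.1 ((connection M).cell e e'.2 γ) :=
  (sumLeft_single e γ).symm.trans ((sumRight_U g h _).symm.trans (sumRight_apply _))

end BdQuivCon

/-! ### The path functor is locally essentially surjective -/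

open Quiver (Path)

section tensor
variable {k : Type*} [Field k] {V W ι : Type*} [AddCommGroup V] [Module k V] [AddCommGroup W]
  [Module k W] [Fintype ι] (b : Module.Basis ι k V)

lemma sum_basis_tmul (w : V ⊗[k] W) :
    ∑ i, b i ⊗ₜ[k] TensorProduct.lid k W ((b.coord i).rTensor W w) = w := by
  induction w using TensorProduct.induction_on with
  | zero => simp
  | add x y hx hy =>
    simp only [map_add, TensorProduct.tmul_add, Finset.sum_add_distrib]
    rw [hx, hy]
  | tmul v w =>
    simp only [LinearMap.rTensor_tmul, TensorProduct.lid_tmul, ← TensorProduct.smul_tmul]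
    rw [← TensorProduct.sum_tmul]
    congr 1
    simp

lemma sum_tmul_basis (w : W ⊗[k] V) :
    ∑ i, TensorProduct.rid k W ((b.coord i).lTensor W w) ⊗ₜ[k] b i = w := by
  induction w using TensorProduct.induction_on with
  | zero => simp
  | add x y hx hy =>
    simp only [map_add, TensorProduct.add_tmul, Finset.sum_add_distrib]
    rw [hx, hy]
  | tmul v w =>
    simp only [LinearMap.lTensor_tmul, TensorProduct.rid_tmul, TensorProduct.smul_tmul]
    rw [← TensorProduct.tmul_sum]
    congr 1
    simp

end tensor

namespace BdQuivCon
open PathAlgebra Bimodule Connection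
variable {k : Type u} [Field k] {X Y : BdQuivCon k} (M : BSA.Hom X.toBSA Y.toBSA)

/-- The map `γ y ↦ γ y` from the path bimodule of the connection of `M` to `M`. -/
def pathEval : (connection M).PathBimodule →ₗ[k] M.bim :=
  pathBimoduleLift fun g h l => (LinearMap.llcomp k _ _ _).flip
    ((Algebra.lsmul k k M.bim : Y.algᵐᵒᵖ →ₐ[k] Module.End k M.bim).toLinearMap ∘ₗ
      (opLinearEquiv k : Y.alg ≃ₗ[k] Y.algᵐᵒᵖ).toLinearMap ∘ₗ Y.proj.toLinearMap ∘ₗ of h l) ∘ₗ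
        LinearMap.applyₗ ∘ₗ cornerIncl g h

variable {M}

lemma pathEval_pin {g : X.Q} {h l : Y.Q} (γ : (connection M).Γ g h) (y : Path h l →₀ k) :
    pathEval M ((connection M).ofPathMod g l ((connection M).pin γ y)) =
      op (Y.proj (of h l y)) • cornerIncl g h γ :=
  pathBimoduleLift_pin _ γ y

lemma pathEval_elt {g : X.Q} {h l : Y.Q} (q : Path h l) (γ : (connection M).Γ g h) :
    pathEval M ((connection M).elt q γ) = op (Y.proj (path q)) • cornerIncl g h γ :=
  pathEval_pin γ _

lemma vertex_smul_incl {g : X.Q} {h : Y.Q} (γ : (connection M).Γ g h) :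
    X.proj (vertex g) • cornerIncl g h γ = cornerIncl g h γ :=
  (Subtype.property (p := (· ∈ corner M g h)) γ).2.1

lemma op_vertex_smul_incl {g : X.Q} {h : Y.Q} (γ : (connection M).Γ g h) :
    op (Y.proj (vertex h)) • cornerIncl g h γ = cornerIncl g h γ :=
  (Subtype.property (p := (· ∈ corner M g h)) γ).2.2

lemma pathEval_leftAct (x : PathAlgebra k X.Q) (m : (connection M).PathBimodule) :
    pathEval M ((connection M).leftAct x m) = X.proj x • pathEval M m := by
  simp only [← leftActₗ_apply]
  induction x using generator_induction generalizing m with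
  | zero => simp
  | add x x' h h' => rw [map_add, LinearMap.add_apply, map_add, map_add, add_smul, h, h']
  | smul t x h => rw [map_smul, LinearMap.smul_apply, map_smul, h, _root_.map_smul X.proj, smul_assoc]
  | mul x x' h h' => rw [leftActₗ_apply, leftAct_mul, ← leftActₗ_apply, ← leftActₗ_apply, h, h', map_mul, mul_smul]
  | vertex v =>
    refine LinearMap.congr_fun (f := pathEval M ∘ₗ (connection M).leftActₗ (vertex v))
      (g := lm _ (X.proj (vertex v)) ∘ₗ pathEval M) (ext_elt fun {g h l} q γ => ?_) m
    change pathEval M ((connection M).leftAct (vertex v) _) = X.proj (vertex v) • pathEval M _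
    rw [pathEval_elt, smul_comm, ← vertex_smul_incl, smul_smul, vertex_mul_vertex_proj]
    by_cases hv : v = g
    · subst hv
      rw [leftAct_vertex_elt, pathEval_elt, if_pos rfl, vertex_smul_incl]
    · rw [leftAct_vertex_elt_of_ne _ hv, if_neg hv, zero_smul, smul_zero, map_zero]
  | @arrow v w e =>
    refine LinearMap.congr_fun (f := pathEval M ∘ₗ (connection M).leftActₗ (arrow e))
      (g := lm _ (X.proj (arrow e)) ∘ₗ pathEval M) (ext_elt fun {g h l} q γ => ?_) m
    change pathEval M ((connection M).leftAct (arrow e) _) = X.proj (arrow e) • pathEval M _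
    rw [pathEval_elt, smul_comm]
    by_cases hv : w = g
    · subst hv
      rw [leftAct_arrow_elt, map_sum, arrow_smul_incl, Finset.smul_sum]
      refine Finset.sum_congr rfl fun e' _ => ?_
      rw [pathEval_elt, smul_smul, ← op_mul, ← map_mul, path_mul_path]
    · rw [leftAct_arrow_elt_of_ne _ hv, ← vertex_smul_incl, smul_smul (X.proj _), ← map_mul,
        path_mul_path_of_ne hv, map_zero, map_zero, zero_smul, smul_zero]

lemma exists_right_dual (g : X.Q) (h : Y.Q) (ξ : (connection M).Γ g h →ₗ[k] k) :
    ∃ Ψ : M.bim →ₗ[k] Y.alg, (∀ b m, Ψ (op b • m) = Ψ m * b) ∧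
      (∀ γ : (connection M).Γ g h, Ψ (cornerIncl g h γ) = ξ γ • Y.proj (vertex h)) ∧
        ∀ g' h', ¬ (g' = g ∧ h' = h) → ∀ γ : (connection M).Γ g' h', Ψ (cornerIncl g' h' γ) = 0 :=
  exists_right_functional g h ξ

lemma exists_left_dual (g : X.Q) (h : Y.Q) (ξ : (connection M).Γ g h →ₗ[k] k) :
    ∃ Ψ : M.bim →ₗ[k] X.alg, (∀ a m, Ψ (a • m) = a * Ψ m) ∧
      (∀ γ : (connection M).Γ g h, Ψ (cornerIncl g h γ) = ξ γ • X.proj (vertex g)) ∧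
        ∀ g' h', ¬ (g' = g ∧ h' = h) → ∀ γ : (connection M).Γ g' h', Ψ (cornerIncl g' h' γ) = 0 :=
  exists_left_functional g h ξ

/-- The elements of the path bimodule which vanish in `M` lie in the ideal part, because `M` is the
direct sum of the right modules `Γ g h ⊗ e_h B`. -/
lemma mem_idealPart {g : X.Q} {l : Y.Q} {t : (connection M).PathMod g l}
    (ht : pathEval M ((connection M).ofPathMod g l t) = 0) :
    t ∈ (connection M).idealPart Y.I g l := by
  -- a functional `ξ` on `Γ g h` extends to a right linear map `Ψ : M → Y.alg`, which detects the factor in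
  -- `e_h Y.alg`
  have key : ∀ (h : Y.Q) (ξ : (connection M).Γ g h →ₗ[k] k), of h l (TensorProduct.lid k
      (Path h l →₀ k) (ξ.rTensor (Path h l →₀ k) (t h))) ∈ Y.I := by
    intro h ξ
    obtain ⟨Ψ, hΨ, hΨ₁, hΨ₀⟩ := exists_right_dual g h ξ
    rw [← Y.proj_eq_zero]
    have h1 := congrArg Ψ ht
    rw [map_zero] at h1
    rw [← h1]
    refine LinearMap.congr_fun (f := Y.proj.toLinearMap ∘ₗ of h l ∘ₗ
      (TensorProduct.lid k (Path h l →₀ k)).toLinearMap ∘ₗ ξ.rTensor (Path h l →₀ k) ∘ₗ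
        LinearMap.proj (φ := fun h => (connection M).Γ g h ⊗[k] (Path h l →₀ k)) h)
      (g := Ψ ∘ₗ pathEval M ∘ₗ (connection M).ofPathMod g l) (ext_pin fun h' γ y => ?_) t
    change Y.proj (of h l (TensorProduct.lid k (Path h l →₀ k) (ξ.rTensor (Path h l →₀ k)
      (Pi.single (M := fun h => (connection M).Γ g h ⊗[k] (Path h l →₀ k)) h' (γ ⊗ₜ y) h)))) =
        Ψ (pathEval M ((connection M).ofPathMod g l ((connection M).pin γ y)))
    have h2 : Ψ (pathEval M ((connection M).ofPathMod g l ((connection M).pin γ y))) =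
        Ψ (cornerIncl g h' γ) * Y.proj (of h' l y) := by rw [pathEval_pin, hΨ]
    refine Eq.trans ?_ h2.symm
    by_cases hh : h' = h
    · subst hh
      rw [Pi.single_eq_same, hΨ₁, smul_mul_assoc, ← map_mul, vertex, path, of_mul_of, nil_concat,
        LinearMap.rTensor_tmul, TensorProduct.lid_tmul, map_smul, _root_.map_smul Y.proj]
    · rw [Pi.single_eq_of_ne (Ne.symm hh), hΨ₀ g h' (fun h3 => hh h3.2), zero_mul, map_zero, map_zero,
        map_zero, map_zero]
  have ht' : t = ∑ h, ∑ i, (connection M).pin (Module.finBasis k ((connection M).Γ g h) i)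
      (TensorProduct.lid k (Path h l →₀ k)
        (((Module.finBasis k ((connection M).Γ g h)).coord i).rTensor (Path h l →₀ k) (t h))) := by
    have h1 := (Finset.univ_sum_single
      (M := fun h => (connection M).Γ g h ⊗[k] (Path h l →₀ k)) t).symm
    refine h1.trans (Finset.sum_congr rfl fun h _ => ?_)
    have h2 := congrArg (LinearMap.single k (fun h => (connection M).Γ g h ⊗[k] (Path h l →₀ k)) h)
      (sum_basis_tmul (Module.finBasis k ((connection M).Γ g h)) (t h))
    rw [map_sum] at h2
    exact h2.symm
  rw [ht']
  exact sum_mem fun h _ => sum_mem fun i _ => Submodule.subset_span ⟨h, _, _, key h _, rfl⟩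

/-- On a generator, the left action is the iterated isomorphism `Uⁿ` summed over all lengths. -/
lemma leftAct_elt_nil_apply {G H : FinQuiver.{u}} (c : Connection k G H) {g g' : G} {l : H}
    (x : PathAlgebra k G) (γ : c.Γ g' l) :
    c.leftAct x (c.elt Path.nil γ) g l = c.act l (x g g') (c.edge γ) := by
  change ∑ g₁, c.act l (x g g₁) (c.ofPathMod g' l (c.edge γ) g₁ l) = _
  rw [Finset.sum_eq_single g']
  · rw [ofPathMod_apply_same]
  · intro g₁ _ hg
    rw [ofPathMod_apply_of_ne _ _ fun h => hg h.1.symm, map_zero]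
  · simp

/-- The analogue of `mem_idealPart` for the decomposition of `M` into the left modules
`A e_g ⊗ Γ g h`. -/
lemma ofLeft_mem_of_pathEval {g : X.Q} {l : Y.Q} {t : (connection M).LeftPathMod l}
    (ht : pathEval M ((connection M).ofLeft l t) = 0) :
    (connection M).ofLeft l t g l ∈ Submodule.span k {m | ∃ (g' : X.Q) (x : Path g g' →₀ k)
      (γ : (connection M).Γ g' l), of g g' x ∈ X.I ∧ m = (connection M).act l x
        ((connection M).edge γ)} := by
  have key : ∀ (g' : X.Q) (ξ : (connection M).Γ g' l →ₗ[k] k), TensorProduct.rid k (PathAlgebra k X.Q)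
      (ξ.lTensor (PathAlgebra k X.Q) (t g')) * vertex g' ∈ X.I := by
    intro g' ξ
    obtain ⟨Ψ, hΨ, hΨ₁, hΨ₀⟩ := exists_left_dual g' l ξ
    rw [← X.proj_eq_zero]
    have h1 := congrArg Ψ ht
    rw [map_zero] at h1
    rw [← h1]
    refine LinearMap.congr_fun (f := X.proj.toLinearMap ∘ₗ LinearMap.mulRight k (vertex g') ∘ₗ
      (TensorProduct.rid k (PathAlgebra k X.Q)).toLinearMap ∘ₗ ξ.lTensor (PathAlgebra k X.Q) ∘ₗ
        LinearMap.proj (φ := fun g => PathAlgebra k X.Q ⊗[k] (connection M).Γ g l) g')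
      (g := Ψ ∘ₗ pathEval M ∘ₗ (connection M).ofLeft l) (ext_leftPin fun g₁ x γ => ?_) t
    change X.proj (TensorProduct.rid k (PathAlgebra k X.Q) (ξ.lTensor (PathAlgebra k X.Q)
      (Pi.single (M := fun g => PathAlgebra k X.Q ⊗[k] (connection M).Γ g l) g₁ (x ⊗ₜ γ) g')) *
        vertex g') = Ψ (pathEval M ((connection M).ofLeft l _))
    rw [ofLeft_leftPin, pathEval_leftAct, hΨ, pathEval_elt, op_vertex_smul_incl]
    by_cases hh : g₁ = g'
    · subst hh
      rw [Pi.single_eq_same, hΨ₁, mul_smul_comm, ← map_mul, ← _root_.map_smul X.proj,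
        LinearMap.lTensor_tmul, TensorProduct.rid_tmul, smul_mul_assoc]
    · rw [Pi.single_eq_of_ne (Ne.symm hh), hΨ₀ g₁ l (fun h3 => hh h3.1), mul_zero, map_zero, map_zero,
        zero_mul, map_zero]
  have ht' : t = ∑ g', ∑ i, (connection M).leftPin (TensorProduct.rid k (PathAlgebra k X.Q)
      (((Module.finBasis k ((connection M).Γ g' l)).coord i).lTensor (PathAlgebra k X.Q) (t g')))
        (Module.finBasis k ((connection M).Γ g' l) i) := by
    have h1 := (Finset.univ_sum_single
      (M := fun g => PathAlgebra k X.Q ⊗[k] (connection M).Γ g l) t).symm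
    refine h1.trans (Finset.sum_congr rfl fun g' _ => ?_)
    have h2 := congrArg (LinearMap.single k (fun g => PathAlgebra k X.Q ⊗[k] (connection M).Γ g l) g')
      (sum_tmul_basis (Module.finBasis k ((connection M).Γ g' l)) (t g'))
    rw [map_sum] at h2
    exact h2.symm
  have h3 : (connection M).ofLeft l t = ∑ g', ∑ i, (connection M).leftAct
      (TensorProduct.rid k (PathAlgebra k X.Q) (((Module.finBasis k
        ((connection M).Γ g' l)).coord i).lTensor (PathAlgebra k X.Q) (t g')) * vertex g')
          ((connection M).elt Path.nil (Module.finBasis k ((connection M).Γ g' l) i)) := by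
    conv_lhs => rw [ht']
    simp only [map_sum]
    refine Finset.sum_congr rfl fun g' _ => Finset.sum_congr rfl fun i _ => ?_
    rw [ofLeft_leftPin, leftAct_mul, leftAct_vertex_elt]
  rw [h3, Connection.sum_apply]
  refine sum_mem fun g' _ => ?_
  rw [Connection.sum_apply]
  refine sum_mem fun i _ => ?_
  rw [leftAct_elt_nil_apply]
  exact Submodule.subset_span ⟨g', _, _, of_mem (key g' _) g g', rfl⟩

lemma toLeft_pin_of_ne {G H : FinQuiver.{u}} (c : Connection k G H) {g : G} {h l l' : H} (hl : l' ≠ l)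
    (γ : c.Γ g h) (y : Path h l →₀ k) : c.toLeft (c.ofPathMod g l (c.pin γ y)) l' = 0 := by
  induction y using Finsupp.induction_linear with
  | zero => simp
  | add y z hy hz => rw [map_add, map_add, map_add, Pi.add_apply, hy, hz, add_zero]
  | single q r =>
    rw [← mul_one r, ← smul_eq_mul, ← Finsupp.smul_single, map_smul, map_smul, map_smul, Pi.smul_apply,
      ← elt_apply, toLeft_elt, LinearMap.single_apply, Pi.single_eq_of_ne hl, smul_zero]

variable (M) in
/-- The value in `M` of `x γ` with `x ∈ I` is 0, and by freeness on the right an element `∑ γ' y` with value 0 has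
its factors `y` in `J`. The same holds with the sides exchanged. -/
lemma isIdeallyConnected_connection : (connection M).IsIdeallyConnected X.I Y.I where
  act_mem g g' h x hx γ := by
    refine mem_idealPart ?_
    have h1 : (connection M).ofPathMod g h ((connection M).act h x ((connection M).edge γ)) =
        (connection M).leftAct (of g g' x) ((connection M).elt Path.nil γ) :=
      ((connection M).leftAct_of_ofPathMod x _).symm
    rw [h1, pathEval_leftAct, X.proj_eq_zero.2 hx, zero_smul]
  pin_mem g h l y hy γ := by
    have h1 : (connection M).ofPathMod g l ((connection M).pin γ y) g l = (connection M).pin γ y :=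
      ofPathMod_apply_same ..
    have h2 := (connection M).sum_ofLeft_toLeft
      ((connection M).ofPathMod g l ((connection M).pin γ y))
    rw [Finset.sum_eq_single l (fun l' _ hl => by rw [toLeft_pin_of_ne _ hl, map_zero])
      (by simp)] at h2
    rw [← h1, ← h2]
    refine ofLeft_mem_of_pathEval ?_
    rw [h2, pathEval_pin, Y.proj_eq_zero.2 hy, op_zero, zero_smul]

variable (M) in
/-- The connection of `M`, as a 1-morphism of bound quivers. -/
abbrev connectionHom : BdQuivCon.Hom X Y := ⟨connection M, isIdeallyConnected_connection M⟩

lemma isCompatible_cornerIncl : (connectionHom M).IsCompatible M.bim cornerIncl where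
  left _ _ γ := vertex_smul_incl γ
  right _ _ γ := op_vertex_smul_incl γ
  arrow e γ := arrow_smul_incl e γ

variable (M) in
/-- The map of bimodules `γ y ↦ γ y` from the bimodule of the connection of `M` to `M`. -/
def connectionEval : (connectionHom M).bim ⟶ M.bim := Hom.homLift isCompatible_cornerIncl

lemma connectionEval_gen {g : X.Q} {h : Y.Q} (γ : (connection M).Γ g h) :
    lin (connectionEval M) ((connectionHom M).gen γ) = cornerIncl g h γ :=
  Hom.homLift_gen isCompatible_cornerIncl γ

lemma connectionEval_proj (m : (connection M).PathBimodule) :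
    lin (connectionEval M) ((connectionHom M).proj m) = pathEval M m := by
  refine LinearMap.congr_fun (f := lin (connectionEval M) ∘ₗ (connectionHom M).proj)
    (g := pathEval M) (ext_elt fun {g h l} q γ => ?_) m
  refine (congrArg (lin (connectionEval M))
    ((connectionHom M).proj_elt q γ)).trans ?_
  rw [lin_right]
  exact (congrArg (op (Y.proj (path q)) • ·)
    (connectionEval_gen γ)).trans (pathEval_elt q γ).symm

lemma pathEval_rightAct (m : (connection M).PathBimodule) (y : PathAlgebra k Y.Q) :
    pathEval M ((connection M).rightAct m y) = op (Y.proj y) • pathEval M m := by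
  rw [← connectionEval_proj, ← connectionEval_proj, ← lin_right]
  rfl

lemma ofPathMod_eq {G H : FinQuiver.{u}} (c : Connection k G H) (g : G) (l : H)
    (m : c.PathBimodule) :
    c.ofPathMod g l (m g l) = c.leftAct (vertex g) (c.rightAct m (vertex l)) := by
  refine LinearMap.congr_fun (f := c.ofPathMod g l ∘ₗ LinearMap.proj (φ := fun l => c.PathMod g l) l ∘ₗ
    LinearMap.proj (φ := fun g => ∀ l, c.PathMod g l) g)
    (g := c.leftActₗ (vertex g) ∘ₗ c.rightActₗ.flip (vertex l)) (ext_elt fun {g' h l'} q γ => ?_) m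
  change c.ofPathMod g l (c.elt q γ g l) = c.leftAct (vertex g) (c.rightAct (c.elt q γ) (vertex l))
  by_cases hl : l' = l
  · subst hl
    rw [rightAct_elt_path, Path.comp_nil]
    by_cases hg : g = g'
    · subst hg
      rw [leftAct_vertex_elt, elt_apply, ofPathMod_apply_same]
    · rw [leftAct_vertex_elt_of_ne _ hg, elt_apply]
      exact (congrArg (c.ofPathMod g l') (c.ofPathMod_apply_of_ne _ fun h => hg h.1.symm)).trans
        (map_zero _)
  · rw [rightAct_elt_path_of_ne _ hl, ← leftActₗ_apply, map_zero, elt_apply]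
    exact (congrArg (c.ofPathMod g l) (c.ofPathMod_apply_of_ne _ fun h => hl h.2)).trans (map_zero _)

lemma connectionEval_injective : Function.Injective (lin (connectionEval M)) := by
  rw [← LinearMap.ker_eq_bot, LinearMap.ker_eq_bot']
  intro m hm
  obtain ⟨m, rfl⟩ := (connectionHom M).proj_surjective m
  rw [connectionEval_proj] at hm
  rw [Hom.proj_eq_zero, ← (connection M).sum_ofPathMod m]
  refine sum_mem fun g _ => sum_mem fun l _ => ?_
  have h1 : m g l ∈ (connection M).idealPart Y.I g l := by
    refine mem_idealPart ?_
    rw [ofPathMod_eq, pathEval_leftAct, pathEval_rightAct, hm, smul_zero, smul_zero]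
  generalize m g l = t at h1
  induction h1 using Submodule.span_induction with
  | mem t ht =>
    obtain ⟨h, γ, y, hy, rfl⟩ := ht
    exact (connection M).ofPathMod_pin_mem γ hy
  | zero => rw [map_zero]; exact zero_mem _
  | add s t _ _ hs ht => rw [map_add]; exact add_mem hs ht
  | smul r t _ ht => rw [map_smul]; exact Submodule.smul_mem _ _ ht

lemma connectionEval_surjective :
    Function.Surjective (lin (connectionEval M)) := by
  let S : Submodule Y.algᵐᵒᵖ M.bim :=
    { carrier := Set.range (lin (connectionEval M))
      add_mem' := by
        rintro _ _ ⟨m, rfl⟩ ⟨n, rfl⟩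
        exact ⟨m + n, map_add _ _ _⟩
      zero_mem' := ⟨0, map_zero _⟩
      smul_mem' := by
        rintro b _ ⟨m, rfl⟩
        exact ⟨b • m, lin_right _ b.unop m⟩ }
  have h1 : S = ⊤ := by
    rw [eq_top_iff, ← span_op_cornerBasis M, Submodule.span_le]
    rintro _ ⟨j, rfl⟩
    exact ⟨_, connectionEval_gen ⟨_, cornerBasis_mem j⟩⟩
  intro m
  have h2 : m ∈ S := by
    rw [h1]
    trivial
  exact h2

variable (M) in
/-- Every 1-morphism between algebras of bound quivers is isomorphic to the one of its connection. -/
def connectionIso : (connectionHom M).toBSA ≅ M :=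
  let e := LinearEquiv.ofBijective _ ⟨connectionEval_injective (M := M), connectionEval_surjective⟩
  (connectionHom M).iso₂ M
    (isoOfInverse (connectionEval M) e.symm.toLinearMap e.symm_apply_apply
      e.apply_symm_apply) fun {g h} γ => by
    change M.d₁ (lin (connectionEval M) ((connectionHom M).gen γ)) =
      lin (connectionEval M) ((connectionHom M).gen γ)
    rw [connectionEval_gen]
    exact (Subtype.property (p := (· ∈ corner M g h)) γ).1

instance (X Y : BdQuivCon k) : ((pathFunctor k).mapFunctor X Y).EssSurj :=
  ⟨fun M => ⟨connectionHom M, ⟨connectionIso M⟩⟩⟩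

end BdQuivCon

/-! ### The bound quiver of a basic algebra with quiver data -/

open Quiver (Path)

namespace PathAlgebra
variable {k : Type u} [Field k] {Q : FinQuiver.{u}} {A : Type u} [Ring A] [Algebra k A]

section lift
variable (v : Q → A) (f : ∀ {a b : Q}, (a ⟶ b) → A)

/-- The product along a path of given elements `f e`, with value `v a` at the path of length `0`
at `a`. -/
def prodPath {a : Q} : ∀ {b : Q}, Path a b → A
  | _, .nil => v a
  | _, .cons p e => prodPath p * f e

/-- The linear extension of `prodPath` to the path algebra. -/
def liftₗ : PathAlgebra k Q →ₗ[k] A :=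
  LinearMap.lsum k (fun a : Q => ∀ b : Q, Path a b →₀ k) k fun a =>
    LinearMap.lsum k (fun b : Q => Path a b →₀ k) k fun b =>
      Finsupp.lsum k fun p : Path a b => LinearMap.toSpanSingleton k A (prodPath v f p)

lemma liftₗ_of {a b : Q} (y : Path a b →₀ k) : liftₗ v f (of a b y) =
    Finsupp.lsum k (fun p : Path a b => LinearMap.toSpanSingleton k A (prodPath v f p)) y :=
  (LinearMap.lsum_piSingle ..).trans (LinearMap.lsum_piSingle ..)

lemma liftₗ_path {a b : Q} (p : Path a b) : liftₗ (k := k) v f (path p) = prodPath v f p := by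
  rw [path, liftₗ_of]
  simp

variable {v f}

lemma mul_prodPath (hv : CompleteOrthogonalIdempotents v) {a b : Q} (p : Path a b) :
    v a * prodPath v f p = prodPath v f p := by
  induction p with
  | nil => exact hv.idem a
  | cons p e ih => rw [prodPath, ← mul_assoc, ih]

lemma prodPath_mul (hv : CompleteOrthogonalIdempotents v)
    (hf : ∀ {a b : Q} (e : a ⟶ b), f e * v b = f e) {a b : Q} (p : Path a b) :
    prodPath v f p * v b = prodPath v f p := by
  cases p with
  | nil => exact hv.idem a
  | cons p e => rw [prodPath, mul_assoc, hf]

lemma prodPath_comp (hv : CompleteOrthogonalIdempotents v)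
    (hf : ∀ {a b : Q} (e : a ⟶ b), f e * v b = f e) {a b c : Q} (p : Path a b) (q : Path b c) :
    prodPath v f (p.comp q) = prodPath v f p * prodPath v f q := by
  induction q with
  | nil => exact (prodPath_mul hv hf p).symm
  | cons q e ih => rw [Path.comp_cons, prodPath, ih, prodPath, mul_assoc]

/-- The universal property of the path algebra. -/
def liftAlg (hv : CompleteOrthogonalIdempotents v)
    (hr : ∀ {a b : Q} (e : a ⟶ b), f e * v b = f e) :
    PathAlgebra k Q →ₐ[k] A :=
  AlgHom.ofLinearMap (liftₗ v f)
    (by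
      rw [← sum_vertex, map_sum]
      simp only [liftₗ_path]
      exact hv.complete)
    (by
      intro x y
      induction x using path_induction with
      | zero => simp
      | add x x' h h' => rw [add_mul, map_add, h, h', map_add, add_mul]
      | smul r x h => rw [smul_mul_assoc, map_smul, h, map_smul, smul_mul_assoc]
      | @path a b p =>
        induction y using path_induction with
        | zero => simp
        | add y y' h h' => rw [mul_add, map_add, h, h', map_add, mul_add]
        | smul r y h => rw [mul_smul_comm, map_smul, h, map_smul, mul_smul_comm]
        | @path b' c q =>
          by_cases hb : b = b'
          · subst hb
            rw [path_mul_path, liftₗ_path, liftₗ_path, liftₗ_path, prodPath_comp hv hr]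
          · rw [path_mul_path_of_ne hb, map_zero, liftₗ_path, liftₗ_path, ← prodPath_mul hv hr p,
              ← mul_prodPath hv q, mul_assoc, ← mul_assoc (v b), hv.ortho hb, zero_mul, mul_zero])

end lift

end PathAlgebra

namespace QuiverData
variable {k A : Type u} [Field k] [Ring A] [Algebra k A] (d : QuiverData k A) {n : ℕ}
  (σ : (A ⧸ rad A) ≃ₐ[k] (Fin n → k))

/-- The idempotent of `A` given by `δ₁` and a factor of `A / rad A ≅ kⁿ`. -/
def idem (i : ULift.{u} (Fin n)) : A := d.δ₁ (σ.symm (Pi.single i.down 1))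

/-- The coordinates of the class of an element in `A / rad A ≅ kⁿ`. -/
def coeff (i : ULift.{u} (Fin n)) : A →ₗ[k] k :=
  LinearMap.proj i.down ∘ₗ σ.toLinearMap ∘ₗ (Ideal.Quotient.mkₐ k (rad A)).toLinearMap

lemma coeff_eq_zero {a : A} (ha : a ∈ rad A) (i : ULift.{u} (Fin n)) : coeff σ i a = 0 := by
  change σ (Ideal.Quotient.mk (rad A) a) i.down = 0
  rw [Ideal.Quotient.eq_zero_iff_mem.2 ha, map_zero]
  rfl

lemma coeff_idem (i j : ULift.{u} (Fin n)) : coeff σ i (d.idem σ j) = if i = j then 1 else 0 := by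
  change σ (cls₁ (d.δ₁ (σ.symm (Pi.single j.down 1)))) i.down = _
  rw [d.section₁, σ.apply_symm_apply, Pi.single_apply]
  simp only [ULift.ext_iff]

lemma D₀_idem (i : ULift.{u} (Fin n)) : d.D₀ (d.idem σ i) = d.idem σ i := d.D₀_δ₁ _

lemma D₀_eq_sum_idem (a : A) : d.D₀ a = ∑ i, coeff σ i a • d.idem σ i := by
  have h1 : cls₁ a = ∑ i : Fin n, σ (cls₁ a) i • σ.symm (Pi.single i 1) := by
    apply σ.injective
    rw [map_sum]
    simp only [map_smul, σ.apply_symm_apply]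
    funext j
    simp [Finset.sum_apply, Pi.single_apply]
  rw [D₀_apply, h1, map_sum]
  simp only [map_smul]
  exact (Equiv.sum_comp (Equiv.ulift.{u} (α := Fin n))
    fun i => σ (cls₁ a) i • d.δ₁ (σ.symm (Pi.single i 1))).symm

lemma completeOrthogonalIdempotents_idem : CompleteOrthogonalIdempotents (d.idem σ) where
  idem i := by
    rw [IsIdempotentElem, idem, ← d.map_mul, ← _root_.map_mul, ← Pi.single_mul, mul_one]
  ortho i j hij := by
    change d.δ₁ _ * d.δ₁ _ = 0
    have h1 : (Pi.single i.down 1 * Pi.single j.down 1 : Fin n → k) = 0 := by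
      funext x
      rw [Pi.mul_apply, Pi.single_apply, Pi.single_apply]
      split_ifs with hi hj
      · exact absurd (ULift.ext _ _ (hi.symm.trans hj)) hij
      all_goals simp
    rw [← d.map_mul, ← _root_.map_mul, h1, map_zero, map_zero]
  complete := by
    rw [← d.D₀_one, D₀_eq_sum_idem d σ]
    refine Finset.sum_congr rfl fun i _ => ?_
    have h1 : coeff σ i (1 : A) = 1 := by
      change σ (Ideal.Quotient.mk (rad A) 1) i.down = 1
      rw [map_one, map_one]
      rfl
    rw [h1, one_smul]

/-- The elements of degree `1` with ends `i` and `j`. -/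
def arrowSpace (i j : ULift.{u} (Fin n)) : Submodule k A where
  carrier := {x | d.D₁ x = x ∧ d.idem σ i * x = x ∧ x * d.idem σ j = x}
  add_mem' := fun {x y} hx hy => ⟨by rw [map_add, hx.1, hy.1], by rw [mul_add, hx.2.1, hy.2.1],
    by rw [add_mul, hx.2.2, hy.2.2]⟩
  zero_mem' := ⟨map_zero _, mul_zero _, zero_mul _⟩
  smul_mem' := fun c x hx => ⟨by rw [map_smul, hx.1], by rw [mul_smul_comm, hx.2.1],
    by rw [smul_mul_assoc, hx.2.2]⟩

/-- The quiver of an algebra with quiver data: its vertices are the factors of `A / rad A ≅ kⁿ`, and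
its edges are a basis of the space of elements of degree `1`. -/
def toQuiver : FinQuiver.{u} where
  V := ULift.{u} (Fin n)
  quiver := ⟨fun i j => ULift.{u} (Fin (Module.finrank k (d.arrowSpace σ i j)))⟩
  finE _ _ := inferInstanceAs (Finite (ULift _))

/-- The idempotents, indexed by the vertices of the quiver. -/
def vertexElt (i : d.toQuiver σ) : A := d.idem σ i

/-- The coordinates in `A / rad A ≅ kⁿ`, indexed by the vertices of the quiver. -/
def vertexCoord (i : d.toQuiver σ) : A →ₗ[k] k := coeff σ i

lemma vertexCoord_vertexElt (i : d.toQuiver σ) : d.vertexCoord σ i (d.vertexElt σ i) = 1 :=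
  (d.coeff_idem σ i i).trans (if_pos rfl)

lemma vertexCoord_eq_zero (i : d.toQuiver σ) {a : A} (ha : a ∈ rad A) : d.vertexCoord σ i a = 0 :=
  coeff_eq_zero σ ha i

lemma D₀_vertexElt (i : d.toQuiver σ) : d.D₀ (d.vertexElt σ i) = d.vertexElt σ i := d.D₀_idem σ i

lemma completeOrthogonalIdempotents_vertexElt : CompleteOrthogonalIdempotents (d.vertexElt σ) := by
  have h := d.completeOrthogonalIdempotents_idem σ
  refine ⟨⟨h.idem, h.ortho⟩, ?_⟩
  -- The two sums differ in the `Fintype` instance on the index type.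
  have hc := h.complete
  exact (congrArg (fun F : Fintype (ULift.{u} (Fin n)) =>
    @Finset.sum (ULift.{u} (Fin n)) A _ (@Finset.univ _ F) (d.idem σ)) (Subsingleton.elim _ _)).trans hc

/-- `arrowSpace`, indexed by the vertices of the quiver. -/
def edgeSpace (i j : d.toQuiver σ) : Submodule k A := d.arrowSpace σ i j

lemma mem_edgeSpace {i j : d.toQuiver σ} {x : A} : x ∈ d.edgeSpace σ i j ↔
    d.D₁ x = x ∧ d.vertexElt σ i * x = x ∧ x * d.vertexElt σ j = x := Iff.rfl

variable [Module.Finite k A]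

/-- The basis of the space of elements of degree `1` which is given by the edges. -/
def arrowBasis (i j : d.toQuiver σ) :
    Module.Basis (i ⟶ j) k (d.edgeSpace σ i j) :=
  (Module.finBasis k (d.arrowSpace σ i j)).reindex Equiv.ulift.symm

/-- An edge of the quiver of `A`, as an element of `A`. -/
def arrowElt {i j : d.toQuiver σ} (e : i ⟶ j) : A := d.arrowBasis σ i j e

lemma arrowElt_mem {i j : d.toQuiver σ} (e : i ⟶ j) : d.D₁ (d.arrowElt σ e) = d.arrowElt σ e ∧
    d.vertexElt σ i * d.arrowElt σ e = d.arrowElt σ e ∧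
    d.arrowElt σ e * d.vertexElt σ j = d.arrowElt σ e :=
  Subtype.property (d.arrowBasis σ i j e)

lemma arrowElt_mem_rad {i j : d.toQuiver σ} (e : i ⟶ j) : d.arrowElt σ e ∈ rad A := by
  rw [← (d.arrowElt_mem σ e).1]
  exact d.D₁_mem _

/-- The evaluation of the path algebra of the quiver of `A` in `A`. -/
def eval : PathAlgebra k (d.toQuiver σ) →ₐ[k] A :=
  PathAlgebra.liftAlg (v := d.vertexElt σ) (f := fun e => d.arrowElt σ e)
    (d.completeOrthogonalIdempotents_vertexElt σ)
    fun e => (d.arrowElt_mem σ e).2.2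

open PathAlgebra

lemma eval_path {i j : d.toQuiver σ} (p : Path i j) :
    d.eval σ (path p) = prodPath (d.vertexElt σ) (fun e => d.arrowElt σ e) p := liftₗ_path ..

lemma eval_vertex (i : d.toQuiver σ) : d.eval σ (vertex i) = d.vertexElt σ i := d.eval_path σ _

lemma eval_path_cons {i j l : d.toQuiver σ} (p : Path i j) (e : j ⟶ l) :
    d.eval σ (path (p.cons e)) = d.eval σ (path p) * d.arrowElt σ e := by
  rw [eval_path, eval_path, prodPath]

lemma eval_arrow {i j : d.toQuiver σ} (e : i ⟶ j) : d.eval σ (arrow e) = d.arrowElt σ e :=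
  (d.eval_path_cons σ Path.nil e).trans
    ((congrArg (· * _) (d.eval_vertex σ i)).trans (d.arrowElt_mem σ e).2.1)

lemma eval_path_mem_rad_pow {i j : d.toQuiver σ} (p : Path i j) :
    d.eval σ (path p) ∈ rad A ^ p.length := by
  induction p with
  | nil =>
    rw [Path.length_nil, Submodule.pow_zero, Ideal.one_eq_top]
    trivial
  | cons p e ih =>
    rw [eval_path_cons, Path.length_cons, Submodule.pow_succ]
    exact Ideal.mul_mem_mul ih (d.arrowElt_mem_rad σ e)

lemma eval_path_cons_mem_rad {i j l : d.toQuiver σ} (p : Path i j) (e : j ⟶ l) :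
    d.eval σ (path (p.cons e)) ∈ rad A := by
  rw [eval_path_cons]
  exact Ideal.mul_mem_left _ _ (d.arrowElt_mem_rad σ e)

lemma eval_path_cons_cons_mem_rad_sq {i j l m : d.toQuiver σ} (p : Path i j) (e : j ⟶ l) (e' : l ⟶ m) :
    d.eval σ (path ((p.cons e).cons e')) ∈ rad A * rad A := by
  rw [eval_path_cons]
  exact Ideal.mul_mem_mul (d.eval_path_cons_mem_rad σ p e) (d.arrowElt_mem_rad σ e')

lemma D₀_eval (x : PathAlgebra k (d.toQuiver σ)) : d.D₀ (d.eval σ x) = d.eval σ (deg 0 x) := by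
  induction x using path_induction with
  | zero => simp
  | add x y hx hy => rw [map_add, map_add, hx, hy, map_add, map_add]
  | smul r x hx => rw [map_smul, map_smul, hx, map_smul, map_smul]
  | @path a b p =>
    rw [deg_path]
    cases p with
    | nil => rw [if_pos (Path.length_nil ..), eval_vertex, D₀_vertexElt]
    | cons p e =>
      rw [if_neg (by rw [Path.length_cons]; omega), map_zero,
        d.D₀_eq_zero (d.eval_path_cons_mem_rad σ p e)]

lemma D₁_eval (x : PathAlgebra k (d.toQuiver σ)) : d.D₁ (d.eval σ x) = d.eval σ (deg 1 x) := by
  induction x using path_induction with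
  | zero => simp
  | add x y hx hy => rw [map_add, map_add, hx, hy, map_add, map_add]
  | smul r x hx => rw [map_smul, map_smul, hx, map_smul, map_smul]
  | @path a b p =>
    rw [deg_path]
    cases p with
    | nil => rw [if_neg (by rw [Path.length_nil]; omega), map_zero, eval_vertex, ← D₀_vertexElt, D₁_D₀]
    | cons p e =>
      cases p with
      | nil =>
        rw [if_pos (by rfl)]
        exact (congrArg d.D₁ (d.eval_arrow σ e)).trans
          ((d.arrowElt_mem σ e).1.trans (d.eval_arrow σ e).symm)
      | cons p e' =>
        rw [if_neg (by rw [Path.length_cons, Path.length_cons]; omega), map_zero,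
          d.D₁_eq_zero (d.eval_path_cons_cons_mem_rad_sq σ p e' e)]

lemma vertexCoord_eval_of {i : d.toQuiver σ} (y : Path i i →₀ k) :
    d.vertexCoord σ i (d.eval σ (of i i y)) = y Path.nil := by
  refine LinearMap.congr_fun (f := d.vertexCoord σ i ∘ₗ (d.eval σ).toLinearMap ∘ₗ of i i)
    (g := Finsupp.lapply Path.nil) (Finsupp.lhom_ext' fun p => LinearMap.ext_ring ?_) y
  change d.vertexCoord σ i (d.eval σ (path p)) = Finsupp.single p 1 Path.nil
  cases p with
  | nil =>
    rw [eval_vertex, Finsupp.single_eq_same]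
    exact d.vertexCoord_vertexElt σ i
  | cons p e =>
    rw [d.vertexCoord_eq_zero σ i (d.eval_path_cons_mem_rad σ p e), Finsupp.single_eq_of_ne (by simp)]

/-- In degree 1 only the edges contribute to the value of a combination of paths. -/
lemma D₁_eval_of {i j : d.toQuiver σ} (y : Path i j →₀ k) :
    d.D₁ (d.eval σ (of i j y)) = ∑ e : i ⟶ j, y e.toPath • d.arrowElt σ e := by
  have h1 : ∀ y, ((∑ e : i ⟶ j, (LinearMap.toSpanSingleton k A (d.arrowElt σ e)) ∘ₗ
      Finsupp.lapply e.toPath : (Path i j →₀ k) →ₗ[k] A)) y =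
        ∑ e : i ⟶ j, y e.toPath • d.arrowElt σ e := fun y => by
    simp [LinearMap.sum_apply]
  rw [← h1]
  refine LinearMap.congr_fun (f := d.D₁ ∘ₗ (d.eval σ).toLinearMap ∘ₗ of i j)
    (Finsupp.lhom_ext' fun p => LinearMap.ext_ring ?_) y
  change d.D₁ (d.eval σ (path p)) = _
  rw [LinearMap.comp_apply, Finsupp.lsingle_apply, h1, D₁_eval, deg_path]
  cases p with
  | nil =>
    rw [if_neg (by rw [Path.length_nil]; omega), map_zero]
    refine (Finset.sum_eq_zero fun e _ => ?_).symm
    rw [Finsupp.single_eq_of_ne (by simp [Quiver.Hom.toPath]), zero_smul]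
  | cons p e =>
    cases p with
    | nil =>
      rw [if_pos (by rfl), Finset.sum_eq_single e]
      · rw [Quiver.Hom.toPath, Finsupp.single_eq_same, one_smul]
        exact d.eval_arrow σ e
      · intro e' _ he
        rw [Finsupp.single_eq_of_ne, zero_smul]
        intro h
        simp [Quiver.Hom.toPath] at h
        exact he h
      · simp
    | cons p e' =>
      rw [if_neg (by rw [Path.length_cons, Path.length_cons]; omega), map_zero]
      refine (Finset.sum_eq_zero fun e _ => ?_).symm
      rw [Finsupp.single_eq_of_ne, zero_smul]
      intro h
      have := congrArg Path.length h
      simp at this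

/-- The kernel of the evaluation is admissible. -/
lemma isAdmissible_ker_eval : IsAdmissible (RingHom.ker (d.eval σ)) where
  twoSided := inferInstance
  two_le_length x hx i j p hp := by
    have h1 : d.eval σ (of i j (x i j)) = 0 := of_mem (I := RingHom.ker (d.eval σ)) hx i j
    cases p with
    | nil =>
      rw [← d.vertexCoord_eval_of σ, h1, map_zero] at hp
      exact absurd rfl hp
    | cons p e =>
      cases p with
      | nil =>
        have h2 := d.D₁_eval_of σ (x i j)
        rw [h1, map_zero] at h2
        have h3 : ∑ e : i ⟶ j, x i j e.toPath • d.arrowBasis σ i j e = 0 := by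
          refine Subtype.ext ?_
          rw [AddSubmonoidClass.coe_finsetSum]
          exact h2.symm
        exact absurd (Fintype.linearIndependent_iff.1 (d.arrowBasis σ i j).linearIndependent _ h3 e) hp
      | cons p e' => rw [Path.length_cons, Path.length_cons]; omega
  exists_length := by
    obtain ⟨N, hN⟩ := exists_rad_pow_eq_zero (k := k) (A := A)
    refine ⟨N, fun i j p hp => ?_⟩
    have h1 := d.eval_path_mem_rad_pow σ p
    rw [hN _ hp] at h1
    exact h1

lemma D₁_mem_range_eval (a : A) : d.D₁ a ∈ (d.eval σ).range := by
  have hc := d.completeOrthogonalIdempotents_vertexElt σ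
  have h1 : d.D₁ a = ∑ i, ∑ j, d.vertexElt σ i * d.D₁ a * d.vertexElt σ j := by
    simp only [← Finset.mul_sum, ← Finset.sum_mul, hc.complete, one_mul, mul_one]
  rw [h1]
  refine sum_mem fun i _ => sum_mem fun j _ => ?_
  have h2 : d.vertexElt σ i * d.D₁ a * d.vertexElt σ j ∈ d.edgeSpace σ i j := by
    refine (d.mem_edgeSpace σ).2 ⟨?_, ?_, ?_⟩
    · rw [D₁_mul, D₁_mul, D₁_D₁, d.D₀_mul, d.D₀_eq_zero (d.D₁_mem a), mul_zero, zero_mul, zero_add,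
        D₀_vertexElt, D₀_vertexElt, ← d.D₀_vertexElt σ i, D₁_D₀, zero_mul, add_zero]
    · rw [← mul_assoc, ← mul_assoc, hc.idem i]
    · rw [mul_assoc, hc.idem j]
  have h3 := congrArg Subtype.val ((d.arrowBasis σ i j).sum_repr ⟨_, h2⟩)
  rw [AddSubmonoidClass.coe_finsetSum] at h3
  change _ = d.vertexElt σ i * d.D₁ a * d.vertexElt σ j at h3
  rw [← h3]
  refine sum_mem fun e _ => ?_
  exact ⟨(d.arrowBasis σ i j).repr ⟨_, h2⟩ e • arrow e, (map_smul (d.eval σ) _ _).trans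
    (congrArg _ (d.eval_arrow σ e))⟩

/-- Successive approximation: every element of `rad ^ n` is, modulo `rad ^ (n + 1)`, the value of a combination
of paths, and the radical is nilpotent. -/
lemma eval_surjective : Function.Surjective (d.eval σ) := by
  have key : ∀ n, ∀ a ∈ rad A ^ n, ∃ s ∈ (d.eval σ).range, s ∈ rad A ^ n ∧ a - s ∈ rad A ^ (n + 1) := by
    intro n
    induction n with
    | zero =>
      intro a ha
      refine ⟨d.D₀ a, ?_, ?_, ?_⟩
      · rw [d.D₀_eq_sum_idem σ]
        exact sum_mem fun i _ => ⟨coeff σ i a • vertex i, (map_smul (d.eval σ) _ _).trans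
          (congrArg _ (d.eval_vertex σ i))⟩
      · rw [Submodule.pow_zero, Ideal.one_eq_top]
        trivial
      · rw [zero_add, Submodule.pow_one]
        exact d.D₀_sub_mem a
    | succ n ih =>
      intro a ha
      rw [Submodule.pow_succ] at ha
      refine Submodule.smul_induction_on ha ?_ ?_
      · intro r hr t ht
        obtain ⟨s, hs, hsn, hrs⟩ := ih r hr
        -- `s` approximates `r ∈ rad ^ n` and `D₁ t` approximates `t ∈ rad`, each with an error one power deeper
        refine ⟨s * d.D₁ t, mul_mem hs (d.D₁_mem_range_eval σ t), ?_, ?_⟩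
        · rw [Submodule.pow_succ]
          exact Ideal.mul_mem_mul hsn (d.D₁_mem t)
        · have h1 : r • t - s * d.D₁ t = (r - s) * t + s * (t - d.D₁ t) := by
            rw [smul_eq_mul]; noncomm_ring
          rw [h1]
          refine add_mem ?_ ?_
          · rw [Submodule.pow_succ]
            exact Ideal.mul_mem_mul hrs ht
          · rw [add_assoc, Ideal.IsTwoSided.pow_add]
            refine Ideal.mul_mem_mul hsn ?_
            rw [Submodule.pow_succ, Submodule.pow_one, ← neg_sub]
            exact neg_mem (d.D₁_sub_mem ht)
      · rintro a b ⟨s, hs, hsn, h⟩ ⟨s', hs', hsn', h'⟩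
        refine ⟨s + s', add_mem hs hs', add_mem hsn hsn', ?_⟩
        rw [add_sub_add_comm]
        exact add_mem h h'
  obtain ⟨N, hN⟩ := exists_rad_pow_eq_zero (k := k) (A := A)
  -- descending induction on `n`, from `rad ^ N = 0`; `t` is the distance to `N`
  have key' : ∀ t n, N ≤ n + t → ∀ a ∈ rad A ^ n, a ∈ (d.eval σ).range := by
    intro t
    induction t with
    | zero =>
      intro n hn a ha
      rw [hN n hn, Ideal.mem_bot] at ha
      rw [ha]
      exact zero_mem _
    | succ t ih =>
      intro n hn a ha
      obtain ⟨s, hs, -, h⟩ := key n a ha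
      have := add_mem (ih (n + 1) (by omega) _ h) hs
      rwa [sub_add_cancel] at this
  intro a
  exact key' N 0 (by omega) a (by rw [Submodule.pow_zero, Ideal.one_eq_top]; trivial)

/-- The bound quiver of an algebra with quiver data. -/
def toBoundQuiver : BdQuivCon k := ⟨d.toQuiver σ, RingHom.ker (d.eval σ), d.isAdmissible_ker_eval σ⟩

/-- The isomorphism `kQ/I ≅ A` for the bound quiver of `A`. -/
def algEquiv : (d.toBoundQuiver σ).alg ≃ₐ[k] A :=
  Ideal.quotientKerAlgEquivOfSurjective (d.eval_surjective σ)

lemma algEquiv_D₀ (a : (d.toBoundQuiver σ).alg) :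
    d.algEquiv σ ((d.toBoundQuiver σ).quiverData.D₀ a) = d.D₀ (d.algEquiv σ a) := by
  obtain ⟨x, rfl⟩ := (d.toBoundQuiver σ).proj_surjective a
  exact (d.D₀_eval σ x).symm

lemma algEquiv_D₁ (a : (d.toBoundQuiver σ).alg) :
    d.algEquiv σ ((d.toBoundQuiver σ).quiverData.D₁ a) = d.D₁ (d.algEquiv σ a) := by
  obtain ⟨x, rfl⟩ := (d.toBoundQuiver σ).proj_surjective a
  rw [BdQuivCon.quiverData_D₁]
  exact (d.D₁_eval σ x).symm

end QuiverData

/-! ### Equivalences from isomorphisms of algebras -/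

namespace Bimodule
variable {k : Type u} [Field k] {A B : Bim k}

lemma map_mem_rad (θ : A ≃ₐ[k] B) {a : A} (ha : a ∈ rad A) : θ a ∈ rad B := by
  have : RingHomSurjective (θ : A →+* B) := ⟨θ.surjective⟩
  exact Ring.le_comap_jacobson (θ : A →+* B) ha

/-- The regular bimodule of `B`, with left action of `A` along an isomorphism `θ : A ≅ B`. -/
def twist (θ : A ≃ₐ[k] B) : Bimodule A B :=
  ofAlgHoms A B B ((Algebra.lmul k B).comp θ.toAlgHom)
    { toFun := fun b => op (LinearMap.mulRight k b)
      map_one' := by rw [LinearMap.mulRight_one]; rfl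
      map_mul' := fun b b' => by rw [LinearMap.mulRight_mul]; rfl
      map_zero' := by rw [LinearMap.mulRight_zero_eq_zero]; rfl
      map_add' := fun b b' => congrArg op (LinearMap.ext fun x => mul_add x b b')
      commutes' := fun r => congrArg op (LinearMap.ext fun x => by
        rw [LinearMap.mulRight_apply, ← Algebra.commutes, ← Algebra.smul_def]; rfl) }
    fun a b m => (mul_assoc _ _ _).symm

/-- The identification of `B` with the underlying space of `twist θ`. -/
def toTwist (θ : A ≃ₐ[k] B) : B ≃ₗ[k] twist θ := LinearEquiv.refl k B

lemma smul_toTwist (θ : A ≃ₐ[k] B) (a : A) (b : B) : a • toTwist θ b = toTwist θ (θ a * b) := rfl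

lemma op_smul_toTwist (θ : A ≃ₐ[k] B) (b b' : B) : op b' • toTwist θ b = toTwist θ (b * b') := rfl

lemma toTwist_mem_radl (θ : A ≃ₐ[k] B) {b : B} (hb : b ∈ rad B) : toTwist θ b ∈ (twist θ).radl := by
  have h := rad_smul_mem (M := twist θ) (map_mem_rad θ.symm hb) (toTwist θ 1)
  rwa [smul_toTwist, θ.apply_symm_apply, mul_one] at h

lemma toTwist_mem_radl₂ (θ : A ≃ₐ[k] B) {b : B} (hb : b ∈ rad B * rad B) :
    toTwist θ b ∈ (twist θ).radl₂ := by
  refine Submodule.smul_induction_on (p := fun b => toTwist θ b ∈ (twist θ).radl₂) hb ?_ ?_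
  · intro r hr s hs
    have h := lmul_mem (M := twist θ) (map_mem_rad θ.symm hr) (toTwist_mem_radl θ hs)
    rwa [smul_toTwist, θ.apply_symm_apply] at h
  · intro x y hx hy
    rw [map_add]
    exact add_mem hx hy

lemma isRadicallySymmetric_twist (θ : A ≃ₐ[k] B) : (twist θ).IsRadicallySymmetric := by
  apply le_antisymm
  · refine lmul_le fun r hr m _ => ?_
    obtain ⟨b, rfl⟩ := (toTwist θ).surjective m
    have h := rmul_mem (M := twist θ) (P := ⊤) (m := toTwist θ 1)
      (Ideal.mul_mem_right b (rad B) (map_mem_rad θ hr)) trivial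
    rwa [op_smul_toTwist, one_mul, ← smul_toTwist] at h
  · refine rmul_le fun r hr m _ => ?_
    obtain ⟨b, rfl⟩ := (toTwist θ).surjective m
    exact toTwist_mem_radl θ (Ideal.mul_mem_left _ b hr)

lemma isDualizable_twist (θ : A ≃ₐ[k] B) : (twist θ).IsDualizable := by
  refine isDualizable_of_dual_bases
    ⟨1, fun _ => toTwist θ 1, fun _ => (toTwist θ).symm.toLinearMap, fun _ m b => rfl, fun m => ?_⟩
    ⟨1, fun _ => toTwist θ 1, fun _ => θ.symm.toLinearMap ∘ₗ (toTwist θ).symm.toLinearMap,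
      fun _ m a => ?_, fun m => ?_⟩
  · rw [Fin.sum_univ_one]
    exact congrArg (toTwist θ) (one_mul ((toTwist θ).symm m))
  · obtain ⟨b, rfl⟩ := (toTwist θ).surjective m
    change θ.symm (θ a * b) = a * θ.symm b
    rw [map_mul, θ.symm_apply_apply]
  · obtain ⟨b, rfl⟩ := (toTwist θ).surjective m
    rw [Fin.sum_univ_one]
    change θ.symm b • toTwist θ 1 = toTwist θ b
    rw [smul_toTwist, θ.apply_symm_apply, mul_one]

/-- The multiplication `b ⊗ a ↦ θ⁻¹(b) a`. -/
def twistMul (θ : A ≃ₐ[k] B) : tensor (twist θ) (twist θ.symm) →ₗ[k] unit A :=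
  tlift (((toUnit A).toLinearMap.compRight k).comp
    ((LinearMap.mul k A).compl₁₂ (θ.symm.toLinearMap ∘ₗ (toTwist θ).symm.toLinearMap)
      (toTwist θ.symm).symm.toLinearMap)) ⟨by
    intro m b n
    obtain ⟨m, rfl⟩ := (toTwist θ).surjective m
    obtain ⟨n, rfl⟩ := (toTwist θ.symm).surjective n
    change toUnit A (θ.symm (m * b) * n) = toUnit A (θ.symm m * (θ.symm b * n))
    rw [map_mul θ.symm, mul_assoc]⟩

lemma twistMul_tm (θ : A ≃ₐ[k] B) (b : B) (a : A) :
    twistMul θ (tm (toTwist θ b) (toTwist θ.symm a)) = toUnit A (θ.symm b * a) := tlift_tm ..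

/-- The bimodules of `θ` and `θ⁻¹` are inverse to each other. -/
def twistIso (θ : A ≃ₐ[k] B) : tensor (twist θ) (twist θ.symm) ≅ unit A :=
  mkIso (twistMul θ)
    (tmₗ (twist θ) (twist θ.symm) (toTwist θ 1) ∘ₗ (toTwist θ.symm).toLinearMap ∘ₗ
      (toUnit A).symm.toLinearMap)
    (by
      intro a t
      refine linearMap_ext (f := twistMul θ ∘ₗ lm _ a) (g := lm _ a ∘ₗ twistMul θ)
        (fun m n => ?_) t
      obtain ⟨m, rfl⟩ := (toTwist θ).surjective m
      obtain ⟨n, rfl⟩ := (toTwist θ.symm).surjective n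
      change twistMul θ (a • tm _ _) = a • twistMul θ (tm _ _)
      rw [smul_tm_left, smul_toTwist, twistMul_tm, twistMul_tm, map_mul θ.symm, θ.symm_apply_apply,
        mul_assoc]
      rfl)
    (by
      intro a t
      refine linearMap_ext (f := twistMul θ ∘ₗ rm _ a) (g := rm _ a ∘ₗ twistMul θ)
        (fun m n => ?_) t
      obtain ⟨m, rfl⟩ := (toTwist θ).surjective m
      obtain ⟨n, rfl⟩ := (toTwist θ.symm).surjective n
      change twistMul θ (op a • tm _ _) = op a • twistMul θ (tm _ _)
      rw [smul_tm_right, op_smul_toTwist, twistMul_tm, twistMul_tm, ← mul_assoc]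
      rfl)
    (by
      intro t
      refine linearMap_ext (f := (tmₗ (twist θ) (twist θ.symm) (toTwist θ 1) ∘ₗ
        (toTwist θ.symm).toLinearMap ∘ₗ (toUnit A).symm.toLinearMap) ∘ₗ twistMul θ)
        (g := LinearMap.id) (fun m n => ?_) t
      obtain ⟨m, rfl⟩ := (toTwist θ).surjective m
      obtain ⟨n, rfl⟩ := (toTwist θ.symm).surjective n
      change tm (toTwist θ 1) (toTwist θ.symm ((toUnit A).symm (twistMul θ (tm _ _)))) = tm _ _
      rw [twistMul_tm, LinearEquiv.symm_apply_apply, ← smul_toTwist, ← tm_balanced, op_smul_toTwist,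
        one_mul])
    (by
      intro x
      obtain ⟨a, rfl⟩ := (toUnit A).surjective x
      change twistMul θ (tm (toTwist θ 1) (toTwist θ.symm a)) = toUnit A a
      rw [twistMul_tm, map_one, one_mul])

end Bimodule

namespace BSA
open Bimodule
variable {k : Type u} [Field k] {X Y : BSA k}

namespace Hom
variable (θ : X.alg ≃ₐ[k] Y.alg) (h₀ : ∀ a, θ (X.data.D₀ a) = Y.data.D₀ (θ a))
  (h₁ : ∀ a, θ (X.data.D₁ a) = Y.data.D₁ (θ a))

/-- The components of degree `0` and `1` of the elements of `twist θ`. -/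
def twistGrading : Bimodule.twist θ ⟶ firstOrder X.data Y.data (Bimodule.twist θ) :=
  Bimodule.Hom.mk
    (firstOrder.mk.toLinearMap ∘ₗ LinearMap.prod
      ((toTwist θ).toLinearMap ∘ₗ Y.data.D₀ ∘ₗ (toTwist θ).symm.toLinearMap)
      ((toTwist θ).toLinearMap ∘ₗ Y.data.D₁ ∘ₗ (toTwist θ).symm.toLinearMap))
    (by
      intro a m
      obtain ⟨m, rfl⟩ := (toTwist θ).surjective m
      change firstOrder.mk (toTwist θ (Y.data.D₀ (θ a * m)), toTwist θ (Y.data.D₁ (θ a * m))) =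
        a • firstOrder.mk (toTwist θ (Y.data.D₀ m), toTwist θ (Y.data.D₁ m))
      rw [firstOrder.smul_mk, smul_toTwist, smul_toTwist, smul_toTwist, h₀, h₁, Y.data.D₀_mul,
        Y.data.D₁_mul, map_add])
    (by
      intro b m
      obtain ⟨m, rfl⟩ := (toTwist θ).surjective m
      change firstOrder.mk (toTwist θ (Y.data.D₀ (m * b)), toTwist θ (Y.data.D₁ (m * b))) =
        op b • firstOrder.mk (toTwist θ (Y.data.D₀ m), toTwist θ (Y.data.D₁ m))
      rw [firstOrder.op_smul_mk, op_smul_toTwist, op_smul_toTwist, op_smul_toTwist, Y.data.D₀_mul,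
        Y.data.D₁_mul, map_add, add_comm])

/-- The 1-morphism of `BSA` given by an isomorphism of algebras that is compatible with the quiver
data. -/
def twist : Hom X Y :=
  ofGrading (Bimodule.twist θ) (isRadicallySymmetric_twist θ) (isDualizable_twist θ)
    (twistGrading θ h₀ h₁)
    (by
      intro m
      obtain ⟨m, rfl⟩ := (toTwist θ).surjective m
      change toTwist θ m - toTwist θ (Y.data.D₀ m) ∈ _
      rw [← map_sub]
      exact toTwist_mem_radl θ (Y.data.D₀_sub_mem m))
    (by
      intro m
      obtain ⟨m, rfl⟩ := (toTwist θ).surjective m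
      change toTwist θ m - toTwist θ (Y.data.D₀ m) - toTwist θ (Y.data.D₁ m) ∈ _
      rw [← map_sub, ← map_sub]
      refine toTwist_mem_radl₂ θ ?_
      have h := neg_mem (Y.data.D₁_sub_mem (Y.data.D₀_sub_mem m))
      rwa [map_sub, Y.data.D₁_D₀, sub_zero, neg_sub] at h)

lemma twist_d₁ (b : Y.alg) : (twist θ h₀ h₁).d₁ (toTwist θ b) = toTwist θ (Y.data.D₀ b) := rfl

/-- The composite of the 1-morphisms given by `θ` and `θ⁻¹` is the identity. -/
def compTwistIso (h₀' : ∀ b, θ.symm (Y.data.D₀ b) = X.data.D₀ (θ.symm b))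
    (h₁' : ∀ b, θ.symm (Y.data.D₁ b) = X.data.D₁ (θ.symm b)) :
    comp (twist θ h₀ h₁) (twist θ.symm h₀' h₁') ≅ Hom.unit X :=
  mkIso (M := comp (twist θ h₀ h₁) (twist θ.symm h₀' h₁')) (N := Hom.unit X) (twistIso θ) (by
    intro t
    refine linearMap_ext (f := twistMul θ ∘ₗ tensor₁ (twist θ h₀ h₁) (twist θ.symm h₀' h₁'))
      (g := (Hom.unit X).d₁ ∘ₗ twistMul θ) (fun m n => ?_) t
    obtain ⟨m, rfl⟩ := (toTwist θ).surjective m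
    obtain ⟨n, rfl⟩ := (toTwist θ.symm).surjective n
    change twistMul θ (tensor₁ (twist θ h₀ h₁) (twist θ.symm h₀' h₁') (tm _ _)) =
      (Hom.unit X).d₁ (twistMul θ (tm _ _))
    refine (congrArg (twistMul θ) (tensor₁_tm (twist θ h₀ h₁) (twist θ.symm h₀' h₁') _ _)).trans ?_
    rw [twistMul_tm, twist_d₁, twist_d₁]
    refine (twistMul_tm θ _ _).trans ?_
    rw [h₀', ← X.data.D₀_mul]
    rfl)

end Hom

/-- An isomorphism of algebras that is compatible with the quiver data gives an equivalence. -/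
lemma nonempty_equivalence (θ : X.alg ≃ₐ[k] Y.alg) (h₀ : ∀ a, θ (X.data.D₀ a) = Y.data.D₀ (θ a))
    (h₁ : ∀ a, θ (X.data.D₁ a) = Y.data.D₁ (θ a)) : Nonempty (Bicategory.Equivalence X Y) := by
  have h₀' : ∀ b, θ.symm (Y.data.D₀ b) = X.data.D₀ (θ.symm b) := fun b => by
    rw [AlgEquiv.symm_apply_eq, h₀, θ.apply_symm_apply]
  have h₁' : ∀ b, θ.symm (Y.data.D₁ b) = X.data.D₁ (θ.symm b) := fun b => by
    rw [AlgEquiv.symm_apply_eq, h₁, θ.apply_symm_apply]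
  exact ⟨Bicategory.Equivalence.mkOfAdjointifyCounit (B := BSA k) (a := X) (b := Y)
    (f := Hom.twist θ h₀ h₁) (g := Hom.twist θ.symm h₀' h₁')
    (Hom.compTwistIso θ h₀ h₁ h₀' h₁').symm (Hom.compTwistIso θ.symm h₀' h₁' h₀ h₁)⟩

end BSA

/-- Every object of `BSA` is equivalent to the algebra of a bound quiver. -/
lemma BdQuivCon.exists_equivalence {k : Type u} [Field k] (Y : BSA k) :
    ∃ X : BdQuivCon k, Nonempty (Bicategory.Equivalence ((BdQuivCon.pathFunctor k).obj X) Y) := by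
  obtain ⟨n, ⟨σ⟩⟩ := Y.basic.split
  have := Y.basic.finite
  exact ⟨Y.data.toBoundQuiver σ, BSA.nonempty_equivalence (X := (Y.data.toBoundQuiver σ).toBSA)
    (Y.data.algEquiv σ) (Y.data.algEquiv_D₀ σ) (Y.data.algEquiv_D₁ σ)⟩

end QuiverConnections

end

theorem mainTheorem1 (k : Type u) [Field k] :
    ∃ P : QuiverConnections.BdQuivCon k ⥤ᵖ QuiverConnections.BSA k,
      Nonempty (QuiverConnections.PathFunctorData P) ∧ QuiverConnections.IsBiequivalence P := by
  exact ⟨QuiverConnections.BdQuivCon.pathFunctor k,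
    ⟨QuiverConnections.BdQuivCon.pathFunctorData⟩,
    QuiverConnections.BdQuivCon.exists_equivalence,
    fun X Y => { faithful := inferInstance, full := inferInstance, essSurj := inferInstance }⟩
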